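/- **Shuffling Simon problem.** Fix $d\in\mathbb N$. A function $f:\{0,1\}^n\to\{0,1\}^n$ is a *Simon function* if for some $s\neq 0$: $f(x)=f(y)$ iff $y\in\{x,x\oplus s\}$. Put $N=(d+2)n$ and regard $\{0,1\}^n\subset\{0,1\}^{N}$ by appending zeros. A *$d$-shuffling* of $f$ is a tuple $(f_0,\dots,f_d)$, where $f_0,\dots,f_{d-1}$ are one-to-one functions on $\{0,1\}^{N}$, and $f_d$ takes $f_{d-1}\circ\cdots\circ f_0(x)$ to $f(x)$ for $x\in\{0,1\}^n$, and all other points to $\bot$. The shuffling oracle of $f$ chooses $f_0,\dots,f_{d-1}$ uniformly at random, once and for all, and answers a query $(j,y)$ by $f_j(y)$. The *$d$-shuffling Simon problem* $\mathrm{SSP}_d$ is: given access to the shuffling oracle of $f$, where $f$ is, with probability $1/2$ each, a uniformly random Simon function or a uniformly random one-to-one function, decide whether $f$ is a Simon function. **Schemes.** A depth-$k$ quantum circuit with oracle $\mathcal O$ starts in a standard basis state, applies $U_{k+1}\mathcal O U_k\cdots\mathcal O U_1$, and measures all qubits in the standard basis; here each $U_i$ is one layer of arbitrary one- and two-qubit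 gates on disjoint qubits, and each $\mathcal O$ is one layer of parallel oracle gates $|x,y\rangle\mapsto|x,y\oplus\mathcal O(x)\rangle$ on disjoint qubits. A *$k$-CQ scheme* is a family, indexed by the problem size $n$, of randomized classical Boolean circuits of size polynomial in $n$ that may query $\mathcal O$ classically and may call depth-$k$ quantum circuits with oracle $\mathcal O$ (all steps, qubits, gates and queries count for the size; the classical part chooses the initial basis state and the wires on which the gates act, and obtains the measurement outcomes). $(\mathsf{BPP}^{\mathsf{BQNC}_k})^{\mathcal O}$ is the class of languages decided by $k$-CQ schemes with oracle $\mathcal O$ with error at most $1/3$ on every input. **Theorem.** For every $d\in\mathbb N$: 1. There is a $(2d+1)$-CQ scheme that solves $\mathrm{SSP}_d$ with high probability: for every $n\ge 1$ its success probability is at least $1-2^{-n}$; moreover, for every Simon function or one-to-one function $f$ and every $d$-shuffling of $f$ its answer is correct with probability at least $1-2^{-n}$. 2. No $d$-CQ scheme solves $\mathrm{SSP}_d$: for every $d$-CQ scheme and every $\varepsilon>0$, the success probability is at most $\frac12+\varepsilon$ for all sufficiently large $n$. 3. There is an oracle $\mathcal O$ that consists of shuffling oracles, namely of one $d$-shuffling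 of a function $f_a:\{0,1\}^{|a|}\to\{0,1\}^{|a|}$ for every string $a$ (a query names $a$, $j$ and $y$), where every $f_a$ is a Simon function or one-to-one, such that the language $L=\{a : f_a \text{ is a Simon function}\}$ is in $(\mathsf{BPP}^{\mathsf{BQNC}_{2d+1}})^{\mathcal O}$, but not in $(\mathsf{BPP}^{\mathsf{BQNC}_d})^{\mathcal O}$. Hence $(\mathsf{BPP}^{\mathsf{BQNC}_d})^{\mathcal O}\ne(\mathsf{BPP}^{\mathsf{BQNC}_{2d+1}})^{\mathcal O}$. -/

import Mathlib

/-! ## Oracles -/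

/-- Bit strings of length `n`. -/
abbrev Bits (n : ℕ) : Type := Fin n → Bool

/-- The kinds `Q` of queries that an oracle answers; a query of kind `q` has input bits indexed by
`In q` and answer bits indexed by `Out q`. -/
structure OracleSig where
  Q : Type
  In : Q → Type
  Out : Q → Type
  fin : ∀ q, Fintype (In q)
  fout : ∀ q, Fintype (Out q)

instance (S : OracleSig) (q : S.Q) : Fintype (S.In q) := S.fin q
instance (S : OracleSig) (q : S.Q) : Fintype (S.Out q) := S.fout q

/-- An oracle of a given signature: a classical Boolean function for every kind of query. -/
abbrev OracleSig.Oracle (S : OracleSig) : Type :=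
  ∀ q : S.Q, (S.In q → Bool) → (S.Out q → Bool)

/-! ## Quantum circuits with oracle gates -/

/-- An arbitrary one- or two-qubit gate, placed on wires of a `w`-qubit register. -/
structure Gate (w : ℕ) where
  k : ℕ
  one_le : 1 ≤ k
  le_two : k ≤ 2
  U : Matrix.unitaryGroup (Fin k → Bool) ℂ
  pos : Fin k → Fin w

/-- An oracle gate, placed on wires of a `w`-qubit register. -/
structure OracleGate (S : OracleSig) (w : ℕ) where
  q : S.Q
  inPos : S.In q → Fin w
  outPos : S.Out q → Fin w

/-- The action of a gate on a state vector, given by its amplitudes in the standard basis.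
`Function.extend g.pos u z` is `z` with the bits at the positions `g.pos` replaced by `u`. -/
noncomputable def Gate.apply {w : ℕ} (g : Gate w) (ψ : Bits w → ℂ) : Bits w → ℂ := fun z =>
  ∑ u : Fin g.k → Bool, g.U.1 (z ∘ g.pos) u * ψ (Function.extend g.pos u z)

/-- The action `|x, y⟩ ↦ |x, y ⊕ O(x)⟩` of an oracle gate on a state vector
(this permutation of the standard basis is its own inverse). -/
noncomputable def OracleGate.apply {S : OracleSig} {w : ℕ} (O : S.Oracle) (g : OracleGate S w)
    (ψ : Bits w → ℂ) : Bits w → ℂ := fun z =>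
  ψ (Function.extend g.outPos (fun o => xor (z (g.outPos o)) (O g.q (z ∘ g.inPos) o)) z)

/-- The gates of a layer act on pairwise different wires. -/
def DisjointWires {w : ℕ} (L : List (Σ ι : Type, ι → Fin w)) : Prop :=
  (∀ g ∈ L, Function.Injective g.2) ∧
    L.Pairwise fun g h => Disjoint (Set.range g.2) (Set.range h.2)

open Classical in
/-- One layer of one- and two-qubit gates. A list of gates that overlap is not a layer, and is
skipped. -/
noncomputable def applyGates {w : ℕ} (L : List (Gate w)) (ψ : Bits w → ℂ) : Bits w → ℂ :=
  if DisjointWires (L.map fun g => ⟨Fin g.k, g.pos⟩) then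
    L.foldl (fun φ g => g.apply φ) ψ
  else ψ

open Classical in
/-- One layer of parallel oracle queries. A list of oracle gates that overlap is not a layer, and
is skipped. -/
noncomputable def applyOracleGates {S : OracleSig} {w : ℕ} (O : S.Oracle)
    (L : List (OracleGate S w)) (ψ : Bits w → ℂ) : Bits w → ℂ :=
  if DisjointWires (L.map fun g => ⟨S.In g.q ⊕ S.Out g.q, Sum.elim g.inPos g.outPos⟩) then
    L.foldl (fun φ g => g.apply O φ) ψ
  else ψ

/-! ## Calls of a quantum circuit by a classical algorithm

The classical algorithm has `M` one-bit registers. It chooses the circuit that it calls: the wires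
on which the gates act are read from its registers. -/

/-- The number whose binary digits, the least significant first, are in the registers `l`. -/
def readNat {M : ℕ} (mem : Fin M → Bool) (l : List (Fin M)) : ℕ :=
  l.foldr (fun r v => (mem r).toNat + 2 * v) 0

/-- A gate whose wires are named by the contents of registers. -/
structure GateSlot (M : ℕ) where
  k : ℕ
  one_le : 1 ≤ k
  le_two : k ≤ 2
  U : Matrix.unitaryGroup (Fin k → Bool) ℂ
  addr : Fin k → List (Fin M)

/-- An oracle gate whose wires are named by the contents of registers. -/
structure OracleSlot (S : OracleSig) (M : ℕ) where
  q : S.Q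
  inAddr : S.In q → List (Fin M)
  outAddr : S.Out q → List (Fin M)

open Classical in
/-- The gate that a slot describes; there is none if a named wire does not exist. -/
noncomputable def GateSlot.resolve {M : ℕ} (s : GateSlot M) (mem : Fin M → Bool) (w : ℕ) :
    Option (Gate w) :=
  if h : ∀ i, readNat mem (s.addr i) < w then
    some ⟨s.k, s.one_le, s.le_two, s.U, fun i => ⟨readNat mem (s.addr i), h i⟩⟩
  else none

open Classical in
/-- The oracle gate that a slot describes; there is none if a named wire does not exist. -/
noncomputable def OracleSlot.resolve {S : OracleSig} {M : ℕ} (s : OracleSlot S M)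
    (mem : Fin M → Bool) (w : ℕ) : Option (OracleGate S w) :=
  if h : (∀ i, readNat mem (s.inAddr i) < w) ∧ ∀ o, readNat mem (s.outAddr o) < w then
    some ⟨s.q, fun i => ⟨readNat mem (s.inAddr i), h.1 i⟩,
      fun o => ⟨readNat mem (s.outAddr o), h.2 o⟩⟩
  else none

/-- A call of a quantum circuit of depth `d`: on `w` qubits, layers `U₁, …, U_{d+1}` of one- and
two-qubit gates with a layer of parallel oracle queries between any two consecutive ones. Qubit `i`
starts in the standard basis state given by register `reg i`; at the end all qubits are measured in
the standard basis, and the outcome for qubit `i` is stored in register `reg i`. -/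
structure QCall (S : OracleSig) (d M : ℕ) where
  w : ℕ
  reg : Fin w ↪ Fin M
  gates : Fin (d + 1) → List (GateSlot M)
  queries : Fin d → List (OracleSlot S M)

/-- The state `U_{d+1} O U_d ⋯ O U₁ |x⟩` before the measurement, where `x` is the classical input of
the circuit. -/
noncomputable def QCall.finalState {S : OracleSig} {d M : ℕ} (C : QCall S d M) (O : S.Oracle)
    (mem : Fin M → Bool) : Bits C.w → ℂ :=
  let layer (i : Fin (d + 1)) (ψ : Bits C.w → ℂ) : Bits C.w → ℂ :=
    applyGates ((C.gates i).filterMap fun s => s.resolve mem C.w) ψ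
  let ask (i : Fin d) (ψ : Bits C.w → ℂ) : Bits C.w → ℂ :=
    applyOracleGates O ((C.queries i).filterMap fun s => s.resolve mem C.w) ψ
  Fin.foldl d (fun ψ i => layer i.succ (ask i ψ))
    (layer 0 fun z => if z = mem ∘ C.reg then 1 else 0)

/-! ## Schemes -/

/-- The steps of a `d`-CQ scheme with `M` registers: Boolean operations, coin tosses, classical
oracle queries (of one answer bit), and calls of quantum circuits of depth `d`. -/
inductive Step (S : OracleSig) (d M : ℕ) : Type
  | nand (dst a b : Fin M)
  | coin (dst : Fin M)
  | query (dst : Fin M) (q : S.Q) (o : S.Out q) (inp : S.In q → Fin M)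
  | call (C : QCall S d M)

/-- A `d`-CQ scheme for one input length: a randomized classical Boolean circuit (written as a
straight-line program) with classical oracle queries and with calls of depth-`d` quantum circuits
that query the oracle in superposition. -/
structure Scheme (S : OracleSig) (d : ℕ) where
  M : ℕ
  steps : List (Step S d M)
  out : Fin M

/-- The probability that the program `l`, started with register contents `mem`, ends with
register `out` equal to `1`. -/
noncomputable def acceptFrom {S : OracleSig} {d M : ℕ} (O : S.Oracle) (out : Fin M) :
    List (Step S d M) → (Fin M → Bool) → ℝ
  | [], mem => if mem out = true then 1 else 0
  | .nand dst a b :: l, mem =>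
      acceptFrom O out l (Function.update mem dst (!(mem a && mem b)))
  | .coin dst :: l, mem =>
      (acceptFrom O out l (Function.update mem dst false) +
        acceptFrom O out l (Function.update mem dst true)) / 2
  | .query dst q o inp :: l, mem =>
      acceptFrom O out l (Function.update mem dst (O q (mem ∘ inp) o))
  | .call C :: l, mem =>
      ∑ z : Bits C.w, ‖C.finalState O mem z‖ ^ 2 *
        acceptFrom O out l (Function.extend C.reg z mem)

/-- The probability that a scheme with oracle `O` accepts `x`. The input is put into the first
registers; all others start with `0`. -/
noncomputable def Scheme.acceptProb {S : OracleSig} {d n : ℕ} (A : Scheme S d) (O : S.Oracle)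
    (x : Bits n) : ℝ :=
  acceptFrom O A.out A.steps fun r => if h : (r : ℕ) < n then x ⟨r, h⟩ else false

def GateSlot.size {M : ℕ} (s : GateSlot M) : ℕ := 1 + ∑ i, (s.addr i).length

def OracleSlot.size {S : OracleSig} {M : ℕ} (s : OracleSlot S M) : ℕ :=
  1 + ∑ i, ((s.inAddr i).length + 1) + ∑ o, ((s.outAddr o).length + 1)

def Step.size {S : OracleSig} {d M : ℕ} : Step S d M → ℕ
  | .nand _ _ _ => 1
  | .coin _ => 1
  | .query _ q _ _ => 1 + Fintype.card (S.In q)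
  | .call C => 1 + C.w + ∑ i, ((C.gates i).map GateSlot.size).sum +
      ∑ i, ((C.queries i).map OracleSlot.size).sum

/-- The size of a scheme: registers, classical steps, qubits, gates and queries all count. -/
def Scheme.size {S : OracleSig} {d : ℕ} (A : Scheme S d) : ℕ :=
  A.M + (A.steps.map Step.size).sum

def PolyBounded (s : ℕ → ℕ) : Prop := ∃ p : Polynomial ℕ, ∀ n, s n ≤ p.eval n

/-- The class `BPP^{BQNC_d}` relative to the oracle `O`: the languages decided with error at most
`1/3` by a polynomial-size family of `d`-CQ schemes with oracle `O`. -/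
def BPPBQNC (S : OracleSig) (O : S.Oracle) (d : ℕ) : Set (∀ n, Set (Bits n)) :=
  {L | ∃ A : ℕ → Scheme S d, PolyBounded (fun n => (A n).size) ∧
    ∀ n, 0 < n → ∀ x : Bits n,
      (x ∈ L n → 2 / 3 ≤ (A n).acceptProb O x) ∧ (x ∉ L n → (A n).acceptProb O x ≤ 1 / 3)}

/-! ## Simon functions and their shufflings -/

/-- `f` is two-to-one with a hidden shift `s ≠ 0`. -/
def IsSimon {n : ℕ} (f : Bits n → Bits n) : Prop :=
  ∃ s : Bits n, s ≠ (fun _ => false) ∧ ∀ x y, f x = f y ↔ y = x ∨ y = fun i => xor (x i) (s i)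

/-- The points of the large domain `{0,1}^{(d+2)n}`. -/
abbrev Big (d n : ℕ) : Type := Bits ((d + 2) * n)

/-- The inclusion of `{0,1}^n` into the large domain: append zeros. -/
def pad {d n : ℕ} (x : Bits n) : Big d n := fun i => if h : (i : ℕ) < n then x ⟨i, h⟩ else false

/-- The first `n` bits of a point of the large domain. -/
def firstBits {d n : ℕ} (y : Big d n) : Bits n := fun i =>
  y ⟨i, i.2.trans_le (Nat.le_mul_of_pos_left n (Nat.succ_pos _))⟩

/-- The one-to-one functions `f₀, …, f_{d-1}` of a shuffling. -/
abbrev Shuffle (d n : ℕ) : Type := Fin d → Equiv.Perm (Big d n)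

/-- The composition `f_{d-1} ∘ ⋯ ∘ f₀`. -/
def Shuffle.comp {d n : ℕ} (F : Shuffle d n) : Equiv.Perm (Big d n) :=
  (List.ofFn F).foldl (fun e g => e.trans g) (Equiv.refl _)

/-- The last function `f_d` of the shuffling of `f`: it takes the image under `f_{d-1} ∘ ⋯ ∘ f₀` of
`x ∈ {0,1}^n` to `f x`, and all other points to `⊥`. -/
def lastFn {d n : ℕ} (f : Bits n → Bits n) (F : Shuffle d n) (y : Big d n) :
    Option (Big d n) :=
  if pad (firstBits (F.comp.symm y)) = F.comp.symm y then
    some (pad (f (firstBits (F.comp.symm y))))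
  else none

/-- The shuffling `(f₀, …, f_d)` of `f`; `none` stands for `⊥`. -/
def shuffling {d n : ℕ} (f : Bits n → Bits n) (F : Shuffle d n) (j : Fin (d + 1))
    (y : Big d n) : Option (Big d n) :=
  if h : (j : ℕ) < d then some (F ⟨j, h⟩ y) else lastFn f F y

/-- Encoding of `{0,1}^N ∪ {⊥}` by `N + 1` bits, the first of which flags `⊥`. -/
def encodeAnswer {N : ℕ} : Option (Bits N) → (Option (Fin N) → Bool)
  | none => fun o => o.isNone
  | some v => fun o => o.elim false v

open Classical in
/-- The answer to the query `(j, y)`, where the index `j` of the function is given in one-hot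
encoding by `c` (if `c` is not the encoding of an index, the answer is `⊥`). -/
noncomputable def shufflingAnswer {d n : ℕ} (f : Bits n → Bits n) (F : Shuffle d n)
    (c : Fin (d + 1) → Bool) (y : Big d n) : Option (Fin ((d + 2) * n)) → Bool :=
  encodeAnswer (if h : ∃ j, ∀ i, c i = true ↔ i = j then shuffling f F h.choose y else none)

/-! ## The shuffling Simon problem -/

/-- The signature of the shuffling oracle of a single function on `{0,1}^n`. -/
def sspSig (d n : ℕ) : OracleSig where
  Q := Unit
  In := fun _ => Fin (d + 1) ⊕ Fin ((d + 2) * n)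
  Out := fun _ => Option (Fin ((d + 2) * n))
  fin := fun _ => inferInstance
  fout := fun _ => inferInstance

/-- The shuffling oracle of `f` with one-to-one functions `F`. -/
noncomputable def sspOracle {d n : ℕ} (f : Bits n → Bits n) (F : Shuffle d n) :
    (sspSig d n).Oracle :=
  fun _ z => shufflingAnswer f F (fun i => z (Sum.inl i)) (fun i => z (Sum.inr i))

/-- The probability that a scheme, which has no input but the oracle, accepts. -/
noncomputable def sspAccept {d n k : ℕ} (A : Scheme (sspSig d n) k) (f : Bits n → Bits n)
    (F : Shuffle d n) : ℝ :=
  A.acceptProb (sspOracle f F) (Fin.elim0 : Bits 0)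

open Classical in
/-- The probability that a scheme solves the `d`-shuffling Simon problem: with probability `1/2`
each, `f` is a uniformly random Simon function (which has to be accepted) or a uniformly random
one-to-one function (which has to be rejected), and `f₀, …, f_{d-1}` are uniformly random
one-to-one functions. -/
noncomputable def sspSuccess {d n k : ℕ} (A : Scheme (sspSig d n) k) : ℝ :=
  1 / 2 * (Finset.univ.filter fun f : Bits n → Bits n => IsSimon f).expect
      (fun f => Finset.univ.expect fun F : Shuffle d n => sspAccept A f F) +
    1 / 2 * (Finset.univ.filter fun f : Bits n → Bits n => Function.Injective f).expect
      (fun f => Finset.univ.expect fun F : Shuffle d n => 1 - sspAccept A f F)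

/-! ## Shuffling oracles for all inputs at once -/

/-- The signature of an oracle that gives access to one shuffling for every bit string `a`. A query
of kind `n` consists of a string `a` of length `n`, an index `j` (in one-hot encoding) and a
point. -/
def familySig (d : ℕ) : OracleSig where
  Q := ℕ
  In := fun n => Fin n ⊕ Fin (d + 1) ⊕ Fin ((d + 2) * n)
  Out := fun n => Option (Fin ((d + 2) * n))
  fin := fun _ => inferInstance
  fout := fun _ => inferInstance

/-- The oracle that gives access to a shuffling of the function `f n a` on `{0,1}^n` for every
string `a` of length `n`. -/
noncomputable def familyOracle {d : ℕ} (f : ∀ n, Bits n → (Bits n → Bits n))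
    (F : ∀ n, Bits n → Shuffle d n) : (familySig d).Oracle :=
  fun n z =>
    let a : Bits n := fun i => z (Sum.inl i)
    shufflingAnswer (n := n) (f n a) (F n a) (fun i => z (Sum.inr (Sum.inl i)))
      (fun i => z (Sum.inr (Sum.inr i)))

/-- The language of the strings whose function is a Simon function. -/
def simonLanguage (f : ∀ n, Bits n → (Bits n → Bits n)) : ∀ n, Set (Bits n) :=
  fun n => {a | IsSimon (f n a)}

/-!
The scheme of depth `2 * d + 1` runs Simon's algorithm. With `d + 1` queries it computes the
functions of the shuffling one after the other, from block `0` of the wires into block `d + 1`, and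
with `d` more queries it clears the intermediate blocks (`simonCall`, `finalState_simonCall`). Hence
a call yields a string that is orthogonal to the shift of a Simon function, and a uniformly random
string for a one-to-one function. After `2 * n + 2` calls a program made of NAND gates decides by
linear algebra over the field with two elements whether the samples have a common nonzero orthogonal
vector (`runOps_decideOps`). This is always so for a Simon function, and by a union bound with
probability at most `2 ^ (-(n + 2))` for a one-to-one function (`acceptProb_simonScheme`).

For the lower bound, the shuffling is described by the compositions `f_j ∘ ⋯ ∘ f_0`, which are
independent uniformly random permutations. The large domain contains a decreasing chain of levels
(`InLevel`), each of density `2 ^ (-n)` in the preceding one, that ends with the image of `pad`. In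
a circuit of depth `d`, the oracle of query layer `i` is replaced by a shadow which gives no answer
on the paths that start in level `i + 1` (`Hidden.shadow`). As the state before layer `i` depends
only on what is visible outside level `i`, it has little amplitude on the positions of these paths,
and the usual hybrid argument bounds the effect of the replacement (`l2_runLayers_sub_le`,
`sum_differWeight_le`). After `d` layers nothing depends on the function `f` itself.

The classical part of a scheme chooses its circuits adaptively, and what it remembers may be
correlated with the shuffling in any way. It is described by a weight `w` with values in `[0, 1]` on
the hidden data, one for every memory content. Relative to such a weight some positions are heavy:
they lie with noticeable conditional probability on a path that starts in the next level. The paths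
through heavy positions are declared to be known and are excepted from the shadow (`known`); all
other positions are then hit with small probability (`sum_hidden_le`). An entropy argument bounds
the expected number of known paths by the logarithm of the density of the weight, and thus
polynomially (`sum_card_known_le`): for uniformly random permutations the exponential moment of the
number of heavy positions that are hit is bounded by a comparison with independent sampling
(`sum_two_pow_heavyHits_le`). Step by step, the scheme is replaced by a process that reveals few
values of `f` (`exists_ideal_law`, `exists_capped`). Such a process does not distinguish Simon
functions from one-to-one functions, since a random Simon function has no collision on a small set,
with high probability, and then its values look like those of a one-to-one function
(`avg_simon_ge`). This gives `eventually_sspSuccess_le`.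

To separate the classes, one oracle has to defeat all nonuniform schemes. Up to a small change of
the gates there are only `2 ^ P` schemes of a given size, for a polynomial `P`
(`exists_scheme_index`). The index of the best scheme is treated as advice, that is, as part of the
weight above. If the shuffled functions of all `2 ^ n` strings of length `n` are independent, then a
fixed scheme decides noticeably more than half of the strings only with probability far below
`2 ^ (-P)`, by a bound on the moments of its success probability (`sum_avgCorrect_pow_le`). So some
choice of the functions and shufflings at length `n` defeats all schemes of that size
(`exists_hidden_defeating`), and a diagonalization along sparse lengths gives the oracle
(`exists_family_defeating`).
-/

set_option linter.unusedSectionVars false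

/-! ### States of a register: the `ℓ²` norm, gates and oracle layers -/

/-- The `ℓ²` norm of a state vector. -/
noncomputable def l2 {w : ℕ} (ψ : Bits w → ℂ) : ℝ := ‖(WithLp.toLp 2 ψ : EuclideanSpace ℂ (Bits w))‖

theorem l2_sq {w : ℕ} (ψ : Bits w → ℂ) : l2 ψ ^ 2 = ∑ z, ‖ψ z‖ ^ 2 := by
  unfold l2; rw [EuclideanSpace.norm_sq_eq]

theorem l2_nonneg {w : ℕ} (ψ : Bits w → ℂ) : 0 ≤ l2 ψ := norm_nonneg _

theorem l2_sub_triangle {w : ℕ} (a b c : Bits w → ℂ) : l2 (a - c) ≤ l2 (a - b) + l2 (b - c) := by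
  unfold l2
  simp only [WithLp.toLp_sub]
  exact norm_sub_le_norm_sub_add_norm_sub _ _ _

theorem l2_sub_self {w : ℕ} (a : Bits w → ℂ) : l2 (a - a) = 0 := by
  unfold l2; simp

theorem l2_eq_of_sum {w : ℕ} {a b : Bits w → ℂ} (h : ∑ z, ‖a z‖ ^ 2 = ∑ z, ‖b z‖ ^ 2) :
    l2 a = l2 b := by
  rw [← l2_sq, ← l2_sq] at h
  exact (pow_left_inj₀ (l2_nonneg _) (l2_nonneg _) two_ne_zero).1 h

/-- Measuring two states that are close in norm gives nearly the same expectation of any payoff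
with values in `[0, 1]`. -/
theorem abs_measure_sub_le {w : ℕ} (a b : Bits w → ℂ) (ha : l2 a = 1) (hb : l2 b = 1)
    (V : Bits w → ℝ) (hV : ∀ z, 0 ≤ V z ∧ V z ≤ 1) :
    |∑ z, ‖a z‖ ^ 2 * V z - ∑ z, ‖b z‖ ^ 2 * V z| ≤ 2 * l2 (a - b) := by
  have h1 : |∑ z, ‖a z‖ ^ 2 * V z - ∑ z, ‖b z‖ ^ 2 * V z| ≤
      ∑ z, ‖(a - b) z‖ * (‖a z‖ + ‖b z‖) := by
    rw [← Finset.sum_sub_distrib]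
    refine (Finset.abs_sum_le_sum_abs _ _).trans (Finset.sum_le_sum fun z _ => ?_)
    have : ‖a z‖ ^ 2 * V z - ‖b z‖ ^ 2 * V z = (‖a z‖ - ‖b z‖) * (‖a z‖ + ‖b z‖) * V z := by ring
    rw [this, abs_mul, abs_mul, abs_of_nonneg (hV z).1,
      abs_of_nonneg (add_nonneg (norm_nonneg (a z)) (norm_nonneg (b z)))]
    have h2 : |‖a z‖ - ‖b z‖| ≤ ‖(a - b) z‖ := abs_norm_sub_norm_le _ _
    calc _ ≤ |‖a z‖ - ‖b z‖| * (‖a z‖ + ‖b z‖) * 1 := by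
          gcongr; exact (hV z).2
      _ ≤ _ := by rw [mul_one]; gcongr
  refine h1.trans ?_
  simp_rw [mul_add]
  rw [Finset.sum_add_distrib]
  have cs : ∀ c : Bits w → ℂ, l2 c = 1 → ∑ z, ‖(a - b) z‖ * ‖c z‖ ≤ l2 (a - b) := by
    intro c hc
    have := Finset.sum_mul_sq_le_sq_mul_sq Finset.univ (fun z => ‖(a - b) z‖) (fun z => ‖c z‖)
    rw [← l2_sq, ← l2_sq, hc, one_pow, mul_one] at this
    exact (abs_le_of_sq_le_sq' this (l2_nonneg _)).2
  linarith [cs a ha, cs b hb]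

theorem extend_comp_self {ι κ : Type*} {p : ι → κ} (z : κ → Bool) :
    Function.extend p (z ∘ p) z = z := by
  funext r
  by_cases h : ∃ i, p i = r
  · obtain ⟨i, rfl⟩ := h
    classical
    rw [Function.extend_def, dif_pos ⟨i, rfl⟩]
    exact congrArg z (Classical.choose_spec (⟨i, rfl⟩ : ∃ j, p j = p i))
  · exact Function.extend_apply' _ _ _ h

theorem extend_extend {ι κ : Type*} {p : ι → κ} (hp : Function.Injective p) (u v : ι → Bool)
    (z : κ → Bool) :
    Function.extend p u (Function.extend p v z) = Function.extend p u z := by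
  funext r
  by_cases h : ∃ i, p i = r
  · obtain ⟨i, rfl⟩ := h
    rw [hp.extend_apply, hp.extend_apply]
  · rw [Function.extend_apply' _ _ _ h, Function.extend_apply' _ _ _ h,
      Function.extend_apply' _ _ _ h]

theorem extend_comp {ι κ : Type*} {p : ι → κ} (hp : Function.Injective p) (u : ι → Bool)
    (z : κ → Bool) : Function.extend p u z ∘ p = u :=
  funext fun i => hp.extend_apply u z i

/-- Rewriting the bits at some positions in all possible ways visits every string equally often. -/
theorem sum_sum_extend {ι κ : Type*} [Fintype ι] [DecidableEq ι] [Fintype κ] [DecidableEq κ]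
    {p : ι → κ} (hp : Function.Injective p) (G : (κ → Bool) → ℝ) :
    ∑ z, ∑ v, G (Function.extend p v z) = (Fintype.card (ι → Bool) : ℝ) * ∑ z, G z := by
  let σ : (κ → Bool) × (ι → Bool) → (κ → Bool) × (ι → Bool) :=
    fun x => (Function.extend p x.2 x.1, x.1 ∘ p)
  have hσ : Function.Involutive σ := by
    rintro ⟨z, v⟩
    simp only [σ]
    rw [extend_extend hp, extend_comp_self, extend_comp hp]
  rw [← Fintype.sum_prod_type' (f := fun z v => G (Function.extend p v z))]
  rw [← Equiv.sum_comp hσ.toPerm]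
  simp only [Function.Involutive.coe_toPerm, σ, extend_extend hp, extend_comp_self]
  rw [Fintype.sum_prod_type]
  simp [Finset.mul_sum]

theorem sum_norm_mulVec_sq {ι : Type*} [Fintype ι] [DecidableEq ι]
    (U : Matrix.unitaryGroup ι ℂ) (x : ι → ℂ) :
    ∑ v, ‖∑ u, U.1 v u * x u‖ ^ 2 = ∑ u, ‖x u‖ ^ 2 := by
  have key : ∀ y : ι → ℂ, ((∑ u, ‖y u‖ ^ 2 : ℝ) : ℂ) = star y ⬝ᵥ y := by
    intro y
    push_cast
    refine Finset.sum_congr rfl fun u _ => ?_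
    simp only [Pi.star_apply, RCLike.star_def]
    rw [Complex.conj_mul']
  have h := key (U.1.mulVec x)
  rw [Matrix.star_mulVec, ← Matrix.dotProduct_mulVec, Matrix.mulVec_mulVec,
    ← Matrix.star_eq_conjTranspose, Matrix.UnitaryGroup.star_mul_self, Matrix.one_mulVec,
    ← key] at h
  exact_mod_cast h

theorem Gate.l2_apply {w : ℕ} (g : Gate w) (hg : Function.Injective g.pos) (ψ : Bits w → ℂ) :
    l2 (g.apply ψ) = l2 ψ := by
  apply l2_eq_of_sum
  have hc : (Fintype.card (Fin g.k → Bool) : ℝ) ≠ 0 := by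
    exact_mod_cast Fintype.card_ne_zero
  apply mul_left_cancel₀ hc
  rw [← sum_sum_extend hg, ← sum_sum_extend hg]
  refine Finset.sum_congr rfl fun z _ => ?_
  unfold Gate.apply
  simp only [extend_extend hg, extend_comp hg]
  exact sum_norm_mulVec_sq g.U fun u => ψ (Function.extend g.pos u z)

theorem Gate.apply_sub {w : ℕ} (g : Gate w) (ψ φ : Bits w → ℂ) :
    g.apply (ψ - φ) = g.apply ψ - g.apply φ := by
  funext z
  simp [Gate.apply, mul_sub, Finset.sum_sub_distrib]

theorem foldl_gates_sub {w : ℕ} (L : List (Gate w)) : ∀ ψ φ : Bits w → ℂ,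
    L.foldl (fun φ g => g.apply φ) (ψ - φ) =
      L.foldl (fun φ g => g.apply φ) ψ - L.foldl (fun φ g => g.apply φ) φ := by
  induction L with
  | nil => intro ψ φ; rfl
  | cons g L ih => intro ψ φ; simp only [List.foldl_cons, Gate.apply_sub, ih]

theorem l2_foldl_gates {w : ℕ} (L : List (Gate w)) (hL : ∀ g ∈ L, Function.Injective g.pos) :
    ∀ ψ : Bits w → ℂ, l2 (L.foldl (fun φ g => g.apply φ) ψ) = l2 ψ := by
  induction L with
  | nil => intro ψ; rfl
  | cons g L ih =>
    intro ψ
    simp only [List.foldl_cons]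
    rw [ih (fun g hg => hL g (List.mem_cons_of_mem _ hg)), g.l2_apply (hL g List.mem_cons_self)]

theorem injective_of_disjointWires {w : ℕ} {L : List (Gate w)}
    (h : DisjointWires (L.map fun g => ⟨Fin g.k, g.pos⟩)) : ∀ g ∈ L, Function.Injective g.pos :=
  fun _ hg => h.1 _ (List.mem_map_of_mem
    (f := fun g : Gate w => (⟨Fin g.k, g.pos⟩ : Σ ι : Type, ι → Fin w)) hg)

theorem l2_applyGates {w : ℕ} (L : List (Gate w)) (ψ : Bits w → ℂ) :
    l2 (applyGates L ψ) = l2 ψ := by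
  unfold applyGates
  split_ifs with h
  · exact l2_foldl_gates L (injective_of_disjointWires h) ψ
  · rfl

theorem applyGates_sub {w : ℕ} (L : List (Gate w)) (ψ φ : Bits w → ℂ) :
    applyGates L (ψ - φ) = applyGates L ψ - applyGates L φ := by
  unfold applyGates
  split_ifs with h
  · exact foldl_gates_sub L ψ φ
  · rfl

/-- The permutation of the standard basis by which an oracle gate acts. -/
noncomputable def OracleGate.flip {S : OracleSig} {w : ℕ} (O : S.Oracle) (g : OracleGate S w)
    (z : Bits w) :
    Bits w :=
  Function.extend g.outPos (fun o => xor (z (g.outPos o)) (O g.q (z ∘ g.inPos) o)) z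

/-- A gate of a layer uses each wire only once. -/
def OracleGate.Proper {S : OracleSig} {w : ℕ} (g : OracleGate S w) : Prop :=
  Function.Injective (Sum.elim g.inPos g.outPos)

theorem OracleGate.Proper.out_injective {S : OracleSig} {w : ℕ} {g : OracleGate S w}
    (h : g.Proper) : Function.Injective g.outPos :=
  h.comp Sum.inr_injective

theorem OracleGate.Proper.in_ne_out {S : OracleSig} {w : ℕ} {g : OracleGate S w}
    (h : g.Proper) (i : S.In g.q) (o : S.Out g.q) : g.outPos o ≠ g.inPos i := fun e => by
  have := @h (Sum.inr o) (Sum.inl i) e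
  simp at this

theorem OracleGate.flip_apply_of_ne {S : OracleSig} {w : ℕ} (O : S.Oracle) (g : OracleGate S w)
    (z : Bits w) {r : Fin w} (hr : ∀ o, g.outPos o ≠ r) : g.flip O z r = z r :=
  Function.extend_apply' _ _ _ (by simpa using hr)

theorem OracleGate.flip_flip {S : OracleSig} {w : ℕ} (O : S.Oracle) {g : OracleGate S w}
    (hg : g.Proper) (z : Bits w) : g.flip O (g.flip O z) = z := by
  have hin : (g.flip O z) ∘ g.inPos = z ∘ g.inPos := by
    funext i; exact g.flip_apply_of_ne O z (hg.in_ne_out i)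
  funext r
  by_cases h : ∃ o, g.outPos o = r
  · obtain ⟨o, rfl⟩ := h
    have e : ∀ y : Bits w, g.flip O y (g.outPos o) =
        xor (y (g.outPos o)) (O g.q (y ∘ g.inPos) o) := fun y =>
      hg.out_injective.extend_apply _ _ _
    rw [e, hin, e]
    simp
  · have h' : ∀ o, g.outPos o ≠ r := by simpa using h
    rw [g.flip_apply_of_ne O _ h', g.flip_apply_of_ne O _ h']

/-- The permutation of the standard basis by which a list of oracle gates acts. -/
noncomputable def flipAll {S : OracleSig} {w : ℕ} (O : S.Oracle) (L : List (OracleGate S w))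
    (z : Bits w) :
    Bits w := L.foldr (fun g z => g.flip O z) z

theorem foldl_oracleGates {S : OracleSig} {w : ℕ} (O : S.Oracle) (L : List (OracleGate S w)) :
    ∀ ψ : Bits w → ℂ, L.foldl (fun φ g => g.apply O φ) ψ = fun z => ψ (flipAll O L z) := by
  induction L with
  | nil => intro ψ; rfl
  | cons g L ih =>
    intro ψ
    rw [List.foldl_cons, ih]
    rfl

/-- The oracle gates of a list form a layer. -/
def OracleLayer {S : OracleSig} {w : ℕ} (L : List (OracleGate S w)) : Prop :=
  DisjointWires (L.map fun g =>
    (⟨S.In g.q ⊕ S.Out g.q, Sum.elim g.inPos g.outPos⟩ : Σ ι : Type, ι → Fin w))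

theorem OracleLayer.proper {S : OracleSig} {w : ℕ} {L : List (OracleGate S w)}
    (h : OracleLayer L) : ∀ g ∈ L, g.Proper :=
  fun _ hg => h.1 _ (List.mem_map_of_mem (f := fun g : OracleGate S w =>
    (⟨S.In g.q ⊕ S.Out g.q, Sum.elim g.inPos g.outPos⟩ : Σ ι : Type, ι → Fin w)) hg)

theorem OracleLayer.tail {S : OracleSig} {w : ℕ} {g : OracleGate S w} {L : List (OracleGate S w)}
    (h : OracleLayer (g :: L)) : OracleLayer L :=
  ⟨fun x hx => h.1 x (List.mem_cons_of_mem _ hx), (List.pairwise_cons.1 h.2).2⟩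

theorem OracleLayer.disjoint {S : OracleSig} {w : ℕ} {g : OracleGate S w}
    {L : List (OracleGate S w)} (h : OracleLayer (g :: L)) {g' : OracleGate S w} (hg' : g' ∈ L) :
    Disjoint (Set.range (Sum.elim g.inPos g.outPos)) (Set.range (Sum.elim g'.inPos g'.outPos)) :=
  (List.pairwise_cons.1 h.2).1 _ (List.mem_map_of_mem (f := fun g : OracleGate S w =>
    (⟨S.In g.q ⊕ S.Out g.q, Sum.elim g.inPos g.outPos⟩ : Σ ι : Type, ι → Fin w)) hg')

theorem flipAll_apply_of_ne {S : OracleSig} {w : ℕ} (O : S.Oracle) (L : List (OracleGate S w))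
    (z : Bits w) {r : Fin w} (hr : ∀ g ∈ L, ∀ o, g.outPos o ≠ r) : flipAll O L z r = z r := by
  induction L with
  | nil => rfl
  | cons g L ih =>
    change g.flip O (flipAll O L z) r = _
    rw [g.flip_apply_of_ne O _ (hr g List.mem_cons_self),
      ih fun g hg => hr g (List.mem_cons_of_mem _ hg)]

theorem OracleLayer.in_ne_out {S : OracleSig} {w : ℕ} {L : List (OracleGate S w)}
    (h : OracleLayer L) : ∀ g ∈ L, ∀ g' ∈ L, ∀ (i : S.In g.q) (o : S.Out g'.q),
      g'.outPos o ≠ g.inPos i := by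
  induction L with
  | nil => simp
  | cons g₀ L ih =>
    intro g hg g' hg' i o e
    rcases List.mem_cons.1 hg with rfl | hg1 <;> rcases List.mem_cons.1 hg' with rfl | hg1'
    · exact (h.proper _ hg).in_ne_out i o e
    · exact Set.disjoint_left.1 (h.disjoint hg1') ⟨Sum.inl i, rfl⟩ ⟨Sum.inr o, e⟩
    · exact Set.disjoint_left.1 (h.disjoint hg1) ⟨Sum.inr o, e⟩ ⟨Sum.inl i, rfl⟩
    · exact ih h.tail g hg1 g' hg1' i o e

theorem flipAll_comp_inPos {S : OracleSig} {w : ℕ} (O : S.Oracle) {L : List (OracleGate S w)}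
    (h : OracleLayer L) {g : OracleGate S w} (hg : g ∈ L) (z : Bits w) :
    flipAll O L z ∘ g.inPos = z ∘ g.inPos := by
  funext i
  exact flipAll_apply_of_ne O L z fun g' hg' o => h.in_ne_out g hg g' hg' i o

theorem flipAll_congr {S : OracleSig} {w : ℕ} (O O' : S.Oracle) {L : List (OracleGate S w)}
    (h : OracleLayer L) (z : Bits w) (hz : ∀ g ∈ L, O g.q (z ∘ g.inPos) = O' g.q (z ∘ g.inPos)) :
    flipAll O L z = flipAll O' L z := by
  induction L with
  | nil => rfl
  | cons g L ih =>
    change g.flip O (flipAll O L z) = g.flip O' (flipAll O' L z)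
    rw [ih h.tail fun g hg => hz g (List.mem_cons_of_mem _ hg)]
    have e : flipAll O' L z ∘ g.inPos = z ∘ g.inPos := by
      funext i
      exact flipAll_apply_of_ne O' L z fun g' hg' o =>
        h.in_ne_out g List.mem_cons_self g' (List.mem_cons_of_mem _ hg') i o
    unfold OracleGate.flip
    rw [e, hz g List.mem_cons_self]

theorem flipAll_bijective {S : OracleSig} {w : ℕ} (O : S.Oracle) {L : List (OracleGate S w)}
    (h : ∀ g ∈ L, g.Proper) : Function.Bijective (flipAll O L) := by
  induction L with
  | nil => exact Function.bijective_id
  | cons g L ih =>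
    have h1 : Function.Bijective (g.flip O) :=
      Function.Involutive.bijective (fun z => g.flip_flip O (h g List.mem_cons_self) z)
    exact h1.comp (ih fun g hg => h g (List.mem_cons_of_mem _ hg))

theorem applyOracleGates_eq {S : OracleSig} {w : ℕ} (O : S.Oracle) (L : List (OracleGate S w))
    (h : OracleLayer L) (ψ : Bits w → ℂ) :
    applyOracleGates O L ψ = fun z => ψ (flipAll O L z) := by
  unfold applyOracleGates
  exact (if_pos h).trans (foldl_oracleGates O L ψ)

theorem applyOracleGates_of_not {S : OracleSig} {w : ℕ} (O : S.Oracle)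
    (L : List (OracleGate S w)) (h : ¬ OracleLayer L) (ψ : Bits w → ℂ) :
    applyOracleGates O L ψ = ψ := by
  unfold applyOracleGates
  exact if_neg h

theorem applyOracleGates_sub {S : OracleSig} {w : ℕ} (O : S.Oracle) (L : List (OracleGate S w))
    (ψ φ : Bits w → ℂ) :
    applyOracleGates O L (ψ - φ) = applyOracleGates O L ψ - applyOracleGates O L φ := by
  by_cases h : OracleLayer L
  · rw [applyOracleGates_eq O L h, applyOracleGates_eq O L h, applyOracleGates_eq O L h]; rfl
  · rw [applyOracleGates_of_not O L h, applyOracleGates_of_not O L h,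
      applyOracleGates_of_not O L h]

theorem l2_applyOracleGates {S : OracleSig} {w : ℕ} (O : S.Oracle) (L : List (OracleGate S w))
    (ψ : Bits w → ℂ) : l2 (applyOracleGates O L ψ) = l2 ψ := by
  by_cases h : OracleLayer L
  · rw [applyOracleGates_eq O L h]
    apply l2_eq_of_sum
    exact (flipAll_bijective O h.proper).sum_comp (fun z => ‖ψ z‖ ^ 2)
  · rw [applyOracleGates_of_not O L h]

/-- Some gate of the layer asks, at the basis state `z`, a query on which the oracles differ. -/
def Differ {S : OracleSig} {w : ℕ} (O O' : S.Oracle) (L : List (OracleGate S w)) (z : Bits w) :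
    Prop := ∃ g ∈ L, O g.q (z ∘ g.inPos) ≠ O' g.q (z ∘ g.inPos)

open Classical in
/-- The squared weight of a state on the basis states at which two oracles differ. -/
noncomputable def differWeight {S : OracleSig} {w : ℕ} (O O' : S.Oracle)
    (L : List (OracleGate S w)) (ψ : Bits w → ℂ) : ℝ :=
  ∑ z, if Differ O O' L z then ‖ψ z‖ ^ 2 else 0

theorem differWeight_nonneg {S : OracleSig} {w : ℕ} (O O' : S.Oracle)
    (L : List (OracleGate S w)) (ψ : Bits w → ℂ) : 0 ≤ differWeight O O' L ψ :=
  Finset.sum_nonneg fun z _ => by split_ifs <;> positivity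

/-- Replacing the oracle in one layer costs at most twice the amplitude on the queries where the
answers differ: both layers permute the basis states and keep that set of basis states. -/
theorem l2_applyOracleGates_sub_le {S : OracleSig} {w : ℕ} (O O' : S.Oracle)
    (L : List (OracleGate S w)) (ψ : Bits w → ℂ) :
    l2 (applyOracleGates O L ψ - applyOracleGates O' L ψ) ≤
      2 * Real.sqrt (differWeight O O' L ψ) := by
  by_cases h : OracleLayer L
  swap
  · rw [applyOracleGates_of_not O L h, applyOracleGates_of_not O' L h, l2_sub_self]; positivity
  classical
  rw [applyOracleGates_eq O L h, applyOracleGates_eq O' L h]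
  have hinv : ∀ (O₁ : S.Oracle) z, Differ O O' L (flipAll O₁ L z) ↔ Differ O O' L z := by
    intro O₁ z
    unfold Differ
    refine exists_congr fun g => and_congr_right fun hg => ?_
    rw [flipAll_comp_inPos O₁ h hg]
  have hsum : ∀ O₁ : S.Oracle,
      ∑ z, (if Differ O O' L z then ‖ψ (flipAll O₁ L z)‖ ^ 2 else 0) = differWeight O O' L ψ := by
    intro O₁
    unfold differWeight
    rw [← (flipAll_bijective O₁ h.proper).sum_comp
      (fun z => if Differ O O' L z then ‖ψ z‖ ^ 2 else 0)]
    simp only [hinv]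
  have hsq : l2 ((fun z => ψ (flipAll O L z)) - fun z => ψ (flipAll O' L z)) ^ 2 ≤
      4 * differWeight O O' L ψ := by
    rw [l2_sq]
    calc _ ≤ ∑ z, (2 * (if Differ O O' L z then ‖ψ (flipAll O L z)‖ ^ 2 else 0) +
            2 * (if Differ O O' L z then ‖ψ (flipAll O' L z)‖ ^ 2 else 0)) := by
          refine Finset.sum_le_sum fun z _ => ?_
          split_ifs with hz
          · rw [Pi.sub_apply]
            have := norm_sub_le (ψ (flipAll O L z)) (ψ (flipAll O' L z))
            nlinarith [norm_nonneg (ψ (flipAll O L z) - ψ (flipAll O' L z)),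
              sq_nonneg (‖ψ (flipAll O L z)‖ - ‖ψ (flipAll O' L z)‖)]
          · have : flipAll O L z = flipAll O' L z := by
              apply flipAll_congr O O' h
              intro g hg
              by_contra hne
              exact hz ⟨g, hg, hne⟩
            simp [this]
      _ = _ := by
          rw [Finset.sum_add_distrib, ← Finset.mul_sum, ← Finset.mul_sum, hsum, hsum]; ring
  have h0 := differWeight_nonneg O O' L ψ
  apply le_of_sq_le_sq _ (by positivity)
  rw [mul_pow, Real.sq_sqrt h0]
  linarith

/-! ### Runs of a layered circuit -/

/-- The state after `i` oracle layers of a circuit with gate layers `G` and query layers `Q`, where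
the `i`-th query layer may have its own oracle. -/
noncomputable def runLayers {S : OracleSig} {w : ℕ} (G : ℕ → List (Gate w))
    (Q : ℕ → List (OracleGate S w)) (Os : ℕ → S.Oracle) (ψ : Bits w → ℂ) : ℕ → Bits w → ℂ
  | 0 => applyGates (G 0) ψ
  | i + 1 => applyGates (G (i + 1)) (applyOracleGates (Os i) (Q i) (runLayers G Q Os ψ i))

theorem l2_runLayers {S : OracleSig} {w : ℕ} (G : ℕ → List (Gate w))
    (Q : ℕ → List (OracleGate S w)) (Os : ℕ → S.Oracle) (ψ : Bits w → ℂ) (i : ℕ) :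
    l2 (runLayers G Q Os ψ i) = l2 ψ := by
  induction i with
  | zero => exact l2_applyGates _ _
  | succ i ih => rw [runLayers, l2_applyGates, l2_applyOracleGates, ih]

/-- The hybrid argument: replacing the oracles layer by layer. -/
theorem l2_runLayers_sub_le {S : OracleSig} {w : ℕ} (G : ℕ → List (Gate w))
    (Q : ℕ → List (OracleGate S w)) (Os Os' : ℕ → S.Oracle) (ψ : Bits w → ℂ) (i : ℕ) :
    l2 (runLayers G Q Os ψ i - runLayers G Q Os' ψ i) ≤
      ∑ k ∈ Finset.range i,
        2 * Real.sqrt (differWeight (Os k) (Os' k) (Q k) (runLayers G Q Os' ψ k)) := by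
  induction i with
  | zero => simp only [runLayers, l2_sub_self, Finset.range_zero, Finset.sum_empty, le_refl]
  | succ i ih =>
    rw [Finset.sum_range_succ]
    simp only [runLayers]
    rw [← applyGates_sub, l2_applyGates]
    refine (l2_sub_triangle _ (applyOracleGates (Os i) (Q i) (runLayers G Q Os' ψ i)) _).trans ?_
    rw [← applyOracleGates_sub, l2_applyOracleGates]
    exact add_le_add ih (l2_applyOracleGates_sub_le _ _ _ _)

/-- The gates of the `i`-th layer of a call. -/
noncomputable def QCall.gatesAt {S : OracleSig} {d M : ℕ} (C : QCall S d M) (mem : Fin M → Bool)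
    (i : ℕ) : List (Gate C.w) :=
  if h : i < d + 1 then (C.gates ⟨i, h⟩).filterMap fun s => s.resolve mem C.w else []

/-- The oracle gates of the `i`-th query layer of a call. -/
noncomputable def QCall.queriesAt {S : OracleSig} {d M : ℕ} (C : QCall S d M) (mem : Fin M → Bool)
    (i : ℕ) : List (OracleGate S C.w) :=
  if h : i < d then (C.queries ⟨i, h⟩).filterMap fun s => s.resolve mem C.w else []

/-- The state after `i` query layers of a call, where every query layer has its own oracle. -/
noncomputable def QCall.stateAt {S : OracleSig} {d M : ℕ} (C : QCall S d M) (Os : ℕ → S.Oracle)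
    (mem : Fin M → Bool) (i : ℕ) : Bits C.w → ℂ :=
  runLayers (C.gatesAt mem) (C.queriesAt mem) Os (fun z => if z = mem ∘ C.reg then 1 else 0) i

theorem Fin.foldl_eq_of_step {α : Type*} (n : ℕ) (f : Fin n → α → α) (s : ℕ → α)
    (h : ∀ i : Fin n, s (i + 1) = f i (s i)) :
    Fin.foldl n (fun a i => f i a) (s 0) = s n := by
  induction n with
  | zero => simp
  | succ n ih =>
    rw [Fin.foldl_succ_last, ih (fun i => f i.castSucc) (fun i => h i.castSucc)]
    exact (h (Fin.last n)).symm

theorem QCall.finalState_eq {S : OracleSig} {d M : ℕ} (C : QCall S d M) (O : S.Oracle)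
    (mem : Fin M → Bool) : C.finalState O mem = C.stateAt (fun _ => O) mem d := by
  unfold QCall.finalState
  rw [← Fin.foldl_eq_of_step d
    (fun i ψ => applyGates ((C.gates i.succ).filterMap fun s => s.resolve mem C.w)
      (applyOracleGates O ((C.queries i).filterMap fun s => s.resolve mem C.w) ψ))
    (C.stateAt (fun _ => O) mem)]
  · simp [QCall.stateAt, runLayers, QCall.gatesAt]
  · intro i
    simp [QCall.stateAt, runLayers, QCall.gatesAt, QCall.queriesAt, Fin.succ]

theorem l2_basisState {w : ℕ} (y : Bits w) : l2 (fun z => if z = y then 1 else 0) = 1 := by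
  have : l2 (fun z : Bits w => if z = y then (1 : ℂ) else 0) ^ 2 = 1 := by
    rw [l2_sq, Finset.sum_eq_single y] <;> simp +contextual
  exact (pow_eq_one_iff_of_nonneg (l2_nonneg _) two_ne_zero).1 this

theorem QCall.l2_stateAt {S : OracleSig} {d M : ℕ} (C : QCall S d M) (Os : ℕ → S.Oracle)
    (mem : Fin M → Bool) (i : ℕ) : l2 (C.stateAt Os mem i) = 1 := by
  unfold QCall.stateAt
  rw [l2_runLayers, l2_basisState]

theorem QCall.l2_finalState {S : OracleSig} {d M : ℕ} (C : QCall S d M) (O : S.Oracle)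
    (mem : Fin M → Bool) : l2 (C.finalState O mem) = 1 := by
  rw [QCall.finalState_eq, QCall.l2_stateAt]

theorem QCall.sum_finalState {S : OracleSig} {d M : ℕ} (C : QCall S d M) (O : S.Oracle)
    (mem : Fin M → Bool) : ∑ z, ‖C.finalState O mem z‖ ^ 2 = 1 := by
  rw [← l2_sq, C.l2_finalState, one_pow]

theorem acceptFrom_mem_Icc {S : OracleSig} {d M : ℕ} (O : S.Oracle) (out : Fin M)
    (l : List (Step S d M)) : ∀ mem, 0 ≤ acceptFrom O out l mem ∧ acceptFrom O out l mem ≤ 1 := by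
  induction l with
  | nil => intro mem; unfold acceptFrom; split_ifs <;> simp
  | cons s l ih =>
    intro mem
    cases s with
    | nand dst a b => exact ih _
    | coin dst =>
      have h1 := ih (Function.update mem dst false)
      have h2 := ih (Function.update mem dst true)
      simp only [acceptFrom]
      constructor <;> linarith [h1.1, h1.2, h2.1, h2.2]
    | query dst q o inp => exact ih _
    | call C =>
      simp only [acceptFrom]
      refine ⟨Finset.sum_nonneg fun z _ => mul_nonneg (by positivity) (ih _).1, ?_⟩
      rw [← C.sum_finalState O mem]
      exact Finset.sum_le_sum fun z _ => mul_le_of_le_one_right (by positivity) (ih _).2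

/-! ### Hidden paths and the paths that a memory content reveals -/

/-- The hidden data of a family of shufflings, one for each salt `a`: the permutations `p a j`,
which stand for the compositions `f_j ∘ ⋯ ∘ f_0`, and the shuffled functions. A *path* is a pair of
a salt and a starting point; the permutation `p a j` gives its position after `j + 1` functions. -/
abbrev Hidden (d n : ℕ) (Salt : Type) : Type :=
  (Salt → Fin d → Equiv.Perm (Big d n)) × (Salt → Bits n → Bits n)

/-- The points of the large domain whose last `k` blocks of `n` bits vanish. These sets decrease
from the whole domain, for `k = 0`, to the image of `pad`, for `k = d + 1`. -/
def InLevel (d n k : ℕ) (x : Big d n) : Prop :=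
  ∀ i : Fin ((d + 2) * n), (d + 2 - k) * n ≤ i → x i = false

theorem InLevel.pred {d n k : ℕ} {x : Big d n} (h : InLevel d n (k + 1) x) : InLevel d n k x :=
  fun i hi => h i (le_trans (Nat.mul_le_mul_right n (by omega)) hi)

open Classical in
theorem card_inLevel (d n k : ℕ) :
    (Finset.univ.filter fun x : Big d n => InLevel d n k x).card = 2 ^ ((d + 2 - k) * n) := by
  have h : (Finset.univ.filter fun x : Big d n => InLevel d n k x) =
      Fintype.piFinset fun i : Fin ((d + 2) * n) =>
        if (d + 2 - k) * n ≤ i then ({false} : Finset Bool) else Finset.univ := by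
    ext x
    rw [Finset.mem_filter, Fintype.mem_piFinset]
    simp only [Finset.mem_univ, true_and]
    refine forall_congr' fun i => ?_
    split_ifs with hi <;> simp [hi]
  rw [h, Fintype.card_piFinset]
  have h2 : ∀ i : Fin ((d + 2) * n),
      (if (d + 2 - k) * n ≤ i then ({false} : Finset Bool) else Finset.univ).card =
        if (i : ℕ) < (d + 2 - k) * n then 2 else 1 := by
    intro i
    by_cases hi : (d + 2 - k) * n ≤ i
    · simp [hi, not_lt.2 hi]
    · simp [hi, not_le.1 hi]
  rw [Finset.prod_congr rfl fun i _ => h2 i, Finset.prod_ite]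
  simp only [Finset.prod_const, one_pow, mul_one]
  congr 1
  have hle : (d + 2 - k) * n ≤ (d + 2) * n := Nat.mul_le_mul_right n (by omega)
  rw [← Fintype.card_subtype]
  rw [Fintype.card_congr (Fin.castLEquiv hle).symm]
  simp

open Classical in
theorem card_inLevel_succ {d n k : ℕ} (hk : k ≤ d + 1) :
    2 ^ n * (Finset.univ.filter fun x : Big d n => InLevel d n (k + 1) x).card =
      (Finset.univ.filter fun x : Big d n => InLevel d n k x).card := by
  rw [card_inLevel, card_inLevel, ← pow_add]
  congr 1
  obtain ⟨c, hc⟩ : ∃ c, d + 2 - k = c + 1 := ⟨d + 1 - k, by omega⟩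
  rw [hc, show d + 2 - (k + 1) = c by omega]; ring

section core
variable {d n : ℕ} {Salt : Type} [Fintype Salt] [DecidableEq Salt]

/-- A path is hidden at level `k` if it starts in the level and is not in the given set. -/
def IsHidden (k : ℕ) (K : Finset (Salt × Big d n)) (e : Salt × Big d n) : Prop :=
  InLevel d n k e.2 ∧ e ∉ K

/-- The path that is at `y` after `j + 1` functions. -/
def Hidden.path (ω : Hidden d n Salt) (j : Fin d) (y : Salt × Big d n) : Salt × Big d n :=
  (y.1, (ω.1 y.1 j).symm y.2)

open Classical in
/-- What is visible of `ω` at level `k` when the paths in `K ω` are known: the first `k`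
permutations, all permutations outside the hidden paths, and the values of the functions on the
known paths. -/
noncomputable def view (K : Hidden d n Salt → Finset (Salt × Big d n)) (k : ℕ)
    (ω : Hidden d n Salt) : Finset (Salt × Big d n) ×
      (Salt → Fin d → Big d n → Option (Big d n)) × (Salt → Bits n → Option (Bits n)) :=
  (K ω, fun a j x => if (j : ℕ) < k ∨ ¬ IsHidden k (K ω) (a, x) then some (ω.1 a j x) else none,
    fun a x => if (a, pad x) ∈ K ω then some (ω.2 a x) else none)

/-- `ω` and `ω'` agree on everything that is visible at level `k` when the paths in `K` are
known. -/
def Agree (k : ℕ) (K : Finset (Salt × Big d n)) (ω ω' : Hidden d n Salt) : Prop :=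
  (∀ a (j : Fin d) x, (j : ℕ) < k ∨ ¬ IsHidden k K (a, x) → ω.1 a j x = ω'.1 a j x) ∧
    ∀ a x, (a, pad x) ∈ K → ω.2 a x = ω'.2 a x

theorem view_eq_of_agree {K : Hidden d n Salt → Finset (Salt × Big d n)} {k : ℕ}
    {ω ω' : Hidden d n Salt} (h : Agree k (K ω) ω ω') (hK : K ω' = K ω) :
    view K k ω' = view K k ω := by
  unfold view
  rw [hK]
  congr 2
  · funext a j x
    split_ifs with hx
    · rw [h.1 a j x hx]
    · rfl
  · funext a x
    split_ifs with hx
    · rw [h.2 a x hx]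
    · rfl

theorem agree_of_view_eq {K : Hidden d n Salt → Finset (Salt × Big d n)} {k : ℕ}
    {ω ω' : Hidden d n Salt} (h : view K k ω = view K k ω') : Agree k (K ω) ω ω' := by
  classical
  have h1 : K ω = K ω' := congrArg Prod.fst h
  constructor
  · intro a j x hx
    have := congrFun (congrFun (congrFun (congrArg (fun v => v.2.1) h) a) j) x
    simp only [view] at this
    rw [← h1, if_pos hx, if_pos hx] at this
    exact Option.some_injective _ this
  · intro a x hx
    have := congrFun (congrFun (congrArg (fun v => v.2.2) h) a) x
    simp only [view] at this
    rw [← h1, if_pos hx, if_pos hx] at this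
    exact Option.some_injective _ this

open Classical in
/-- The hidden data with a given view. -/
noncomputable def fiber (K : Hidden d n Salt → Finset (Salt × Big d n)) (k : ℕ)
    (v : Finset (Salt × Big d n) ×
      (Salt → Fin d → Big d n → Option (Big d n)) × (Salt → Bits n → Option (Bits n))) :
    Finset (Hidden d n Salt) :=
  Finset.univ.filter fun ω => view K k ω = v

theorem mem_fiber {K : Hidden d n Salt → Finset (Salt × Big d n)} {k : ℕ} {v} {ω} :
    ω ∈ fiber K k v ↔ view K k ω = v := by
  simp [fiber]

open Classical in
/-- A position `y` is heavy for a view if, under the conditional distribution given by the weight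
`μ`, the path through `y` is with probability more than `θ` one of the hidden paths of the next
level. -/
def Heavy (θ : ℝ) (μ : Hidden d n Salt → ℝ) (K : Hidden d n Salt → Finset (Salt × Big d n))
    (k : ℕ) (j : Fin d) (v : Finset (Salt × Big d n) ×
      (Salt → Fin d → Big d n → Option (Big d n)) × (Salt → Bits n → Option (Bits n)))
    (y : Salt × Big d n) : Prop :=
  θ * ∑ ω ∈ fiber K k v, μ ω <
    ∑ ω ∈ fiber K k v, if IsHidden (k + 1) (K ω) (ω.path j y) then μ ω else 0

open Classical in
/-- The known paths at level `k`: at each level the paths through heavy positions become known. -/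
noncomputable def known (θ : ℝ) (μ : Hidden d n Salt → ℝ) :
    ℕ → Hidden d n Salt → Finset (Salt × Big d n)
  | 0 => fun _ => ∅
  | k + 1 => fun ω => known θ μ k ω ∪ Finset.univ.filter fun e =>
      InLevel d n (k + 1) e.2 ∧ ∃ j : Fin d, k ≤ j ∧
        Heavy θ μ (known θ μ k) k j (view (known θ μ k) k ω) (e.1, ω.1 e.1 j e.2)

theorem mem_known_succ {θ : ℝ} {μ : Hidden d n Salt → ℝ} {k : ℕ} {ω : Hidden d n Salt}
    {e : Salt × Big d n} : e ∈ known θ μ (k + 1) ω ↔ e ∈ known θ μ k ω ∨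
      (InLevel d n (k + 1) e.2 ∧ ∃ j : Fin d, k ≤ j ∧
        Heavy θ μ (known θ μ k) k j (view (known θ μ k) k ω) (e.1, ω.1 e.1 j e.2)) := by
  simp [known]

/-- The set of known paths is itself visible. -/
theorem known_congr {θ : ℝ} {μ : Hidden d n Salt → ℝ} {k : ℕ} : ∀ {ω ω' : Hidden d n Salt},
    Agree k (known θ μ k ω) ω ω' → known θ μ k ω' = known θ μ k ω := by
  induction k with
  | zero => intro ω ω' _; rfl
  | succ k ih =>
    intro ω ω' h
    have hsub : ∀ e, ¬ IsHidden k (known θ μ k ω) e → ¬ IsHidden (k + 1) (known θ μ (k + 1) ω) e :=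
      fun e he h1 => he ⟨h1.1.pred, fun h2 => h1.2 (mem_known_succ.2 (Or.inl h2))⟩
    have h0 : Agree k (known θ μ k ω) ω ω' := by
      refine ⟨fun a j x hx => h.1 a j x ?_, fun a x hx => h.2 a x (mem_known_succ.2 (Or.inl hx))⟩
      exact hx.imp (fun h => Nat.lt_succ_of_lt h) (hsub _)
    have hk := ih h0
    have hv := view_eq_of_agree h0 hk
    ext e
    rw [mem_known_succ, mem_known_succ, hk, hv]
    by_cases hk1 : e ∈ known θ μ k ω
    · simp [hk1]
    simp only [hk1, false_or]
    refine and_congr_right fun he => exists_congr fun j => and_congr_right fun hj => ?_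
    by_cases hK : e ∈ known θ μ (k + 1) ω
    · rw [h.1 e.1 j e.2 (Or.inr fun hh => hh.2 hK)]
    · -- Both permutations map the hidden paths onto the same set of positions.
      have hno : ¬ Heavy θ μ (known θ μ k) k j (view (known θ μ k) k ω) (e.1, ω.1 e.1 j e.2) :=
        fun hH => hK (mem_known_succ.2 (Or.inr ⟨he, j, hj, hH⟩))
      refine iff_of_false (fun hH => ?_) hno
      set x₁ := (ω.1 e.1 j).symm (ω'.1 e.1 j e.2) with hx₁
      have hx₁' : ω.1 e.1 j x₁ = ω'.1 e.1 j e.2 := by rw [hx₁, Equiv.apply_symm_apply]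
      by_cases hh : IsHidden (k + 1) (known θ μ (k + 1) ω) (e.1, x₁)
      · apply hh.2
        refine mem_known_succ.2 (Or.inr ⟨hh.1, j, hj, ?_⟩)
        rw [← hx₁'] at hH
        exact hH
      · have h1 := h.1 e.1 j x₁ (Or.inr hh)
        rw [hx₁'] at h1
        have h2 : e.2 = x₁ := (ω'.1 e.1 j).injective h1
        exact hh ⟨h2 ▸ he, h2 ▸ hK⟩

/-- A quantity that is determined by what is visible splits into sums over the views. -/
theorem sum_le_of_fiber (K : Hidden d n Salt → Finset (Salt × Big d n)) (k : ℕ)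
    (F G : Hidden d n Salt → ℝ)
    (h : ∀ v, ∑ ω ∈ fiber K k v, F ω ≤ ∑ ω ∈ fiber K k v, G ω) : ∑ ω, F ω ≤ ∑ ω, G ω := by
  classical
  rw [← Finset.sum_fiberwise_of_maps_to (s := Finset.univ) (t := Finset.univ.image (view K k))
    (g := view K k) (fun ω _ => Finset.mem_image_of_mem _ (Finset.mem_univ ω)) F,
    ← Finset.sum_fiberwise_of_maps_to (s := Finset.univ) (t := Finset.univ.image (view K k))
    (g := view K k) (fun ω _ => Finset.mem_image_of_mem _ (Finset.mem_univ ω)) G]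
  refine Finset.sum_le_sum fun v _ => ?_
  have := h v
  unfold fiber at this
  convert this

open Classical in
/-- A visible query hits a path that stays hidden with conditional probability at most `θ`. -/
theorem sum_hidden_le {θ : ℝ} (hθ : 0 ≤ θ) {μ : Hidden d n Salt → ℝ} (hμ : ∀ ω, 0 ≤ μ ω) (k : ℕ)
    (j : Fin d) (hj : k ≤ j) (y : Salt × Big d n) (g : Hidden d n Salt → ℝ) (hg : ∀ ω, 0 ≤ g ω)
    (hgv : ∀ ω ω', view (known θ μ k) k ω = view (known θ μ k) k ω' → g ω = g ω') :
    ∑ ω, (if IsHidden (k + 1) (known θ μ (k + 1) ω) (ω.path j y) then μ ω * g ω else 0) ≤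
      θ * ∑ ω, μ ω * g ω := by
  rw [Finset.mul_sum]
  refine sum_le_of_fiber (known θ μ k) k _ _ fun v => ?_
  rcases (fiber (known θ μ k) k v).eq_empty_or_nonempty with he | ⟨ω₀, hω₀⟩
  · simp [he]
  have hg0 : ∀ ω ∈ fiber (known θ μ k) k v, g ω = g ω₀ := fun ω hω =>
    hgv _ _ ((mem_fiber.1 hω).trans (mem_fiber.1 hω₀).symm)
  have hR : ∑ ω ∈ fiber (known θ μ k) k v, θ * (μ ω * g ω) =
      (θ * ∑ ω ∈ fiber (known θ μ k) k v, μ ω) * g ω₀ := by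
    rw [mul_assoc, Finset.sum_mul, Finset.mul_sum]
    exact Finset.sum_congr rfl fun ω hω => by rw [hg0 ω hω]
  rw [hR]
  by_cases hH : Heavy θ μ (known θ μ k) k j v y
  · refine (Finset.sum_nonpos fun ω hω => ?_).trans
      (mul_nonneg (mul_nonneg hθ (Finset.sum_nonneg fun ω _ => hμ ω)) (hg ω₀))
    rw [if_neg]
    intro hh
    refine hh.2 (mem_known_succ.2 (Or.inr ⟨hh.1, j, hj, ?_⟩))
    rw [mem_fiber.1 hω]
    simpa [Hidden.path] using hH
  · calc _ ≤ (∑ ω ∈ fiber (known θ μ k) k v,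
            if IsHidden (k + 1) (known θ μ k ω) (ω.path j y) then μ ω else 0) * g ω₀ := by
          rw [Finset.sum_mul]
          refine Finset.sum_le_sum fun ω hω => ?_
          rw [hg0 ω hω]
          have h0 := mul_nonneg (hμ ω) (hg ω₀)
          by_cases h1 : IsHidden (k + 1) (known θ μ (k + 1) ω) (ω.path j y)
          · have h2 : IsHidden (k + 1) (known θ μ k ω) (ω.path j y) :=
              ⟨h1.1, fun h => h1.2 (mem_known_succ.2 (Or.inl h))⟩
            rw [if_pos h1, if_pos h2]
          · rw [if_neg h1]; split_ifs <;> simp [h0]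
      _ ≤ _ := mul_le_mul_of_nonneg_right (not_lt.1 hH) (hg ω₀)

/-! ### The number of known paths -/

/-- Exchange the roles of two starting points of the salt `a` from the function `j + 1` on. -/
def Hidden.swapAt (ω : Hidden d n Salt) (a : Salt) (j : Fin d) (x x' : Big d n) :
    Hidden d n Salt :=
  (Function.update ω.1 a (Function.update (ω.1 a) j (ω.1 a j * Equiv.swap x x')), ω.2)

theorem Hidden.swapAt_apply (ω : Hidden d n Salt) (a : Salt) (j : Fin d) (x x' : Big d n) :
    (ω.swapAt a j x x').1 a j = ω.1 a j * Equiv.swap x x' := by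
  simp [Hidden.swapAt]

theorem Hidden.swapAt_swapAt (ω : Hidden d n Salt) (a : Salt) (j : Fin d) (x x' : Big d n) :
    (ω.swapAt a j x x').swapAt a j x x' = ω := by
  simp [Hidden.swapAt, mul_assoc]

theorem Hidden.swapAt_agree {k : ℕ} {K : Finset (Salt × Big d n)} (ω : Hidden d n Salt) (a : Salt)
    {j : Fin d} (hj : k ≤ j) {x x' : Big d n} (hx : IsHidden k K (a, x))
    (hx' : IsHidden k K (a, x')) : Agree k K ω (ω.swapAt a j x x') := by
  refine ⟨fun b i z hz => ?_, fun _ _ _ => rfl⟩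
  by_cases hb : b = a
  · subst hb
    by_cases hi : i = j
    · subst hi
      rcases hz with hz | hz
      · omega
      · rw [Hidden.swapAt_apply, Equiv.Perm.mul_apply, Equiv.swap_apply_of_ne_of_ne]
        · rintro rfl; exact hz hx
        · rintro rfl; exact hz hx'
    · simp [Hidden.swapAt, hi]
  · simp [Hidden.swapAt, hb]

open Classical in
/-- The hidden starting points of the salt `a` at level `k`. -/
noncomputable def hiddenPoints (k : ℕ) (K : Finset (Salt × Big d n)) (a : Salt) :
    Finset (Big d n) :=
  Finset.univ.filter fun x => IsHidden k K (a, x)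

open Classical in
/-- The hidden data with a given view for which the paths through the positions in `B` are hidden
paths of the next level. -/
noncomputable def hitFiber (K : Hidden d n Salt → Finset (Salt × Big d n)) (k : ℕ) (j : Fin d)
    (v : Finset (Salt × Big d n) ×
      (Salt → Fin d → Big d n → Option (Big d n)) × (Salt → Bits n → Option (Bits n)))
    (B : Finset (Salt × Big d n)) : Finset (Hidden d n Salt) :=
  (fiber K k v).filter fun ω => ∀ y ∈ B, IsHidden (k + 1) v.1 (ω.path j y)

/-- Sampling without replacement: by exchanging the path through a new position `y` with any other
hidden path, the probability that `y` belongs to the next level is seen to be at most the density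
of that level, even if other positions are known to belong to it. -/
theorem sum_hitFiber_insert_le {K : Hidden d n Salt → Finset (Salt × Big d n)} {k : ℕ}
    (hK : ∀ ω ω', Agree k (K ω) ω ω' → K ω' = K ω) {j : Fin d} (hj : k ≤ j) (v)
    {ν : Hidden d n Salt → ℝ} (hν0 : ∀ ω, 0 ≤ ν ω) (hν : ∀ p p' f, ν (p, f) = ν (p', f))
    {B : Finset (Salt × Big d n)} {y : Salt × Big d n} (hy : y ∉ B) :
    ((hiddenPoints k v.1 y.1).card : ℝ) * ∑ ω ∈ hitFiber K k j v (insert y B), ν ω ≤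
      ((hiddenPoints (k + 1) v.1 y.1).card : ℝ) * ∑ ω ∈ hitFiber K k j v B, ν ω := by
  classical
  obtain ⟨a, y⟩ := y
  -- Let `x` be hidden at level `k`. The map exchanges `x` with the starting point `x₀` of the path
  -- through `y` from the function `j + 1` on, and remembers `x₀` instead of `x`; it is injective,
  -- as the path through `y` now starts at `x`, and it keeps both the view and the weight.
  let φ : Hidden d n Salt × Big d n → Hidden d n Salt × Big d n := fun s =>
    (s.1.swapAt a j ((s.1.1 a j).symm y) s.2, (s.1.1 a j).symm y)
  have hL : ((hiddenPoints k v.1 a).card : ℝ) * ∑ ω ∈ hitFiber K k j v (insert (a, y) B), ν ω =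
      ∑ s ∈ hitFiber K k j v (insert (a, y) B) ×ˢ hiddenPoints k v.1 a, ν s.1 := by
    rw [Finset.sum_product, Finset.mul_sum]
    simp
  have hR : ((hiddenPoints (k + 1) v.1 a).card : ℝ) * ∑ ω ∈ hitFiber K k j v B, ν ω =
      ∑ s ∈ hitFiber K k j v B ×ˢ hiddenPoints (k + 1) v.1 a, ν s.1 := by
    rw [Finset.sum_product, Finset.mul_sum]
    simp
  have hφν : ∀ s, ν (φ s).1 = ν s.1 := fun s => hν _ _ _
  have hinj : Function.Injective φ := by
    rintro ⟨ω, x⟩ ⟨ω', x'⟩ h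
    simp only [φ, Prod.mk.injEq] at h
    obtain ⟨h1, h2⟩ := h
    have e : ∀ (ω : Hidden d n Salt) x, (ω.swapAt a j ((ω.1 a j).symm y) x).1 a j x = y := by
      intro ω x
      rw [Hidden.swapAt_apply, Equiv.Perm.mul_apply, Equiv.swap_apply_right,
        Equiv.apply_symm_apply]
    have hx : x = x' := by
      have h3 := e ω x
      have h4 := e ω' x'
      rw [h1] at h3
      exact (((ω'.swapAt a j ((ω'.1 a j).symm y) x').1 a j).injective (h3.trans h4.symm))
    subst hx
    rw [h2] at h1
    have := congrArg (fun ω => Hidden.swapAt ω a j ((ω'.1 a j).symm y) x) h1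
    simp only [Hidden.swapAt_swapAt] at this
    rw [this]
  have hmaps : ∀ s ∈ hitFiber K k j v (insert (a, y) B) ×ˢ hiddenPoints k v.1 a,
      φ s ∈ hitFiber K k j v B ×ˢ hiddenPoints (k + 1) v.1 a := by
    rintro ⟨ω, x⟩ hs
    simp only [Finset.mem_product, hitFiber, Finset.mem_filter, hiddenPoints, Finset.mem_univ,
      true_and, mem_fiber] at hs ⊢
    obtain ⟨⟨hv, hB⟩, hx⟩ := hs
    have hKv : K ω = v.1 := by rw [← hv]; rfl
    have h0 : IsHidden (k + 1) v.1 (a, (ω.1 a j).symm y) := hB _ (Finset.mem_insert_self _ _)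
    have h0' : IsHidden k v.1 (a, (ω.1 a j).symm y) := ⟨h0.1.pred, h0.2⟩
    have hag : Agree k (K ω) ω (ω.swapAt a j ((ω.1 a j).symm y) x) := by
      rw [hKv]; exact ω.swapAt_agree a hj h0' hx
    refine ⟨⟨(view_eq_of_agree hag (hK _ _ hag)).trans hv, ?_⟩, h0⟩
    rintro ⟨b, z⟩ hz
    have hbz := hB _ (Finset.mem_insert_of_mem hz)
    simp only [Hidden.path] at hbz ⊢
    by_cases hb : b = a
    · subst hb
      have hzy : z ≠ y := by rintro rfl; exact hy hz
      rw [Hidden.swapAt_apply]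
      have : (ω.1 b j * Equiv.swap ((ω.1 b j).symm y) x).symm z =
          Equiv.swap ((ω.1 b j).symm y) x ((ω.1 b j).symm z) := by
        rw [Equiv.symm_apply_eq, Equiv.Perm.mul_apply, Equiv.swap_apply_self,
          Equiv.apply_symm_apply]
      rw [this]
      by_cases hzx : (ω.1 b j).symm z = x
      · rw [hzx, Equiv.swap_apply_right]; exact h0
      · rw [Equiv.swap_apply_of_ne_of_ne _ hzx]
        · exact hbz
        · exact fun h => hzy ((ω.1 b j).symm.injective h)
    · have : (ω.swapAt a j ((ω.1 a j).symm y) x).1 b = ω.1 b := by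
        simp [Hidden.swapAt, hb]
      rw [this]; exact hbz
  rw [hL, hR]
  calc _ = ∑ s ∈ hitFiber K k j v (insert (a, y) B) ×ˢ hiddenPoints k v.1 a, ν (φ s).1 :=
        Finset.sum_congr rfl fun s _ => (hφν s).symm
    _ = ∑ s ∈ (hitFiber K k j v (insert (a, y) B) ×ˢ hiddenPoints k v.1 a).image φ, ν s.1 :=
        (Finset.sum_image (f := fun s : Hidden d n Salt × Big d n => ν s.1)
          fun s _ t _ h => hinj h).symm
    _ ≤ _ := Finset.sum_le_sum_of_subset_of_nonneg (Finset.image_subset_iff.2 hmaps)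
        fun s _ _ => hν0 _

/-- A view for which the next level has density at most `2 / 2 ^ n` among the hidden points of every
salt. -/
def GoodView (d n : ℕ) {Salt : Type} (k : ℕ) (K : Finset (Salt × Big d n)) : Prop :=
  ∀ a, 2 ^ n * (hiddenPoints (k + 1) K a).card ≤ 2 * (hiddenPoints k K a).card

theorem hitFiber_empty {K : Hidden d n Salt → Finset (Salt × Big d n)} {k : ℕ} {j : Fin d} {v} :
    hitFiber K k j v ∅ = fiber K k v := by
  simp [hitFiber]

/-- For independent sampling, the positions in `B` all belong to the next level with probability at
most `(2 / 2 ^ n) ^ |B|`: they are exposed one after the other. -/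
theorem sum_hitFiber_le {K : Hidden d n Salt → Finset (Salt × Big d n)} {k : ℕ}
    (hK : ∀ ω ω', Agree k (K ω) ω ω' → K ω' = K ω) {j : Fin d} (hj : k ≤ j) {v}
    (hv : GoodView d n k v.1)
    {ν : Hidden d n Salt → ℝ} (hν0 : ∀ ω, 0 ≤ ν ω) (hν : ∀ p p' f, ν (p, f) = ν (p', f))
    (B : Finset (Salt × Big d n)) :
    ∑ ω ∈ hitFiber K k j v B, ν ω ≤ (2 / 2 ^ n) ^ B.card * ∑ ω ∈ fiber K k v, ν ω := by
  classical
  induction B using Finset.induction_on with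
  | empty => simp [hitFiber_empty]
  | insert y B hy ih =>
    have h1 := sum_hitFiber_insert_le hK hj v hν0 hν hy
    have h0 : 0 ≤ ∑ ω ∈ hitFiber K k j v B, ν ω := Finset.sum_nonneg fun ω _ => hν0 ω
    rw [Finset.card_insert_of_notMem hy, pow_succ']
    rcases (hitFiber K k j v (insert y B)).eq_empty_or_nonempty with he | ⟨ω, hω⟩
    · rw [he, Finset.sum_empty]
      have := Finset.sum_nonneg (s := fiber K k v) fun ω _ => hν0 ω
      positivity
    have hpos : (0 : ℝ) < (hiddenPoints k v.1 y.1).card := by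
      have : ω.path j y = (y.1, (ω.1 y.1 j).symm y.2) := rfl
      simp only [hitFiber, Finset.mem_filter] at hω
      have hh := hω.2 y (Finset.mem_insert_self _ _)
      exact_mod_cast Finset.card_pos.2 ⟨(ω.1 y.1 j).symm y.2, by
        simp only [hiddenPoints, Finset.mem_filter, Finset.mem_univ, true_and]
        exact ⟨hh.1.pred, hh.2⟩⟩
    have hg : (2 : ℝ) ^ n * (hiddenPoints (k + 1) v.1 y.1).card ≤
        2 * (hiddenPoints k v.1 y.1).card := by exact_mod_cast hv y.1
    have hg' : ((hiddenPoints (k + 1) v.1 y.1).card : ℝ) ≤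
        2 / 2 ^ n * (hiddenPoints k v.1 y.1).card := by
      rw [div_mul_eq_mul_div, le_div_iff₀ (by positivity)]; linarith
    have h2 : ((hiddenPoints k v.1 y.1).card : ℝ) * ∑ ω ∈ hitFiber K k j v (insert y B), ν ω ≤
        (hiddenPoints k v.1 y.1).card * (2 / 2 ^ n * ∑ ω ∈ hitFiber K k j v B, ν ω) := by
      refine h1.trans ((mul_le_mul_of_nonneg_right hg' h0).trans (le_of_eq (by ring)))
    have h3 := le_of_mul_le_mul_left h2 hpos
    rw [mul_assoc]
    exact h3.trans (mul_le_mul_of_nonneg_left ih (by positivity))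

open Classical in
/-- The heavy positions through which there is a hidden path of the next level. -/
noncomputable def heavyHits (θ : ℝ) (μ : Hidden d n Salt → ℝ)
    (K : Hidden d n Salt → Finset (Salt × Big d n)) (k : ℕ) (j : Fin d) (ω : Hidden d n Salt) :
    Finset (Salt × Big d n) :=
  Finset.univ.filter fun y => Heavy θ μ K k j (view K k ω) y ∧
    IsHidden (k + 1) (K ω) (ω.path j y)

open Classical in
/-- The heavy positions. -/
noncomputable def heavySet (θ : ℝ) (μ : Hidden d n Salt → ℝ)
    (K : Hidden d n Salt → Finset (Salt × Big d n)) (k : ℕ) (j : Fin d)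
    (v : Finset (Salt × Big d n) ×
      (Salt → Fin d → Big d n → Option (Big d n)) × (Salt → Bits n → Option (Bits n))) :
    Finset (Salt × Big d n) :=
  Finset.univ.filter fun y => Heavy θ μ K k j v y

open Classical in
/-- The exponential moment of the number of heavy hits, for independent sampling. -/
theorem sum_two_pow_heavyHits_le (θ : ℝ) (μ : Hidden d n Salt → ℝ)
    {K : Hidden d n Salt → Finset (Salt × Big d n)} {k : ℕ}
    (hK : ∀ ω ω', Agree k (K ω) ω ω' → K ω' = K ω) {j : Fin d} (hj : k ≤ j) {v}
    (hv : GoodView d n k v.1)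
    {ν : Hidden d n Salt → ℝ} (hν0 : ∀ ω, 0 ≤ ν ω) (hν : ∀ p p' f, ν (p, f) = ν (p', f)) :
    ∑ ω ∈ fiber K k v, ν ω * 2 ^ (heavyHits θ μ K k j ω).card ≤
      Real.exp (2 / 2 ^ n * (heavySet θ μ K k j v).card) * ∑ ω ∈ fiber K k v, ν ω := by
  -- `2 ^ |hits|` is the number of sets `B` of heavy positions that are all hit.
  have h1 : ∀ ω ∈ fiber K k v, ν ω * 2 ^ (heavyHits θ μ K k j ω).card =
      ∑ B ∈ (heavySet θ μ K k j v).powerset,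
        if ω ∈ hitFiber K k j v B then ν ω else 0 := by
    intro ω hω
    have hvω := mem_fiber.1 hω
    have hKv : K ω = v.1 := by rw [← hvω]; rfl
    rw [← Finset.sum_filter, Finset.sum_const, nsmul_eq_mul, mul_comm]
    congr 1
    have : (heavySet θ μ K k j v).powerset.filter (fun B => ω ∈ hitFiber K k j v B) =
        (heavyHits θ μ K k j ω).powerset := by
      ext B
      simp only [Finset.mem_filter, Finset.mem_powerset, hitFiber, hω, true_and,
        Finset.subset_iff, heavySet, heavyHits, Finset.mem_univ, hvω, hKv]
      exact ⟨fun h y hy => ⟨h.1 hy, h.2 y hy⟩,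
        fun h => ⟨fun y hy => (h hy).1, fun y hy => (h hy).2⟩⟩
    rw [this, Finset.card_powerset]
    push_cast; ring
  rw [Finset.sum_congr rfl h1, Finset.sum_comm]
  have h2 : ∀ B ∈ (heavySet θ μ K k j v).powerset,
      ∑ ω ∈ fiber K k v, (if ω ∈ hitFiber K k j v B then ν ω else 0) ≤
        (2 / 2 ^ n) ^ B.card * ∑ ω ∈ fiber K k v, ν ω := by
    intro B _
    refine le_trans (le_of_eq ?_) (sum_hitFiber_le hK hj hv hν0 hν B)
    rw [← Finset.sum_filter]
    congr 1
    ext ω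
    simp [hitFiber]
  refine (Finset.sum_le_sum h2).trans ?_
  rw [← Finset.sum_mul]
  refine mul_le_mul_of_nonneg_right ?_ (Finset.sum_nonneg fun ω _ => hν0 ω)
  have h3 := Finset.sum_pow_mul_eq_add_pow (2 / 2 ^ n : ℝ) 1 (heavySet θ μ K k j v)
  simp only [one_pow, mul_one] at h3
  rw [h3, mul_comm (2 / 2 ^ n : ℝ), Real.exp_nat_mul]
  exact pow_le_pow_left₀ (by positivity) (Real.add_one_le_exp _) _

end core

/-- The inequality behind the entropy argument: a change of measure with density at most `1 / q`
increases the expectation of `b` to at most `log (1 / q)` plus a multiple of the exponential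
moment of `b`. -/
theorem mul_le_log_add_exp {w q b : ℝ} (hw0 : 0 ≤ w) (hw1 : w ≤ 1) (hq : 0 < q) :
    w * b ≤ w * Real.log (1 / q) + q * Real.exp b := by
  have h1 : q * Real.exp b = Real.exp (b + Real.log q) := by
    rw [Real.exp_add, Real.exp_log hq, mul_comm]
  have h2 := Real.add_one_le_exp (b + Real.log q)
  have h3 := Real.exp_pos (b + Real.log q)
  have h4 : w * (b + Real.log q) ≤ Real.exp (b + Real.log q) := by
    rcases le_or_gt 0 (b + Real.log q) with h | h
    · nlinarith
    · nlinarith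
  rw [h1, one_div, Real.log_inv]
  linarith

section core
variable {d n : ℕ} {Salt : Type} [Fintype Salt] [DecidableEq Salt]

/-- If a view is not good, then more than half of the level is known, and the next level is small
compared with the number of known paths. -/
theorem card_level_le_of_not_good {k : ℕ} (hk : k ≤ d) (hS : Fintype.card Salt ≤ 2 ^ n)
    {K : Finset (Salt × Big d n)} (hK : ¬ GoodView d n k K) (R : Finset (Salt × Big d n))
    (hR : ∀ e ∈ R, InLevel d n (k + 1) e.2) : R.card ≤ 2 * K.card := by
  classical
  simp only [GoodView, not_forall, not_le] at hK
  obtain ⟨a, ha⟩ := hK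
  have h1 : (hiddenPoints (k + 1) K a).card ≤
      (Finset.univ.filter fun x : Big d n => InLevel d n (k + 1) x).card := by
    apply Finset.card_le_card
    intro x hx
    rw [hiddenPoints, Finset.mem_filter] at hx
    exact Finset.mem_filter.2 ⟨Finset.mem_univ _, hx.2.1⟩
  have h2 := card_inLevel_succ (d := d) (n := n) (k := k) (by omega)
  have h3 : (Finset.univ.filter fun x : Big d n => InLevel d n k x).card ≤
      (hiddenPoints k K a).card + K.card := by
    have hsub : (Finset.univ.filter fun x : Big d n => InLevel d n k x) ⊆
        hiddenPoints k K a ∪ K.image Prod.snd := by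
      intro x hx
      rw [Finset.mem_filter] at hx
      by_cases hxK : (a, x) ∈ K
      · exact Finset.mem_union_right _ (Finset.mem_image.2 ⟨_, hxK, rfl⟩)
      · refine Finset.mem_union_left _ ?_
        simp only [hiddenPoints, Finset.mem_filter, Finset.mem_univ, true_and]
        exact ⟨hx.2, hxK⟩
    exact (Finset.card_le_card hsub).trans ((Finset.card_union_le _ _).trans
      (Nat.add_le_add_left Finset.card_image_le _))
  have h4 : R.card ≤ Fintype.card Salt *
      (Finset.univ.filter fun x : Big d n => InLevel d n (k + 1) x).card := by
    rw [← Finset.card_univ, ← Finset.card_product]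
    apply Finset.card_le_card
    intro e he
    simp [hR e he]
  -- The next level has, over all salts, at most as many paths as the level has for a single salt.
  have h5 : R.card ≤ (Finset.univ.filter fun x : Big d n => InLevel d n k x).card := by
    rw [← h2]; exact h4.trans (Nat.mul_le_mul_right _ hS)
  have h6 := Nat.mul_le_mul_left (2 ^ n) h1
  omega

/-- The expected number of heavy positions that are hit. -/
theorem sum_heavyHits_le {θ : ℝ} (hθ : 8 / 2 ^ n ≤ θ) (hS : Fintype.card Salt ≤ 2 ^ n)
    {ν w : Hidden d n Salt → ℝ} (hν0 : ∀ ω, 0 ≤ ν ω) (hν : ∀ p p' f, ν (p, f) = ν (p', f))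
    (hν1 : ∑ ω, ν ω = 1) (hw : ∀ ω, 0 ≤ w ω ∧ w ω ≤ 1) {q : ℝ} (hq : 0 < q)
    {K : Hidden d n Salt → Finset (Salt × Big d n)} {k : ℕ}
    (hK : ∀ ω ω', Agree k (K ω) ω ω' → K ω' = K ω) (j : Fin d) (hj : k ≤ j) :
    ∑ ω, ν ω * w ω * ((heavyHits θ (fun ω => ν ω * w ω) K k j ω).card : ℝ) ≤
      3 * (Real.log (1 / q) * ∑ ω, ν ω * w ω + q) +
        2 * ∑ ω, ν ω * w ω * ((K ω).card : ℝ) := by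
  classical
  set μ : Hidden d n Salt → ℝ := fun ω => ν ω * w ω with hμ
  have hμ0 : ∀ ω, 0 ≤ μ ω := fun ω => mul_nonneg (hν0 ω) (hw ω).1
  set Z : Hidden d n Salt → ℝ := fun ω => ((heavyHits θ μ K k j ω).card : ℝ) with hZ
  set H : Hidden d n Salt → ℝ := fun ω => ((heavySet θ μ K k j (view K k ω)).card : ℝ) with hH
  -- On good views `b` is the number of hits, scaled and shifted such that the expectation of
  -- `exp b` under `ν` is at most `1`; on the other views it is `0`.
  set b : Hidden d n Salt → ℝ := fun ω =>
    if GoodView d n k (K ω) then Real.log 2 * Z ω - 2 / 2 ^ n * H ω else 0 with hb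
  have hexp : ∑ ω, ν ω * Real.exp (b ω) ≤ 1 := by
    rw [← hν1]
    refine sum_le_of_fiber K k _ _ fun v => ?_
    have hKv : ∀ ω ∈ fiber K k v, K ω = v.1 := fun ω hω => by rw [← mem_fiber.1 hω]; rfl
    by_cases hv : GoodView d n k v.1
    · have h1 := sum_two_pow_heavyHits_le θ μ hK hj hv hν0 hν
      have h2 : ∀ ω ∈ fiber K k v, ν ω * Real.exp (b ω) =
          Real.exp (-(2 / 2 ^ n * (heavySet θ μ K k j v).card)) *
            (ν ω * 2 ^ (heavyHits θ μ K k j ω).card) := by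
        intro ω hω
        simp only [hb, hKv ω hω, if_pos hv, hZ, hH, mem_fiber.1 hω]
        rw [sub_eq_add_neg, Real.exp_add, mul_comm (Real.log 2), Real.exp_nat_mul,
          Real.exp_log two_pos]
        ring
      rw [Finset.sum_congr rfl h2, ← Finset.mul_sum]
      refine (mul_le_mul_of_nonneg_left h1 (Real.exp_nonneg _)).trans (le_of_eq ?_)
      rw [← mul_assoc, ← Real.exp_add, neg_add_cancel, Real.exp_zero, one_mul]
    · refine Finset.sum_le_sum fun ω hω => ?_
      simp [hb, hKv ω hω, if_neg hv]
  -- The entropy inequality bounds the expectation of `b` under `μ`, whose density relative to `ν`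
  -- is at most `1`.
  have hdv : ∑ ω, μ ω * b ω ≤ Real.log (1 / q) * ∑ ω, μ ω + q := by
    calc _ ≤ ∑ ω, (Real.log (1 / q) * μ ω + q * (ν ω * Real.exp (b ω))) := by
          refine Finset.sum_le_sum fun ω _ => ?_
          have := mul_le_mul_of_nonneg_left (mul_le_log_add_exp (b := b ω) (hw ω).1 (hw ω).2 hq)
            (hν0 ω)
          simp only [hμ]
          linarith
      _ ≤ _ := by
          rw [Finset.sum_add_distrib, ← Finset.mul_sum, ← Finset.mul_sum]
          nlinarith
  -- On good views, the number of heavy positions is bounded by the number of hits.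
  have hheavy : ∑ ω, (if GoodView d n k (K ω) then θ * (μ ω * H ω) else 0) ≤
      ∑ ω, (if GoodView d n k (K ω) then μ ω * Z ω else 0) := by
    refine sum_le_of_fiber K k _ _ fun v => ?_
    have hKv : ∀ ω ∈ fiber K k v, K ω = v.1 := fun ω hω => by rw [← mem_fiber.1 hω]; rfl
    by_cases hv : GoodView d n k v.1
    · have h1 : ∀ ω ∈ fiber K k v, (if GoodView d n k (K ω) then θ * (μ ω * H ω) else 0) =
          (heavySet θ μ K k j v).card * (θ * μ ω) := by
        intro ω hω
        rw [hKv ω hω, if_pos hv]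
        simp only [hH, mem_fiber.1 hω]
        ring
      have h2 : ∀ ω ∈ fiber K k v, (if GoodView d n k (K ω) then μ ω * Z ω else 0) =
          ∑ y ∈ heavySet θ μ K k j v,
            if IsHidden (k + 1) (K ω) (ω.path j y) then μ ω else 0 := by
        intro ω hω
        have h3 : heavyHits θ μ K k j ω = (heavySet θ μ K k j v).filter
            fun y => IsHidden (k + 1) (K ω) (ω.path j y) := by
          ext y
          simp [heavyHits, heavySet, mem_fiber.1 hω]
        rw [hKv ω hω, if_pos hv, ← Finset.sum_filter, Finset.sum_const, nsmul_eq_mul]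
        simp only [hZ, h3, hKv ω hω]
        ring
      rw [Finset.sum_congr rfl h1, Finset.sum_congr rfl h2, Finset.sum_comm, ← Finset.mul_sum,
        ← nsmul_eq_mul, ← Finset.sum_const]
      refine Finset.sum_le_sum fun y hy => ?_
      rw [← Finset.mul_sum]
      simp only [heavySet, Finset.mem_filter] at hy
      exact hy.2.le
    · refine Finset.sum_le_sum fun ω hω => ?_
      simp [hKv ω hω, if_neg hv]
  -- As `θ ≥ 4 * (2 / 2 ^ n)`, the shift in `b` costs at most a quarter of the hits, and
  -- `log 2 - 1 / 4 ≥ 1 / 3`.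
  have hgood : ∑ ω, (if GoodView d n k (K ω) then μ ω * Z ω else 0) ≤
      3 * (Real.log (1 / q) * ∑ ω, μ ω + q) := by
    have h1 : ∑ ω, μ ω * b ω =
        Real.log 2 * ∑ ω, (if GoodView d n k (K ω) then μ ω * Z ω else 0) -
          2 / 2 ^ n * ∑ ω, (if GoodView d n k (K ω) then μ ω * H ω else 0) := by
      rw [Finset.mul_sum, Finset.mul_sum, ← Finset.sum_sub_distrib]
      refine Finset.sum_congr rfl fun ω _ => ?_
      simp only [hb]
      split_ifs <;> ring
    have h2 : ∑ ω, (if GoodView d n k (K ω) then θ * (μ ω * H ω) else 0) =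
        θ * ∑ ω, (if GoodView d n k (K ω) then μ ω * H ω else 0) := by
      rw [Finset.mul_sum]
      exact Finset.sum_congr rfl fun ω _ => by split_ifs <;> ring
    rw [h2] at hheavy
    have h3 : 0 ≤ ∑ ω, (if GoodView d n k (K ω) then μ ω * H ω else 0) :=
      Finset.sum_nonneg fun ω _ => by
        split_ifs
        · exact mul_nonneg (hμ0 ω) (Nat.cast_nonneg _)
        · exact le_rfl
    have h4 : 0 ≤ ∑ ω, (if GoodView d n k (K ω) then μ ω * Z ω else 0) :=
      Finset.sum_nonneg fun ω _ => by
        split_ifs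
        · exact mul_nonneg (hμ0 ω) (Nat.cast_nonneg _)
        · exact le_rfl
    have h5 := mul_le_mul_of_nonneg_right hθ h3
    have h6 : (8 / 2 ^ n : ℝ) = 4 * (2 / 2 ^ n) := by ring
    rw [h6] at h5
    have := Real.log_two_gt_d9
    rw [h1] at hdv
    nlinarith
  -- On the other views there are at most twice as many hits as paths that are known already.
  have hbad : ∑ ω, (if GoodView d n k (K ω) then 0 else μ ω * Z ω) ≤
      2 * ∑ ω, μ ω * ((K ω).card : ℝ) := by
    rw [Finset.mul_sum]
    refine Finset.sum_le_sum fun ω _ => ?_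
    split_ifs with hv
    · exact mul_nonneg two_pos.le (mul_nonneg (hμ0 ω) (Nat.cast_nonneg _))
    · have hcard : (heavyHits θ μ K k j ω).card ≤ 2 * (K ω).card := by
        have := card_level_le_of_not_good (by omega) hS hv
          ((heavyHits θ μ K k j ω).image (ω.path j)) (by
            intro e he
            obtain ⟨y, hy, rfl⟩ := Finset.mem_image.1 he
            simp only [heavyHits, Finset.mem_filter] at hy
            exact hy.2.2.1)
        rwa [Finset.card_image_of_injective] at this
        rintro ⟨a, x⟩ ⟨a', x'⟩ h
        simp only [Hidden.path, Prod.mk.injEq] at h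
        obtain ⟨rfl, h⟩ := h
        rw [(ω.1 a j).symm.injective h]
      have : Z ω ≤ 2 * ((K ω).card : ℝ) := by simp only [hZ]; exact_mod_cast hcard
      nlinarith [mul_le_mul_of_nonneg_left this (hμ0 ω)]
  have hsplit : ∑ ω, μ ω * Z ω = ∑ ω, (if GoodView d n k (K ω) then μ ω * Z ω else 0) +
      ∑ ω, (if GoodView d n k (K ω) then 0 else μ ω * Z ω) := by
    rw [← Finset.sum_add_distrib]
    exact Finset.sum_congr rfl fun ω _ => by split_ifs <;> ring
  rw [hsplit]
  exact add_le_add hgood hbad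

/-- The constants in the bound for the number of known paths. -/
def knownConst (d : ℕ) : ℕ → ℝ
  | 0 => 0
  | k + 1 => (1 + 2 * d) * knownConst d k + 3 * d

/-- The expected number of known paths is bounded by the logarithm of the density of the
weight. -/
theorem sum_card_known_le {θ : ℝ} (hθ : 8 / 2 ^ n ≤ θ) (hS : Fintype.card Salt ≤ 2 ^ n)
    {ν w : Hidden d n Salt → ℝ} (hν0 : ∀ ω, 0 ≤ ν ω) (hν : ∀ p p' f, ν (p, f) = ν (p', f))
    (hν1 : ∑ ω, ν ω = 1) (hw : ∀ ω, 0 ≤ w ω ∧ w ω ≤ 1) {q : ℝ} (hq : 0 < q) (k : ℕ) :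
    ∑ ω, ν ω * w ω * ((known θ (fun ω => ν ω * w ω) k ω).card : ℝ) ≤
      knownConst d k * (Real.log (1 / q) * ∑ ω, ν ω * w ω + q) := by
  classical
  set μ : Hidden d n Salt → ℝ := fun ω => ν ω * w ω with hμ
  have hμ0 : ∀ ω, 0 ≤ μ ω := fun ω => mul_nonneg (hν0 ω) (hw ω).1
  induction k with
  | zero => simp [known, knownConst]
  | succ k ih =>
    -- A path becomes known because one of its positions is heavy.
    have hcard : ∀ ω, ((known θ μ (k + 1) ω).card : ℝ) ≤ ((known θ μ k ω).card : ℝ) +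
        ∑ j : Fin d, if k ≤ j then ((heavyHits θ μ (known θ μ k) k j ω).card : ℝ) else 0 := by
      intro ω
      have hsub : known θ μ (k + 1) ω ⊆ known θ μ k ω ∪ Finset.univ.biUnion fun j : Fin d =>
          if k ≤ j then (heavyHits θ μ (known θ μ k) k j ω).image (ω.path j) else ∅ := by
        intro e he
        by_cases hek : e ∈ known θ μ k ω
        · exact Finset.mem_union_left _ hek
        · rcases mem_known_succ.1 he with he | ⟨he, j, hj, hH⟩
          · exact absurd he hek
          refine Finset.mem_union_right _ (Finset.mem_biUnion.2 ⟨j, Finset.mem_univ _, ?_⟩)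
          have hp : ω.path j (e.1, ω.1 e.1 j e.2) = e := by simp [Hidden.path]
          rw [if_pos hj]
          refine Finset.mem_image.2 ⟨_, ?_, hp⟩
          simp only [heavyHits, Finset.mem_filter, Finset.mem_univ, true_and]
          exact ⟨hH, by rw [hp]; exact ⟨he, hek⟩⟩
      have h1 : (known θ μ (k + 1) ω).card ≤ (known θ μ k ω).card +
          ∑ j : Fin d, if k ≤ j then (heavyHits θ μ (known θ μ k) k j ω).card else 0 := by
        refine (Finset.card_le_card hsub).trans ((Finset.card_union_le _ _).trans
          (Nat.add_le_add_left (Finset.card_biUnion_le.trans (Finset.sum_le_sum fun j _ => ?_)) _))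
        split_ifs
        · exact Finset.card_image_le
        · simp
      exact_mod_cast h1
    have hq0 : ∀ j : Fin d, ∑ ω, μ ω *
        (if k ≤ j then ((heavyHits θ μ (known θ μ k) k j ω).card : ℝ) else 0) ≤
        3 * (Real.log (1 / q) * ∑ ω, μ ω + q) +
          2 * ∑ ω, μ ω * ((known θ μ k ω).card : ℝ) := by
      intro j
      by_cases hj : k ≤ j
      · simp only [if_pos hj]
        exact sum_heavyHits_le hθ hS hν0 hν hν1 hw hq (fun ω ω' h => known_congr h) j hj
      · simp only [if_neg hj, mul_zero, Finset.sum_const_zero]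
        -- The bound is claimed for `j < k` too, where it only says that its right-hand side is not
        -- negative, even if `log (1 / q)` is.
        have h1 : ∑ ω, μ ω * Real.log q ≤ ∑ ω, ν ω * q := by
          refine Finset.sum_le_sum fun ω _ => ?_
          have h2 := Real.log_le_sub_one_of_pos hq
          rcases le_or_gt 0 (Real.log q) with h3 | h3
          · calc μ ω * Real.log q ≤ ν ω * Real.log q :=
                mul_le_mul_of_nonneg_right (mul_le_of_le_one_right (hν0 ω) (hw ω).2) h3
              _ ≤ _ := mul_le_mul_of_nonneg_left (by linarith) (hν0 ω)
          · exact (mul_nonpos_of_nonneg_of_nonpos (hμ0 ω) h3.le).trans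
              (mul_nonneg (hν0 ω) hq.le)
        rw [← Finset.sum_mul, ← Finset.sum_mul, hν1] at h1
        rw [one_div, Real.log_inv]
        have h4 : 0 ≤ ∑ ω, μ ω * ((known θ μ k ω).card : ℝ) :=
          Finset.sum_nonneg fun ω _ => mul_nonneg (hμ0 ω) (Nat.cast_nonneg _)
        linarith
    calc _ ≤ ∑ ω, (μ ω * ((known θ μ k ω).card : ℝ) + ∑ j : Fin d, μ ω *
            (if k ≤ j then ((heavyHits θ μ (known θ μ k) k j ω).card : ℝ) else 0)) := by
          refine Finset.sum_le_sum fun ω _ => ?_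
          rw [← Finset.mul_sum, ← mul_add]
          exact mul_le_mul_of_nonneg_left (hcard ω) (hμ0 ω)
      _ ≤ ∑ ω, μ ω * ((known θ μ k ω).card : ℝ) + ∑ _j : Fin d,
            (3 * (Real.log (1 / q) * ∑ ω, μ ω + q) +
              2 * ∑ ω, μ ω * ((known θ μ k ω).card : ℝ)) := by
          rw [Finset.sum_add_distrib, Finset.sum_comm (t := (Finset.univ : Finset (Fin d)))]
          exact add_le_add_right (Finset.sum_le_sum fun j _ => hq0 j) _
      _ ≤ _ := by
          rw [Finset.sum_const, Finset.card_univ, Fintype.card_fin, nsmul_eq_mul, knownConst]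
          have hd : (0 : ℝ) ≤ d := Nat.cast_nonneg d
          nlinarith [mul_le_mul_of_nonneg_left ih hd]

end core

/-! ### Real and shadow oracles -/

/-- The composition of the first `j` functions of the shuffling with hidden permutations `p`. -/
def prefixPerm {d n : ℕ} (p : Fin d → Equiv.Perm (Big d n)) : ℕ → Equiv.Perm (Big d n)
  | 0 => 1
  | j + 1 => if h : j < d then p ⟨j, h⟩ else 1

theorem prefixPerm_succ {d n : ℕ} (p : Fin d → Equiv.Perm (Big d n)) (j : Fin d) :
    prefixPerm p (j + 1) = p j := by
  simp [prefixPerm]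

theorem firstBits_pad {d n : ℕ} (x : Bits n) : firstBits (pad x : Big d n) = x := by
  funext i
  simp [firstBits, pad]

theorem pad_injective {d n : ℕ} : Function.Injective (pad : Bits n → Big d n) :=
  Function.LeftInverse.injective firstBits_pad

theorem inLevel_pad {d n k : ℕ} (hk : k ≤ d + 1) (x : Bits n) : InLevel d n k (pad x) := by
  intro i hi
  have : n ≤ (d + 2 - k) * n := Nat.le_mul_of_pos_left n (by omega)
  simp [pad, not_lt.2 (this.trans hi)]

section oracles
variable {d n : ℕ} {Salt : Type} [Fintype Salt] [DecidableEq Salt]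

/-- The answers of the shuffling oracles in terms of the hidden data. -/
def Hidden.answer (ω : Hidden d n Salt) (a : Salt) (j : Fin (d + 1)) (y : Big d n) :
    Option (Big d n) :=
  if (j : ℕ) < d then some (prefixPerm (ω.1 a) (j + 1) ((prefixPerm (ω.1 a) j).symm y))
  else if pad (firstBits ((prefixPerm (ω.1 a) j).symm y)) = (prefixPerm (ω.1 a) j).symm y then
    some (pad (ω.2 a (firstBits ((prefixPerm (ω.1 a) j).symm y))))
  else none

open Classical in
/-- The answers of the shadow of the shuffling oracles at level `k`, which denies all knowledge
about the functions from `f_k` on at the positions of hidden paths. -/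
noncomputable def Hidden.shadow (k : ℕ) (K : Finset (Salt × Big d n)) (ω : Hidden d n Salt)
    (a : Salt) (j : Fin (d + 1)) (y : Big d n) : Option (Big d n) :=
  if k ≤ j ∧ IsHidden k K (a, (prefixPerm (ω.1 a) j).symm y) then none else ω.answer a j y

/-- The shadow at level `k` is determined by what is visible at level `k`. -/
theorem Hidden.shadow_congr {k : ℕ} (hk : k ≤ d) {K : Finset (Salt × Big d n)}
    {ω ω' : Hidden d n Salt} (h : Agree k K ω ω') : ω.shadow k K = ω'.shadow k K := by
  have hfull : ∀ a i, i ≤ k → prefixPerm (ω.1 a) i = prefixPerm (ω'.1 a) i := by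
    intro a i hi
    cases i with
    | zero => rfl
    | succ i =>
      have hid : i < d := by omega
      rw [prefixPerm_succ _ ⟨i, hid⟩, prefixPerm_succ _ ⟨i, hid⟩]
      exact Equiv.ext fun x => h.1 a ⟨i, hid⟩ x (Or.inl (by simpa using hi))
  have hoff : ∀ a i x, ¬ IsHidden k K (a, x) → prefixPerm (ω.1 a) i x =
      prefixPerm (ω'.1 a) i x := by
    intro a i x hx
    cases i with
    | zero => rfl
    | succ i =>
      by_cases hid : i < d
      · rw [prefixPerm_succ _ ⟨i, hid⟩, prefixPerm_succ _ ⟨i, hid⟩]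
        exact h.1 a ⟨i, hid⟩ x (Or.inr hx)
      · simp [prefixPerm, hid]
  funext a j y
  unfold Hidden.shadow
  by_cases hh : IsHidden k K (a, (prefixPerm (ω.1 a) j).symm y)
  · have hh' : k ≤ j → IsHidden k K (a, (prefixPerm (ω'.1 a) j).symm y) := by
      intro _
      by_contra hc
      have := hoff a j _ hc
      rw [Equiv.apply_symm_apply, ← Equiv.eq_symm_apply] at this
      rw [this] at hc
      exact hc hh
    by_cases hkj : k ≤ j
    · rw [if_pos ⟨hkj, hh⟩, if_pos ⟨hkj, hh' hkj⟩]
    · rw [if_neg fun h => hkj h.1, if_neg fun h => hkj h.1]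
      have hj : (j : ℕ) < d := by omega
      unfold Hidden.answer
      rw [if_pos hj, if_pos hj, hfull a j (by omega), hfull a (j + 1) (by omega)]
  · have e := hoff a j _ hh
    rw [Equiv.apply_symm_apply] at e
    have e' : (prefixPerm (ω'.1 a) j).symm y = (prefixPerm (ω.1 a) j).symm y := by
      rw [Equiv.symm_apply_eq]; exact e
    rw [e', if_neg fun h => hh h.2, if_neg fun h => hh h.2]
    unfold Hidden.answer
    rw [e', hoff a (j + 1) _ hh]
    split_ifs with h1 h2
    · rfl
    · have hin : IsHidden k K (a, (prefixPerm (ω.1 a) j).symm y) ∨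
          (a, pad (firstBits ((prefixPerm (ω.1 a) j).symm y))) ∈ K := by
        by_cases hK : (a, (prefixPerm (ω.1 a) j).symm y) ∈ K
        · right; rw [h2]; exact hK
        · left
          exact ⟨h2 ▸ inLevel_pad (by omega) _, hK⟩
      rcases hin with hin | hin
      · exact absurd hin hh
      · rw [h.2 a _ hin]
    · rfl

/-- How an oracle of signature `S` gives access to shuffling oracles: from a query a salt, an index
and a point are read, and the answer is encoded. A query from which nothing is read has a fixed
answer. -/
structure OracleFrame (S : OracleSig) (d n : ℕ) (Salt : Type) where
  parse : ∀ q, (S.In q → Bool) → Option (Salt × Fin (d + 1) × Big d n)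
  enc : ∀ q, (S.In q → Bool) → Option (Big d n) → (S.Out q → Bool)

/-- The oracle with the given answers. -/
def OracleFrame.oracle {S : OracleSig} (Fr : OracleFrame S d n Salt)
    (g : Salt → Fin (d + 1) → Big d n → Option (Big d n)) : S.Oracle :=
  fun q z => Fr.enc q z ((Fr.parse q z).bind fun s => g s.1 s.2.1 s.2.2)

theorem agree_pred {θ : ℝ} {μ : Hidden d n Salt → ℝ} {k : ℕ} {ω ω' : Hidden d n Salt}
    (h : Agree (k + 1) (known θ μ (k + 1) ω) ω ω') : Agree k (known θ μ k ω) ω ω' := by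
  refine ⟨fun a j x hx => h.1 a j x ?_, fun a x hx => h.2 a x (mem_known_succ.2 (Or.inl hx))⟩
  refine hx.imp (fun h => Nat.lt_succ_of_lt h) fun he h1 => ?_
  exact he ⟨h1.1.pred, fun h2 => h1.2 (mem_known_succ.2 (Or.inl h2))⟩

theorem agree_of_le {θ : ℝ} {μ : Hidden d n Salt → ℝ} {k i : ℕ} (hi : i ≤ k)
    {ω ω' : Hidden d n Salt} (h : Agree k (known θ μ k ω) ω ω') :
    Agree i (known θ μ i ω) ω ω' := by
  induction hi with
  | refl => exact h
  | step _ ih => exact ih (agree_pred h)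

/-- The shadow oracles that replace the real one in the query layers of a call. -/
noncomputable def shadowOracle {S : OracleSig} (Fr : OracleFrame S d n Salt) (θ : ℝ)
    (μ : Hidden d n Salt → ℝ) (ω : Hidden d n Salt) (i : ℕ) : S.Oracle :=
  Fr.oracle (ω.shadow (i + 1) (known θ μ (i + 1) ω))

theorem shadowOracle_congr {S : OracleSig} (Fr : OracleFrame S d n Salt) {θ : ℝ}
    {μ : Hidden d n Salt → ℝ} {ω ω' : Hidden d n Salt} {k i : ℕ} (hi : i < k) (hk : k ≤ d)
    (h : Agree k (known θ μ k ω) ω ω') :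
    shadowOracle Fr θ μ ω i = shadowOracle Fr θ μ ω' i := by
  have h1 := agree_of_le (i := i + 1) (by omega) h
  unfold shadowOracle
  rw [known_congr h1, Hidden.shadow_congr (by omega) h1]

theorem runLayers_congr {S : OracleSig} {w : ℕ} (G : ℕ → List (Gate w))
    (Q : ℕ → List (OracleGate S w)) {Os Os' : ℕ → S.Oracle} (ψ : Bits w → ℂ) {i : ℕ}
    (h : ∀ k < i, Os k = Os' k) : runLayers G Q Os ψ i = runLayers G Q Os' ψ i := by
  induction i with
  | zero => rfl
  | succ i ih =>
    rw [runLayers, runLayers, ih fun k hk => h k (by omega), h i (by omega)]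

theorem stateAt_shadow_congr {S : OracleSig} (Fr : OracleFrame S d n Salt) {θ : ℝ}
    {μ : Hidden d n Salt → ℝ} {M : ℕ} (C : QCall S d M) (mem : Fin M → Bool)
    {ω ω' : Hidden d n Salt} {k : ℕ} (hk : k ≤ d) (h : Agree k (known θ μ k ω) ω ω') :
    C.stateAt (shadowOracle Fr θ μ ω) mem k = C.stateAt (shadowOracle Fr θ μ ω') mem k :=
  runLayers_congr _ _ _ fun _ hi => shadowOracle_congr Fr hi hk h

open Classical in
/-- The squared weight of the queries of a layer on which the real oracle and the shadow differ is
small on average: the shadow answers all queries except those that hit a hidden path of the next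
level, which the state before the layer has no information about. -/
theorem sum_differWeight_le {S : OracleSig} (Fr : OracleFrame S d n Salt) {θ : ℝ} (hθ : 0 ≤ θ)
    {μ : Hidden d n Salt → ℝ} (hμ : ∀ ω, 0 ≤ μ ω) {M : ℕ} (C : QCall S d M) (mem : Fin M → Bool)
    {i : ℕ} (hi : i < d) :
    ∑ ω, μ ω * differWeight (Fr.oracle ω.answer) (shadowOracle Fr θ μ ω i) (C.queriesAt mem i)
      (C.stateAt (shadowOracle Fr θ μ ω) mem i) ≤
      (C.queriesAt mem i).length * θ * ∑ ω, μ ω := by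
  set L := C.queriesAt mem i with hL
  set φ : Hidden d n Salt → Bits C.w → ℝ := fun ω z =>
    ‖C.stateAt (shadowOracle Fr θ μ ω) mem i z‖ ^ 2 with hφ
  -- The query of `g` in the basis state `z` hits a path that is hidden at the next level.
  let Bad : OracleGate S C.w → Bits C.w → Hidden d n Salt → Prop := fun g z ω =>
    ∃ a, ∃ j : Fin d, ∃ y, i ≤ j ∧ Fr.parse g.q (z ∘ g.inPos) = some (a, j.succ, y) ∧
      IsHidden (i + 1) (known θ μ (i + 1) ω) (ω.path j (a, y))
  have hbad : ∀ (g : OracleGate S C.w) z ω,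
      Fr.oracle ω.answer g.q (z ∘ g.inPos) ≠ shadowOracle Fr θ μ ω i g.q (z ∘ g.inPos) →
      Bad g z ω := by
    intro g z ω hne
    rcases hp : Fr.parse g.q (z ∘ g.inPos) with _ | ⟨a, j, y⟩
    · simp [OracleFrame.oracle, shadowOracle, hp] at hne
    · simp only [OracleFrame.oracle, shadowOracle, hp, Option.bind_some, Hidden.shadow] at hne
      split_ifs at hne with hc
      · obtain ⟨hc1, hc2⟩ := hc
        obtain ⟨j', rfl⟩ : ∃ j' : Fin d, j = j'.succ :=
          ⟨j.pred (by rintro rfl; simp at hc1), by simp⟩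
        refine ⟨a, j', y, by simpa using hc1, hp, ?_⟩
        rwa [Fin.val_succ, prefixPerm_succ] at hc2
      · exact absurd rfl hne
  have hone : ∀ g z, ∑ ω, (if Bad g z ω then μ ω * φ ω z else 0) ≤ θ * ∑ ω, μ ω * φ ω z := by
    intro g z
    by_cases hp : ∃ a, ∃ j : Fin d, ∃ y, i ≤ j ∧
        Fr.parse g.q (z ∘ g.inPos) = some (a, j.succ, y)
    · obtain ⟨a, j, y, hij, hp⟩ := hp
      have hiff : ∀ ω, Bad g z ω ↔
          IsHidden (i + 1) (known θ μ (i + 1) ω) (ω.path j (a, y)) := by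
        intro ω
        constructor
        · rintro ⟨a', j', y', _, hp', hh⟩
          rw [hp] at hp'
          simp only [Option.some.injEq, Prod.mk.injEq, Fin.succ_inj] at hp'
          obtain ⟨rfl, rfl, rfl⟩ := hp'
          exact hh
        · exact fun hh => ⟨a, j, y, hij, hp, hh⟩
      simp only [hiff]
      -- The state before layer `i` uses only the shadows of the layers before, which are determined
      -- by the view at level `i`.
      refine sum_hidden_le hθ hμ i j hij (a, y) (fun ω => φ ω z) (fun ω => by positivity) ?_
      intro ω ω' hv
      simp only [hφ]
      rw [stateAt_shadow_congr Fr C mem hi.le (agree_of_view_eq hv)]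
    · have : ∀ ω, ¬ Bad g z ω := fun ω ⟨a, j, y, hij, hp', _⟩ => hp ⟨a, j, y, hij, hp'⟩
      simp only [this, if_false, Finset.sum_const_zero]
      exact mul_nonneg hθ (Finset.sum_nonneg fun ω _ => mul_nonneg (hμ ω) (by positivity))
  have hlist : ∀ (L : List (OracleGate S C.w)) z ω,
      (if Differ (Fr.oracle ω.answer) (shadowOracle Fr θ μ ω i) L z then μ ω * φ ω z else 0) ≤
        (L.map fun g => if Bad g z ω then μ ω * φ ω z else 0).sum := by
    intro L z ω
    have h0 : 0 ≤ μ ω * φ ω z := mul_nonneg (hμ ω) (by positivity)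
    have hs : ∀ L : List (OracleGate S C.w),
        0 ≤ (L.map fun g => if Bad g z ω then μ ω * φ ω z else 0).sum := by
      intro L
      apply List.sum_nonneg
      intro x hx
      obtain ⟨g, _, rfl⟩ := List.mem_map.1 hx
      split_ifs <;> simp [h0]
    split_ifs with hd
    · obtain ⟨g, hg, hne⟩ := hd
      have := List.single_le_sum (l := L.map fun g => if Bad g z ω then μ ω * φ ω z else 0) (by
        intro x hx
        obtain ⟨g, _, rfl⟩ := List.mem_map.1 hx
        split_ifs <;> simp [h0]) _ (List.mem_map_of_mem hg)
      rwa [if_pos (hbad g z ω hne)] at this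
    · exact hs L
  have hφ1 : ∀ ω, ∑ z, φ ω z = 1 := by
    intro ω
    simp only [hφ]
    rw [← l2_sq, C.l2_stateAt, one_pow]
  have hlistsum : ∀ L : List (OracleGate S C.w), ∑ ω, ∑ z,
      (L.map fun g => if Bad g z ω then μ ω * φ ω z else 0).sum ≤
        L.length * θ * ∑ ω, μ ω := by
    intro L
    induction L with
    | nil => simp
    | cons g L ih =>
      simp only [List.map_cons, List.sum_cons, Finset.sum_add_distrib, List.length_cons]
      have h1 : ∑ ω, ∑ z, (if Bad g z ω then μ ω * φ ω z else 0) ≤ θ * ∑ ω, μ ω := by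
        rw [Finset.sum_comm]
        refine (Finset.sum_le_sum fun z _ => hone g z).trans (le_of_eq ?_)
        rw [← Finset.mul_sum, Finset.sum_comm]
        simp only [← Finset.mul_sum, hφ1, mul_one]
      push_cast
      linarith
  calc _ = ∑ ω, ∑ z, (if Differ (Fr.oracle ω.answer) (shadowOracle Fr θ μ ω i) L z
          then μ ω * φ ω z else 0) := by
        refine Finset.sum_congr rfl fun ω _ => ?_
        unfold differWeight
        rw [Finset.mul_sum]
        refine Finset.sum_congr rfl fun z _ => ?_
        split_ifs <;> simp [hφ]
    _ ≤ ∑ ω, ∑ z, (L.map fun g => if Bad g z ω then μ ω * φ ω z else 0).sum :=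
        Finset.sum_le_sum fun ω _ => Finset.sum_le_sum fun z _ => hlist L z ω
    _ ≤ _ := hlistsum L

end oracles

/-! ### The ideal process -/

section ideal
variable {d n : ℕ} {Salt : Type} [Fintype Salt] [DecidableEq Salt]

/-- A process that reveals values of the hidden functions: for all hidden data a distribution on
pairs of a memory content `m` and a set `k` of revealed arguments, such that the weight of `(m, k)`
depends on the functions only through their values on `k`. -/
structure IsLaw {Mem : Type} [Fintype Mem]
    (L : Mem → Finset (Salt × Bits n) → Hidden d n Salt → ℝ) : Prop where
  nonneg : ∀ m k ω, 0 ≤ L m k ω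
  sum_eq : ∀ ω, ∑ m, ∑ k, L m k ω = 1
  locality : ∀ m k p f f', (∀ e ∈ k, f e.1 e.2 = f' e.1 e.2) → L m k (p, f) = L m k (p, f')

/-- A step of a process that reveals values of the hidden functions: in the memory content `m`, it
reveals the arguments `R m ω`, and the memory then changes with the transition probabilities
`ker m m' ω`. -/
structure IsKernel {Mem : Type} [Fintype Mem]
    (R : Mem → Hidden d n Salt → Finset (Salt × Bits n))
    (ker : Mem → Mem → Hidden d n Salt → ℝ) : Prop where
  nonneg : ∀ m m' ω, 0 ≤ ker m m' ω
  sum_eq : ∀ m ω, ∑ m', ker m m' ω = 1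
  locality : ∀ m p f f', (∀ e ∈ R m (p, f), f e.1 e.2 = f' e.1 e.2) →
    R m (p, f') = R m (p, f) ∧ ∀ m', ker m m' (p, f') = ker m m' (p, f)

/-- The law of a process after one more step. -/
noncomputable def nextLaw {Mem : Type} [Fintype Mem]
    (L : Mem → Finset (Salt × Bits n) → Hidden d n Salt → ℝ)
    (R : Mem → Hidden d n Salt → Finset (Salt × Bits n))
    (ker : Mem → Mem → Hidden d n Salt → ℝ) :
    Mem → Finset (Salt × Bits n) → Hidden d n Salt → ℝ :=
  fun m' k' ω => ∑ m, ∑ k, if k ∪ R m ω = k' then L m k ω * ker m m' ω else 0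

/-- The expectation of `g` after one more step. -/
theorem sum_nextLaw {Mem : Type} [Fintype Mem]
    {L : Mem → Finset (Salt × Bits n) → Hidden d n Salt → ℝ}
    {R : Mem → Hidden d n Salt → Finset (Salt × Bits n)}
    {ker : Mem → Mem → Hidden d n Salt → ℝ} (g : Mem → Finset (Salt × Bits n) → ℝ)
    (ω : Hidden d n Salt) :
    ∑ m', ∑ k', nextLaw L R ker m' k' ω * g m' k' =
      ∑ m, ∑ k, L m k ω * ∑ m', ker m m' ω * g m' (k ∪ R m ω) := by
  unfold nextLaw
  simp only [Finset.sum_mul, Finset.mul_sum]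
  calc _ = ∑ m', ∑ m, ∑ k, ∑ k',
        (if k ∪ R m ω = k' then L m k ω * ker m m' ω else 0) * g m' k' := by
        refine Finset.sum_congr rfl fun m' _ => ?_
        rw [Finset.sum_comm]
        refine Finset.sum_congr rfl fun m _ => ?_
        rw [Finset.sum_comm]
    _ = ∑ m', ∑ m, ∑ k, L m k ω * (ker m m' ω * g m' (k ∪ R m ω)) := by
        refine Finset.sum_congr rfl fun m' _ => Finset.sum_congr rfl fun m _ =>
          Finset.sum_congr rfl fun k _ => ?_
        rw [Finset.sum_eq_single (k ∪ R m ω)]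
        · simp [mul_assoc]
        · intro k' _ hk'; simp [Ne.symm hk']
        · simp
    _ = _ := by
        rw [Finset.sum_comm]
        refine Finset.sum_congr rfl fun m _ => ?_
        rw [Finset.sum_comm]

/-- A process followed by a step that reveals values is again such a process. -/
theorem IsLaw.next {Mem : Type} [Fintype Mem]
    {L : Mem → Finset (Salt × Bits n) → Hidden d n Salt → ℝ} (hL : IsLaw L)
    {R : Mem → Hidden d n Salt → Finset (Salt × Bits n)}
    {ker : Mem → Mem → Hidden d n Salt → ℝ} (hk : IsKernel R ker) :
    IsLaw (nextLaw L R ker) where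
  nonneg m' k' ω := Finset.sum_nonneg fun m _ => Finset.sum_nonneg fun k _ => by
    split_ifs
    · exact mul_nonneg (hL.nonneg _ _ _) (hk.nonneg _ _ _)
    · exact le_rfl
  sum_eq ω := by
    have := sum_nextLaw (L := L) (R := R) (ker := ker) (fun _ _ => 1) ω
    simp only [mul_one, hk.sum_eq] at this
    rw [this, hL.sum_eq]
  locality m' k' p f f' h := by
    unfold nextLaw
    refine Finset.sum_congr rfl fun m _ => Finset.sum_congr rfl fun k _ => ?_
    have key : ∀ f f' : Salt → Bits n → Bits n, (∀ e ∈ k', f e.1 e.2 = f' e.1 e.2) →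
        k ∪ R m (p, f) = k' →
        (k ∪ R m (p, f') = k' ∧
          L m k (p, f) * ker m m' (p, f) = L m k (p, f') * ker m m' (p, f')) := by
      intro f f' h hc
      have h1 := hk.locality m p f f' fun e he => h e (hc ▸ Finset.mem_union_right _ he)
      have h2 := hL.locality m k p f f' fun e he => h e (hc ▸ Finset.mem_union_left _ he)
      exact ⟨by rw [h1.1, hc], by rw [h2, h1.2]⟩
    by_cases hc : k ∪ R m (p, f) = k'
    · have := key f f' h hc
      rw [if_pos hc, if_pos this.1, this.2]
    · rw [if_neg hc, if_neg]
      exact fun hc' => hc (key f' f (fun e he => (h e he).symm) hc').1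

/-- The parameters of the bounds for one step, for size `s`. -/
noncomputable def stepError (d s : ℕ) (θ η : ℝ) : ℝ := 2 * (s * θ / η + d * η)

/-- A step of a scheme is replaced by a step that reveals few values of the hidden functions: the
quantum circuits of a call get the shadow oracles. -/
def StepIdeal {S : OracleSig} (Fr : OracleFrame S d n Salt) {M : ℕ} (s : Step S d M)
    (ν u : Hidden d n Salt → ℝ) (w : (Fin M → Bool) → Hidden d n Salt → ℝ) (ε κ : ℝ) : Prop :=
  ∃ (R : (Fin M → Bool) → Hidden d n Salt → Finset (Salt × Bits n))
    (ker : (Fin M → Bool) → (Fin M → Bool) → Hidden d n Salt → ℝ), IsKernel R ker ∧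
    (∀ out l, ∑ ω, ν ω * ∑ m, w m ω * |acceptFrom (Fr.oracle ω.answer) out (s :: l) m -
      ∑ m', ker m m' ω * acceptFrom (Fr.oracle ω.answer) out l m'| ≤ ε * ∑ ω, ν ω * u ω) ∧
    ∑ ω, ν ω * ∑ m, w m ω * ((R m ω).card : ℝ) ≤ κ

/-- A step that does not query the oracle in superposition is its own replacement. -/
theorem stepIdeal_of_exact {S : OracleSig} (Fr : OracleFrame S d n Salt) {M : ℕ} (s : Step S d M)
    {ν u : Hidden d n Salt → ℝ} {w : (Fin M → Bool) → Hidden d n Salt → ℝ} {ε κ : ℝ}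
    (hν : ∀ ω, 0 ≤ ν ω) (hw : ∀ m ω, 0 ≤ w m ω) (hwu : ∀ ω, ∑ m, w m ω = u ω)
    (hε : 0 ≤ ε) (hκ : ∑ ω, ν ω * u ω ≤ κ)
    (R : (Fin M → Bool) → Hidden d n Salt → Finset (Salt × Bits n))
    (ker : (Fin M → Bool) → (Fin M → Bool) → Hidden d n Salt → ℝ) (hker : IsKernel R ker)
    (h1 : ∀ ω out l m, acceptFrom (Fr.oracle ω.answer) out (s :: l) m =
      ∑ m', ker m m' ω * acceptFrom (Fr.oracle ω.answer) out l m')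
    (h2 : ∀ m ω, (R m ω).card ≤ 1) : StepIdeal Fr s ν u w ε κ := by
  have hu : 0 ≤ ∑ ω, ν ω * u ω := Finset.sum_nonneg fun ω _ =>
    mul_nonneg (hν ω) (hwu ω ▸ Finset.sum_nonneg fun m _ => hw m ω)
  refine ⟨R, ker, hker, fun out l => ?_, le_trans (Finset.sum_le_sum fun ω _ => ?_) hκ⟩
  · simp only [h1, sub_self, abs_zero, mul_zero, Finset.sum_const_zero]
    exact mul_nonneg hε hu
  · rw [← hwu ω]
    refine mul_le_mul_of_nonneg_left (Finset.sum_le_sum fun m _ => ?_) (hν ω)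
    exact mul_le_of_le_one_right (hw m ω) (by exact_mod_cast h2 m ω)

open Classical in
/-- The arguments revealed by a known path set. -/
noncomputable def revealed (K : Finset (Salt × Big d n)) : Finset (Salt × Bits n) :=
  Finset.univ.filter fun e => (e.1, pad e.2) ∈ K

theorem card_revealed_le (K : Finset (Salt × Big d n)) : (revealed K).card ≤ K.card := by
  classical
  refine Finset.card_le_card_of_injOn (fun e => (e.1, pad e.2)) ?_ ?_
  · intro e he
    have he' := Finset.mem_coe.1 he
    rw [revealed, Finset.mem_filter] at he'
    exact he'.2
  · rintro ⟨a, x⟩ _ ⟨b, y⟩ _ h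
    simp only [Prod.mk.injEq] at h
    rw [h.1, pad_injective h.2]

theorem mem_revealed {K : Finset (Salt × Big d n)} {e : Salt × Bits n} :
    e ∈ revealed K ↔ (e.1, pad e.2) ∈ K := by
  simp [revealed]

theorem queriesAt_length_le {S : OracleSig} {M : ℕ} (C : QCall S d M) (mem : Fin M → Bool) :
    ∑ i ∈ Finset.range d, (C.queriesAt mem i).length ≤ (Step.call C).size := by
  rw [Finset.sum_range]
  have h : ∀ i : Fin d, (C.queriesAt mem i).length ≤ ((C.queries i).map OracleSlot.size).sum := by
    intro i
    rw [QCall.queriesAt, dif_pos i.2]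
    refine (List.length_filterMap_le _ _).trans ?_
    have : ∀ L : List (OracleSlot S M), L.length ≤ (L.map OracleSlot.size).sum := by
      intro L
      induction L with
      | nil => simp
      | cons a L ih =>
        simp only [List.length_cons, List.map_cons, List.sum_cons, OracleSlot.size] at ih ⊢
        omega
    exact this _
  exact (Finset.sum_le_sum fun i _ => h i).trans (Nat.le_add_left _ _)

theorem knownConst_nonneg (d k : ℕ) : 0 ≤ knownConst d k := by
  induction k with
  | zero => simp [knownConst]
  | succ k ih => rw [knownConst]; positivity

/-- A call is replaced by the circuit in which query layer `i` is answered by the shadow at level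
`i + 1`. After all `d` layers its state depends on the known paths at level `d` only, and their
starting points are what the step reveals. The weight is taken for every memory content `m`
separately, so that the known paths, which depend on it, may depend on `m`. -/
theorem stepIdeal_call {S : OracleSig} (Fr : OracleFrame S d n Salt) {M : ℕ} (C : QCall S d M)
    {ν u : Hidden d n Salt → ℝ} {w : (Fin M → Bool) → Hidden d n Salt → ℝ}
    (hS : Fintype.card Salt ≤ 2 ^ n) (hν0 : ∀ ω, 0 ≤ ν ω) (hν : ∀ p p' f, ν (p, f) = ν (p', f))
    (hν1 : ∑ ω, ν ω = 1) (hw : ∀ m ω, 0 ≤ w m ω) (hwu : ∀ ω, ∑ m, w m ω = u ω)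
    (hu : ∀ ω, u ω ≤ 1) {θ η q : ℝ} (hθ : 8 / 2 ^ n ≤ θ) (hη : 0 < η) (hq : 0 < q) {s : ℕ}
    (hs : (Step.call C).size ≤ s) :
    StepIdeal Fr (Step.call C) ν u w (stepError d s θ η)
      (knownConst d d * (Real.log (1 / q) * ∑ ω, ν ω * u ω + q * 2 ^ M)) := by
  classical
  have hθ0 : 0 ≤ θ := le_trans (by positivity) hθ
  set μ : (Fin M → Bool) → Hidden d n Salt → ℝ := fun m ω => ν ω * w m ω with hμ
  have hμ0 : ∀ m ω, 0 ≤ μ m ω := fun m ω => mul_nonneg (hν0 ω) (hw m ω)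
  have hw1 : ∀ m ω, 0 ≤ w m ω ∧ w m ω ≤ 1 := fun m ω => ⟨hw m ω, le_trans
    (Finset.single_le_sum (f := fun m => w m ω) (fun m _ => hw m ω) (Finset.mem_univ m))
    ((hwu ω).le.trans (hu ω))⟩
  set ψ : (Fin M → Bool) → Hidden d n Salt → Bits C.w → ℂ := fun m ω =>
    C.stateAt (shadowOracle Fr θ (μ m) ω) m d with hψ
  have hψ1 : ∀ m ω, ∑ z, ‖ψ m ω z‖ ^ 2 = 1 := by
    intro m ω
    rw [← l2_sq, C.l2_stateAt, one_pow]
  have hnext : ∀ (m : Fin M → Bool) ω (g : (Fin M → Bool) → ℝ),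
      ∑ m', (∑ z, if Function.extend C.reg z m = m' then ‖ψ m ω z‖ ^ 2 else 0) * g m' =
        ∑ z, ‖ψ m ω z‖ ^ 2 * g (Function.extend C.reg z m) := by
    intro m ω g
    simp only [Finset.sum_mul]
    rw [Finset.sum_comm]
    refine Finset.sum_congr rfl fun z _ => ?_
    rw [Finset.sum_eq_single (Function.extend C.reg z m)]
    · simp
    · intro m' _ hm'; simp [Ne.symm hm']
    · simp
  refine ⟨fun m ω => revealed (known θ (μ m) d ω),
    fun m m' ω => ∑ z, if Function.extend C.reg z m = m' then ‖ψ m ω z‖ ^ 2 else 0,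
    ⟨?_, ?_, ?_⟩, ?_, ?_⟩
  · intro m m' ω
    exact Finset.sum_nonneg fun z _ => by split_ifs <;> positivity
  · intro m ω
    have := hnext m ω fun _ => 1
    simpa only [mul_one, hψ1] using this
  · intro m p f f' h
    have hag : Agree d (known θ (μ m) d (p, f)) (p, f) (p, f') :=
      ⟨fun _ _ _ _ => rfl, fun a x hx => h (a, x) (mem_revealed.2 hx)⟩
    refine ⟨by rw [known_congr hag], fun m' => ?_⟩
    simp only [hψ]
    rw [stateAt_shadow_congr Fr C m le_rfl hag]
  · intro out l
    have herr : ∀ m ω, |acceptFrom (Fr.oracle ω.answer) out (Step.call C :: l) m -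
        ∑ m', (∑ z, if Function.extend C.reg z m = m' then ‖ψ m ω z‖ ^ 2 else 0) *
          acceptFrom (Fr.oracle ω.answer) out l m'| ≤
        ∑ i ∈ Finset.range d, 2 * (differWeight (Fr.oracle ω.answer)
          (shadowOracle Fr θ (μ m) ω i) (C.queriesAt m i)
          (C.stateAt (shadowOracle Fr θ (μ m) ω) m i) / η + η) := by
      intro m ω
      rw [hnext]
      simp only [acceptFrom]
      refine (abs_measure_sub_le _ _ (C.l2_finalState _ m) (C.l2_stateAt _ m d)
        (fun z => acceptFrom (Fr.oracle ω.answer) out l (Function.extend C.reg z m))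
        fun z => acceptFrom_mem_Icc _ _ _ _).trans ?_
      rw [C.finalState_eq]
      refine (mul_le_mul_of_nonneg_left (l2_runLayers_sub_le _ _ _ _ _ d) two_pos.le).trans ?_
      rw [Finset.mul_sum]
      refine Finset.sum_le_sum fun i _ => ?_
      have hx := differWeight_nonneg (Fr.oracle ω.answer)
        (shadowOracle Fr θ (μ m) ω i) (C.queriesAt m i)
        (C.stateAt (shadowOracle Fr θ (μ m) ω) m i)
      change 2 * (2 * Real.sqrt (differWeight (Fr.oracle ω.answer)
        (shadowOracle Fr θ (μ m) ω i) (C.queriesAt m i)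
        (C.stateAt (shadowOracle Fr θ (μ m) ω) m i))) ≤ _
      generalize differWeight (Fr.oracle ω.answer)
        (shadowOracle Fr θ (μ m) ω i) (C.queriesAt m i)
        (C.stateAt (shadowOracle Fr θ (μ m) ω) m i) = x at hx ⊢
      -- `x` is small only on average, so the square root is replaced by a linear bound.
      have h1 : 2 * Real.sqrt x ≤ x / η + η := by
        have h2 := Real.sq_sqrt hx
        have h3 : x / η + η - 2 * Real.sqrt x = (Real.sqrt x - η) ^ 2 / η := by
          field_simp
          nlinarith
        have h4 : 0 ≤ (Real.sqrt x - η) ^ 2 / η := by positivity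
        linarith
      linarith
    calc _ ≤ ∑ ω, ∑ m, μ m ω * ∑ i ∈ Finset.range d, 2 * (differWeight (Fr.oracle ω.answer)
          (shadowOracle Fr θ (μ m) ω i) (C.queriesAt m i)
          (C.stateAt (shadowOracle Fr θ (μ m) ω) m i) / η + η) := by
          refine Finset.sum_le_sum fun ω _ => ?_
          rw [Finset.mul_sum]
          refine Finset.sum_le_sum fun m _ => ?_
          rw [← mul_assoc]
          exact mul_le_mul_of_nonneg_left (herr m ω) (hμ0 m ω)
      _ = ∑ m, ∑ i ∈ Finset.range d, (2 / η * ∑ ω, μ m ω * differWeight (Fr.oracle ω.answer)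
          (shadowOracle Fr θ (μ m) ω i) (C.queriesAt m i)
          (C.stateAt (shadowOracle Fr θ (μ m) ω) m i) + 2 * η * ∑ ω, μ m ω) := by
          rw [Finset.sum_comm]
          refine Finset.sum_congr rfl fun m _ => ?_
          simp only [Finset.mul_sum]
          rw [Finset.sum_comm]
          refine Finset.sum_congr rfl fun i _ => ?_
          rw [← Finset.sum_add_distrib]
          refine Finset.sum_congr rfl fun ω _ => ?_
          ring
      _ ≤ ∑ m, ∑ i ∈ Finset.range d, (2 / η * ((C.queriesAt m i).length * θ * ∑ ω, μ m ω) +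
          2 * η * ∑ ω, μ m ω) := by
          refine Finset.sum_le_sum fun m _ => Finset.sum_le_sum fun i hi => ?_
          have := sum_differWeight_le Fr hθ0 (hμ0 m) C m (Finset.mem_range.1 hi)
          have h2 : 0 ≤ 2 / η := by positivity
          exact add_le_add_left (mul_le_mul_of_nonneg_left this h2) _
      _ ≤ ∑ m, stepError d s θ η * ∑ ω, μ m ω := by
          refine Finset.sum_le_sum fun m _ => ?_
          have h1 : ((∑ i ∈ Finset.range d, (C.queriesAt m i).length : ℕ) : ℝ) ≤ s := by
            exact_mod_cast (queriesAt_length_le C m).trans hs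
          have h2 : 0 ≤ ∑ ω, μ m ω := Finset.sum_nonneg fun ω _ => hμ0 m ω
          rw [Finset.sum_add_distrib, ← Finset.mul_sum, ← Finset.sum_mul, ← Finset.sum_mul,
            Finset.sum_const, Finset.card_range, nsmul_eq_mul, stepError]
          push_cast at h1
          have h3 : 2 / η * ((∑ i ∈ Finset.range d, ((C.queriesAt m i).length : ℝ)) * θ *
              ∑ ω, μ m ω) ≤ 2 / η * (s * θ * ∑ ω, μ m ω) := by gcongr
          refine (add_le_add_left h3 _).trans (le_of_eq ?_)
          ring
      _ = _ := by
          rw [← Finset.mul_sum, Finset.sum_comm]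
          congr 1
          refine Finset.sum_congr rfl fun ω _ => ?_
          rw [← hwu ω, Finset.mul_sum]
  · calc _ ≤ ∑ ω, ∑ m, ν ω * w m ω * ((known θ (μ m) d ω).card : ℝ) := by
          refine Finset.sum_le_sum fun ω _ => ?_
          rw [Finset.mul_sum]
          refine Finset.sum_le_sum fun m _ => ?_
          rw [← mul_assoc]
          exact mul_le_mul_of_nonneg_left (by exact_mod_cast card_revealed_le _) (hμ0 m ω)
      _ ≤ ∑ m, knownConst d d * (Real.log (1 / q) * ∑ ω, ν ω * w m ω + q) := by
          rw [Finset.sum_comm]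
          exact Finset.sum_le_sum fun m _ =>
            sum_card_known_le hθ hS hν0 hν hν1 (hw1 m) hq d
      _ = _ := by
          rw [← Finset.mul_sum, Finset.sum_add_distrib, ← Finset.mul_sum, Finset.sum_comm]
          simp only [← Finset.mul_sum, hwu]
          simp [mul_comm]

/-- Every step has a replacement that reveals few values. A classical query reveals at most one:
only the last function of a shuffling depends on the shuffled function, and it uses the value at a
single point. -/
theorem stepIdeal {S : OracleSig} (Fr : OracleFrame S d n Salt) {M : ℕ} (t : Step S d M)
    {ν u : Hidden d n Salt → ℝ} {w : (Fin M → Bool) → Hidden d n Salt → ℝ}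
    (hS : Fintype.card Salt ≤ 2 ^ n) (hν0 : ∀ ω, 0 ≤ ν ω) (hν : ∀ p p' f, ν (p, f) = ν (p', f))
    (hν1 : ∑ ω, ν ω = 1) (hw : ∀ m ω, 0 ≤ w m ω) (hwu : ∀ ω, ∑ m, w m ω = u ω)
    (hu : ∀ ω, u ω ≤ 1) {θ η q : ℝ} (hθ : 8 / 2 ^ n ≤ θ) (hη : 0 < η) (hq : 0 < q)
    (hq1 : q ≤ 1) {s : ℕ} (hs : t.size ≤ s) :
    StepIdeal Fr t ν u w (stepError d s θ η)
      (∑ ω, ν ω * u ω +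
        knownConst d d * (Real.log (1 / q) * ∑ ω, ν ω * u ω + q * 2 ^ M)) := by
  classical
  have hθ0 : 0 ≤ θ := le_trans (by positivity) hθ
  have hε : 0 ≤ stepError d s θ η := by unfold stepError; positivity
  have hu0 : 0 ≤ ∑ ω, ν ω * u ω := Finset.sum_nonneg fun ω _ =>
    mul_nonneg (hν0 ω) (hwu ω ▸ Finset.sum_nonneg fun m _ => hw m ω)
  have hlog : 0 ≤ Real.log (1 / q) := Real.log_nonneg (by rw [le_div_iff₀ hq]; linarith)
  have hC := knownConst_nonneg d d
  have hκ0 : 0 ≤ knownConst d d * (Real.log (1 / q) * ∑ ω, ν ω * u ω + q * 2 ^ M) := by positivity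
  have hκ : ∑ ω, ν ω * u ω ≤ ∑ ω, ν ω * u ω +
        knownConst d d * (Real.log (1 / q) * ∑ ω, ν ω * u ω + q * 2 ^ M) := by linarith
  cases t with
  | nand dst a b =>
    refine stepIdeal_of_exact Fr _ hν0 hw hwu hε hκ (fun _ _ => ∅)
      (fun m m' _ => if m' = Function.update m dst (!(m a && m b)) then 1 else 0)
      ⟨fun m m' ω => by split_ifs <;> simp, fun m ω => by simp,
        fun m p f f' _ => ⟨rfl, fun _ => rfl⟩⟩
      (fun ω out l m => by simp [acceptFrom]) (fun m ω => by simp)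
  | coin dst =>
    refine stepIdeal_of_exact Fr _ hν0 hw hwu hε hκ (fun _ _ => ∅)
      (fun m m' _ => (if m' = Function.update m dst false then 1 / 2 else 0) +
        (if m' = Function.update m dst true then 1 / 2 else 0))
      ⟨fun m m' ω => by split_ifs <;> norm_num,
        fun m ω => by rw [Finset.sum_add_distrib]; simp; norm_num,
        fun m p f f' _ => ⟨rfl, fun _ => rfl⟩⟩
      (fun ω out l m => by
        simp only [acceptFrom, add_mul, Finset.sum_add_distrib, ite_mul, zero_mul,
          Finset.sum_ite_eq', Finset.mem_univ, if_true]
        ring) (fun m ω => by simp)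
  | query dst q' o inp =>
    refine stepIdeal_of_exact Fr _ hν0 hw hwu hε hκ
      (fun m ω => match Fr.parse q' (m ∘ inp) with
        | none => ∅
        | some (a, _, y) => Finset.univ.filter fun e =>
            e.1 = a ∧ pad e.2 = (prefixPerm (ω.1 a) d).symm y)
      (fun m m' ω => if m' = Function.update m dst (Fr.oracle ω.answer q' (m ∘ inp) o)
        then 1 else 0)
      ⟨fun m m' ω => by split_ifs <;> simp, fun m ω => by simp, fun m p f f' h => ?_⟩
      (fun ω out l m => by simp [acceptFrom]) (fun m ω => ?_)
    · rcases hp : Fr.parse q' (m ∘ inp) with _ | ⟨a, j, y⟩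
      · simp [OracleFrame.oracle, hp]
      · simp only [hp] at h
        refine ⟨rfl, fun m' => ?_⟩
        have : Fr.oracle (Hidden.answer (p, f')) q' (m ∘ inp) =
            Fr.oracle (Hidden.answer (p, f)) q' (m ∘ inp) := by
          simp only [OracleFrame.oracle, hp, Option.bind_some, Hidden.answer]
          congr 1
          split_ifs with h1 h2
          · rfl
          · have hj : (j : ℕ) = d := by have := j.2; omega
            rw [h (a, firstBits ((prefixPerm (p a) j).symm y))]
            simp only [Finset.mem_filter, Finset.mem_univ, true_and]
            rw [h2, hj]
          · rfl
        rw [this]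
    · rcases hp : Fr.parse q' (m ∘ inp) with _ | ⟨a, j, y⟩
      · simp
      · simp only
        rw [Finset.card_le_one]
        rintro ⟨a, x⟩ hx ⟨b, z⟩ hz
        simp only [Finset.mem_filter, Finset.mem_univ, true_and] at hx hz
        rw [hx.1, hz.1, pad_injective (hx.2.trans hz.2.symm)]
  | call C =>
    obtain ⟨R, ker, h1, h2, h3⟩ := stepIdeal_call Fr C hS hν0 hν hν1 hw hwu hu hθ hη hq hs
    exact ⟨R, ker, h1, h2, h3.trans (by linarith)⟩

open Classical in
/-- The real process is close to an ideal process that reveals few values of the hidden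
functions. The weight `u` may be correlated with the hidden data in any way, which stands for
advice. -/
theorem exists_ideal_law {S : OracleSig} (Fr : OracleFrame S d n Salt) {M : ℕ} (out : Fin M)
    {ν u : Hidden d n Salt → ℝ}
    (hS : Fintype.card Salt ≤ 2 ^ n) (hν0 : ∀ ω, 0 ≤ ν ω) (hν : ∀ p p' f, ν (p, f) = ν (p', f))
    (hν1 : ∑ ω, ν ω = 1) (hu : ∀ ω, 0 ≤ u ω ∧ u ω ≤ 1) {θ η q : ℝ} (hθ : 8 / 2 ^ n ≤ θ)
    (hη : 0 < η) (hq : 0 < q) (hq1 : q ≤ 1) {s : ℕ} (l : List (Step S d M)) :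
    (∀ t ∈ l, t.size ≤ s) →
    ∀ L : (Fin M → Bool) → Finset (Salt × Bits n) → Hidden d n Salt → ℝ, IsLaw L →
    ∃ L' : (Fin M → Bool) → Finset (Salt × Bits n) → Hidden d n Salt → ℝ, IsLaw L' ∧
      ∑ ω, ν ω * u ω * |∑ m, ∑ k, L m k ω * acceptFrom (Fr.oracle ω.answer) out l m -
        ∑ m, ∑ k, L' m k ω * (if m out = true then 1 else 0)| ≤
          l.length * (stepError d s θ η * ∑ ω, ν ω * u ω) ∧
      ∑ ω, ν ω * u ω * ∑ m, ∑ k, L' m k ω * (k.card : ℝ) ≤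
        ∑ ω, ν ω * u ω * ∑ m, ∑ k, L m k ω * (k.card : ℝ) + l.length * (∑ ω, ν ω * u ω +
          knownConst d d * (Real.log (1 / q) * ∑ ω, ν ω * u ω + q * 2 ^ M)) := by
  induction l with
  | nil =>
    intro _ L hL
    exact ⟨L, hL, by simp [acceptFrom], by simp⟩
  | cons t l ih =>
    intro hl L hL
    -- The remaining steps are started from the ideal process, so the error of this step is averaged
    -- over the memory contents of that process.
    set w : (Fin M → Bool) → Hidden d n Salt → ℝ := fun m ω => u ω * ∑ k, L m k ω with hw
    have hw0 : ∀ m ω, 0 ≤ w m ω := fun m ω =>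
      mul_nonneg (hu ω).1 (Finset.sum_nonneg fun k _ => hL.nonneg m k ω)
    have hwu : ∀ ω, ∑ m, w m ω = u ω := fun ω => by
      simp only [hw, ← Finset.mul_sum, hL.sum_eq, mul_one]
    obtain ⟨R, ker, hker, h1, h2⟩ := stepIdeal Fr t hS hν0 hν hν1 hw0 hwu (fun ω => (hu ω).2) hθ hη
      hq hq1 (hl t List.mem_cons_self)
    obtain ⟨L', hL', h3, h4⟩ := ih (fun t ht => hl t (List.mem_cons_of_mem _ ht)) _ (hL.next hker)
    refine ⟨L', hL', ?_, ?_⟩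
    · have hstep : ∀ ω, ν ω * u ω *
          |∑ m, ∑ k, L m k ω * acceptFrom (Fr.oracle ω.answer) out (t :: l) m -
          ∑ m, ∑ k, nextLaw L R ker m k ω * acceptFrom (Fr.oracle ω.answer) out l m| ≤
          ν ω * ∑ m, w m ω * |acceptFrom (Fr.oracle ω.answer) out (t :: l) m -
            ∑ m', ker m m' ω * acceptFrom (Fr.oracle ω.answer) out l m'| := by
        intro ω
        rw [sum_nextLaw (fun m _ => acceptFrom (Fr.oracle ω.answer) out l m) ω, mul_assoc]
        refine mul_le_mul_of_nonneg_left ?_ (hν0 ω)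
        rw [← Finset.sum_sub_distrib]
        calc _ ≤ u ω * ∑ m, |(∑ k, L m k ω) * (acceptFrom (Fr.oracle ω.answer) out (t :: l) m -
                ∑ m', ker m m' ω * acceptFrom (Fr.oracle ω.answer) out l m')| := by
              refine mul_le_mul_of_nonneg_left ?_ (hu ω).1
              refine (Finset.abs_sum_le_sum_abs _ _).trans (le_of_eq ?_)
              refine Finset.sum_congr rfl fun m _ => ?_
              rw [← Finset.sum_mul, ← Finset.sum_mul, mul_sub]
          _ = _ := by
              rw [Finset.mul_sum]
              refine Finset.sum_congr rfl fun m _ => ?_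
              rw [abs_mul, abs_of_nonneg (Finset.sum_nonneg fun k _ => hL.nonneg m k ω), hw,
                mul_assoc]
      have htri : ∀ ω, ν ω * u ω *
          |∑ m, ∑ k, L m k ω * acceptFrom (Fr.oracle ω.answer) out (t :: l) m -
          ∑ m, ∑ k, L' m k ω * (if m out = true then 1 else 0)| ≤
          ν ω * ∑ m, w m ω * |acceptFrom (Fr.oracle ω.answer) out (t :: l) m -
            ∑ m', ker m m' ω * acceptFrom (Fr.oracle ω.answer) out l m'| +
          ν ω * u ω * |∑ m, ∑ k, nextLaw L R ker m k ω * acceptFrom (Fr.oracle ω.answer) out l m -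
          ∑ m, ∑ k, L' m k ω * (if m out = true then 1 else 0)| := by
        intro ω
        refine le_trans ?_ (add_le_add_left (hstep ω) _)
        rw [← mul_add]
        exact mul_le_mul_of_nonneg_left (abs_sub_le _ _ _) (mul_nonneg (hν0 ω) (hu ω).1)
      refine (Finset.sum_le_sum fun ω _ => htri ω).trans ?_
      rw [Finset.sum_add_distrib, List.length_cons]
      push_cast
      linarith [h1 out l]
    · refine h4.trans ?_
      have h5 : ∑ ω, ν ω * u ω * ∑ m, ∑ k, nextLaw L R ker m k ω * (k.card : ℝ) ≤
          ∑ ω, ν ω * u ω * ∑ m, ∑ k, L m k ω * (k.card : ℝ) +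
            ∑ ω, ν ω * ∑ m, w m ω * ((R m ω).card : ℝ) := by
        rw [← Finset.sum_add_distrib]
        refine Finset.sum_le_sum fun ω _ => ?_
        rw [sum_nextLaw (fun _ k => (k.card : ℝ)) ω]
        have h6 : ∑ m, w m ω * ((R m ω).card : ℝ) =
            u ω * ∑ m, ∑ k, L m k ω * ((R m ω).card : ℝ) := by
          rw [Finset.mul_sum]
          refine Finset.sum_congr rfl fun m _ => ?_
          rw [hw, ← Finset.sum_mul, mul_assoc]
        rw [h6, ← mul_assoc, ← mul_add, ← Finset.sum_add_distrib]
        refine mul_le_mul_of_nonneg_left (Finset.sum_le_sum fun m _ => ?_)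
          (mul_nonneg (hν0 ω) (hu ω).1)
        rw [← Finset.sum_add_distrib]
        refine Finset.sum_le_sum fun k _ => ?_
        rw [← Finset.sum_mul, hker.sum_eq, one_mul, ← mul_add]
        exact mul_le_mul_of_nonneg_left (by exact_mod_cast Finset.card_union_le _ _)
          (hL.nonneg m k ω)
      rw [List.length_cons]
      push_cast
      linarith

end ideal

/-! ### Few values do not distinguish Simon functions from one-to-one functions -/

section simon
variable {n : ℕ}

/-- The bitwise sum of bit strings. -/
def xorBits (x s : Bits n) : Bits n := fun i => xor (x i) (s i)

/-- `f` is two-to-one with hidden shift `s`. -/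
def HasShift (s : Bits n) (f : Bits n → Bits n) : Prop :=
  ∀ x y, f x = f y ↔ y = x ∨ y = xorBits x s

theorem isSimon_iff (f : Bits n → Bits n) :
    IsSimon f ↔ ∃ s : Bits n, s ≠ (fun _ => false) ∧ HasShift s f := Iff.rfl

theorem xorBits_xorBits (x s : Bits n) : xorBits (xorBits x s) s = x := by
  funext i; simp [xorBits]

theorem HasShift.unique {s t : Bits n} {f : Bits n → Bits n} (hs : HasShift s f)
    (ht : HasShift t f) (hs0 : s ≠ fun _ => false) : s = t := by
  have h1 : f (fun _ => false) = f s := (hs _ _).2 (Or.inr (by funext i; simp [xorBits]))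
  rcases (ht _ _).1 h1 with h | h
  · exact absurd h hs0
  · rw [h]; funext i; simp [xorBits]

theorem IsSimon.not_injective {f : Bits n → Bits n} (h : IsSimon f) : ¬ Function.Injective f := by
  obtain ⟨s, hs, hf⟩ := h
  intro hi
  have h1 : f (fun _ => false) = f s := (hf _ _).2 (Or.inr (by funext i; simp))
  exact hs (hi h1).symm

theorem exists_hasShift {s : Bits n} (hs : s ≠ fun _ => false) :
    ∃ f : Bits n → Bits n, HasShift s f := by
  obtain ⟨i, hi⟩ : ∃ i, s i = true := by
    by_contra h
    push Not at h
    exact hs (funext fun i => by simpa using h i)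
  refine ⟨fun x l => xor (x l) (x i && s l), fun x y => ⟨fun h => ?_, ?_⟩⟩
  · have h' : ∀ l, xor (x l) (x i && s l) = xor (y l) (y i && s l) := fun l => congrFun h l
    by_cases hxy : x i = y i
    · left
      funext l
      have := h' l
      rw [hxy] at this
      simpa using this.symm
    · right
      funext l
      have := h' l
      simp only [xorBits]
      revert this hxy
      cases x i <;> cases y i <;> cases x l <;> cases y l <;> cases s l <;> simp
  · rintro (rfl | rfl)
    · rfl
    · funext l
      simp only [xorBits, hi]
      cases x i <;> cases x l <;> cases s l <;> rfl

/-- There is an additive involution that exchanges two given nonzero shifts. -/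
theorem exists_exchange {s t : Bits n} (hs : s ≠ fun _ => false) (ht : t ≠ fun _ => false) :
    ∃ A : Bits n → Bits n, (∀ x, A (A x) = x) ∧ (∀ x y, A (xorBits x y) = xorBits (A x) (A y)) ∧
      A s = t := by
  have hne : ∀ u : Bits n, u ≠ (fun _ => false) → ∃ i, u i = true := by
    intro u hu
    by_contra h
    push Not at h
    exact hu (funext fun i => by simpa using h i)
  -- With an additive functional `ℓ` that is one on `s` and on `t`, the map `x ↦ x + ℓ x • (s + t)`
  -- exchanges `s` and `t`.
  obtain ⟨ℓ, hadd, hℓs, hℓt⟩ : ∃ ℓ : Bits n → Bool,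
      (∀ x y, ℓ (xorBits x y) = xor (ℓ x) (ℓ y)) ∧ ℓ s = true ∧ ℓ t = true := by
    by_cases h : ∃ i, s i = true ∧ t i = true
    · obtain ⟨i, h1, h2⟩ := h
      exact ⟨fun x => x i, fun x y => rfl, h1, h2⟩
    · push Not at h
      obtain ⟨i, hi⟩ := hne s hs
      obtain ⟨j, hj⟩ := hne t ht
      have hti : t i = false := by simpa using h i hi
      have hsj : s j = false := by
        by_contra hc
        exact h j (by simpa using hc) hj
      refine ⟨fun x => xor (x i) (x j), fun x y => ?_, by simp [hi, hsj], by simp [hj, hti]⟩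
      simp only [xorBits]
      cases x i <;> cases x j <;> cases y i <;> cases y j <;> rfl
  have hst : ℓ (xorBits s t) = false := by rw [hadd, hℓs, hℓt]; rfl
  let A : Bits n → Bits n := fun x i => xor (x i) (ℓ x && xor (s i) (t i))
  have hAℓ : ∀ x, ℓ (A x) = ℓ x := by
    intro x
    rcases hx : ℓ x with _ | _
    · have : A x = x := by funext i; simp [A, hx]
      rw [this, hx]
    · have : A x = xorBits x (xorBits s t) := by funext i; simp [A, hx, xorBits]
      rw [this, hadd, hst, hx]; rfl
  refine ⟨A, fun x => ?_, fun x y => ?_, ?_⟩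
  · funext i
    change xor (A x i) (ℓ (A x) && xor (s i) (t i)) = x i
    rw [hAℓ]
    simp [A]
  · funext i
    simp only [A, hadd, xorBits]
    cases ℓ x <;> cases ℓ y <;> cases x i <;> cases y i <;> cases s i <;> cases t i <;> rfl
  · funext i
    simp [A, hℓs]

open Classical in
/-- The Simon functions on `n` bits. -/
noncomputable def simonSet (n : ℕ) : Finset (Bits n → Bits n) := Finset.univ.filter IsSimon

open Classical in
/-- The one-to-one functions on `n` bits. -/
noncomputable def injSet (n : ℕ) : Finset (Bits n → Bits n) :=
  Finset.univ.filter Function.Injective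

open Classical in
/-- The Simon functions with shift `s`. -/
noncomputable def shiftSet (s : Bits n) : Finset (Bits n → Bits n) :=
  Finset.univ.filter (HasShift s)

/-- All nonzero shifts belong to the same number of Simon functions: an additive involution that
exchanges two shifts exchanges their Simon functions. -/
theorem card_shiftSet_eq {s t : Bits n} (hs : s ≠ fun _ => false) (ht : t ≠ fun _ => false) :
    (shiftSet s).card = (shiftSet t).card := by
  obtain ⟨A, h1, h2, h3⟩ := exists_exchange hs ht
  have h3' : A t = s := by rw [← h3, h1]
  have key : ∀ {s t : Bits n}, A t = s → ∀ f, HasShift s f → HasShift t (f ∘ A) := by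
    intro s t hst f hf x y
    rw [Function.comp_apply, Function.comp_apply, hf]
    refine or_congr ?_ ?_
    · exact (Function.LeftInverse.injective h1).eq_iff
    · rw [← hst, ← h2]
      exact (Function.LeftInverse.injective h1).eq_iff
  refine Finset.card_nbij' (fun f => f ∘ A) (fun f => f ∘ A) ?_ ?_ ?_ ?_
  · intro f hf
    have hf' := Finset.mem_coe.1 hf
    simp only [shiftSet, Finset.coe_filter, Finset.mem_univ, true_and, Set.mem_ofPred_eq,
      Finset.mem_filter] at hf' ⊢
    exact key h3' f hf'
  · intro f hf
    have hf' := Finset.mem_coe.1 hf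
    simp only [shiftSet, Finset.coe_filter, Finset.mem_univ, true_and, Set.mem_ofPred_eq,
      Finset.mem_filter] at hf' ⊢
    exact key h3 f hf'
  · intro f _; funext x; simp [h1]
  · intro f _; funext x; simp [h1]

theorem card_simonSet {s : Bits n} (hs : s ≠ fun _ => false) :
    (2 ^ n - 1) * (shiftSet s).card = (simonSet n).card := by
  classical
  have h1 : simonSet n = (Finset.univ.erase (fun _ => false)).biUnion shiftSet := by
    ext f
    simp [simonSet, shiftSet, isSimon_iff]
  rw [h1, Finset.card_biUnion]
  · rw [Finset.sum_congr rfl fun t ht => card_shiftSet_eq (Finset.ne_of_mem_erase ht) hs]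
    simp
  · intro t ht t' _ hne
    rw [Function.onFun, Finset.disjoint_left]
    intro f hf hf'
    simp only [shiftSet, Finset.mem_filter, Finset.mem_univ, true_and] at hf hf'
    exact hne (hf.unique hf' (Finset.ne_of_mem_erase ht))

theorem simonSet_nonempty (hn : 0 < n) : (simonSet n).Nonempty := by
  have hs : (fun _ : Fin n => true) ≠ fun _ => false := fun h => by
    simpa using congrFun h ⟨0, hn⟩
  obtain ⟨f, hf⟩ := exists_hasShift hs
  refine ⟨f, ?_⟩
  simp only [simonSet, Finset.mem_filter, Finset.mem_univ, true_and]
  exact ⟨_, hs, hf⟩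

theorem injSet_nonempty : (injSet n).Nonempty :=
  ⟨id, by simp [injSet, Function.injective_id]⟩

/-- Few Simon functions have a collision on a small set. -/
theorem card_simon_not_injOn_le (k : Finset (Bits n)) :
    (2 ^ n - 1) * ((simonSet n).filter fun f => ¬ Set.InjOn f k).card ≤
      k.card ^ 2 * (simonSet n).card := by
  classical
  have hsub : ((simonSet n).filter fun f => ¬ Set.InjOn f k) ⊆
      ((k ×ˢ k).filter fun e => e.1 ≠ e.2).biUnion fun e => shiftSet (xorBits e.1 e.2) := by
    intro f hf
    simp only [Finset.mem_filter, simonSet, Finset.mem_univ, true_and, Set.InjOn, not_forall] at hf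
    obtain ⟨⟨s, hs, hf⟩, x, hx, y, hy, hxy, hne⟩ := hf
    refine Finset.mem_biUnion.2 ⟨(x, y), by simp_all, ?_⟩
    simp only [shiftSet, Finset.mem_filter, Finset.mem_univ, true_and]
    rcases (hf x y).1 hxy with h | h
    · exact absurd h.symm hne
    · have : xorBits x y = s := by rw [h]; funext i; simp [xorBits]
      rw [this]; exact hf
  calc _ ≤ (2 ^ n - 1) * ∑ e ∈ (k ×ˢ k).filter (fun e => e.1 ≠ e.2),
          (shiftSet (xorBits e.1 e.2)).card :=
        Nat.mul_le_mul_left _ ((Finset.card_le_card hsub).trans Finset.card_biUnion_le)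
    _ = ∑ e ∈ (k ×ˢ k).filter (fun e => e.1 ≠ e.2), (simonSet n).card := by
        rw [Finset.mul_sum]
        refine Finset.sum_congr rfl fun e he => card_simonSet ?_
        intro h
        apply (Finset.mem_filter.1 he).2
        funext i
        have := congrFun h i
        simpa [xorBits] using this
    _ ≤ _ := by
        rw [Finset.sum_const, smul_eq_mul]
        refine Nat.mul_le_mul_right _ ((Finset.card_filter_le _ _).trans ?_)
        rw [Finset.card_product, sq]

theorem sum_injSet (Φ : (Bits n → Bits n) → ℝ) :
    ∑ f ∈ injSet n, Φ f = ∑ g : Equiv.Perm (Bits n), Φ g := by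
  symm
  refine Finset.sum_bij (fun g _ => (g : Bits n → Bits n)) ?_ ?_ ?_ ?_
  · intro g _; simp [injSet, g.injective]
  · intro g _ g' _ h; exact Equiv.ext fun x => congrFun h x
  · intro f hf
    simp only [injSet, Finset.mem_filter, Finset.mem_univ, true_and] at hf
    exact ⟨Equiv.ofBijective f (Finite.injective_iff_bijective.1 hf), Finset.mem_univ _, rfl⟩
  · intro g _; rfl

/-- The average of a function over a finite set. -/
noncomputable def avg (S : Finset (Bits n → Bits n)) (Φ : (Bits n → Bits n) → ℝ) : ℝ :=
  (∑ f ∈ S, Φ f) / S.card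

/-- What depends only on the values on a small set is almost as likely for a random Simon function
as for a random one-to-one function: on a set without collisions, the values of both are uniformly
random distinct values. -/
theorem avg_simon_ge (hn : 0 < n) (k : Finset (Bits n)) (Φ : (Bits n → Bits n) → ℝ)
    (h0 : ∀ f, 0 ≤ Φ f) (hΦ : ∀ f f', (∀ x ∈ k, f x = f' x) → Φ f = Φ f') :
    (1 - (k.card : ℝ) ^ 2 / (2 ^ n - 1)) * avg (injSet n) Φ ≤ avg (simonSet n) Φ := by
  classical
  set T : ℝ := ∑ g : Equiv.Perm (Bits n), Φ g with hT
  have hT0 : 0 ≤ T := Finset.sum_nonneg fun g _ => h0 _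
  set P : ℝ := ((Fintype.card (Equiv.Perm (Bits n)) : ℕ) : ℝ) with hP
  have hP0 : 0 < P := by simp only [hP]; exact_mod_cast Fintype.card_pos
  have hI : avg (injSet n) Φ = T / P := by
    have hc : ((injSet n).card : ℝ) = P := by
      have := sum_injSet (n := n) fun _ => 1
      simp only [Finset.sum_const, nsmul_eq_mul, mul_one] at this
      rw [this, hP, Finset.card_univ]
    rw [avg, sum_injSet, hc]
  -- Composition with a random permutation `g` of the values does not change the distribution of a
  -- random Simon function `f`; if `f` is one-to-one on `k`, then `g ∘ f` looks on `k` like a random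
  -- one-to-one function.
  have hleft : ∀ g : Equiv.Perm (Bits n), ∑ f ∈ simonSet n, Φ f = ∑ f ∈ simonSet n, Φ (g ∘ f) := by
    intro g
    have hiff : ∀ f : Bits n → Bits n, IsSimon (g ∘ f) ↔ IsSimon f := by
      intro f
      simp only [IsSimon, Function.comp_apply, g.injective.eq_iff]
    symm
    refine Finset.sum_bij (fun f _ => g ∘ f) ?_ ?_ ?_ ?_
    · intro f hf
      simp only [simonSet, Finset.mem_filter, Finset.mem_univ, true_and] at hf ⊢
      exact (hiff f).2 hf
    · intro f _ f' _ h
      funext x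
      exact g.injective (congrFun h x)
    · intro f hf
      simp only [simonSet, Finset.mem_filter, Finset.mem_univ, true_and] at hf
      have he : g ∘ (g.symm ∘ f) = f := by funext x; simp
      refine ⟨g.symm ∘ f, ?_, he⟩
      simp only [simonSet, Finset.mem_filter, Finset.mem_univ, true_and]
      rw [← hiff, he]; exact hf
    · intro f _; rfl
  have hinj : ∀ f : Bits n → Bits n, Set.InjOn f k →
      ∑ g : Equiv.Perm (Bits n), Φ (g ∘ f) = T := by
    intro f hf
    obtain ⟨e, he⟩ := Finset.exists_equiv_extend_of_card_eq (α := Bits n) (β := Bits n)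
      (t := Finset.univ) (by simp) (s := k) (f := f) (Finset.subset_univ _) hf
    let f₀ : Equiv.Perm (Bits n) := Equiv.ofBijective (fun x => (e x : Bits n))
      (Finite.injective_iff_bijective.1 (Subtype.val_injective.comp e.injective))
    have h1 : ∀ g : Equiv.Perm (Bits n), Φ (g ∘ f) = Φ ⇑(g * f₀) := by
      intro g
      apply hΦ
      intro x hx
      simp only [Function.comp_apply, Equiv.Perm.mul_apply]
      rw [← he x hx]; rfl
    rw [Finset.sum_congr rfl fun g _ => h1 g, hT]
    exact Equiv.sum_comp (Equiv.mulRight f₀) (fun g : Equiv.Perm (Bits n) => Φ g)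
  have hsum : P * ∑ f ∈ simonSet n, Φ f ≥
      ((simonSet n).filter fun f => Set.InjOn f k).card * T := by
    have h1 : P * ∑ f ∈ simonSet n, Φ f =
        ∑ f ∈ simonSet n, ∑ g : Equiv.Perm (Bits n), Φ (g ∘ f) := by
      rw [Finset.sum_comm, ← Finset.sum_congr rfl fun g _ => hleft g, Finset.sum_const,
        Finset.card_univ, nsmul_eq_mul]
    rw [h1, ← nsmul_eq_mul, ← Finset.sum_const]
    calc _ = ∑ f ∈ (simonSet n).filter fun f => Set.InjOn f k,
            ∑ g : Equiv.Perm (Bits n), Φ (g ∘ f) :=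
          Finset.sum_congr rfl fun f hf => (hinj f (Finset.mem_filter.1 hf).2).symm
      _ ≤ _ := Finset.sum_le_sum_of_subset_of_nonneg (Finset.filter_subset _ _)
          fun f _ _ => Finset.sum_nonneg fun g _ => h0 _
  have hS0 : (0 : ℝ) < (simonSet n).card := by exact_mod_cast (simonSet_nonempty hn).card_pos
  have h2n : (0 : ℝ) < 2 ^ n - 1 := by
    have : (1 : ℝ) < 2 ^ n := one_lt_pow₀ one_lt_two hn.ne'
    linarith
  have hcount : (1 - (k.card : ℝ) ^ 2 / (2 ^ n - 1)) * (simonSet n).card ≤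
      ((simonSet n).filter fun f => Set.InjOn f k).card := by
    have h1 := card_simon_not_injOn_le k
    have h2 : ((2 : ℝ) ^ n - 1) * ((simonSet n).filter fun f => ¬ Set.InjOn f k).card ≤
        (k.card : ℝ) ^ 2 * (simonSet n).card := by
      have : ((2 ^ n - 1 : ℕ) : ℝ) = 2 ^ n - 1 := by
        rw [Nat.cast_sub Nat.one_le_two_pow]; simp
      rw [← this]
      exact_mod_cast h1
    have h3 := Finset.card_filter_add_card_filter_not (s := simonSet n)
      (fun f => Set.InjOn f (k : Set (Bits n)))
    have h4 : (((simonSet n).filter fun f => Set.InjOn f k).card : ℝ) +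
        ((simonSet n).filter fun f => ¬ Set.InjOn f k).card = (simonSet n).card := by
      exact_mod_cast h3
    have h5 : (((simonSet n).filter fun f => ¬ Set.InjOn f k).card : ℝ) ≤
        (k.card : ℝ) ^ 2 / (2 ^ n - 1) * (simonSet n).card := by
      rw [div_mul_eq_mul_div, le_div_iff₀ h2n]; linarith
    linarith
  rw [hI, avg, le_div_iff₀ hS0]
  have h6 := mul_le_mul_of_nonneg_right hcount hT0
  have h7 : ∑ f ∈ simonSet n, Φ f ≥ ((simonSet n).filter fun f => Set.InjOn f k).card * T / P := by
    rw [ge_iff_le, div_le_iff₀ hP0]; linarith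
  calc _ = (1 - (k.card : ℝ) ^ 2 / (2 ^ n - 1)) * (simonSet n).card * T / P := by ring
    _ ≤ _ := by
        refine le_trans ?_ h7
        exact div_le_div_of_nonneg_right h6 hP0.le

open Classical in
/-- The prior of the problem: with probability `1 / 2` each, a uniformly random Simon function or a
uniformly random one-to-one function. -/
noncomputable def prior (f : Bits n → Bits n) : ℝ :=
  1 / 2 * (if IsSimon f then ((simonSet n).card : ℝ)⁻¹ else 0) +
    1 / 2 * (if Function.Injective f then ((injSet n).card : ℝ)⁻¹ else 0)

theorem prior_nonneg (f : Bits n → Bits n) : 0 ≤ prior f := by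
  unfold prior; positivity

theorem sum_prior_mul (Φ : (Bits n → Bits n) → ℝ) :
    ∑ f, prior f * Φ f = 1 / 2 * avg (simonSet n) Φ + 1 / 2 * avg (injSet n) Φ := by
  classical
  unfold prior avg simonSet injSet
  simp only [add_mul, Finset.sum_add_distrib, Finset.sum_filter, div_eq_mul_inv, Finset.sum_mul,
    Finset.mul_sum]
  congr 1 <;> refine Finset.sum_congr rfl fun f _ => ?_ <;> split_ifs <;> ring

theorem sum_prior (hn : 0 < n) : ∑ f : Bits n → Bits n, prior f = 1 := by
  have h := sum_prior_mul (n := n) fun _ => 1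
  simp only [mul_one] at h
  rw [h, avg, avg, Finset.sum_const, Finset.sum_const, nsmul_eq_mul, nsmul_eq_mul, mul_one, mul_one,
    div_self, div_self]
  · norm_num
  · exact_mod_cast injSet_nonempty.card_pos.ne'
  · exact_mod_cast (simonSet_nonempty hn).card_pos.ne'

open Classical in
/-- A process that learns at most `c` values of a random function from the prior, and rejects with
probability `∑ i, Φ i f`, is correct with probability little more than `1 / 2`. -/
theorem sum_prior_success_le (hn : 0 < n) {ι : Type*} [Fintype ι] (k : ι → Finset (Bits n)) (c : ℕ)
    (hk : ∀ i, (k i).card ≤ c) (Φ : ι → (Bits n → Bits n) → ℝ) (h0 : ∀ i f, 0 ≤ Φ i f)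
    (hΦ : ∀ i f f', (∀ x ∈ k i, f x = f' x) → Φ i f = Φ i f') (X : (Bits n → Bits n) → ℝ)
    (hX0 : ∀ f, 0 ≤ X f) (hX : ∀ f, X f + ∑ i, Φ i f ≤ 1) :
    ∑ f, prior f * (if IsSimon f then X f else ∑ i, Φ i f) ≤
      1 / 2 + (c : ℝ) ^ 2 / (2 ^ n - 1) := by
  have h2n : (0 : ℝ) < 2 ^ n - 1 := by
    have : (1 : ℝ) < 2 ^ n := one_lt_pow₀ one_lt_two hn.ne'
    linarith
  set δ : ℝ := (c : ℝ) ^ 2 / (2 ^ n - 1) with hδ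
  have hδ0 : 0 ≤ δ := by positivity
  have hS0 : (0 : ℝ) < (simonSet n).card := by exact_mod_cast (simonSet_nonempty hn).card_pos
  have hI0 : (0 : ℝ) < (injSet n).card := by exact_mod_cast (injSet_nonempty (n := n)).card_pos
  rw [sum_prior_mul]
  have h1 : avg (simonSet n) (fun f => if IsSimon f then X f else ∑ i, Φ i f) ≤
      1 - avg (simonSet n) fun f => ∑ i, Φ i f := by
    unfold avg
    rw [le_sub_iff_add_le, ← add_div, div_le_one hS0, ← Finset.sum_add_distrib]
    calc _ ≤ ∑ f ∈ simonSet n, (1 : ℝ) := by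
          refine Finset.sum_le_sum fun f hf => ?_
          simp only [simonSet, Finset.mem_filter, Finset.mem_univ, true_and] at hf
          rw [if_pos hf]; exact hX f
      _ = _ := by simp
  have h2 : avg (injSet n) (fun f => if IsSimon f then X f else ∑ i, Φ i f) =
      avg (injSet n) fun f => ∑ i, Φ i f := by
    unfold avg
    congr 1
    refine Finset.sum_congr rfl fun f hf => ?_
    simp only [injSet, Finset.mem_filter, Finset.mem_univ, true_and] at hf
    exact if_neg fun h => h.not_injective hf
  have hsum : ∀ S : Finset (Bits n → Bits n),
      avg S (fun f => ∑ i, Φ i f) = ∑ i, avg S (Φ i) := by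
    intro S
    unfold avg
    rw [Finset.sum_comm, Finset.sum_div]
  have h3 : (1 - δ) * avg (injSet n) (fun f => ∑ i, Φ i f) ≤
      avg (simonSet n) fun f => ∑ i, Φ i f := by
    rw [hsum, hsum, Finset.mul_sum]
    refine Finset.sum_le_sum fun i _ => le_trans ?_ (avg_simon_ge hn (k i) (Φ i) (h0 i) (hΦ i))
    refine mul_le_mul_of_nonneg_right ?_ (div_nonneg (Finset.sum_nonneg fun f _ => h0 i f) hI0.le)
    have : ((k i).card : ℝ) ≤ c := by exact_mod_cast hk i
    rw [hδ]
    gcongr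
  have h4 : avg (injSet n) (fun f => ∑ i, Φ i f) ≤ 1 := by
    unfold avg
    rw [div_le_one hI0]
    calc _ ≤ ∑ f ∈ injSet n, (1 : ℝ) := by
          refine Finset.sum_le_sum fun f hf => ?_
          linarith [hX f, hX0 f]
      _ = _ := by simp
  have h5 : 0 ≤ avg (injSet n) fun f => ∑ i, Φ i f := div_nonneg
    (Finset.sum_nonneg fun f _ => Finset.sum_nonneg fun i _ => h0 i f) hI0.le
  rw [h2]
  nlinarith

end simon

/-! ### The prior on the hidden data and capped processes -/

section prior
variable {d n : ℕ} {Salt : Type} [Fintype Salt] [DecidableEq Salt]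

/-- The prior for the functions of all salts, which are independent. -/
noncomputable def priorAll (f : Salt → Bits n → Bits n) : ℝ := ∏ a, prior (f a)

theorem priorAll_nonneg (f : Salt → Bits n → Bits n) : 0 ≤ priorAll f :=
  Finset.prod_nonneg fun a _ => prior_nonneg (f a)

theorem priorAll_update (f : Salt → Bits n → Bits n) (a : Salt) (g : Bits n → Bits n) :
    priorAll (Function.update f a g) * prior (f a) = priorAll f * prior g := by
  unfold priorAll
  rw [← Finset.mul_prod_erase Finset.univ _ (Finset.mem_univ a),
    ← Finset.mul_prod_erase Finset.univ (fun a => prior (f a)) (Finset.mem_univ a)]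
  rw [Finset.prod_congr rfl (g := fun b => prior (f b)) fun b hb => by
    rw [Function.update_of_ne (Finset.ne_of_mem_erase hb)]]
  rw [Function.update_self]
  ring

/-- Resampling the function of one salt does not change the distribution. -/
theorem sum_priorAll_resample (hn : 0 < n) (a : Salt) (H : (Salt → Bits n → Bits n) → ℝ) :
    ∑ f, priorAll f * ∑ g, prior g * H (Function.update f a g) = ∑ f, priorAll f * H f := by
  have hinv : Function.Involutive
      (fun x : (Salt → Bits n → Bits n) × (Bits n → Bits n) =>
        (Function.update x.1 a x.2, x.1 a)) := by
    rintro ⟨f, g⟩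
    simp
  calc _ = ∑ x : (Salt → Bits n → Bits n) × (Bits n → Bits n),
          priorAll x.1 * prior x.2 * H (Function.update x.1 a x.2) := by
        rw [Fintype.sum_prod_type]
        refine Finset.sum_congr rfl fun f _ => ?_
        rw [Finset.mul_sum]
        exact Finset.sum_congr rfl fun g _ => by ring
    _ = ∑ x : (Salt → Bits n → Bits n) × (Bits n → Bits n), priorAll x.1 * prior x.2 * H x.1 := by
        rw [← Equiv.sum_comp hinv.toPerm]
        refine Finset.sum_congr rfl fun x _ => ?_
        simp only [Function.Involutive.coe_toPerm, Function.update_idem, Function.update_eq_self]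
        rw [priorAll_update]
    _ = _ := by
        rw [Fintype.sum_prod_type]
        refine Finset.sum_congr rfl fun f _ => ?_
        rw [Finset.sum_congr rfl fun g _ => show priorAll f * prior g * H f =
          priorAll f * H f * prior g by ring, ← Finset.mul_sum, sum_prior hn, mul_one]

theorem sum_priorAll (hn : 0 < n) : ∑ f : Salt → Bits n → Bits n, priorAll f = 1 := by
  unfold priorAll
  have h := (Finset.prod_univ_sum (fun _ : Salt => (Finset.univ : Finset (Bits n → Bits n)))
    (fun _ f => prior f)).symm
  rw [Fintype.piFinset_univ] at h
  rw [h]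
  simp [sum_prior hn]

/-- The distribution of the hidden data: the permutations are uniformly random. -/
noncomputable def hiddenPrior (ω : Hidden d n Salt) : ℝ :=
  (Fintype.card (Salt → Fin d → Equiv.Perm (Big d n)) : ℝ)⁻¹ * priorAll ω.2

theorem hiddenPrior_nonneg (ω : Hidden d n Salt) : 0 ≤ hiddenPrior ω :=
  mul_nonneg (by positivity) (priorAll_nonneg _)

theorem sum_hiddenPrior_mul (H : Hidden d n Salt → ℝ) :
    ∑ ω, hiddenPrior ω * H ω = (Fintype.card (Salt → Fin d → Equiv.Perm (Big d n)) : ℝ)⁻¹ *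
      ∑ p, ∑ f, priorAll f * H (p, f) := by
  rw [Fintype.sum_prod_type, Finset.mul_sum]
  refine Finset.sum_congr rfl fun p _ => ?_
  rw [Finset.mul_sum]
  exact Finset.sum_congr rfl fun f _ => by simp [hiddenPrior, mul_assoc]

theorem sum_hiddenPrior (hn : 0 < n) : ∑ ω : Hidden d n Salt, hiddenPrior ω = 1 := by
  have h := sum_hiddenPrior_mul (d := d) (n := n) (Salt := Salt) fun _ => 1
  simp only [mul_one] at h
  rw [h, Finset.sum_congr rfl fun p _ => sum_priorAll hn]
  simp

/-- A bound that holds for all permutations holds on average. -/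
theorem sum_hiddenPrior_mul_le {H : Hidden d n Salt → ℝ} {c : ℝ}
    (h : ∀ p, ∑ f, priorAll f * H (p, f) ≤ c) : ∑ ω, hiddenPrior ω * H ω ≤ c := by
  rw [sum_hiddenPrior_mul]
  have h0 : (0 : ℝ) < Fintype.card (Salt → Fin d → Equiv.Perm (Big d n)) := by
    exact_mod_cast Fintype.card_pos
  rw [inv_mul_le_iff₀ h0]
  refine (Finset.sum_le_sum fun p _ => h p).trans (le_of_eq ?_)
  rw [Finset.sum_const, Finset.card_univ, nsmul_eq_mul]

open Classical in
/-- The probability of a correct answer about the salt `a`, given the probability `x` of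
acceptance. -/
noncomputable def correct (f : Salt → Bits n → Bits n) (a : Salt) (x : ℝ) : ℝ :=
  if IsSimon (f a) then x else 1 - x

/-- A decision process that reveals at most `c` values of the hidden functions: `acc k` and `rej k`
are the probabilities to reveal the arguments `k` and to accept or to reject. -/
structure IsCapped (c : ℕ) (acc rej : Finset (Salt × Bits n) → Hidden d n Salt → ℝ) : Prop where
  acc_nonneg : ∀ k ω, 0 ≤ acc k ω
  rej_nonneg : ∀ k ω, 0 ≤ rej k ω
  sum_le : ∀ ω, ∑ k, acc k ω + ∑ k, rej k ω ≤ 1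
  acc_locality : ∀ k p f f', (∀ e ∈ k, f e.1 e.2 = f' e.1 e.2) → acc k (p, f) = acc k (p, f')
  rej_locality : ∀ k p f f', (∀ e ∈ k, f e.1 e.2 = f' e.1 e.2) → rej k (p, f) = rej k (p, f')
  card_le : ∀ k, c < k.card → ∀ ω, acc k ω = 0 ∧ rej k ω = 0

open Classical in
/-- The probability that a capped process is correct about the salt `a`. -/
noncomputable def cappedCorrect (acc rej : Finset (Salt × Bits n) → Hidden d n Salt → ℝ) (a : Salt)
    (ω : Hidden d n Salt) : ℝ :=
  if IsSimon (ω.2 a) then ∑ k, acc k ω else ∑ k, rej k ω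

/-- Every run of a scheme is close to a capped process. -/
theorem exists_capped {S : OracleSig} (Fr : OracleFrame S d n Salt) {M : ℕ} (out : Fin M)
    (hn : 0 < n) (hS : Fintype.card Salt ≤ 2 ^ n) {u : Hidden d n Salt → ℝ}
    (hu : ∀ ω, 0 ≤ u ω ∧ u ω ≤ 1) {θ η q : ℝ} (hθ : 8 / 2 ^ n ≤ θ)
    (hη : 0 < η) (hq : 0 < q) (hq1 : q ≤ 1) {s : ℕ} (l : List (Step S d M))
    (hl : ∀ t ∈ l, t.size ≤ s) (m₀ : Fin M → Bool) (a : Salt) (c : ℕ) :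
    ∃ acc rej : Finset (Salt × Bits n) → Hidden d n Salt → ℝ, IsCapped c acc rej ∧
      ∑ ω, hiddenPrior ω * u ω *
        correct ω.2 a (acceptFrom (Fr.oracle ω.answer) out l m₀) ≤
      ∑ ω, hiddenPrior ω * u ω * cappedCorrect acc rej a ω +
        (l.length * (stepError d s θ η * ∑ ω, hiddenPrior ω * u ω) +
        l.length * (∑ ω, hiddenPrior ω * u ω + knownConst d d *
          (Real.log (1 / q) * ∑ ω, hiddenPrior ω * u ω + q * 2 ^ M)) / (c + 1)) := by
  classical
  let L₀ : (Fin M → Bool) → Finset (Salt × Bits n) → Hidden d n Salt → ℝ :=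
    fun m k _ => if m = m₀ then if k = ∅ then 1 else 0 else 0
  have hL₀ : IsLaw L₀ :=
    ⟨fun m k ω => by simp only [L₀]; split_ifs <;> simp, fun ω => by
      simp only [L₀]
      rw [Finset.sum_eq_single m₀ (fun m _ hm => by simp [hm]) (by simp)]
      simp, fun m k p f f' _ => rfl⟩
  obtain ⟨L, hL, h1, h2⟩ := exists_ideal_law Fr out hS hiddenPrior_nonneg (fun _ _ _ => rfl)
    (sum_hiddenPrior hn) hu hθ hη hq hq1 l hl L₀ hL₀
  have hL₀sum : ∀ ω (g : (Fin M → Bool) → Finset (Salt × Bits n) → ℝ),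
      ∑ m, ∑ k, L₀ m k ω * g m k = g m₀ ∅ := by
    intro ω g
    rw [Finset.sum_eq_single m₀ (fun m _ hm => by simp [L₀, hm]) (by simp),
      Finset.sum_eq_single ∅ (fun k _ hk => by simp [L₀, hk]) (by simp)]
    simp [L₀]
  simp only [hL₀sum, Finset.card_empty, Nat.cast_zero, mul_zero, Finset.sum_const_zero,
    zero_add] at h1 h2
  -- The ideal process, which gives no answer if it has revealed more than `c` values.
  let P : Bool → Finset (Salt × Bits n) → Hidden d n Salt → ℝ := fun b k ω =>
    if k.card ≤ c then ∑ m, if m out = b then L m k ω else 0 else 0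
  have hP0 : ∀ b k ω, 0 ≤ P b k ω := by
    intro b k ω
    simp only [P]
    split_ifs
    · exact Finset.sum_nonneg fun m _ => by
        split_ifs
        · exact hL.nonneg _ _ _
        · exact le_rfl
    · exact le_rfl
  have hPl : ∀ b k p f f', (∀ e ∈ k, f e.1 e.2 = f' e.1 e.2) → P b k (p, f) = P b k (p, f') := by
    intro b k p f f' h
    simp only [P, hL.locality _ k p f f' h]
  have htot : ∀ ω, ∑ k, P true k ω + ∑ k, P false k ω =
      ∑ k, if k.card ≤ c then ∑ m, L m k ω else 0 := by
    intro ω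
    rw [← Finset.sum_add_distrib]
    refine Finset.sum_congr rfl fun k _ => ?_
    simp only [P]
    split_ifs
    · rw [← Finset.sum_add_distrib]
      refine Finset.sum_congr rfl fun m _ => ?_
      cases m out <;> simp
    · simp
  have hsum1 : ∀ ω, ∑ k, ∑ m, L m k ω = 1 := fun ω => by rw [Finset.sum_comm, hL.sum_eq]
  refine ⟨P true, P false, ⟨hP0 true, hP0 false, ?_, hPl true, hPl false, ?_⟩, ?_⟩
  · intro ω
    rw [htot, ← hsum1 ω]
    refine Finset.sum_le_sum fun k _ => ?_
    split_ifs
    · exact le_rfl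
    · exact Finset.sum_nonneg fun m _ => hL.nonneg _ _ _
  · intro k hk ω
    simp only [P, if_neg (not_le.2 hk), and_self]
  · have hc0 : (0 : ℝ) < c + 1 := by positivity
    -- Acceptance and rejection of the ideal process, without the cap.
    have hcap : ∀ ω b, ∑ m, ∑ k, L m k ω * (if m out = b then 1 else 0) ≤
        ∑ k, P b k ω + (∑ m, ∑ k, L m k ω * (k.card : ℝ)) / (c + 1) := by
      intro ω b
      rw [Finset.sum_comm, Finset.sum_comm (f := fun m k => L m k ω * (k.card : ℝ)),
        Finset.sum_div, ← Finset.sum_add_distrib]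
      refine Finset.sum_le_sum fun k _ => ?_
      simp only [P]
      split_ifs with hk
      · have h0 : 0 ≤ (∑ m, L m k ω * (k.card : ℝ)) / (c + 1) := div_nonneg
          (Finset.sum_nonneg fun m _ => mul_nonneg (hL.nonneg _ _ _) (Nat.cast_nonneg _)) hc0.le
        simp only [mul_ite, mul_one, mul_zero]
        linarith
      · rw [zero_add, le_div_iff₀ hc0, Finset.sum_mul]
        refine Finset.sum_le_sum fun m _ => ?_
        have h3 : (c + 1 : ℝ) ≤ k.card := by exact_mod_cast not_le.1 hk
        rw [mul_assoc]
        refine mul_le_mul_of_nonneg_left ?_ (hL.nonneg _ _ _)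
        split_ifs
        · linarith
        · simp
    have hone : ∀ ω, ∑ m, ∑ k, L m k ω * (if m out = true then (1 : ℝ) else 0) +
        ∑ m, ∑ k, L m k ω * (if m out = false then (1 : ℝ) else 0) = 1 := by
      intro ω
      refine Eq.trans ?_ (hL.sum_eq ω)
      rw [← Finset.sum_add_distrib]
      refine Finset.sum_congr rfl fun m _ => ?_
      rw [← Finset.sum_add_distrib]
      refine Finset.sum_congr rfl fun k _ => ?_
      cases m out <;> simp
    have hpt : ∀ ω, correct ω.2 a (acceptFrom (Fr.oracle ω.answer) out l m₀) ≤
        cappedCorrect (P true) (P false) a ω +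
        (|acceptFrom (Fr.oracle ω.answer) out l m₀ -
          ∑ m, ∑ k, L m k ω * (if m out = true then 1 else 0)| +
        (∑ m, ∑ k, L m k ω * (k.card : ℝ)) / (c + 1)) := by
      intro ω
      unfold correct cappedCorrect
      have ht := hcap ω true
      have hf := hcap ω false
      have h3 := hone ω
      have h4 := le_abs_self (acceptFrom (Fr.oracle ω.answer) out l m₀ -
          ∑ m, ∑ k, L m k ω * (if m out = true then 1 else 0))
      have h5 := neg_abs_le (acceptFrom (Fr.oracle ω.answer) out l m₀ -
          ∑ m, ∑ k, L m k ω * (if m out = true then 1 else 0))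
      split_ifs <;> linarith
    calc _ ≤ ∑ ω, (hiddenPrior ω * u ω * cappedCorrect (P true) (P false) a ω +
          (hiddenPrior ω * u ω * |acceptFrom (Fr.oracle ω.answer) out l m₀ -
            ∑ m, ∑ k, L m k ω * (if m out = true then 1 else 0)| +
          hiddenPrior ω * u ω * (∑ m, ∑ k, L m k ω * (k.card : ℝ)) / (c + 1))) := by
          refine Finset.sum_le_sum fun ω _ => ?_
          refine (mul_le_mul_of_nonneg_left (hpt ω)
            (mul_nonneg (hiddenPrior_nonneg ω) (hu ω).1)).trans (le_of_eq ?_)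
          ring
      _ ≤ _ := by
          rw [Finset.sum_add_distrib, Finset.sum_add_distrib, ← Finset.sum_div]
          gcongr

/-- A capped process is not much better than guessing about a salt that is independent of what is
already known. -/
theorem sum_cappedCorrect_le (hn : 0 < n) {c : ℕ}
    {acc rej : Finset (Salt × Bits n) → Hidden d n Salt → ℝ} (h : IsCapped c acc rej) (a : Salt)
    (p : Salt → Fin d → Equiv.Perm (Big d n)) (G : (Salt → Bits n → Bits n) → ℝ)
    (hG0 : ∀ f, 0 ≤ G f) (hG : ∀ f g, G (Function.update f a g) = G f) :
    ∑ f, priorAll f * (G f * cappedCorrect acc rej a (p, f)) ≤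
      (1 / 2 + (c : ℝ) ^ 2 / (2 ^ n - 1)) * ∑ f, priorAll f * G f := by
  classical
  rw [← sum_priorAll_resample hn a, Finset.mul_sum]
  refine Finset.sum_le_sum fun f _ => ?_
  rw [mul_left_comm]
  refine mul_le_mul_of_nonneg_left ?_ (priorAll_nonneg f)
  simp only [hG]
  have h1 := sum_prior_success_le hn (ι := {k : Finset (Salt × Bits n) // k.card ≤ c})
    (fun k => Finset.univ.filter fun x => (a, x) ∈ k.1) c
    (fun k => by
      refine le_trans (Finset.card_le_card_of_injOn (fun x => (a, x)) ?_ ?_) k.2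
      · intro x hx
        exact (Finset.mem_filter.1 (Finset.mem_coe.1 hx)).2
      · intro x _ y _ hxy
        exact (Prod.mk.inj hxy).2)
    (fun k g => rej k.1 (p, Function.update f a g)) (fun k g => h.rej_nonneg _ _)
    (fun k g g' hgg => by
      apply h.rej_locality
      rintro ⟨b, x⟩ hx
      by_cases hb : b = a
      · subst hb
        simp only [Function.update_self]
        exact hgg x (by simpa using hx)
      · simp [hb])
    (fun g => ∑ k, acc k (p, Function.update f a g))
    (fun g => Finset.sum_nonneg fun k _ => h.acc_nonneg _ _)
  have h2 : ∀ ω, ∑ k : {k : Finset (Salt × Bits n) // k.card ≤ c}, rej k.1 ω = ∑ k, rej k ω := by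
    intro ω
    rw [← Fintype.sum_subtype_add_sum_subtype
      (fun k : Finset (Salt × Bits n) => k.card ≤ c) (fun k => rej k ω)]
    rw [Fintype.sum_eq_zero (fun k : {k : Finset (Salt × Bits n) // ¬ k.card ≤ c} => rej k.1 ω)
      fun k => (h.card_le k.1 (not_le.1 k.2) ω).2, add_zero]
  simp only [h2] at h1
  have h3 := h1 fun g => h.sum_le _
  calc _ = G f * ∑ g, prior g * (if IsSimon g then ∑ k, acc k (p, Function.update f a g)
          else ∑ k, rej k (p, Function.update f a g)) := by
        rw [Finset.mul_sum]
        refine Finset.sum_congr rfl fun g _ => ?_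
        simp only [cappedCorrect, Function.update_self]
        ring
    _ ≤ G f * (1 / 2 + (c : ℝ) ^ 2 / (2 ^ n - 1)) := mul_le_mul_of_nonneg_left h3 (hG0 f)
    _ = _ := mul_comm _ _

end prior

/-! ### Shufflings and their prefix compositions -/

/-- The shuffling whose prefix compositions are `p`. -/
def toShuffle {d n : ℕ} (p : Fin d → Equiv.Perm (Big d n)) : Shuffle d n := fun j =>
  (prefixPerm p j).symm.trans (prefixPerm p (j + 1))

theorem prefixPerm_succ_eq_trans {d n : ℕ} (p : Fin d → Equiv.Perm (Big d n)) (j : Fin d) :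
    prefixPerm p (j + 1) = (prefixPerm p j).trans (toShuffle p j) := by
  ext x
  simp [toShuffle]

/-- Uniformly random shufflings are the same as uniformly random prefix compositions. -/
theorem toShuffle_bijective (d n : ℕ) : Function.Bijective (toShuffle (d := d) (n := n)) := by
  refine Finite.injective_iff_bijective.1 fun p p' h => ?_
  have key : ∀ i, i ≤ d → prefixPerm p i = prefixPerm p' i := by
    intro i
    induction i with
    | zero => intro _; rfl
    | succ i ih =>
      intro hi
      rw [prefixPerm_succ_eq_trans p ⟨i, hi⟩, prefixPerm_succ_eq_trans p' ⟨i, hi⟩, h]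
      simp only [ih (Nat.le_of_succ_le hi)]
  funext j
  rw [← prefixPerm_succ p, ← prefixPerm_succ p', key _ j.2]

theorem foldl_trans_ofFn {α : Type*} : ∀ {m : ℕ} (F : Fin m → Equiv.Perm α)
    (P : ℕ → Equiv.Perm α), (∀ j : Fin m, P (j + 1) = (P j).trans (F j)) →
    (List.ofFn F).foldl (fun e g => e.trans g) (P 0) = P m
  | 0, _, _, _ => by simp
  | m + 1, F, P, h => by
    rw [List.ofFn_succ, List.foldl_cons]
    have h0 := h 0
    simp only [Fin.val_zero, zero_add] at h0
    rw [← h0]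
    exact foldl_trans_ofFn (fun i => F i.succ) (fun i => P (i + 1)) fun j => by
      simpa using h j.succ

theorem toShuffle_comp {d n : ℕ} (p : Fin d → Equiv.Perm (Big d n)) :
    Shuffle.comp (toShuffle p) = prefixPerm p d :=
  foldl_trans_ofFn (toShuffle p) (prefixPerm p) (prefixPerm_succ_eq_trans p)

/-- The answers of the shuffling oracle with prefix compositions `ω.1 a` are those of the hidden
data `ω`. -/
theorem shuffling_toShuffle {d n : ℕ} {Salt : Type} (ω : Hidden d n Salt) (a : Salt)
    (j : Fin (d + 1)) (y : Big d n) :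
    shuffling (ω.2 a) (toShuffle (ω.1 a)) j y = ω.answer a j y := by
  unfold shuffling Hidden.answer
  split_ifs with h1 h2
  · simp [toShuffle]
  · have hj : (j : ℕ) = d := by omega
    rw [hj] at h2 ⊢
    rw [lastFn, toShuffle_comp, if_pos h2]
  · have hj : (j : ℕ) = d := by omega
    rw [hj] at h2
    rw [lastFn, toShuffle_comp, if_neg h2]

/-! ### Explicit parameters -/

/-- The polynomial in the size `s` and the length `P` of the advice that bounds the error of the
ideal process. -/
noncomputable def errorPoly (d s P : ℕ) : ℝ :=
  s * (16 * s + 2 * d + 1 + knownConst d d * (s + P + 1))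

theorem one_le_size {S : OracleSig} {d M : ℕ} (t : Step S d M) : 1 ≤ t.size := by
  cases t <;> simp only [Step.size] <;> omega

theorem Scheme.size_le {S : OracleSig} {d s : ℕ} {A : Scheme S d} (h : A.size ≤ s) :
    A.M ≤ s ∧ A.steps.length ≤ s ∧ ∀ t ∈ A.steps, t.size ≤ s := by
  unfold Scheme.size at h
  refine ⟨by omega, ?_, fun t ht => ?_⟩
  · have h1 := List.card_nsmul_le_sum (A.steps.map Step.size) 1 (by
      intro x hx
      obtain ⟨t, _, rfl⟩ := List.mem_map.1 hx
      exact one_le_size t)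
    simp only [List.length_map, smul_eq_mul, mul_one] at h1
    omega
  · have := List.single_le_sum (l := A.steps.map Step.size) (fun _ _ => Nat.zero_le _) _
      (List.mem_map_of_mem ht)
    omega

/-- Every run of a scheme is close to a process that reveals at most `2 ^ (n / 8)` values. -/
theorem Scheme.exists_capped {d n : ℕ} {Salt : Type} [Fintype Salt] [DecidableEq Salt]
    {S : OracleSig} (Fr : OracleFrame S d n Salt) (hn : 0 < n) (hS : Fintype.card Salt ≤ 2 ^ n)
    {u : Hidden d n Salt → ℝ} (hu : ∀ ω, 0 ≤ u ω ∧ u ω ≤ 1) {s : ℕ} {A : Scheme S d}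
    (hA : A.size ≤ s) (P : ℕ) (m₀ : Fin A.M → Bool) (a : Salt) :
    ∃ acc rej : Finset (Salt × Bits n) → Hidden d n Salt → ℝ, IsCapped (2 ^ (n / 8)) acc rej ∧
      ∑ ω, hiddenPrior ω * u ω *
        correct ω.2 a (acceptFrom (Fr.oracle ω.answer) A.out A.steps m₀) ≤
      ∑ ω, hiddenPrior ω * u ω * cappedCorrect acc rej a ω +
        errorPoly d s P / 2 ^ (n / 8) * (∑ ω, hiddenPrior ω * u ω + 1 / 2 ^ P) := by
  obtain ⟨hM, hl, hsz⟩ := Scheme.size_le hA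
  set t := n / 8 with ht
  have h8 : 8 * t ≤ n := Nat.mul_div_le n 8
  set U := ∑ ω, hiddenPrior ω * u ω with hU
  have hU0 : 0 ≤ U := Finset.sum_nonneg fun ω _ => mul_nonneg (hiddenPrior_nonneg ω) (hu ω).1
  -- The parameters, with `t = n / 8`: heavy positions have probability more than `θ = 8 / 4 ^ t`,
  -- the cap is `2 ^ t`, and `q = 2 ^ (- s - P)` makes up for the `2 ^ s` memory contents and for
  -- the density of the advice.
  obtain ⟨acc, rej, hcap, h⟩ := _root_.exists_capped Fr A.out hn hS hu (θ := 8 / 2 ^ (2 * t))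
    (η := 1 / 2 ^ t) (q := 1 / 2 ^ (s + P))
    (div_le_div_of_nonneg_left (by norm_num) (by positivity)
      (pow_le_pow_right₀ (by norm_num) (by omega)))
    (by positivity) (by positivity)
    (div_le_one_of_le₀ (one_le_pow₀ (by norm_num)) (by positivity)) A.steps hsz m₀ a (2 ^ t)
  refine ⟨acc, rej, hcap, h.trans (add_le_add_right ?_ _)⟩
  have hC := knownConst_nonneg d d
  set C := knownConst d d
  have hT : (0 : ℝ) < 2 ^ t := by positivity
  have hlen : (A.steps.length : ℝ) ≤ s := by exact_mod_cast hl
  have hP0 : (0 : ℝ) < 1 / 2 ^ P := by positivity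
  have e1 : stepError d s (8 / 2 ^ (2 * t)) (1 / 2 ^ t) = (16 * s + 2 * d) / 2 ^ t := by
    unfold stepError
    rw [two_mul t, pow_add]
    field_simp
    ring
  have e2 : Real.log (1 / (1 / 2 ^ (s + P))) ≤ s + P := by
    rw [one_div_one_div, Real.log_pow]
    have := Real.log_two_lt_d9
    have h0 : 0 < Real.log 2 := Real.log_pos (by norm_num)
    push_cast
    calc ((s : ℝ) + P) * Real.log 2 ≤ (s + P) * 1 := by gcongr; linarith
      _ = _ := mul_one _
  have e3 : 1 / (2 : ℝ) ^ (s + P) * 2 ^ A.M ≤ 1 / 2 ^ P := by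
    rw [pow_add, div_mul_eq_mul_div, one_mul, div_le_div_iff₀ (by positivity) (by positivity),
      one_mul]
    exact mul_le_mul_of_nonneg_right (pow_le_pow_right₀ (by norm_num) hM) (by positivity)
  calc _ ≤ (s : ℝ) * ((16 * s + 2 * d) / 2 ^ t * U) +
        s * (U + C * ((s + P) * U + 1 / 2 ^ P)) / 2 ^ t := by
        rw [e1]
        have h2 : (A.steps.length : ℝ) * (U + C * (Real.log (1 / (1 / 2 ^ (s + P))) * U +
            1 / 2 ^ (s + P) * 2 ^ A.M)) ≤ s * (U + C * ((s + P) * U + 1 / 2 ^ P)) := by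
          have h3 : C * (Real.log (1 / (1 / 2 ^ (s + P))) * U + 1 / 2 ^ (s + P) * 2 ^ A.M) ≤
              C * ((s + P) * U + 1 / 2 ^ P) := by gcongr
          refine (mul_le_mul_of_nonneg_left (add_le_add_right h3 U) (Nat.cast_nonneg _)).trans
            (mul_le_mul_of_nonneg_right hlen (by positivity))
        refine add_le_add (mul_le_mul_of_nonneg_right hlen (by positivity)) ?_
        refine (div_le_div_of_nonneg_right h2 (by positivity)).trans ?_
        refine div_le_div_of_nonneg_left (by positivity) hT ?_
        push_cast
        linarith
    _ = (s * (16 * s + 2 * d + 1) * U + s * C * ((s + P) * U + 1 / 2 ^ P)) / 2 ^ t := by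
        field_simp
        ring
    _ ≤ _ := by
        rw [div_mul_eq_mul_div]
        refine div_le_div_of_nonneg_right ?_ hT.le
        unfold errorPoly
        have h3 : 0 ≤ (s : ℝ) * (16 * s + 2 * d + 1) * (1 / 2 ^ P) := by positivity
        have h4 : 0 ≤ (s : ℝ) * C * U := by positivity
        have h5 : 0 ≤ (s : ℝ) * C * (s + P) * (1 / 2 ^ P) := by positivity
        nlinarith

/-- The advantage of a process that reveals at most `2 ^ (n / 8)` values. -/
theorem cap_advantage_le {n : ℕ} (hn : 0 < n) :
    (((2 ^ (n / 8) : ℕ) : ℝ)) ^ 2 / (2 ^ n - 1) ≤ 1 / 2 ^ (n / 8) := by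
  set t := n / 8 with ht
  have h8 : 8 * t ≤ n := Nat.mul_div_le n 8
  have h1 : (1 : ℝ) < 2 ^ n := one_lt_pow₀ (by norm_num) hn.ne'
  have hT : (1 : ℝ) ≤ 2 ^ t := one_le_pow₀ (by norm_num)
  rw [div_le_div_iff₀ (by linarith) (by positivity), one_mul]
  push_cast
  rcases Nat.eq_zero_or_pos t with h0 | h0
  · rw [h0]
    have : (2 : ℝ) ^ 1 ≤ 2 ^ n := pow_le_pow_right₀ (by norm_num) hn
    norm_num at this ⊢
    linarith
  · have h2 : (2 : ℝ) ^ (3 * t + 1) ≤ 2 ^ n := pow_le_pow_right₀ (by norm_num) (by omega)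
    have h3 : ((2 : ℝ) ^ t) ^ 2 * 2 ^ t = 2 ^ (3 * t) := by
      rw [← pow_mul, ← pow_add]; congr 1; omega
    have h4 : (1 : ℝ) ≤ 2 ^ (3 * t) := one_le_pow₀ (by norm_num)
    rw [h3]
    rw [pow_succ] at h2
    linarith

/-! ### Asymptotics -/

theorem PolyBounded.eventually_le {s : ℕ → ℕ} (h : PolyBounded s) :
    ∃ e : ℕ, ∀ᶠ n in Filter.atTop, s n ≤ n ^ e := by
  obtain ⟨p, hp⟩ := h
  refine ⟨p.natDegree + 1, ?_⟩
  filter_upwards [Filter.eventually_ge_atTop (p.eval 1), Filter.eventually_ge_atTop 1] with n h1 h2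
  refine (hp n).trans ?_
  rw [Polynomial.eval_eq_sum_range] at h1 ⊢
  calc _ ≤ ∑ i ∈ Finset.range (p.natDegree + 1), p.coeff i * n ^ p.natDegree :=
        Finset.sum_le_sum fun i hi => Nat.mul_le_mul_left _
          (Nat.pow_le_pow_right h2 (Nat.le_of_lt_succ (Finset.mem_range.1 hi)))
    _ = (∑ i ∈ Finset.range (p.natDegree + 1), p.coeff i * 1 ^ i) * n ^ p.natDegree := by
        simp [Finset.sum_mul]
    _ ≤ n * n ^ p.natDegree := Nat.mul_le_mul_right _ h1
    _ = _ := by rw [pow_succ, mul_comm]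

/-- A polynomial is negligible against `2 ^ (n / 8)`. -/
theorem tendsto_pow_div_two_pow (e : ℕ) :
    Filter.Tendsto (fun n : ℕ => (n : ℝ) ^ e / 2 ^ (n / 8)) Filter.atTop (nhds 0) := by
  have h1 := (tendsto_pow_const_div_const_pow_of_one_lt e (r := (2 : ℝ) ^ (1 / 8 : ℝ))
    (Real.one_lt_rpow (by norm_num) (by norm_num))).const_mul 2
  rw [mul_zero] at h1
  refine squeeze_zero (fun n => by positivity) (fun n => ?_) h1
  rw [← mul_div_assoc, div_le_div_iff₀ (by positivity) (by positivity)]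
  have h2 : ((2 : ℝ) ^ (1 / 8 : ℝ)) ^ n ≤ 2 * 2 ^ (n / 8) := by
    rw [← Real.rpow_natCast, ← Real.rpow_mul (by norm_num), ← pow_succ', ← Real.rpow_natCast]
    refine Real.rpow_le_rpow_of_exponent_le (by norm_num) ?_
    have : n ≤ 8 * (n / 8 + 1) := by omega
    have : (n : ℝ) ≤ 8 * ((n / 8 + 1 : ℕ) : ℝ) := by exact_mod_cast this
    linarith
  have h0 : (0 : ℝ) ≤ (n : ℝ) ^ e := by positivity
  nlinarith

/-- The error is polynomial in the size of the scheme and the length of the advice. -/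
theorem errorPoly_le (d P : ℕ) {s : ℕ} (hs : 1 ≤ s) :
    errorPoly d s P ≤ (17 + 2 * d + 2 * knownConst d d) * ((s : ℝ) ^ 2 * (P + 1)) := by
  have h1 : (1 : ℝ) ≤ s := by exact_mod_cast hs
  have hC := knownConst_nonneg d d
  have hP : (0 : ℝ) ≤ P := Nat.cast_nonneg _
  have hsP : 0 ≤ (s : ℝ) * P := by positivity
  have hd : (0 : ℝ) ≤ d := Nat.cast_nonneg _
  unfold errorPoly
  have h2 : (16 * s + 2 * d + 1 : ℝ) ≤ (17 + 2 * d) * (s * (P + 1)) := by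
    nlinarith [mul_nonneg hd hsP, mul_nonneg hd (sub_nonneg.2 h1)]
  have h3 : (s + P + 1 : ℝ) ≤ 2 * (s * (P + 1)) := by
    nlinarith [mul_nonneg hP (sub_nonneg.2 h1)]
  have h4 := mul_le_mul_of_nonneg_left h3 hC
  calc _ ≤ (s : ℝ) * ((17 + 2 * d) * (s * (P + 1)) + knownConst d d * (2 * (s * (P + 1)))) := by
        gcongr
    _ = _ := by ring

/-! ### The shuffling Simon problem is hard for circuits of depth `d` -/

open Classical in
/-- Queries to the shuffling oracle of a single function. -/
noncomputable def sspFrame (d n : ℕ) : OracleFrame (sspSig d n) d n Unit where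
  parse := fun _ z => if h : ∃ j : Fin (d + 1), ∀ i, z (Sum.inl i) = true ↔ i = j then
    some ((), h.choose, fun i => z (Sum.inr i)) else none
  enc := fun _ _ o => encodeAnswer o

/-- The oracle of the problem in terms of the hidden data. -/
theorem sspFrame_oracle {d n : ℕ} (ω : Hidden d n Unit) :
    (sspFrame d n).oracle ω.answer = sspOracle (ω.2 ()) (toShuffle (ω.1 ())) := by
  funext q z
  unfold OracleFrame.oracle sspOracle shufflingAnswer sspFrame
  dsimp only
  congr 1
  split_ifs with h
  · simp only [Option.bind_some, shuffling_toShuffle]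
  · rfl

open Classical in
/-- The success probability as an average over the hidden data. -/
theorem sspSuccess_eq {d n k : ℕ} (A : Scheme (sspSig d n) k) :
    sspSuccess A = ∑ ω : Hidden d n Unit, hiddenPrior ω * correct ω.2 ()
      (A.acceptProb ((sspFrame d n).oracle ω.answer) (Fin.elim0 : Bits 0)) := by
  have hF : ∀ g : Shuffle d n → ℝ, Finset.univ.expect g =
      (Fintype.card (Unit → Fin d → Equiv.Perm (Big d n)) : ℝ)⁻¹ *
        ∑ p : Unit → Fin d → Equiv.Perm (Big d n), g (toShuffle (p ())) := by
    intro g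
    rw [Finset.expect_eq_sum_div_card, div_eq_inv_mul, Finset.card_univ,
      Fintype.card_congr (Equiv.funUnique Unit (Fin d → Equiv.Perm (Big d n)))]
    congr 1
    rw [← (toShuffle_bijective d n).sum_comp,
      ← (Equiv.funUnique Unit (Fin d → Equiv.Perm (Big d n))).sum_comp]
    rfl
  have key : sspSuccess A = ∑ f : Bits n → Bits n, prior f * Finset.univ.expect
      (fun F : Shuffle d n => if IsSimon f then sspAccept A f F else 1 - sspAccept A f F) := by
    rw [sum_prior_mul]
    unfold sspSuccess avg simonSet injSet
    rw [Finset.expect_eq_sum_div_card, Finset.expect_eq_sum_div_card]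
    congr 3
    · refine Finset.sum_congr (by congr) fun f hf => ?_
      simp only [if_pos (Finset.mem_filter.1 hf).2]
    · refine Finset.sum_congr (by congr) fun f hf => ?_
      have : ¬ IsSimon f := fun h => h.not_injective (Finset.mem_filter.1 hf).2
      simp only [if_neg this]
  rw [key, sum_hiddenPrior_mul, Finset.sum_comm, Finset.mul_sum,
    ← (Equiv.funUnique Unit (Bits n → Bits n)).sum_comp]
  refine Finset.sum_congr rfl fun f _ => ?_
  rw [hF, mul_left_comm]
  congr 1
  rw [Finset.mul_sum]
  refine Finset.sum_congr rfl fun p _ => ?_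
  simp only [sspFrame_oracle, correct, sspAccept, priorAll, Finset.univ_unique,
    Finset.prod_singleton]
  rfl

/-- The success probability of a scheme of size `s`. -/
theorem sspSuccess_le {d n s : ℕ} (hn : 0 < n) {A : Scheme (sspSig d n) d} (hA : A.size ≤ s) :
    sspSuccess A ≤ 1 / 2 + (1 + 2 * errorPoly d s 0) / 2 ^ (n / 8) := by
  obtain ⟨acc, rej, hcap, h⟩ := Scheme.exists_capped (sspFrame d n) hn
    (by simpa using Nat.one_le_two_pow) (u := fun _ => 1) (fun _ => ⟨zero_le_one, le_rfl⟩) hA 0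
    (fun r => if h : (r : ℕ) < 0 then (Fin.elim0 : Bits 0) ⟨r, h⟩ else false) ()
  have h1 : ∑ ω, hiddenPrior ω * cappedCorrect acc rej () ω ≤ 1 / 2 + 1 / 2 ^ (n / 8) := by
    refine sum_hiddenPrior_mul_le fun p => ?_
    have h2 := sum_cappedCorrect_le hn hcap () p (fun _ => 1) (fun _ => zero_le_one) fun _ _ => rfl
    simp only [one_mul, mul_one, sum_priorAll hn] at h2
    exact h2.trans (add_le_add_right (cap_advantage_le hn) _)
  rw [sspSuccess_eq]
  simp only [mul_one, sum_hiddenPrior hn] at h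
  refine h.trans ?_
  rw [add_div]
  have : errorPoly d s 0 / 2 ^ (n / 8) * (1 + 1 / 2 ^ 0) = 2 * errorPoly d s 0 / 2 ^ (n / 8) := by
    ring
  linarith

/-- No scheme of polynomial size with circuits of depth `d` does noticeably better than guessing. -/
theorem eventually_sspSuccess_le {d : ℕ} (A : ∀ n, Scheme (sspSig d n) d)
    (hA : PolyBounded fun n => (A n).size) {ε : ℝ} (hε : 0 < ε) :
    ∀ᶠ n in Filter.atTop, sspSuccess (A n) ≤ 1 / 2 + ε := by
  obtain ⟨e, he⟩ := hA.eventually_le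
  set K : ℝ := 1 + 2 * (17 + 2 * d + 2 * knownConst d d) with hK
  have ht := (tendsto_pow_div_two_pow (2 * e)).const_mul K
  rw [mul_zero] at ht
  filter_upwards [he, Filter.eventually_ge_atTop 1, ht.eventually (gt_mem_nhds hε)] with n h1 h2 h3
  refine (sspSuccess_le h2 h1).trans (add_le_add_right (le_trans ?_ h3.le) _)
  rw [← mul_div_assoc]
  refine div_le_div_of_nonneg_right ?_ (by positivity)
  have h4 := errorPoly_le d 0 (s := n ^ e) (Nat.one_le_pow _ _ h2)
  have h5 : (1 : ℝ) ≤ (n : ℝ) ^ (2 * e) := one_le_pow₀ (by exact_mod_cast h2)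
  have h6 : (((n ^ e : ℕ) : ℝ)) ^ 2 * ((0 : ℕ) + 1) = (n : ℝ) ^ (2 * e) := by
    push_cast
    ring
  rw [h6] at h4
  rw [hK]
  linarith

/-! ### Circuits with nearly equal gates -/

/-- Two unitary matrices whose entries differ by at most `δ`. -/
def UnitaryClose (δ : ℝ) {k : ℕ} (U U' : Matrix.unitaryGroup (Fin k → Bool) ℂ) : Prop :=
  ∀ v u, ‖U.1 v u - U'.1 v u‖ ≤ δ

/-- Two gates on the same wires with nearly equal unitary matrices. -/
def Gate.Close (δ : ℝ) {w : ℕ} (g g' : Gate w) : Prop :=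
  ∃ U', UnitaryClose δ g.U U' ∧ g' = ⟨g.k, g.one_le, g.le_two, U', g.pos⟩

/-- Two gates of a call with the same addresses of wires and nearly equal unitary matrices. -/
def GateSlot.Close (δ : ℝ) {M : ℕ} (g g' : GateSlot M) : Prop :=
  ∃ U', UnitaryClose δ g.U U' ∧ g' = ⟨g.k, g.one_le, g.le_two, U', g.addr⟩

/-- Two calls that agree up to nearly equal gates. -/
def QCall.Close (δ : ℝ) {S : OracleSig} {d M : ℕ} (C C' : QCall S d M) : Prop :=
  ∃ G', (∀ i, List.Forall₂ (GateSlot.Close δ) (C.gates i) (G' i)) ∧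
    C' = ⟨C.w, C.reg, G', C.queries⟩

/-- Two steps that agree up to nearly equal gates in the circuits that are called. -/
def Step.Close (δ : ℝ) {S : OracleSig} {d M : ℕ} (t t' : Step S d M) : Prop :=
  t' = t ∨ ∃ C C', C.Close δ C' ∧ t = .call C ∧ t' = .call C'

/-- Two schemes that agree up to nearly equal gates in the circuits that are called. -/
def Scheme.Close (δ : ℝ) {S : OracleSig} {d : ℕ} (A A' : Scheme S d) : Prop :=
  ∃ l', List.Forall₂ (Step.Close δ) A.steps l' ∧ A' = ⟨A.M, l', A.out⟩

/-- The factor `4` is the number of entries in a row of the matrix of a gate. -/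
theorem Gate.Close.l2_apply_sub_le {δ : ℝ} (hδ : 0 ≤ δ) {w : ℕ} {g g' : Gate w}
    (h : g.Close δ g') (hg : Function.Injective g.pos) (ψ : Bits w → ℂ) :
    l2 (g.apply ψ - g'.apply ψ) ≤ 4 * δ * l2 ψ := by
  obtain ⟨U', hU, rfl⟩ := h
  have hc : (Fintype.card (Fin g.k → Bool) : ℝ) ≤ 4 := by
    have : Fintype.card (Fin g.k → Bool) = 2 ^ g.k := by simp
    rw [this]
    have h2 : 2 ^ g.k ≤ 2 ^ 2 := Nat.pow_le_pow_right (by norm_num) g.le_two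
    exact_mod_cast h2
  refine (pow_le_pow_iff_left₀ (l2_nonneg _) (by have := l2_nonneg ψ; positivity)
    two_ne_zero).1 ?_
  rw [mul_pow, l2_sq, l2_sq]
  have key : ∀ z, ‖(g.apply ψ - Gate.apply ⟨g.k, g.one_le, g.le_two, U', g.pos⟩ ψ) z‖ ^ 2 ≤
      δ ^ 2 * 4 * ∑ u, ‖ψ (Function.extend g.pos u z)‖ ^ 2 := by
    intro z
    have h1 : ‖(g.apply ψ - Gate.apply ⟨g.k, g.one_le, g.le_two, U', g.pos⟩ ψ) z‖ ≤
        δ * ∑ u, ‖ψ (Function.extend g.pos u z)‖ := by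
      simp only [Pi.sub_apply, Gate.apply, ← Finset.sum_sub_distrib, ← sub_mul]
      refine (norm_sum_le _ _).trans ?_
      rw [Finset.mul_sum]
      refine Finset.sum_le_sum fun u _ => ?_
      rw [norm_mul]
      exact mul_le_mul_of_nonneg_right (hU _ _) (norm_nonneg _)
    refine (pow_le_pow_left₀ (norm_nonneg _) h1 2).trans ?_
    rw [mul_pow, mul_assoc]
    refine mul_le_mul_of_nonneg_left ?_ (sq_nonneg δ)
    refine sq_sum_le_card_mul_sum_sq.trans ?_
    rw [Finset.card_univ]
    exact mul_le_mul_of_nonneg_right hc (Finset.sum_nonneg fun _ _ => sq_nonneg _)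
  refine (Finset.sum_le_sum fun z _ => key z).trans ?_
  rw [← Finset.mul_sum, sum_sum_extend hg fun z => ‖ψ z‖ ^ 2]
  have h3 : 0 ≤ ∑ z, ‖ψ z‖ ^ 2 := Finset.sum_nonneg fun _ _ => sq_nonneg _
  have h4 := mul_le_mul_of_nonneg_right hc h3
  nlinarith [mul_le_mul_of_nonneg_left h4 (sq_nonneg δ)]

theorem map_wires_eq_of_close {δ : ℝ} {w : ℕ} {L L' : List (Gate w)}
    (h : List.Forall₂ (Gate.Close δ) L L') :
    L.map (fun g => (⟨Fin g.k, g.pos⟩ : Σ ι : Type, ι → Fin w)) =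
      L'.map fun g => ⟨Fin g.k, g.pos⟩ := by
  induction h with
  | nil => rfl
  | cons h1 _ ih =>
    obtain ⟨U', _, rfl⟩ := h1
    simp only [List.map_cons, ih]

theorem l2_foldl_gates_sub_le {δ : ℝ} (hδ : 0 ≤ δ) {w : ℕ} {L L' : List (Gate w)}
    (h : List.Forall₂ (Gate.Close δ) L L') :
    (∀ g ∈ L, Function.Injective g.pos) → ∀ ψ : Bits w → ℂ,
    l2 (L.foldl (fun φ g => g.apply φ) ψ - L'.foldl (fun φ g => g.apply φ) ψ) ≤
      4 * δ * L.length * l2 ψ := by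
  induction h with
  | nil => intro _ ψ; simp only [List.foldl_nil, l2_sub_self, List.length_nil, Nat.cast_zero,
      mul_zero, zero_mul, le_refl]
  | @cons g g' L L' h1 _ ih =>
    intro hL ψ
    have hg : Function.Injective g.pos := hL g List.mem_cons_self
    have hL' : ∀ g ∈ L, Function.Injective g.pos := fun x hx => hL x (List.mem_cons_of_mem _ hx)
    have hg' : l2 (g'.apply ψ) = l2 ψ := by
      obtain ⟨U', _, rfl⟩ := h1
      exact Gate.l2_apply (⟨g.k, g.one_le, g.le_two, U', g.pos⟩ : Gate w) hg ψ
    have h2 := ih hL' (g'.apply ψ)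
    have h3 : l2 (L.foldl (fun φ g => g.apply φ) (g.apply ψ) -
        L.foldl (fun φ g => g.apply φ) (g'.apply ψ)) ≤ 4 * δ * l2 ψ := by
      rw [← foldl_gates_sub, l2_foldl_gates L hL']
      exact h1.l2_apply_sub_le hδ hg ψ
    rw [hg'] at h2
    simp only [List.foldl_cons, List.length_cons]
    refine (l2_sub_triangle _ (L.foldl (fun φ g => g.apply φ) (g'.apply ψ)) _).trans ?_
    push_cast
    linarith

theorem l2_applyGates_sub_le {δ : ℝ} (hδ : 0 ≤ δ) {w : ℕ} {L L' : List (Gate w)}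
    (h : List.Forall₂ (Gate.Close δ) L L') (ψ : Bits w → ℂ) :
    l2 (applyGates L ψ - applyGates L' ψ) ≤ 4 * δ * L.length * l2 ψ := by
  unfold applyGates
  rw [← map_wires_eq_of_close h]
  split_ifs with hd
  · exact l2_foldl_gates_sub_le hδ h (injective_of_disjointWires hd) ψ
  · rw [l2_sub_self]
    have := l2_nonneg ψ
    positivity

theorem forall₂_resolve {δ : ℝ} {M : ℕ} {L L' : List (GateSlot M)}
    (h : List.Forall₂ (GateSlot.Close δ) L L') (mem : Fin M → Bool) (w : ℕ) :
    List.Forall₂ (Gate.Close δ) (L.filterMap fun s => s.resolve mem w)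
      (L'.filterMap fun s => s.resolve mem w) := by
  induction h with
  | nil => exact .nil
  | @cons g g' L L' h1 _ ih =>
    obtain ⟨U', hU, rfl⟩ := h1
    rw [List.filterMap_cons, List.filterMap_cons]
    unfold GateSlot.resolve at ih ⊢
    split_ifs with h2
    · exact .cons ⟨U', hU, rfl⟩ ih
    · exact ih

/-- The number of gates of a call. -/
def QCall.numGates {S : OracleSig} {d M : ℕ} (C : QCall S d M) : ℕ := ∑ i, (C.gates i).length

theorem QCall.numGates_le {S : OracleSig} {d M : ℕ} (C : QCall S d M) :
    C.numGates ≤ (Step.call C).size := by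
  have h : C.numGates ≤ ∑ i, ((C.gates i).map GateSlot.size).sum := by
    refine Finset.sum_le_sum fun i _ => ?_
    have h1 := List.card_nsmul_le_sum ((C.gates i).map GateSlot.size) 1 (by
      intro x hx
      obtain ⟨t, _, rfl⟩ := List.mem_map.1 hx
      unfold GateSlot.size
      omega)
    simpa using h1
  simp only [Step.size]
  omega

/-- The errors of the gates add up, as all gates and oracle layers are isometries. -/
theorem QCall.Close.l2_finalState_sub_le {δ : ℝ} (hδ : 0 ≤ δ) {S : OracleSig} {d M : ℕ}
    (C : QCall S d M) {G' : Fin (d + 1) → List (GateSlot M)}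
    (hG : ∀ i, List.Forall₂ (GateSlot.Close δ) (C.gates i) (G' i)) (O : S.Oracle)
    (mem : Fin M → Bool) :
    l2 (C.finalState O mem - QCall.finalState ⟨C.w, C.reg, G', C.queries⟩ O mem) ≤
      4 * δ * C.numGates := by
  set C' : QCall S d M := ⟨C.w, C.reg, G', C.queries⟩ with hC'
  rw [QCall.finalState_eq, QCall.finalState_eq]
  have hat : ∀ i, List.Forall₂ (Gate.Close δ) (C.gatesAt mem i) (C'.gatesAt mem i) := by
    intro i
    unfold QCall.gatesAt
    split_ifs with hi
    · exact forall₂_resolve (hG ⟨i, hi⟩) mem C.w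
    · exact .nil
  have key : ∀ i, l2 (C.stateAt (fun _ => O) mem i - C'.stateAt (fun _ => O) mem i) ≤
      ∑ j ∈ Finset.range (i + 1), 4 * δ * (C.gatesAt mem j).length := by
    intro i
    induction i with
    | zero =>
      rw [zero_add, Finset.sum_range_one]
      have := l2_applyGates_sub_le hδ (hat 0) fun z => if z = mem ∘ C.reg then 1 else 0
      rwa [l2_basisState, mul_one] at this
    | succ i ih =>
      rw [Finset.sum_range_succ]
      set ψ := C.stateAt (fun _ => O) mem i with hψ
      set φ := C'.stateAt (fun _ => O) mem i with hφ
      have e1 : C.stateAt (fun _ => O) mem (i + 1) =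
        applyGates (C.gatesAt mem (i + 1)) (applyOracleGates O (C.queriesAt mem i) ψ) := rfl
      have e2 : C'.stateAt (fun _ => O) mem (i + 1) =
        applyGates (C'.gatesAt mem (i + 1)) (applyOracleGates O (C.queriesAt mem i) φ) := rfl
      rw [e1, e2]
      refine (l2_sub_triangle _
        (applyGates (C.gatesAt mem (i + 1)) (applyOracleGates O (C.queriesAt mem i) φ)) _).trans
        (add_le_add ?_ ?_)
      · rw [← applyGates_sub, ← applyOracleGates_sub, l2_applyGates, l2_applyOracleGates]
        exact ih
      · have h1 := l2_applyGates_sub_le hδ (hat (i + 1)) (applyOracleGates O (C.queriesAt mem i) φ)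
        have h2 : l2 φ = 1 := C'.l2_stateAt _ _ _
        rwa [l2_applyOracleGates, h2, mul_one] at h1
  refine (key d).trans ?_
  rw [← Finset.mul_sum]
  refine mul_le_mul_of_nonneg_left ?_ (by positivity)
  rw [QCall.numGates, ← Fin.sum_univ_eq_sum_range (fun j => ((C.gatesAt mem j).length : ℝ)) (d + 1)]
  push_cast
  refine Finset.sum_le_sum fun i _ => ?_
  have : (C.gatesAt mem i).length ≤ (C.gates i).length := by
    simp only [QCall.gatesAt, i.2, dif_pos]
    exact List.length_filterMap_le _ _
  exact_mod_cast this

/-- Schemes with nearly equal gates accept with nearly equal probabilities, for all oracles. -/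
theorem abs_acceptFrom_sub_le {δ : ℝ} (hδ : 0 ≤ δ) {S : OracleSig} {d M : ℕ} (O : S.Oracle)
    (out : Fin M) {l l' : List (Step S d M)} (h : List.Forall₂ (Step.Close δ) l l') :
    ∀ mem, |acceptFrom O out l mem - acceptFrom O out l' mem| ≤
      8 * δ * (l.map Step.size).sum := by
  induction h with
  | nil => intro mem; simp
  | @cons t t' l l' ht _ ih =>
    intro mem
    have hsz : (8 * δ * (l.map Step.size).sum : ℝ) ≤ 8 * δ * ((t :: l).map Step.size).sum := by
      refine mul_le_mul_of_nonneg_left ?_ (by positivity)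
      simp
    rcases ht with rfl | ⟨C, C', ⟨G', hG, rfl⟩, rfl, rfl⟩
    · refine le_trans ?_ hsz
      have hb : (0 : ℝ) ≤ 8 * δ * (l.map Step.size).sum := by positivity
      cases t' with
      | nand dst a b => exact ih _
      | coin dst =>
        simp only [acceptFrom]
        have h1 := abs_le.1 (ih (Function.update mem dst false))
        have h2 := abs_le.1 (ih (Function.update mem dst true))
        rw [abs_le]
        constructor <;> linarith [h1.1, h1.2, h2.1, h2.2]
      | query dst q o inp => exact ih _
      | call C =>
        simp only [acceptFrom]
        rw [← Finset.sum_sub_distrib]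
        refine (Finset.abs_sum_le_sum_abs _ _).trans ?_
        refine (Finset.sum_le_sum (g := fun z => ‖C.finalState O mem z‖ ^ 2 *
          (8 * δ * (l.map Step.size).sum)) fun z _ => ?_).trans ?_
        · rw [← mul_sub, abs_mul, abs_of_nonneg (sq_nonneg _)]
          exact mul_le_mul_of_nonneg_left (ih _) (sq_nonneg _)
        · rw [← Finset.sum_mul, C.sum_finalState, one_mul]
    · set C' : QCall S d M := ⟨C.w, C.reg, G', C.queries⟩ with hC'
      have e1 : acceptFrom O out (.call C :: l) mem = ∑ z, ‖C.finalState O mem z‖ ^ 2 *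
        acceptFrom O out l (Function.extend C.reg z mem) := rfl
      have e2 : acceptFrom O out (.call C' :: l') mem = ∑ z : Bits C.w,
        ‖C'.finalState O mem z‖ ^ 2 * acceptFrom O out l' (Function.extend C.reg z mem) := rfl
      -- First the circuit is exchanged, then the steps that follow it.
      have h1 := abs_measure_sub_le (C.finalState O mem) (C'.finalState O mem)
        (C.l2_finalState O mem) (C'.l2_finalState O mem)
        (fun z => acceptFrom O out l (Function.extend C.reg z mem))
        fun z => acceptFrom_mem_Icc O out l _
      have h2 := QCall.Close.l2_finalState_sub_le hδ C hG O mem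
      have h3 : |∑ z : Bits C.w, ‖C'.finalState O mem z‖ ^ 2 *
            acceptFrom O out l (Function.extend C.reg z mem) -
          ∑ z : Bits C.w, ‖C'.finalState O mem z‖ ^ 2 *
            acceptFrom O out l' (Function.extend C.reg z mem)| ≤ 8 * δ * (l.map Step.size).sum := by
        rw [← Finset.sum_sub_distrib]
        refine (Finset.abs_sum_le_sum_abs _ _).trans ?_
        refine (Finset.sum_le_sum (g := fun z => ‖C'.finalState O mem z‖ ^ 2 *
          (8 * δ * (l.map Step.size).sum)) fun z _ => ?_).trans ?_
        · rw [← mul_sub, abs_mul, abs_of_nonneg (sq_nonneg _)]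
          exact mul_le_mul_of_nonneg_left (ih _) (sq_nonneg _)
        · rw [← Finset.sum_mul]
          exact le_of_eq (by rw [show ∑ z : Bits C.w, ‖C'.finalState O mem z‖ ^ 2 = 1 from
            C'.sum_finalState O mem, one_mul])
      have h4 : (C.numGates : ℝ) ≤ (Step.call C).size := by exact_mod_cast C.numGates_le
      have h5 := mul_le_mul_of_nonneg_left h4 (show 0 ≤ 8 * δ by positivity)
      rw [e1, e2]
      refine (abs_sub_le _ _ _).trans ((add_le_add h1 h3).trans ?_)
      rw [List.map_cons, List.sum_cons]
      push_cast
      linarith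

theorem Scheme.Close.abs_acceptProb_sub_le {δ : ℝ} (hδ : 0 ≤ δ) {S : OracleSig} {d n : ℕ}
    {A A' : Scheme S d} (h : A.Close δ A') (O : S.Oracle) (x : Bits n) :
    |A.acceptProb O x - A'.acceptProb O x| ≤ 8 * δ * A.size := by
  obtain ⟨l', hl, rfl⟩ := h
  refine (abs_acceptFrom_sub_le hδ O A.out hl _).trans ?_
  refine mul_le_mul_of_nonneg_left ?_ (by positivity)
  unfold Scheme.size
  exact_mod_cast Nat.le_add_left _ _

/-! ### Codes of schemes -/

/-- A prefix code, which determines what is coded up to the relation `R`. -/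
def IsPrefixCode {α : Type*} (c : α → List ℕ) (R : α → α → Prop) : Prop :=
  ∀ a a' r r', c a ++ r = c a' ++ r' → R a a' ∧ r = r'

/-- A list of at most `ℓ` numbers below `B`. -/
def Fits (B ℓ : ℕ) (l : List ℕ) : Prop := l.length ≤ ℓ ∧ ∀ x ∈ l, x < B

theorem Fits.mono {B ℓ ℓ' : ℕ} {l : List ℕ} (h : Fits B ℓ l) (hℓ : ℓ ≤ ℓ') : Fits B ℓ' l :=
  ⟨h.1.trans hℓ, h.2⟩

theorem Fits.cons {B ℓ x : ℕ} {l : List ℕ} (hx : x < B) (h : Fits B ℓ l) :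
    Fits B (ℓ + 1) (x :: l) := by
  refine ⟨by simpa using h.1, fun y hy => ?_⟩
  rcases List.mem_cons.1 hy with rfl | hy
  · exact hx
  · exact h.2 y hy

theorem Fits.nil (B : ℕ) : Fits B 0 [] := ⟨by simp, by simp⟩

theorem Fits.append {B ℓ ℓ' : ℕ} {l l' : List ℕ} (h : Fits B ℓ l) (h' : Fits B ℓ' l') :
    Fits B (ℓ + ℓ') (l ++ l') := by
  refine ⟨by rw [List.length_append]; exact add_le_add h.1 h'.1, fun y hy => ?_⟩
  rcases List.mem_append.1 hy with hy | hy
  · exact h.2 y hy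
  · exact h'.2 y hy

theorem Fits.flatMap {α : Type*} {c : α → List ℕ} {B : ℕ} {b : α → ℕ} (l : List α)
    (h : ∀ a ∈ l, Fits B (b a) (c a)) : Fits B (l.map b).sum (l.flatMap c) := by
  induction l with
  | nil => exact Fits.nil B
  | cons a l ih =>
    rw [List.flatMap_cons, List.map_cons, List.sum_cons]
    exact (h a List.mem_cons_self).append (ih fun x hx => h x (List.mem_cons_of_mem _ hx))

theorem IsPrefixCode.flatMap {α : Type*} {c : α → List ℕ} {R : α → α → Prop}
    (hc : IsPrefixCode c R) : ∀ (l l' : List α) (r r' : List ℕ), l.length = l'.length →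
    l.flatMap c ++ r = l'.flatMap c ++ r' → List.Forall₂ R l l' ∧ r = r'
  | [], [], r, r', _, h => ⟨.nil, by simpa using h⟩
  | [], _ :: _, _, _, h, _ => by simp at h
  | _ :: _, [], _, _, h, _ => by simp at h
  | a :: l, a' :: l', r, r', hl, h => by
    rw [List.flatMap_cons, List.flatMap_cons, List.append_assoc, List.append_assoc] at h
    obtain ⟨h1, h2⟩ := hc _ _ _ _ h
    obtain ⟨h3, h4⟩ := IsPrefixCode.flatMap hc l l' r r' (by simpa using hl) h2
    exact ⟨.cons h1 h3, h4⟩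

/-- The code of a list: its length, followed by the codes of its entries. -/
def listCode {α : Type*} (c : α → List ℕ) (l : List α) : List ℕ := l.length :: l.flatMap c

theorem isPrefixCode_listCode {α : Type*} {c : α → List ℕ} {R : α → α → Prop}
    (hc : IsPrefixCode c R) : IsPrefixCode (listCode c) (List.Forall₂ R) := by
  intro l l' r r' h
  simp only [listCode, List.cons_append, List.cons.injEq] at h
  exact hc.flatMap l l' r r' h.1 h.2

theorem fits_listCode {α : Type*} {c : α → List ℕ} {B : ℕ} {b : α → ℕ} (l : List α)
    (hB : l.length < B) (h : ∀ a ∈ l, Fits B (b a) (c a)) :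
    Fits B ((l.map b).sum + 1) (listCode c l) := (Fits.flatMap l h).cons hB

/-- The code of a function on a finite type: the codes of its values. -/
noncomputable def funCode {ι α : Type*} [Fintype ι] (c : α → List ℕ) (f : ι → α) : List ℕ :=
  (List.ofFn fun i => f ((Fintype.equivFin ι).symm i)).flatMap c

theorem isPrefixCode_funCode {ι α : Type*} [Fintype ι] {c : α → List ℕ} {R : α → α → Prop}
    (hc : IsPrefixCode c R) : IsPrefixCode (funCode (ι := ι) c)
      fun f f' => ∀ i, R (f i) (f' i) := by
  intro f f' r r' h
  obtain ⟨h1, h2⟩ := hc.flatMap _ _ r r' (by simp) h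
  refine ⟨fun i => ?_, h2⟩
  have h3 := (List.forall₂_iff_get.1 h1).2 (Fintype.equivFin ι i) (by simp) (by simp)
  simpa using h3

theorem fits_funCode {ι α : Type*} [Fintype ι] {c : α → List ℕ} {B : ℕ} {b : α → ℕ} (f : ι → α)
    (h : ∀ i, Fits B (b (f i)) (c (f i))) : Fits B (∑ i, b (f i)) (funCode c f) := by
  have h1 := Fits.flatMap (b := b) (List.ofFn fun i => f ((Fintype.equivFin ι).symm i))
    (B := B) (c := c) (by
      intro a ha
      obtain ⟨i, rfl⟩ := (List.mem_ofFn' _ _).1 ha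
      exact h _)
  rw [List.map_ofFn, List.sum_ofFn] at h1
  rwa [← (Fintype.equivFin ι).symm.sum_comp]

/-- A complex number in the unit disk, rounded with precision `1 / D`. -/
noncomputable def complexCode (D : ℕ) (x : ℂ) : List ℕ := [⌊(x.re + 1) * D⌋₊, ⌊(x.im + 1) * D⌋₊]

theorem abs_sub_le_of_floor_eq {D : ℕ} (hD : 0 < D) {x y : ℝ} (hx : |x| ≤ 1) (hy : |y| ≤ 1)
    (h : ⌊(x + 1) * D⌋₊ = ⌊(y + 1) * D⌋₊) : |x - y| ≤ 1 / D := by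
  have hD' : (0 : ℝ) < D := by exact_mod_cast hD
  have hx0 : 0 ≤ (x + 1) * D := mul_nonneg (by linarith [(abs_le.1 hx).1]) hD'.le
  have hy0 : 0 ≤ (y + 1) * D := mul_nonneg (by linarith [(abs_le.1 hy).1]) hD'.le
  have h1 := Nat.floor_le hx0
  have h2 := Nat.lt_floor_add_one ((x + 1) * D)
  have h3 := Nat.floor_le hy0
  have h4 := Nat.lt_floor_add_one ((y + 1) * D)
  rw [h] at h1 h2
  rw [abs_le, neg_le, le_div_iff₀ hD', le_div_iff₀ hD']
  constructor <;> linarith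

theorem isPrefixCode_complexCode {D : ℕ} (hD : 0 < D) : IsPrefixCode (complexCode D) fun x y =>
    ‖x‖ ≤ 1 → ‖y‖ ≤ 1 → ‖x - y‖ ≤ 2 / D := by
  intro x y r r' h
  simp only [complexCode, List.cons_append, List.nil_append, List.cons.injEq] at h
  refine ⟨fun hx hy => ?_, h.2.2⟩
  have h1 := abs_sub_le_of_floor_eq hD ((Complex.abs_re_le_norm x).trans hx)
    ((Complex.abs_re_le_norm y).trans hy) h.1
  have h2 := abs_sub_le_of_floor_eq hD ((Complex.abs_im_le_norm x).trans hx)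
    ((Complex.abs_im_le_norm y).trans hy) h.2.1
  have h3 := Complex.norm_le_abs_re_add_abs_im (x - y)
  rw [Complex.sub_re, Complex.sub_im] at h3
  have : (2 / D : ℝ) = 1 / D + 1 / D := by ring
  linarith

theorem fits_complexCode {D : ℕ} {x : ℂ} (hx : ‖x‖ ≤ 1) :
    Fits (2 * D + 1) 2 (complexCode D x) := by
  have key : ∀ y : ℝ, |y| ≤ 1 → ⌊(y + 1) * D⌋₊ < 2 * D + 1 := by
    intro y hy
    rw [Nat.lt_add_one_iff]
    refine Nat.floor_le_of_le ?_
    push_cast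
    exact mul_le_mul_of_nonneg_right (by linarith [(abs_le.1 hy).2]) (Nat.cast_nonneg _)
  exact ((Fits.nil _).cons (key _ ((Complex.abs_im_le_norm x).trans hx))).cons
    (key _ ((Complex.abs_re_le_norm x).trans hx))

/-- The code of the number of a register. -/
def finCode {M : ℕ} (r : Fin M) : List ℕ := [r]

theorem isPrefixCode_finCode (M : ℕ) : IsPrefixCode (finCode (M := M)) Eq := by
  intro a a' r r' h
  simp only [finCode, List.cons_append, List.nil_append, List.cons.injEq] at h
  exact ⟨Fin.ext h.1, h.2⟩

theorem fits_finCode {M B : ℕ} (hB : M ≤ B) (r : Fin M) : Fits B 1 (finCode r) :=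
  (Fits.nil _).cons (r.2.trans_le hB)

/-- The code of a gate: its number of wires, the entries of its matrix, rounded with precision
`1 / D`, and the addresses of its wires. -/
noncomputable def GateSlot.code (D : ℕ) {M : ℕ} (g : GateSlot M) : List ℕ :=
  g.k :: (funCode (complexCode D)
    (fun x : (Fin g.k → Bool) × (Fin g.k → Bool) => g.U.1 x.1 x.2) ++
      funCode (listCode finCode) g.addr)

theorem norm_unitary_le {k : ℕ} (U : Matrix.unitaryGroup (Fin k → Bool) ℂ) (v u : Fin k → Bool) :
    ‖U.1 v u‖ ≤ 1 := entry_norm_bound_of_unitary U.2 v u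

theorem isPrefixCode_gateSlot {D : ℕ} (hD : 0 < D) (M : ℕ) :
    IsPrefixCode (GateSlot.code D (M := M)) (GateSlot.Close (2 / D)) := by
  rintro ⟨k, h1, h2, U, addr⟩ ⟨k', h1', h2', U', addr'⟩ r r' h
  simp only [GateSlot.code, List.cons_append, List.cons.injEq] at h
  obtain ⟨rfl, h⟩ := h
  rw [List.append_assoc, List.append_assoc] at h
  obtain ⟨h3, h4⟩ := isPrefixCode_funCode (isPrefixCode_complexCode hD) _ _ _ _ h
  obtain ⟨h5, h6⟩ := isPrefixCode_funCode (isPrefixCode_listCode (isPrefixCode_finCode M))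
    _ _ _ _ h4
  refine ⟨⟨U', fun v u => h3 (v, u) (norm_unitary_le U v u) (norm_unitary_le U' v u), ?_⟩, h6⟩
  have : addr = addr' := funext fun i => by simpa [List.forall₂_eq_eq_eq] using h5 i
  simp only [this]

theorem fits_gateSlot {D M B : ℕ} (hB : 2 * D + 3 ≤ B) (hM : M ≤ B) (g : GateSlot M)
    (hg : g.size ≤ B) : Fits B (35 * g.size) (g.code D) := by
  have h1 : Fits B (∑ _i : (Fin g.k → Bool) × (Fin g.k → Bool), 2)
      (funCode (complexCode D) (fun x : (Fin g.k → Bool) × (Fin g.k → Bool) => g.U.1 x.1 x.2)) :=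
    fits_funCode (b := fun _ => 2) _ fun i =>
      ⟨(fits_complexCode (norm_unitary_le g.U i.1 i.2)).1, fun x hx =>
        ((fits_complexCode (D := D) (norm_unitary_le g.U i.1 i.2)).2 x hx).trans_le (by omega)⟩
  have hlen : ∀ i, (g.addr i).length < B := by
    intro i
    have h1 : (g.addr i).length ≤ ∑ i, (g.addr i).length := Finset.single_le_sum
      (f := fun i => (g.addr i).length) (fun _ _ => Nat.zero_le _) (Finset.mem_univ i)
    unfold GateSlot.size at hg
    omega
  have h2 : Fits B (∑ i, ((g.addr i).length + 1)) (funCode (listCode finCode) g.addr) :=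
    fits_funCode (b := fun l => l.length + 1) g.addr fun i => by
      have := fits_listCode (b := fun _ => 1) (g.addr i) (hlen i) fun r _ => fits_finCode hM r
      simpa using this
  refine ((h1.append h2).cons (by have := g.le_two; omega)).mono ?_
  have hk : 2 ^ g.k ≤ 2 ^ 2 := Nat.pow_le_pow_right (by norm_num) g.le_two
  have hk2 := g.le_two
  have h3 : 2 ^ g.k * 2 ^ g.k ≤ 16 := Nat.mul_le_mul hk hk
  simp only [Finset.sum_const, Finset.card_univ, Fintype.card_prod, Fintype.card_pi,
    Fintype.card_bool, Finset.prod_const, Fintype.card_fin, smul_eq_mul, Finset.sum_add_distrib,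
    mul_one]
  unfold GateSlot.size
  omega

/-- The code of an oracle gate, for a code `cq` of the kinds of queries. -/
noncomputable def OracleSlot.code {S : OracleSig} (cq : S.Q → ℕ) {M : ℕ} (g : OracleSlot S M) :
    List ℕ :=
  cq g.q :: (funCode (listCode finCode) g.inAddr ++ funCode (listCode finCode) g.outAddr)

theorem isPrefixCode_oracleSlot {S : OracleSig} {cq : S.Q → ℕ} (hq : Function.Injective cq)
    (M : ℕ) : IsPrefixCode (OracleSlot.code cq (M := M)) Eq := by
  rintro ⟨q, i, o⟩ ⟨q', i', o'⟩ r r' h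
  simp only [OracleSlot.code, List.cons_append, List.cons.injEq] at h
  obtain ⟨hqq, h⟩ := h
  obtain rfl := hq hqq
  rw [List.append_assoc, List.append_assoc] at h
  obtain ⟨h3, h4⟩ := isPrefixCode_funCode (isPrefixCode_listCode (isPrefixCode_finCode M))
    _ _ _ _ h
  obtain ⟨h5, h6⟩ := isPrefixCode_funCode (isPrefixCode_listCode (isPrefixCode_finCode M))
    _ _ _ _ h4
  have e1 : i = i' := funext fun i => by simpa [List.forall₂_eq_eq_eq] using h3 i
  have e2 : o = o' := funext fun i => by simpa [List.forall₂_eq_eq_eq] using h5 i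
  exact ⟨by rw [e1, e2], h6⟩

theorem fits_oracleSlot {S : OracleSig} {cq : S.Q → ℕ} (hq : ∀ q, cq q ≤ Fintype.card (S.In q))
    {M B : ℕ} (hM : M ≤ B) (g : OracleSlot S M) (hg : g.size ≤ B) :
    Fits B g.size (g.code cq) := by
  unfold OracleSlot.size at hg
  have hin : ∀ i, (g.inAddr i).length < B := by
    intro i
    have h1 : (g.inAddr i).length + 1 ≤ ∑ i, ((g.inAddr i).length + 1) := Finset.single_le_sum
      (f := fun i => (g.inAddr i).length + 1) (fun _ _ => Nat.zero_le _) (Finset.mem_univ i)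
    omega
  have hout : ∀ i, (g.outAddr i).length < B := by
    intro i
    have h1 : (g.outAddr i).length + 1 ≤ ∑ i, ((g.outAddr i).length + 1) := Finset.single_le_sum
      (f := fun i => (g.outAddr i).length + 1) (fun _ _ => Nat.zero_le _) (Finset.mem_univ i)
    omega
  have h1 : Fits B (∑ i, ((g.inAddr i).length + 1)) (funCode (listCode finCode) g.inAddr) :=
    fits_funCode (b := fun l => l.length + 1) g.inAddr fun i => by
      have := fits_listCode (b := fun _ => 1) (g.inAddr i) (hin i) fun r _ => fits_finCode hM r
      simpa using this
  have h2 : Fits B (∑ i, ((g.outAddr i).length + 1)) (funCode (listCode finCode) g.outAddr) :=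
    fits_funCode (b := fun l => l.length + 1) g.outAddr fun i => by
      have := fits_listCode (b := fun _ => 1) (g.outAddr i) (hout i) fun r _ => fits_finCode hM r
      simpa using this
  refine ((h1.append h2).cons ?_).mono ?_
  · have := hq g.q
    have h3 : Fintype.card (S.In g.q) ≤ ∑ i, ((g.inAddr i).length + 1) := by
      simp [Finset.sum_add_distrib]
    omega
  · unfold OracleSlot.size
    omega

/-- The code of a step: a number for the type of the step, followed by its data. -/
noncomputable def Step.code (D : ℕ) {S : OracleSig} (cq : S.Q → ℕ) {d M : ℕ} :
    Step S d M → List ℕ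
  | .nand dst a b => [0, dst, a, b]
  | .coin dst => [1, dst]
  | .query dst q o inp => 2 :: dst :: cq q :: Fintype.equivFin (S.Out q) o :: funCode finCode inp
  | .call C => 3 :: C.w :: (funCode finCode C.reg ++
      (funCode (listCode (GateSlot.code D)) C.gates ++
        funCode (listCode (OracleSlot.code cq)) C.queries))

theorem isPrefixCode_step {D : ℕ} (hD : 0 < D) {S : OracleSig} {cq : S.Q → ℕ}
    (hq : Function.Injective cq) (d M : ℕ) :
    IsPrefixCode (Step.code D cq (d := d) (M := M)) (Step.Close (2 / D)) := by
  intro t t' r r' h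
  cases t with
  | nand dst a b =>
    cases t' with
    | nand dst' a' b' =>
      simp only [Step.code, List.cons_append, List.nil_append, List.cons.injEq, true_and] at h
      exact ⟨Or.inl (by rw [Fin.ext h.1, Fin.ext h.2.1, Fin.ext h.2.2.1]), h.2.2.2⟩
    | coin => simp [Step.code] at h
    | query => simp [Step.code] at h
    | call => simp [Step.code] at h
  | coin dst =>
    cases t' with
    | coin dst' =>
      simp only [Step.code, List.cons_append, List.nil_append, List.cons.injEq, true_and] at h
      exact ⟨Or.inl (by rw [Fin.ext h.1]), h.2⟩
    | nand => simp [Step.code] at h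
    | query => simp [Step.code] at h
    | call => simp [Step.code] at h
  | query dst q o inp =>
    cases t' with
    | query dst' q' o' inp' =>
      simp only [Step.code, List.cons_append, List.cons.injEq, true_and] at h
      obtain ⟨h1, h2, h3, h4⟩ := h
      obtain rfl := hq h2
      obtain ⟨h5, h6⟩ := isPrefixCode_funCode (isPrefixCode_finCode M) _ _ _ _ h4
      have e : o = o' := (Fintype.equivFin (S.Out q)).injective (Fin.ext h3)
      exact ⟨Or.inl (by rw [Fin.ext h1, e, funext h5]), h6⟩
    | nand => simp [Step.code] at h
    | coin => simp [Step.code] at h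
    | call => simp [Step.code] at h
  | call C =>
    cases t' with
    | call C' =>
      obtain ⟨w, reg, G, Q⟩ := C
      obtain ⟨w', reg', G', Q'⟩ := C'
      simp only [Step.code, List.cons_append, List.cons.injEq, true_and] at h
      obtain ⟨rfl, h⟩ := h
      simp only [List.append_assoc] at h
      obtain ⟨h1, h2⟩ := isPrefixCode_funCode (isPrefixCode_finCode M) _ _ _ _ h
      obtain ⟨h3, h4⟩ := isPrefixCode_funCode
        (isPrefixCode_listCode (isPrefixCode_gateSlot hD M)) _ _ _ _ h2
      obtain ⟨h5, h6⟩ := isPrefixCode_funCode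
        (isPrefixCode_listCode (isPrefixCode_oracleSlot hq M)) _ _ _ _ h4
      have e1 : reg = reg' := DFunLike.ext _ _ h1
      have e2 : Q = Q' := funext fun i => by simpa [List.forall₂_eq_eq_eq] using h5 i
      subst e1 e2
      exact ⟨Or.inr ⟨_, _, ⟨G', h3, rfl⟩, rfl, rfl⟩, h6⟩
    | nand => simp [Step.code] at h
    | coin => simp [Step.code] at h
    | query => simp [Step.code] at h

theorem sum_length_lt {α : Type*} {b : α → ℕ} (hb : ∀ a, 1 ≤ b a) (l : List α) :
    l.length ≤ (l.map b).sum := by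
  have h1 := List.card_nsmul_le_sum (l.map b) 1 (by
    intro x hx
    obtain ⟨t, _, rfl⟩ := List.mem_map.1 hx
    exact hb t)
  simpa using h1

theorem fits_step {D : ℕ} {S : OracleSig} {cq : S.Q → ℕ}
    (hq : ∀ q, cq q ≤ Fintype.card (S.In q))
    (ho : ∀ q, Fintype.card (S.Out q) ≤ Fintype.card (S.In q)) {d M B : ℕ}
    (hB : 2 * D + 4 ≤ B) (hM : M ≤ B) (t : Step S d M) (ht : t.size ≤ B) :
    Fits B ((2 * d + 40) * t.size) (t.code D cq) := by
  cases t with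
  | nand dst a b =>
    exact (((((Fits.nil B).cons (b.2.trans_le hM)).cons (a.2.trans_le hM)).cons
      (dst.2.trans_le hM)).cons (by omega)).mono (by simp only [Step.size]; omega)
  | coin dst =>
    exact (((Fits.nil B).cons (dst.2.trans_le hM)).cons (by omega)).mono
      (by simp only [Step.size]; omega)
  | query dst q o inp =>
    simp only [Step.size] at ht
    have h1 : Fits B (∑ _i : S.In q, 1) (funCode finCode inp) :=
      fits_funCode (b := fun _ => 1) inp fun i => fits_finCode hM _
    have h2 := (Fintype.equivFin (S.Out q) o).2
    have h3 := ho q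
    have h4 := hq q
    refine ((((h1.cons ?_).cons ?_).cons (dst.2.trans_le hM)).cons ?_).mono ?_
    · omega
    · omega
    · omega
    · simp only [Step.size, Finset.sum_const, Finset.card_univ, smul_eq_mul, mul_one]
      nlinarith
  | call C =>
    simp only [Step.size] at ht
    have hG : ∀ i, ((C.gates i).map GateSlot.size).sum ≤
        ∑ i, ((C.gates i).map GateSlot.size).sum := fun i =>
      Finset.single_le_sum (f := fun i => ((C.gates i).map GateSlot.size).sum)
        (fun _ _ => Nat.zero_le _) (Finset.mem_univ i)
    have hQ : ∀ i, ((C.queries i).map OracleSlot.size).sum ≤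
        ∑ i, ((C.queries i).map OracleSlot.size).sum := fun i =>
      Finset.single_le_sum (f := fun i => ((C.queries i).map OracleSlot.size).sum)
        (fun _ _ => Nat.zero_le _) (Finset.mem_univ i)
    have h1 : Fits B (∑ _i : Fin C.w, 1) (funCode finCode C.reg) :=
      fits_funCode (b := fun _ => 1) C.reg fun i => fits_finCode hM _
    have h2 : Fits B (∑ i, (((C.gates i).map fun g => 35 * g.size).sum + 1))
        (funCode (listCode (GateSlot.code D)) C.gates) :=
      fits_funCode (b := fun l => (l.map fun g => 35 * g.size).sum + 1) C.gates fun i => by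
        have hl := sum_length_lt (b := GateSlot.size) (fun g => by unfold GateSlot.size; omega)
          (C.gates i)
        refine fits_listCode (C.gates i) (by have := hG i; omega) fun g hg =>
          fits_gateSlot (by omega) hM g ?_
        have h3 := List.single_le_sum (l := (C.gates i).map GateSlot.size)
          (fun _ _ => Nat.zero_le _) _ (List.mem_map_of_mem hg)
        have := hG i
        omega
    have h3 : Fits B (∑ i, (((C.queries i).map OracleSlot.size).sum + 1))
        (funCode (listCode (OracleSlot.code cq)) C.queries) :=
      fits_funCode (b := fun l => (l.map OracleSlot.size).sum + 1) C.queries fun i => by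
        have hl := sum_length_lt (b := OracleSlot.size) (fun g => by unfold OracleSlot.size; omega)
          (C.queries i)
        refine fits_listCode (C.queries i) (by have := hQ i; omega) fun g hg =>
          fits_oracleSlot hq hM g ?_
        have h3 := List.single_le_sum (l := (C.queries i).map OracleSlot.size)
          (fun _ _ => Nat.zero_le _) _ (List.mem_map_of_mem hg)
        have := hQ i
        omega
    refine (((h1.append (h2.append h3)).cons (x := C.w) ?_).cons (x := 3) ?_).mono ?_
    · omega
    · omega
    · simp only [Step.size, Finset.sum_add_distrib, List.sum_map_mul_left, ← Finset.mul_sum,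
        Finset.sum_const, Finset.card_univ, Fintype.card_fin, smul_eq_mul, mul_one]
      generalize ∑ i, ((C.gates i).map GateSlot.size).sum = X
      generalize ∑ i, ((C.queries i).map OracleSlot.size).sum = Y
      have h5 := Nat.mul_le_mul_left (2 * d) (show 1 ≤ 1 + C.w + X + Y by omega)
      linarith

/-- The code of a scheme. -/
noncomputable def Scheme.code (D : ℕ) {S : OracleSig} (cq : S.Q → ℕ) {d : ℕ} (A : Scheme S d) :
    List ℕ := A.M :: (A.out : ℕ) :: listCode (Step.code D cq) A.steps

/-- The code determines a scheme up to the rounding of its gates. -/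
theorem isPrefixCode_scheme {D : ℕ} (hD : 0 < D) {S : OracleSig} {cq : S.Q → ℕ}
    (hq : Function.Injective cq) (d : ℕ) :
    IsPrefixCode (Scheme.code D cq (d := d)) (Scheme.Close (2 / D)) := by
  rintro ⟨M, l, out⟩ ⟨M', l', out'⟩ r r' h
  simp only [Scheme.code, List.cons_append, List.cons.injEq] at h
  obtain ⟨rfl, h1, h2⟩ := h
  obtain ⟨h3, h4⟩ := isPrefixCode_listCode (isPrefixCode_step hD hq d M) _ _ _ _ h2
  obtain rfl := Fin.ext h1
  exact ⟨⟨l', h3, rfl⟩, h4⟩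

/-- The length of the code is linear in the size of the scheme, and the numbers in it, namely
addresses, lengths, kinds of queries and rounded entries, are all below `B`. -/
theorem fits_scheme {D : ℕ} {S : OracleSig} {cq : S.Q → ℕ}
    (hq : ∀ q, cq q ≤ Fintype.card (S.In q))
    (ho : ∀ q, Fintype.card (S.Out q) ≤ Fintype.card (S.In q)) {d B : ℕ} (hB : 2 * D + 4 ≤ B)
    (A : Scheme S d) (hA : A.size < B) :
    Fits B ((2 * d + 40) * (A.size + 1)) (A.code D cq) := by
  obtain ⟨h1, h2, h3⟩ := Scheme.size_le (le_refl A.size)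
  refine (((fits_listCode (b := fun t => (2 * d + 40) * t.size) A.steps (by omega) fun t ht =>
    fits_step hq ho hB (by omega) t ((h3 t ht).trans hA.le)).cons
      (A.out.2.trans (by omega))).cons (by omega)).mono ?_
  rw [List.sum_map_mul_left]
  unfold Scheme.size
  nlinarith

/-- Up to a change of the acceptance probabilities by at most `1 / 20`, there are at most
`2 ^ P` schemes of size `s`, for a polynomial `P` in `s`. -/
theorem exists_scheme_index {S : OracleSig} {cq : S.Q → ℕ} (hq : Function.Injective cq)
    (hq' : ∀ q, cq q ≤ Fintype.card (S.In q))
    (ho : ∀ q, Fintype.card (S.Out q) ≤ Fintype.card (S.In q)) (d s : ℕ) :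
    ∃ idx : Scheme S d → (Fin ((2 * d + 40) * (s + 1)) → Fin (640 * (s + 1))),
      ∀ A A', A.size ≤ s → A'.size ≤ s → idx A = idx A' → ∀ (O : S.Oracle) (n : ℕ) (x : Bits n),
        |A.acceptProb O x - A'.acceptProb O x| ≤ 1 / 20 := by
  set B := 640 * (s + 1) with hB
  set ℓ := (2 * d + 40) * (s + 1) with hℓ
  set D := 320 * s + 1 with hD
  -- The index is the code, filled up with zeros; a prefix code can still be read.
  refine ⟨fun A i => ⟨(A.code D cq).getD i 0 % B, Nat.mod_lt _ (by omega)⟩, ?_⟩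
  intro A A' hA hA' h O n x
  have key : ∀ A : Scheme S d, A.size ≤ s →
      A.code D cq ++ List.replicate (ℓ - (A.code D cq).length) 0 =
      List.ofFn fun i : Fin ℓ => (A.code D cq).getD i 0 % B := by
    intro A hA
    have hf := (fits_scheme (D := D) (B := B) hq' ho (by omega) A (by omega)).mono
      (Nat.mul_le_mul_left _ (Nat.succ_le_succ hA))
    refine List.ext_getElem (by
      rw [List.length_append, List.length_replicate, List.length_ofFn]
      exact Nat.add_sub_cancel' hf.1) fun i h1 h2 => ?_
    rw [List.getElem_ofFn]
    by_cases hi : i < (A.code D cq).length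
    · rw [List.getElem_append_left hi, List.getD_eq_getElem _ _ hi,
        Nat.mod_eq_of_lt (hf.2 _ (List.getElem_mem hi))]
    · rw [List.getElem_append_right (not_lt.1 hi), List.getElem_replicate,
        List.getD_eq_default _ _ (not_lt.1 hi), Nat.zero_mod]
  have h1 : A.code D cq ++ List.replicate (ℓ - (A.code D cq).length) 0 =
      A'.code D cq ++ List.replicate (ℓ - (A'.code D cq).length) 0 := by
    rw [key A hA, key A' hA']
    congr 1
    funext i
    exact congrArg Fin.val (congrFun h i)
  obtain ⟨h2, _⟩ := isPrefixCode_scheme (D := D) (by omega) hq d _ _ _ _ h1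
  refine (h2.abs_acceptProb_sub_le (by positivity) O x).trans ?_
  have h3 : (A.size : ℝ) ≤ s := by exact_mod_cast hA
  have h4 : (0 : ℝ) ≤ s := Nat.cast_nonneg _
  rw [hD]
  push_cast
  rw [mul_div_assoc', div_mul_eq_mul_div, div_le_div_iff₀ (by positivity) (by norm_num)]
  linarith

/-! ### Many salts at once -/

section moments
variable {d n : ℕ} {Salt : Type} [Fintype Salt] [DecidableEq Salt]

/-- A power of a sum of local terms is a sum of local terms, which depend on more salts. -/
theorem exists_local_pow {J : Type} [Fintype J] (y : J → (Salt → Bits n → Bits n) → ℝ)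
    (T : J → Finset Salt) (c : ℕ) (hy0 : ∀ j f, 0 ≤ y j f)
    (hy : ∀ j f f', (∀ a ∈ T j, f a = f' a) → y j f = y j f')
    (hc : ∀ j f, c < (T j).card → y j f = 0) (l : ℕ) :
    ∃ W : Finset Salt → (Salt → Bits n → Bits n) → ℝ, (∀ τ f, 0 ≤ W τ f) ∧
      (∀ f, ∑ τ, W τ f = (∑ j, y j f) ^ l) ∧
      (∀ τ f f', (∀ a ∈ τ, f a = f' a) → W τ f = W τ f') ∧
      ∀ τ f, l * c < τ.card → W τ f = 0 := by
  classical
  induction l with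
  | zero =>
    refine ⟨fun τ _ => if τ = ∅ then 1 else 0, fun τ f => by dsimp only; split_ifs <;> simp,
      fun f => by simp,
      fun τ f f' _ => rfl, fun τ f h => ?_⟩
    dsimp only
    rw [if_neg]
    rintro rfl
    simp at h
  | succ l ih =>
    obtain ⟨W, h0, h1, h2, h3⟩ := ih
    refine ⟨fun τ f => ∑ x : Finset Salt × J, if x.1 ∪ T x.2 = τ then W x.1 f * y x.2 f else 0,
      ?_, ?_, ?_, ?_⟩
    · intro τ f
      exact Finset.sum_nonneg fun x _ => by
        split_ifs
        · exact mul_nonneg (h0 _ _) (hy0 _ _)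
        · exact le_rfl
    · intro f
      rw [Finset.sum_comm]
      simp only [Finset.sum_ite_eq, Finset.mem_univ, if_true]
      rw [Fintype.sum_prod_type, pow_succ, ← h1, Finset.sum_mul_sum]
    · intro τ f f' h
      refine Finset.sum_congr rfl fun x _ => ?_
      split_ifs with hx
      · rw [h2 x.1 f f' fun a ha => h a (hx ▸ Finset.mem_union_left _ ha),
          hy x.2 f f' fun a ha => h a (hx ▸ Finset.mem_union_right _ ha)]
      · rfl
    · intro τ f h
      refine Finset.sum_eq_zero fun x _ => ?_
      split_ifs with hx
      · subst hx
        have hu := Finset.card_union_le x.1 (T x.2)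
        by_cases hl : l * c < x.1.card
        · rw [h3 _ _ hl, zero_mul]
        · rw [hc x.2 f (by rw [Nat.succ_mul] at h; omega), mul_zero]
      · rfl

/-- The average over all salts of the probability to be correct. -/
noncomputable def avgCorrect (acc rej : Salt → Finset (Salt × Bits n) → Hidden d n Salt → ℝ)
    (ω : Hidden d n Salt) : ℝ :=
  (Fintype.card Salt : ℝ)⁻¹ * ∑ a, cappedCorrect (acc a) (rej a) a ω

theorem IsCapped.cappedCorrect_mem {c : ℕ} {acc rej : Finset (Salt × Bits n) → Hidden d n Salt → ℝ}
    (h : IsCapped c acc rej) (a : Salt) (ω : Hidden d n Salt) :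
    0 ≤ cappedCorrect acc rej a ω ∧ cappedCorrect acc rej a ω ≤ 1 := by
  have h1 : 0 ≤ ∑ k, acc k ω := Finset.sum_nonneg fun k _ => h.acc_nonneg k ω
  have h2 : 0 ≤ ∑ k, rej k ω := Finset.sum_nonneg fun k _ => h.rej_nonneg k ω
  have h3 := h.sum_le ω
  unfold cappedCorrect
  split_ifs <;> constructor <;> linarith

theorem avgCorrect_mem [Nonempty Salt] {c : ℕ}
    {acc rej : Salt → Finset (Salt × Bits n) → Hidden d n Salt → ℝ}
    (h : ∀ a, IsCapped c (acc a) (rej a)) (ω : Hidden d n Salt) :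
    0 ≤ avgCorrect acc rej ω ∧ avgCorrect acc rej ω ≤ 1 := by
  have hN : (0 : ℝ) < Fintype.card Salt := by exact_mod_cast Fintype.card_pos
  unfold avgCorrect
  refine ⟨mul_nonneg (by positivity) (Finset.sum_nonneg fun a _ => ((h a).cappedCorrect_mem a ω).1),
    ?_⟩
  rw [inv_mul_le_iff₀ hN, mul_one]
  refine (Finset.sum_le_sum fun a _ => ((h a).cappedCorrect_mem a ω).2).trans ?_
  simp

/-- The moments of the average success probability of capped processes: a salt that is independent
of those touched before contributes at most the success probability for a single function. -/
theorem sum_avgCorrect_pow_le (hn : 0 < n) [Nonempty Salt] {c R : ℕ}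
    {acc rej : Salt → Finset (Salt × Bits n) → Hidden d n Salt → ℝ}
    (h : ∀ a, IsCapped c (acc a) (rej a)) (p : Salt → Fin d → Equiv.Perm (Big d n)) {β : ℝ}
    (hβ : 1 / 2 + (c : ℝ) ^ 2 / (2 ^ n - 1) + R * (c + 1) / Fintype.card Salt ≤ β) (l : ℕ)
    (hl : l ≤ R) : ∑ f, priorAll f * avgCorrect acc rej (p, f) ^ l ≤ β ^ l := by
  classical
  have hN : (0 : ℝ) < Fintype.card Salt := by exact_mod_cast Fintype.card_pos
  have h2n : (0 : ℝ) < 2 ^ n - 1 := by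
    have : (1 : ℝ) < 2 ^ n := one_lt_pow₀ (by norm_num) hn.ne'
    linarith
  have hβ0 : 0 ≤ β := le_trans (by positivity) hβ
  induction l with
  | zero => simp [sum_priorAll hn]
  | succ l ih =>
    let y : Salt × Finset (Salt × Bits n) → (Salt → Bits n → Bits n) → ℝ := fun j f =>
      (Fintype.card Salt : ℝ)⁻¹ *
        if IsSimon (f j.1) then acc j.1 j.2 (p, f) else rej j.1 j.2 (p, f)
    have hy : ∀ f, ∑ j, y j f = avgCorrect acc rej (p, f) := by
      intro f
      rw [← Finset.mul_sum, Fintype.sum_prod_type, avgCorrect]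
      congr 1
      refine Finset.sum_congr rfl fun a _ => ?_
      unfold cappedCorrect
      dsimp only
      split_ifs <;> rfl
    -- The power `l` of the average is a sum of terms `W τ`, each of which depends on the functions
    -- of at most `l * (c + 1)` salts `τ`.
    obtain ⟨W, h0, h1, h2, h3⟩ := exists_local_pow y (fun j => insert j.1 (j.2.image Prod.fst))
      (c + 1) (fun j f => mul_nonneg (by positivity) (by
        split_ifs
        · exact (h _).acc_nonneg _ _
        · exact (h _).rej_nonneg _ _))
      (fun j f f' hf => by
        have e : f j.1 = f' j.1 := hf _ (Finset.mem_insert_self _ _)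
        have e' : ∀ x ∈ j.2, f x.1 x.2 = f' x.1 x.2 := fun x hx => congrFun (hf x.1
          (Finset.mem_insert_of_mem (Finset.mem_image_of_mem _ hx))) _
        simp only [y, e, (h j.1).acc_locality j.2 p f f' e', (h j.1).rej_locality j.2 p f f' e'])
      (fun j f hj => by
        have h4 := (Finset.card_insert_le j.1 (j.2.image Prod.fst)).trans
          (Nat.add_le_add_right Finset.card_image_le 1)
        have h5 := (h j.1).card_le j.2 (by omega) (p, f)
        simp only [y, h5.1, h5.2, ite_self, mul_zero]) l
    simp only [hy] at h1
    have key : ∀ τ, ∑ f, priorAll f * (W τ f * avgCorrect acc rej (p, f)) ≤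
        β * ∑ f, priorAll f * W τ f := by
      intro τ
      have hW0 : 0 ≤ ∑ f, priorAll f * W τ f :=
        Finset.sum_nonneg fun f _ => mul_nonneg (priorAll_nonneg f) (h0 _ _)
      by_cases hτ : l * (c + 1) < τ.card
      · simp [h3 _ _ hτ]
      -- For the few salts in `τ` the success probability is bounded by `1`; for the others the
      -- function is independent of `W τ`.
      have hone : ∀ a, ∑ f, priorAll f * (W τ f * cappedCorrect (acc a) (rej a) a (p, f)) ≤
          (1 / 2 + (c : ℝ) ^ 2 / (2 ^ n - 1) + if a ∈ τ then 1 else 0) *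
            ∑ f, priorAll f * W τ f := by
        intro a
        split_ifs with ha
        · refine le_trans (Finset.sum_le_sum fun f _ => mul_le_mul_of_nonneg_left
            (mul_le_of_le_one_right (h0 _ _) ((h a).cappedCorrect_mem a (p, f)).2)
            (priorAll_nonneg f)) ?_
          refine le_mul_of_one_le_left hW0 ?_
          have : 0 ≤ (c : ℝ) ^ 2 / (2 ^ n - 1) := by positivity
          linarith
        · rw [add_zero]
          exact sum_cappedCorrect_le hn (h a) a p (W τ) (h0 τ) fun f g =>
            h2 τ _ _ fun b hb => Function.update_of_ne (by rintro rfl; exact ha hb) _ _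
      calc _ = (Fintype.card Salt : ℝ)⁻¹ *
            ∑ a, ∑ f, priorAll f * (W τ f * cappedCorrect (acc a) (rej a) a (p, f)) := by
            rw [Finset.sum_comm, Finset.mul_sum]
            refine Finset.sum_congr rfl fun f _ => ?_
            rw [avgCorrect, Finset.mul_sum, Finset.mul_sum, Finset.mul_sum, Finset.mul_sum]
            exact Finset.sum_congr rfl fun a _ => by ring
        _ ≤ (Fintype.card Salt : ℝ)⁻¹ * ∑ a, (1 / 2 + (c : ℝ) ^ 2 / (2 ^ n - 1) +
              if a ∈ τ then 1 else 0) * ∑ f, priorAll f * W τ f := by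
            gcongr with a
            exact hone a
        _ = (1 / 2 + (c : ℝ) ^ 2 / (2 ^ n - 1) + τ.card / Fintype.card Salt) *
              ∑ f, priorAll f * W τ f := by
            rw [← Finset.sum_mul, Finset.sum_add_distrib]
            simp only [Finset.sum_const, Finset.card_univ, nsmul_eq_mul, Finset.sum_ite_mem,
              Finset.univ_inter, mul_one]
            field_simp
        _ ≤ _ := by
            refine mul_le_mul_of_nonneg_right (le_trans ?_ hβ) hW0
            gcongr
            have h6 : τ.card ≤ R * (c + 1) :=
              (not_lt.1 hτ).trans (Nat.mul_le_mul_right _ (by omega))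
            exact_mod_cast h6
    calc _ = ∑ τ, ∑ f, priorAll f * (W τ f * avgCorrect acc rej (p, f)) := by
          rw [Finset.sum_comm]
          refine Finset.sum_congr rfl fun f _ => ?_
          rw [← Finset.mul_sum, ← Finset.sum_mul, h1, pow_succ]
      _ ≤ ∑ τ, β * ∑ f, priorAll f * W τ f := Finset.sum_le_sum fun τ _ => key τ
      _ = β * ∑ f, priorAll f * avgCorrect acc rej (p, f) ^ l := by
          rw [← Finset.mul_sum, Finset.sum_comm]
          congr 1
          refine Finset.sum_congr rfl fun f _ => ?_
          rw [← Finset.mul_sum, h1]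
      _ ≤ β * β ^ l := mul_le_mul_of_nonneg_left (ih (by omega)) hβ0
      _ = _ := (pow_succ' _ _).symm

/-- Whatever the advice `u` is, the average success probability exceeds `3 / 5` only with tiny
probability. -/
theorem sum_advice_mul_avgCorrect_le (hn : 0 < n) [Nonempty Salt] {c R : ℕ}
    {acc rej : Salt → Finset (Salt × Bits n) → Hidden d n Salt → ℝ}
    (h : ∀ a, IsCapped c (acc a) (rej a))
    (hβ : 1 / 2 + (c : ℝ) ^ 2 / (2 ^ n - 1) + R * (c + 1) / Fintype.card Salt ≤ 11 / 20)
    {u : Hidden d n Salt → ℝ} (hu : ∀ ω, 0 ≤ u ω ∧ u ω ≤ 1) :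
    ∑ ω, hiddenPrior ω * u ω * avgCorrect acc rej ω ≤
      3 / 5 * ∑ ω, hiddenPrior ω * u ω + (11 / 12) ^ R := by
  have hpt : ∀ ω, hiddenPrior ω * u ω * avgCorrect acc rej ω ≤
      3 / 5 * (hiddenPrior ω * u ω) +
        hiddenPrior ω * ((5 / 3) ^ R * avgCorrect acc rej ω ^ R) := by
    intro ω
    obtain ⟨h1, h2⟩ := avgCorrect_mem h ω
    obtain ⟨h3, h4⟩ := hu ω
    have h5 : u ω * avgCorrect acc rej ω ≤
        3 / 5 * u ω + (5 / 3) ^ R * avgCorrect acc rej ω ^ R := by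
      have h6 : 0 ≤ (5 / 3 : ℝ) ^ R * avgCorrect acc rej ω ^ R := by positivity
      -- If the average exceeds `3 / 5`, then the moment term is at least `1`.
      by_cases hx : avgCorrect acc rej ω ≤ 3 / 5
      · nlinarith
      · have h7 : (1 : ℝ) ≤ (5 / 3) ^ R * avgCorrect acc rej ω ^ R := by
          rw [← mul_pow]
          exact one_le_pow₀ (by linarith)
        nlinarith
    have h6 := mul_le_mul_of_nonneg_left h5 (hiddenPrior_nonneg ω)
    linarith
  have hpow : ∑ ω, hiddenPrior ω * ((5 / 3) ^ R * avgCorrect acc rej ω ^ R) ≤ (11 / 12) ^ R := by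
    refine sum_hiddenPrior_mul_le fun p => ?_
    have h1 := sum_avgCorrect_pow_le hn h p hβ R le_rfl
    calc _ = (5 / 3) ^ R * ∑ f, priorAll f * avgCorrect acc rej (p, f) ^ R := by
          rw [Finset.mul_sum]
          exact Finset.sum_congr rfl fun f _ => by ring
      _ ≤ (5 / 3) ^ R * (11 / 20) ^ R := by gcongr
      _ = _ := by rw [← mul_pow]; norm_num
  refine (Finset.sum_le_sum fun ω _ => hpt ω).trans ?_
  rw [Finset.sum_add_distrib, ← Finset.mul_sum]
  exact add_le_add_right hpow _

theorem prior_eq_zero {f : Bits n → Bits n} (h : ¬ (IsSimon f ∨ Function.Injective f)) :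
    prior f = 0 := by
  unfold prior
  rw [if_neg fun h1 => h (Or.inl h1), if_neg fun h1 => h (Or.inr h1)]
  simp

theorem hiddenPrior_eq_zero {ω : Hidden d n Salt} {a : Salt}
    (h : ¬ (IsSimon (ω.2 a) ∨ Function.Injective (ω.2 a))) : hiddenPrior ω = 0 := by
  unfold hiddenPrior priorAll
  rw [Finset.prod_eq_zero (Finset.mem_univ a) (prior_eq_zero h), mul_zero]

theorem correct_sub_le (f : Salt → Bits n → Bits n) (a : Salt) {x y : ℝ} {δ : ℝ}
    (h : |x - y| ≤ δ) : correct f a x - δ ≤ correct f a y := by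
  have := abs_le.1 h
  unfold correct
  split_ifs <;> linarith

end moments

set_option synthInstance.maxSize 256 in
/-- Some choice of the functions and of the shufflings defeats all schemes of bounded size at
once: every scheme errs for some string. -/
theorem exists_hidden_defeating {S : OracleSig} {cq : S.Q → ℕ} (hq : Function.Injective cq)
    (hq' : ∀ q, cq q ≤ Fintype.card (S.In q))
    (ho : ∀ q, Fintype.card (S.Out q) ≤ Fintype.card (S.In q)) {d n : ℕ} (hn : 0 < n)
    (Fr : OracleFrame S d n (Bits n)) {s P : ℕ}
    (hP : (640 * (s + 1)) ^ ((2 * d + 40) * (s + 1)) ≤ 2 ^ P)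
    (h1 : errorPoly d s P / 2 ^ (n / 8) ≤ 1 / 200)
    (h2 : (1 + 2 * (8 * (P + 8) : ℕ)) / (2 : ℝ) ^ (n / 8) ≤ 1 / 20) :
    ∃ ω : Hidden d n (Bits n), (∀ a, IsSimon (ω.2 a) ∨ Function.Injective (ω.2 a)) ∧
      ∀ A : Scheme S d, A.size ≤ s → ∃ a : Bits n,
        correct ω.2 a (A.acceptProb (Fr.oracle ω.answer) a) < 2 / 3 := by
  classical
  -- Otherwise every `ω` has a scheme that decides all strings. The index of that scheme is advice
  -- of length `P`; for each fixed index a single scheme is correct on average with probability more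
  -- than `3 / 5`, which for a fixed scheme happens with probability less than `2 ^ (-P)`.
  by_contra hcon
  push Not at hcon
  obtain ⟨I, _, idx, hcard, hidx⟩ : ∃ (I : Type) (_ : Fintype I) (idx : Scheme S d → I),
      Fintype.card I ≤ 2 ^ P ∧ ∀ A A', A.size ≤ s → A'.size ≤ s → idx A = idx A' →
        ∀ (O : S.Oracle) (n : ℕ) (x : Bits n),
          |A.acceptProb O x - A'.acceptProb O x| ≤ 1 / 20 := by
    obtain ⟨idx, hidx⟩ := exists_scheme_index hq hq' ho d s
    exact ⟨_, inferInstance, idx, by simpa using hP, hidx⟩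
  have hcardI : (Fintype.card I : ℝ) ≤ 2 ^ P := by exact_mod_cast hcard
  -- The best scheme for `ω`, and a representative of the schemes with a given index.
  have hbest : ∀ ω : Hidden d n (Bits n), ∃ i : I,
      (∀ a, IsSimon (ω.2 a) ∨ Function.Injective (ω.2 a)) → ∃ A : Scheme S d, A.size ≤ s ∧
        idx A = i ∧ ∀ a : Bits n, 2 / 3 ≤ correct ω.2 a (A.acceptProb (Fr.oracle ω.answer) a) := by
    intro ω
    by_cases hω : ∀ a, IsSimon (ω.2 a) ∨ Function.Injective (ω.2 a)
    · obtain ⟨A, hA, hA'⟩ := hcon ω hω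
      exact ⟨idx A, fun _ => ⟨A, hA, rfl, hA'⟩⟩
    · exact ⟨idx ⟨1, [], 0⟩, fun h => absurd h hω⟩
  choose best hbest using hbest
  let u : I → Hidden d n (Bits n) → ℝ := fun i ω => if best ω = i then 1 else 0
  have hu : ∀ i ω, 0 ≤ u i ω ∧ u i ω ≤ 1 := fun i ω => by
    simp only [u]; split_ifs <;> simp
  have hβ : 1 / 2 + (((2 ^ (n / 8) : ℕ) : ℝ)) ^ 2 / (2 ^ n - 1) +
      (8 * (P + 8) : ℕ) * (((2 ^ (n / 8) : ℕ) : ℝ) + 1) / Fintype.card (Bits n) ≤ 11 / 20 := by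
    have h3 := cap_advantage_le hn
    have hT : (1 : ℝ) ≤ 2 ^ (n / 8) := one_le_pow₀ (by norm_num)
    have h4 : (2 : ℝ) ^ (n / 8) * 2 ^ (n / 8) ≤ 2 ^ n := by
      rw [← pow_add]
      exact pow_le_pow_right₀ (by norm_num) (by omega)
    have h5 : ((8 * (P + 8) : ℕ) : ℝ) * (((2 ^ (n / 8) : ℕ) : ℝ) + 1) / Fintype.card (Bits n) ≤
        2 * (8 * (P + 8) : ℕ) / 2 ^ (n / 8) := by
      -- Here the moment `R = 8 * (P + 8)` beats the number `2 ^ P` of indices, as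
      -- `(11 / 12) ^ 8 ≤ 1 / 2`.
      have hR : (0 : ℝ) ≤ (8 * (P + 8) : ℕ) := Nat.cast_nonneg _
      have : (Fintype.card (Bits n) : ℝ) = 2 ^ n := by simp
      rw [this, div_le_div_iff₀ (by positivity) (by positivity)]
      generalize (((8 * (P + 8) : ℕ) : ℝ)) = r at hR
      push_cast
      nlinarith [mul_le_mul_of_nonneg_left h4 hR, mul_le_mul_of_nonneg_left hT hR,
        mul_nonneg hR (mul_nonneg (sub_nonneg.2 hT) (zero_le_one.trans hT))]
    rw [add_div] at h2
    linarith
  have hR : (11 / 12 : ℝ) ^ (8 * (P + 8)) ≤ 1 / 2 ^ P / 256 := by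
    rw [pow_mul]
    calc ((11 / 12 : ℝ) ^ 8) ^ (P + 8) ≤ (1 / 2) ^ (P + 8) := by
          gcongr; norm_num
      _ = _ := by rw [pow_add, one_div_pow]; norm_num [div_eq_mul_inv]
  have hU : ∑ i, ∑ ω, hiddenPrior ω * u i ω = 1 := by
    rw [Finset.sum_comm, ← sum_hiddenPrior (d := d) (Salt := Bits n) hn]
    refine Finset.sum_congr rfl fun ω _ => ?_
    rw [← Finset.mul_sum]
    simp [u]
  have hN : (0 : ℝ) < Fintype.card (Bits n) := by exact_mod_cast Fintype.card_pos
  -- The contribution of one index to the average success probability.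
  have hper : ∀ i : I, (2 / 3 - 1 / 20) * ∑ ω, hiddenPrior ω * u i ω ≤
      3 / 5 * ∑ ω, hiddenPrior ω * u i ω + 1 / 2 ^ P / 256 +
        1 / 200 * (∑ ω, hiddenPrior ω * u i ω + 1 / 2 ^ P) := by
    intro i
    have hP0 : (0 : ℝ) < 1 / 2 ^ P := by positivity
    have hUi : 0 ≤ ∑ ω, hiddenPrior ω * u i ω :=
      Finset.sum_nonneg fun ω _ => mul_nonneg (hiddenPrior_nonneg ω) (hu i ω).1
    by_cases hrep : ∃ A : Scheme S d, A.size ≤ s ∧ idx A = i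
    swap
    · have hz : ∑ ω, hiddenPrior ω * u i ω = 0 := by
        refine Finset.sum_eq_zero fun ω _ => ?_
        by_cases hω : ∀ a, IsSimon (ω.2 a) ∨ Function.Injective (ω.2 a)
        · obtain ⟨A, hA, hi, _⟩ := hbest ω hω
          simp only [u]
          rw [if_neg, mul_zero]
          rintro rfl
          exact hrep ⟨A, hA, hi⟩
        · obtain ⟨a, ha⟩ := not_forall.1 hω
          rw [hiddenPrior_eq_zero ha, zero_mul]
      rw [hz]
      linarith
    obtain ⟨A, hA, hAi⟩ := hrep
    choose acc rej hcap hle using fun a : Bits n => Scheme.exists_capped Fr hn (by simp) (hu i) hA P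
      (fun r => if h : (r : ℕ) < n then a ⟨r, h⟩ else false) a
    have h3 := sum_advice_mul_avgCorrect_le hn hcap hβ (hu i)
    have h4 : ∀ a : Bits n, (2 / 3 - 1 / 20) * ∑ ω, hiddenPrior ω * u i ω ≤
        ∑ ω, hiddenPrior ω * u i ω *
          correct ω.2 a (A.acceptProb (Fr.oracle ω.answer) a) := by
      intro a
      rw [Finset.mul_sum]
      refine Finset.sum_le_sum fun ω _ => ?_
      by_cases hω : ∀ a, IsSimon (ω.2 a) ∨ Function.Injective (ω.2 a)
      · by_cases hi : best ω = i
        · obtain ⟨A', hA', hi', hc⟩ := hbest ω hω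
          have h5 := correct_sub_le ω.2 a (hidx A' A hA' hA (by rw [hi', hAi, hi])
            (Fr.oracle ω.answer) n a)
          rw [mul_comm]
          exact mul_le_mul_of_nonneg_left (by linarith [hc a])
            (mul_nonneg (hiddenPrior_nonneg ω) (hu i ω).1)
        · simp [u, hi]
      · obtain ⟨b, hb⟩ := not_forall.1 hω
        simp [hiddenPrior_eq_zero hb]
    have h5 : (2 / 3 - 1 / 20) * ∑ ω, hiddenPrior ω * u i ω ≤
        ∑ ω, hiddenPrior ω * u i ω * avgCorrect acc rej ω +
          errorPoly d s P / 2 ^ (n / 8) * (∑ ω, hiddenPrior ω * u i ω + 1 / 2 ^ P) := by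
      have h6 := Finset.sum_le_sum fun (a : Bits n) (_ : a ∈ Finset.univ) =>
        (h4 a).trans (hle a)
      rw [Finset.sum_const, Finset.card_univ, nsmul_eq_mul, Finset.sum_add_distrib,
        Finset.sum_const, Finset.card_univ, nsmul_eq_mul] at h6
      have h7 : ∑ a : Bits n, ∑ ω, hiddenPrior ω * u i ω * cappedCorrect (acc a) (rej a) a ω =
          Fintype.card (Bits n) * ∑ ω, hiddenPrior ω * u i ω * avgCorrect acc rej ω := by
        rw [Finset.sum_comm, Finset.mul_sum]
        refine Finset.sum_congr rfl fun ω _ => ?_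
        rw [avgCorrect, ← Finset.mul_sum]
        field_simp
      rw [h7, ← mul_add] at h6
      exact le_of_mul_le_mul_left h6 hN
    have h6 := mul_le_mul_of_nonneg_right h1 (add_nonneg hUi hP0.le)
    linarith
  -- The sum over all indices gives `37 / 60 ≤ 3 / 5 + 1 / 256 + 1 / 100`, which is false.
  have hsum := Finset.sum_le_sum fun (i : I) (_ : i ∈ Finset.univ) => hper i
  simp only [← Finset.mul_sum, Finset.sum_add_distrib, hU, Finset.sum_const, Finset.card_univ,
    nsmul_eq_mul] at hsum
  have h3 : (Fintype.card I : ℝ) * (1 / 2 ^ P) ≤ 1 := by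
    rw [mul_one_div, div_le_one (by positivity)]
    exact hcardI
  have h4 : (Fintype.card I : ℝ) * (1 / 2 ^ P / 256) = Fintype.card I * (1 / 2 ^ P) / 256 := by ring
  rw [h4] at hsum
  linarith

theorem pow_le_two_pow_mul (B m : ℕ) : B ^ m ≤ 2 ^ (B * m) := by
  rw [pow_mul]
  exact Nat.pow_le_pow_left Nat.lt_two_pow_self.le _

/-- For large `n` all schemes of size `n ^ e` are defeated at length `n`. -/
theorem eventually_exists_hidden_defeating {S : OracleSig} {cq : S.Q → ℕ}
    (hq : Function.Injective cq) (hq' : ∀ q, cq q ≤ Fintype.card (S.In q))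
    (ho : ∀ q, Fintype.card (S.Out q) ≤ Fintype.card (S.In q)) (d e : ℕ) :
    ∀ᶠ n in Filter.atTop, ∀ Fr : OracleFrame S d n (Bits n),
      ∃ ω : Hidden d n (Bits n), (∀ a, IsSimon (ω.2 a) ∨ Function.Injective (ω.2 a)) ∧
        ∀ A : Scheme S d, A.size ≤ n ^ e → ∃ a : Bits n,
          correct ω.2 a (A.acceptProb (Fr.oracle ω.answer) a) < 2 / 3 := by
  -- The advice has length `P ≤ K * s ^ 2` for schemes of size `s = n ^ e`.
  set K : ℝ := 640 * (2 * d + 40) * 4 with hK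
  set K₁ : ℝ := (17 + 2 * d + 2 * knownConst d d) * (K + 1) with hK₁
  have ht1 := (tendsto_pow_div_two_pow (4 * e)).const_mul K₁
  have ht2 := (tendsto_pow_div_two_pow (2 * e)).const_mul (129 + 16 * K)
  rw [mul_zero] at ht1 ht2
  filter_upwards [Filter.eventually_ge_atTop 1,
    ht1.eventually (ge_mem_nhds (show (0 : ℝ) < 1 / 200 by norm_num)),
    ht2.eventually (ge_mem_nhds (show (0 : ℝ) < 1 / 20 by norm_num))] with n hn h1 h2 Fr
  set s := n ^ e with hs
  have hs1 : 1 ≤ s := Nat.one_le_pow _ _ hn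
  obtain ⟨P, hP⟩ : ∃ P, P = 640 * (s + 1) * ((2 * d + 40) * (s + 1)) := ⟨_, rfl⟩
  have hs1' : (1 : ℝ) ≤ s := by exact_mod_cast hs1
  have hPK : (P : ℝ) ≤ K * s ^ 2 := by
    rw [hP, hK]
    push_cast
    have : ((s : ℝ) + 1) * (s + 1) ≤ 4 * s ^ 2 := by nlinarith
    calc (640 * ((s : ℝ) + 1) * ((2 * d + 40) * (s + 1))) =
          640 * (2 * d + 40) * ((s + 1) * (s + 1)) := by ring
      _ ≤ 640 * (2 * d + 40) * (4 * s ^ 2) := by gcongr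
      _ = _ := by ring
  have hs2 : (s : ℝ) ^ 2 = n ^ (2 * e) := by
    rw [hs]; push_cast; ring
  have hs4 : (s : ℝ) ^ 2 * s ^ 2 = n ^ (4 * e) := by
    rw [hs2]; ring
  have hs21 : (1 : ℝ) ≤ s ^ 2 := one_le_pow₀ hs1'
  refine exists_hidden_defeating hq hq' ho hn Fr (P := P) ?_ ?_ ?_
  · rw [hP]
    exact pow_le_two_pow_mul _ _
  · refine le_trans ?_ h1
    rw [← mul_div_assoc]
    refine div_le_div_of_nonneg_right ?_ (by positivity)
    refine (errorPoly_le d P hs1).trans ?_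
    have hC := knownConst_nonneg d d
    rw [hK₁, ← hs4, mul_assoc]
    refine mul_le_mul_of_nonneg_left ?_ (by positivity)
    nlinarith
  · refine le_trans ?_ h2
    rw [← mul_div_assoc]
    refine div_le_div_of_nonneg_right ?_ (by positivity)
    rw [← hs2]
    push_cast
    nlinarith

/-! ### An oracle relative to which circuits of depth `d` fail -/

section family
variable {d : ℕ}

/-- The length of the strings in a query to the family of shuffling oracles. -/
def familyKind (q : (familySig d).Q) : ℕ := q

theorem card_familySig_in (q : (familySig d).Q) :
    Fintype.card ((familySig d).In q) = familyKind q + ((d + 1) + (d + 2) * familyKind q) := by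
  change Fintype.card (Fin (familyKind q) ⊕ Fin (d + 1) ⊕ Fin ((d + 2) * familyKind q)) = _
  rw [Fintype.card_sum, Fintype.card_sum, Fintype.card_fin, Fintype.card_fin, Fintype.card_fin]

theorem card_familySig_out (q : (familySig d).Q) :
    Fintype.card ((familySig d).Out q) = (d + 2) * familyKind q + 1 := by
  change Fintype.card (Option (Fin ((d + 2) * familyKind q))) = _
  rw [Fintype.card_option, Fintype.card_fin]

open Classical in
/-- What a query to the family of shuffling oracles asks for. -/
noncomputable def familyParse (d q : ℕ) (z : (familySig d).In q → Bool) :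
    Option (Bits q × Fin (d + 1) × Big d q) :=
  if h : ∃ j : Fin (d + 1), ∀ i, z (Sum.inr (Sum.inl i)) = true ↔ i = j then
    some (fun i => z (Sum.inl i), h.choose, fun i => z (Sum.inr (Sum.inr i))) else none

/-- Queries of kind `n` to a family of shuffling oracles; all other queries are answered by `O`. -/
noncomputable def familyFrame (d n : ℕ) (O : (familySig d).Oracle) :
    OracleFrame (familySig d) d n (Bits n) where
  parse := fun (q : ℕ) z => if h : q = n then h ▸ familyParse d q z else none
  enc := fun (q : ℕ) z o => if h : q = n then encodeAnswer (h ▸ o : Option (Big d q)) else O q z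

/-- Replacing the functions and shufflings at length `n` means to answer the queries of kind `n` by
the hidden data, and all others as before. -/
theorem familyFrame_oracle {n : ℕ} (O : (familySig d).Oracle) (ω : Hidden d n (Bits n))
    (f : ∀ n, Bits n → (Bits n → Bits n)) (F : ∀ n, Bits n → Shuffle d n) (hf : f n = ω.2)
    (hF : F n = fun a => toShuffle (ω.1 a)) (hO : ∀ q : ℕ, q ≠ n → familyOracle f F q = O q) :
    (familyFrame d n O).oracle ω.answer = familyOracle f F := by
  funext (q : ℕ) z
  by_cases hq : q = n
  · subst hq
    have e1 : (familyFrame d q O).parse q z = familyParse d q z := dif_pos rfl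
    have e2 : ∀ o, (familyFrame d q O).enc q z o = encodeAnswer o := fun o => dif_pos rfl
    unfold OracleFrame.oracle
    rw [e1, e2]
    unfold familyOracle shufflingAnswer familyParse
    rw [hf, hF]
    dsimp only
    congr 1
    split_ifs with h
    · simp only [Option.bind_some, shuffling_toShuffle]
    · rfl
  · rw [hO q hq]
    exact dif_neg hq

/-! A scheme uses only oracle queries of bounded kind. -/

theorem applyOracleGates_congr {S : OracleSig} {w : ℕ} {O O' : S.Oracle}
    {L : List (OracleGate S w)} (h : ∀ g ∈ L, O g.q = O' g.q) (ψ : Bits w → ℂ) :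
    applyOracleGates O L ψ = applyOracleGates O' L ψ := by
  unfold applyOracleGates
  split_ifs with hd
  · clear hd
    induction L generalizing ψ with
    | nil => rfl
    | cons g L ih =>
      rw [List.foldl_cons, List.foldl_cons, ih fun g hg => h g (List.mem_cons_of_mem _ hg)]
      unfold OracleGate.apply
      rw [h g List.mem_cons_self]
  · rfl

theorem QCall.finalState_congr {S : OracleSig} {k M : ℕ} (C : QCall S k M) {O O' : S.Oracle}
    (h : ∀ i, ∀ g ∈ C.queries i, O g.q = O' g.q) (mem : Fin M → Bool) :
    C.finalState O mem = C.finalState O' mem := by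
  unfold QCall.finalState
  dsimp only
  congr 1
  funext ψ i
  congr 1
  refine applyOracleGates_congr (fun g hg => ?_) ψ
  obtain ⟨s, hs, hsg⟩ := List.mem_filterMap.1 hg
  unfold OracleSlot.resolve at hsg
  split_ifs at hsg
  rw [← Option.some.inj hsg]
  exact h i s hs

/-- Steps of size at most `B` do not notice a change of the oracle on queries with at least `B`
input bits. -/
theorem acceptFrom_congr {S : OracleSig} {k M B : ℕ} {O O' : S.Oracle}
    (h : ∀ q, Fintype.card (S.In q) < B → O q = O' q) (out : Fin M) (l : List (Step S k M)) :
    (∀ t ∈ l, t.size ≤ B) → ∀ mem, acceptFrom O out l mem = acceptFrom O' out l mem := by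
  induction l with
  | nil => intro _ mem; rfl
  | cons t l ih =>
    intro hl mem
    have ih := ih fun t ht => hl t (List.mem_cons_of_mem _ ht)
    have ht := hl t List.mem_cons_self
    cases t with
    | nand dst a b => exact ih _
    | coin dst => simp only [acceptFrom, ih]
    | query dst q o inp =>
      simp only [Step.size] at ht
      simp only [acceptFrom, ih, h q (by omega)]
    | call C =>
      simp only [acceptFrom, ih]
      rw [C.finalState_congr]
      intro i g hg
      apply h
      have h1 := List.single_le_sum (l := (C.queries i).map OracleSlot.size)
        (fun _ _ => Nat.zero_le _) _ (List.mem_map_of_mem hg)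
      have h2 : ((C.queries i).map OracleSlot.size).sum ≤
          ∑ i, ((C.queries i).map OracleSlot.size).sum :=
        Finset.single_le_sum (f := fun i => ((C.queries i).map OracleSlot.size).sum)
          (fun _ _ => Nat.zero_le _) (Finset.mem_univ i)
      have h3 : Fintype.card (S.In g.q) + 1 ≤ g.size := by
        simp only [OracleSlot.size, Finset.sum_add_distrib, Finset.sum_const, Finset.card_univ,
          smul_eq_mul, mul_one]
        omega
      simp only [Step.size] at ht
      omega

theorem familyOracle_congr {f f' : ∀ n, Bits n → (Bits n → Bits n)}
    {F F' : ∀ n, Bits n → Shuffle d n} {q : ℕ} (hf : f q = f' q) (hF : F q = F' q) :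
    familyOracle f F q = familyOracle f' F' q := by
  unfold familyOracle
  rw [hf, hF]

/-- A family of functions with their shufflings. -/
abbrev ShuffledFamily (d : ℕ) : Type :=
  (∀ n, Bits n → (Bits n → Bits n)) × (∀ n, Bits n → Shuffle d n)

/-- The functions and the shufflings at length `n` can be replaced such that all schemes of size
`s` fail at that length. -/
theorem exists_update_defeating {n s : ℕ}
    (h : ∀ Fr : OracleFrame (familySig d) d n (Bits n),
      ∃ ω : Hidden d n (Bits n), (∀ a, IsSimon (ω.2 a) ∨ Function.Injective (ω.2 a)) ∧
        ∀ A : Scheme (familySig d) d, A.size ≤ s → ∃ a : Bits n,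
          correct ω.2 a (A.acceptProb (Fr.oracle ω.answer) a) < 2 / 3) (g : ShuffledFamily d) :
    ∃ g' : ShuffledFamily d, (∀ m, m ≠ n → g'.1 m = g.1 m ∧ g'.2 m = g.2 m) ∧
      (∀ a, IsSimon (g'.1 n a) ∨ Function.Injective (g'.1 n a)) ∧
      ∀ A : Scheme (familySig d) d, A.size ≤ s → ∃ a : Bits n,
        correct (g'.1 n) a (A.acceptProb (familyOracle g'.1 g'.2) a) < 2 / 3 := by
  obtain ⟨ω, h1, h2⟩ := h (familyFrame d n (familyOracle g.1 g.2))
  have e := familyFrame_oracle (familyOracle g.1 g.2) ω (Function.update g.1 n ω.2)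
    (Function.update g.2 n fun a => toShuffle (ω.1 a)) (Function.update_self _ _ _)
    (Function.update_self _ _ _) fun q hq => familyOracle_congr (Function.update_of_ne hq _ _)
      (Function.update_of_ne hq _ _)
  refine ⟨(Function.update g.1 n ω.2, Function.update g.2 n fun a => toShuffle (ω.1 a)),
    fun m hm => ⟨Function.update_of_ne hm _ _, Function.update_of_ne hm _ _⟩, ?_, ?_⟩
  · simpa only [Function.update_self] using h1
  · intro A hA
    obtain ⟨a, ha⟩ := h2 A hA
    refine ⟨a, ?_⟩
    rw [e] at ha
    simpa only [Function.update_self] using ha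

/-- Diagonalization along a sparse sequence of lengths: a scheme that fails at one of them is too
small to query the oracle at the next one. -/
theorem exists_family_defeating (d : ℕ) :
    ∃ (f : ∀ n, Bits n → (Bits n → Bits n)) (F : ∀ n, Bits n → Shuffle d n),
      (∀ n a, IsSimon (f n a) ∨ Function.Injective (f n a)) ∧
      simonLanguage f ∉ BPPBQNC (familySig d) (familyOracle f F) d := by
  have hev := fun e => Filter.eventually_atTop.1 (eventually_exists_hidden_defeating
    (S := familySig d) (cq := familyKind) (fun _ _ h => h)
    (fun q => by rw [card_familySig_in]; exact Nat.le_add_right q _)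
    (fun q => by rw [card_familySig_in, card_familySig_out]; omega) d e)
  choose T hT using hev
  -- The lengths: later ones exceed the size of the schemes that are treated earlier.
  obtain ⟨N, hN1, hN2⟩ : ∃ N : ℕ → ℕ, (∀ i, T i ≤ N i) ∧ ∀ i, N i ^ i + N i < N (i + 1) := by
    refine ⟨fun i => Nat.rec (T 0) (fun j x => max (T (j + 1)) (x ^ j + x + 1)) i, ?_, ?_⟩
    · intro i
      cases i with
      | zero => exact le_rfl
      | succ i => exact le_max_left _ _
    · intro i
      exact Nat.lt_of_succ_le (le_max_right _ _)
  have hmono : StrictMono N := strictMono_nat_of_lt_succ fun i =>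
    (Nat.le_add_left _ _).trans_lt (hN2 i)
  have hid : ∀ i, i ≤ N i := fun i => hmono.le_apply
  choose next hnext1 hnext2 hnext3 using fun (i : ℕ) (g : ShuffledFamily d) =>
    exists_update_defeating (hT i (N i) (hN1 i)) g
  let G : ℕ → ShuffledFamily d := fun i =>
    Nat.rec (⟨fun _ _ => id, fun _ _ _ => 1⟩ : ShuffledFamily d) (fun j g => next j g) i
  have hG : ∀ i, G (i + 1) = next i (G i) := fun i => rfl
  have hstep : ∀ i m, m ≠ N i → (G (i + 1)).1 m = (G i).1 m ∧ (G (i + 1)).2 m = (G i).2 m :=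
    fun i m hm => by rw [hG]; exact hnext1 i (G i) m hm
  have hstable : ∀ i m, m < N i → ∀ j, i ≤ j → (G j).1 m = (G i).1 m ∧ (G j).2 m = (G i).2 m := by
    intro i m hm j hij
    induction hij with
    | refl => exact ⟨rfl, rfl⟩
    | @step j hij ih =>
      have := hstep j m (hm.trans_le (hmono.monotone hij)).ne
      exact ⟨this.1.trans ih.1, this.2.trans ih.2⟩
  have hlim : ∀ i m, m < N i → (G (m + 1)).1 m = (G i).1 m ∧ (G (m + 1)).2 m = (G i).2 m := by
    intro i m hm
    rcases le_total i (m + 1) with h | h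
    · exact hstable i m hm _ h
    · have := hstable (m + 1) m (Nat.lt_of_succ_le (hid (m + 1))) i h
      exact ⟨this.1.symm, this.2.symm⟩
  have hgood : ∀ i m a, IsSimon ((G i).1 m a) ∨ Function.Injective ((G i).1 m a) := by
    intro i
    induction i with
    | zero => intro m a; exact Or.inr Function.injective_id
    | succ i ih =>
      intro m a
      by_cases hm : m = N i
      · subst hm
        rw [hG]
        exact hnext2 i (G i) a
      · rw [(hstep i m hm).1]
        exact ih m a
  refine ⟨fun m => (G (m + 1)).1 m, fun m => (G (m + 1)).2 m, fun m a => hgood (m + 1) m a, ?_⟩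
  rintro ⟨A, hA, hdec⟩
  obtain ⟨e, he⟩ := hA.eventually_le
  obtain ⟨n₀, hn₀⟩ := Filter.eventually_atTop.1 he
  -- The scheme is small enough at length `N i` to be among those that were defeated there.
  set i := e + n₀ + 1 with hi
  have hNi : i ≤ N i := hid i
  have hsize : (A (N i)).size ≤ N i ^ i :=
    (hn₀ (N i) (by omega)).trans (Nat.pow_le_pow_right (by omega) (by omega))
  obtain ⟨a, ha⟩ := hnext3 i (G i) (A (N i)) hsize
  rw [← hG] at ha
  -- The later changes of the oracle are at lengths that are out of reach for the scheme.
  have hacc : (A (N i)).acceptProb (familyOracle (G (i + 1)).1 (G (i + 1)).2) a =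
      (A (N i)).acceptProb (familyOracle (fun m => (G (m + 1)).1 m)
        fun m => (G (m + 1)).2 m) a := by
    refine acceptFrom_congr (B := N (i + 1)) (fun q hq => ?_) _ _ (fun t ht => ?_) _
    · rw [card_familySig_in] at hq
      have h1 := hlim (i + 1) (familyKind q) (by omega)
      exact familyOracle_congr h1.1.symm h1.2.symm
    · have h1 := (Scheme.size_le hsize).2.2 t ht
      have h2 := hN2 i
      omega
  have hfN := (hlim (i + 1) (N i) (hmono (Nat.lt_succ_self i))).1
  rw [hacc] at ha
  have hd := hdec (N i) (by omega) a
  unfold correct at ha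
  rw [← hfN] at ha
  split_ifs at ha with hs
  · exact absurd (hd.1 hs) (not_le.2 ha)
  · have := hd.2 hs
    linarith

end family

/-! ### Layers of Hadamard gates -/

/-- The parity of the bits that two strings have in common. -/
def dot {n : ℕ} (y s : Bits n) : ZMod 2 := ∑ k, if y k && s k then 1 else 0

/-- The character of the group of bit strings that belongs to `y`. -/
noncomputable def chi {n : ℕ} (y u : Bits n) : ℂ := ∏ k, if y k && u k then -1 else 1

theorem chi_eq {n : ℕ} (y u : Bits n) : chi y u = if dot y u = 0 then 1 else -1 := by
  have h2 : ∀ x : ZMod 2, x = 0 ∨ x = 1 := by decide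
  have key : ∀ t : Finset (Fin n), (∏ k ∈ t, if y k && u k then (-1 : ℂ) else 1) =
      if (∑ k ∈ t, if y k && u k then (1 : ZMod 2) else 0) = 0 then 1 else -1 := by
    intro t
    induction t using Finset.induction_on with
    | empty => simp
    | insert a t ha ih =>
      rw [Finset.prod_insert ha, Finset.sum_insert ha, ih]
      have h11 : (1 + 1 : ZMod 2) = 0 := by decide
      generalize (∑ k ∈ t, if y k && u k then (1 : ZMod 2) else 0) = x
      rcases h2 x with rfl | rfl <;> cases y a && u a <;> simp [h11]
  exact key Finset.univ

theorem chi_xorBits {n : ℕ} (y u s : Bits n) : chi y (xorBits u s) = chi y u * chi y s := by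
  unfold chi
  rw [← Finset.prod_mul_distrib]
  refine Finset.prod_congr rfl fun k _ => ?_
  unfold xorBits
  cases y k <;> cases u k <;> cases s k <;> simp

theorem norm_chi {n : ℕ} (y u : Bits n) : ‖chi y u‖ = 1 := by
  rw [chi_eq]; split_ifs <;> simp

/-- The absolute value `1 / √2` of the entries of the Hadamard gate. -/
noncomputable def hadamardConst : ℂ := ((1 / Real.sqrt 2 : ℝ) : ℂ)

theorem hadamardConst_mul_self : hadamardConst * hadamardConst = 1 / 2 := by
  unfold hadamardConst
  rw [← Complex.ofReal_mul, div_mul_div_comm, Real.mul_self_sqrt (by norm_num)]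
  norm_num

/-- The Hadamard gate. -/
noncomputable def hadamard : Matrix.unitaryGroup (Fin 1 → Bool) ℂ :=
  ⟨Matrix.of fun v u => hadamardConst * if v 0 && u 0 then -1 else 1, by
    have hc : star hadamardConst = hadamardConst := by
      unfold hadamardConst; exact Complex.conj_ofReal _
    rw [Matrix.mem_unitaryGroup_iff]
    ext v u
    rw [Matrix.mul_apply, ← (Equiv.funUnique (Fin 1) Bool).symm.sum_comp]
    have hvu : v = u ↔ v 0 = u 0 :=
      ⟨fun h => by rw [h], fun h => funext fun i => by rw [Subsingleton.elim i 0, h]⟩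
    have h2 := hadamardConst_mul_self
    simp only [Matrix.of_apply, Matrix.star_apply, Fintype.sum_bool, star_mul', hc,
      Matrix.one_apply, hvu]
    cases v 0 <;> cases u 0 <;> simp [Equiv.funUnique] <;> linear_combination 2 * h2⟩

/-- A Hadamard gate on the wire `r`. -/
noncomputable def hadamardGate {w : ℕ} (r : Fin w) : Gate w :=
  ⟨1, le_rfl, by norm_num, hadamard, fun _ => r⟩

theorem hadamardGate_apply {w : ℕ} (r : Fin w) (ψ : Bits w → ℂ) (z : Bits w) :
    (hadamardGate r).apply ψ z =
      ∑ b : Bool, (hadamardConst * if z r && b then -1 else 1) * ψ (Function.update z r b) := by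
  unfold Gate.apply hadamardGate
  dsimp only
  rw [← (Equiv.funUnique (Fin 1) Bool).symm.sum_comp]
  refine Finset.sum_congr rfl fun b _ => ?_
  congr 2
  funext i
  by_cases hi : i = r
  · subst hi
    have : Function.Injective (fun _ : Fin 1 => i) := fun a b _ => Subsingleton.elim a b
    rw [Function.update_self]
    exact this.extend_apply _ _ 0
  · rw [Function.update_of_ne hi, Function.extend_apply' _ _ _ fun ⟨_, h⟩ => hi h.symm]

/-- A layer of Hadamard gates is the Fourier transform on the wires `p`. -/
theorem foldl_hadamard {w : ℕ} : ∀ {n : ℕ} (p : Fin n → Fin w), Function.Injective p →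
    ∀ (ψ : Bits w → ℂ) (z : Bits w),
    (List.ofFn fun k => hadamardGate (p k)).foldl (fun φ g => g.apply φ) ψ z =
      hadamardConst ^ n * ∑ u : Bits n, chi (z ∘ p) u * ψ (Function.extend p u z)
  | 0, p, _, ψ, z => by
    have h : ∀ u, Function.extend p u z = z := fun u => funext fun i =>
      Function.extend_apply' _ _ _ fun ⟨k, _⟩ => k.elim0
    simp [chi, h]
  | n + 1, p, hp, ψ, z => by
    rw [List.ofFn_succ, List.foldl_cons,
      foldl_hadamard (fun k => p k.succ) (hp.comp (Fin.succ_injective n)),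
      ← (Fin.consEquiv fun _ => Bool).sum_comp, Fintype.sum_prod_type, Finset.sum_comm, pow_succ,
      mul_assoc]
    congr 1
    rw [Finset.mul_sum]
    refine Finset.sum_congr rfl fun u _ => ?_
    have h0 : ∀ k : Fin n, p k.succ ≠ p 0 := fun k h => Fin.succ_ne_zero k (hp h)
    have hz : Function.extend (fun k => p k.succ) u z (p 0) = z (p 0) :=
      Function.extend_apply' _ _ _ fun ⟨k, hk⟩ => h0 k hk
    rw [hadamardGate_apply, hz, Finset.mul_sum, Finset.mul_sum]
    refine Finset.sum_congr rfl fun b _ => ?_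
    have h1 : Function.update (Function.extend (fun k => p k.succ) u z) (p 0) b =
        Function.extend p (Fin.cons b u) z := by
      funext i
      by_cases hi : ∃ k, p k = i
      · obtain ⟨k, rfl⟩ := hi
        rw [hp.extend_apply]
        refine Fin.cases ?_ (fun k => ?_) k
        · rw [Function.update_self, Fin.cons_zero]
        · rw [Function.update_of_ne (h0 k), Fin.cons_succ]
          exact (hp.comp (Fin.succ_injective n)).extend_apply u z k
      · rw [Function.extend_apply' _ _ _ hi, Function.update_of_ne fun h => hi ⟨0, h.symm⟩,
          Function.extend_apply' _ _ _ fun ⟨k, hk⟩ => hi ⟨k.succ, hk⟩]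
    rw [h1]
    change _ = hadamardConst * (chi (z ∘ p) (Fin.cons b u) * ψ (Function.extend p (Fin.cons b u) z))
    have h2 : chi (z ∘ p) (Fin.cons b u) =
        (if z (p 0) && b then -1 else 1) * chi (z ∘ fun k => p k.succ) u := by
      unfold chi
      rw [Fin.prod_univ_succ]
      rfl
    rw [h2]
    ring

theorem applyGates_hadamard {w n : ℕ} (p : Fin n → Fin w) (hp : Function.Injective p)
    (ψ : Bits w → ℂ) (z : Bits w) :
    applyGates (List.ofFn fun k => hadamardGate (p k)) ψ z =
      hadamardConst ^ n * ∑ u : Bits n, chi (z ∘ p) u * ψ (Function.extend p u z) := by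
  unfold applyGates
  rw [if_pos, foldl_hadamard p hp]
  rw [List.map_ofFn]
  refine ⟨fun g hg => ?_, ?_⟩
  · obtain ⟨k, rfl⟩ := (List.mem_ofFn' _ _).1 hg
    exact fun (a b : Fin 1) _ => Subsingleton.elim a b
  · rw [List.pairwise_ofFn]
    intro i j hij
    rw [Set.disjoint_left]
    rintro _ ⟨_, rfl⟩ ⟨_, h⟩
    exact hij.ne' (hp h)

/-! ### The state of the circuit for Simon's problem -/

section simonState
variable {S : OracleSig} {w n : ℕ}

/-- Between two layers of Hadamard gates on the wires `p`, the queries take the basis state `g i x`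
to `g (i + 1) x`. The result is a sum over all `u` that are compatible with the other wires. -/
theorem runLayers_hadamard {D : ℕ} {O : S.Oracle} {G : ℕ → List (Gate w)}
    {Q : ℕ → List (OracleGate S w)} {p : Fin n → Fin w} (hp : Function.Injective p)
    (hG0 : G 0 = List.ofFn fun k => hadamardGate (p k))
    (hG : ∀ i, i < D → G (i + 1) = []) (hGD : G (D + 1) = List.ofFn fun k => hadamardGate (p k))
    {γ : ℕ → OracleGate S w} (hQ : ∀ i, i ≤ D → Q i = [γ i]) (hγ : ∀ i, i ≤ D → (γ i).Proper)
    {g : ℕ → Bits n → Bits w} {z₀ : Bits w} (hz₀ : ∀ k, z₀ (p k) = false)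
    (hg0 : ∀ x, g 0 x = Function.extend p x z₀)
    (hg : ∀ i, i ≤ D → ∀ x, (γ i).flip O (g i x) = g (i + 1) x)
    (hgp : ∀ x, g (D + 1) x ∘ p = x) (z : Bits w) :
    runLayers G Q (fun _ => O) (fun z => if z = z₀ then 1 else 0) (D + 1) z =
      (1 / 2) ^ n * ∑ u, if Function.extend p u z = g (D + 1) u then chi (z ∘ p) u else 0 := by
  classical
  have hlayer : ∀ i, i ≤ D → OracleLayer [γ i] := fun i hi =>
    ⟨fun x hx => by obtain rfl := List.mem_singleton.1 hx; exact hγ i hi, by simp⟩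
  have hflip : ∀ i, i ≤ D → ∀ ψ : Bits w → ℂ, applyOracleGates O (Q i) ψ =
      fun z => ψ ((γ i).flip O z) := fun i hi ψ => by
    rw [hQ i hi, applyOracleGates_eq O _ (hlayer i hi)]
    rfl
  have hiff : ∀ i, i ≤ D → ∀ z, (∃ x, (γ i).flip O z = g i x) ↔ ∃ x, z = g (i + 1) x := by
    intro i hi z
    refine exists_congr fun x => ?_
    rw [← hg i hi x]
    constructor
    · intro h
      rw [← h, (γ i).flip_flip O (hγ i hi)]
    · rintro rfl
      rw [(γ i).flip_flip O (hγ i hi)]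
  -- Before each query layer, the state is uniform on the basis states `g i x`.
  have hstate : ∀ i, i ≤ D → runLayers G Q (fun _ => O) (fun z => if z = z₀ then 1 else 0) i =
      fun z => if ∃ x, z = g i x then hadamardConst ^ n else 0 := by
    intro i
    induction i with
    | zero =>
      intro _
      funext z
      rw [runLayers, hG0, applyGates_hadamard p hp]
      have h0 : ∀ u, Function.extend p u z = z₀ ↔ (u = fun _ => false) ∧ ∃ x, z = g 0 x := by
        intro u
        constructor
        · intro h
          refine ⟨?_, z ∘ p, ?_⟩
          · rw [← extend_comp hp u z, h]
            exact funext hz₀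
          · rw [hg0, ← h, extend_extend hp, extend_comp_self]
        · rintro ⟨rfl, x, rfl⟩
          rw [hg0, extend_extend hp]
          have : (fun _ => false) = z₀ ∘ p := (funext hz₀).symm
          rw [this, extend_comp_self]
      simp only [h0]
      split_ifs with h
      · rw [Finset.sum_eq_single fun _ => false]
        · simp [h, chi]
        · intro u _ hu
          simp [hu]
        · simp
      · simp [h]
    | succ i ih =>
      intro hi
      rw [runLayers, ih (by omega), hflip i (by omega), hG i (by omega)]
      funext z
      simp only [hiff i (Nat.le_of_succ_le hi)]
      unfold applyGates
      rw [if_pos ⟨by simp, by simp⟩]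
      rfl
  rw [runLayers, hstate D le_rfl, hflip D le_rfl, hGD, applyGates_hadamard p hp]
  simp only [hiff D le_rfl]
  rw [← hadamardConst_mul_self, mul_pow, mul_assoc]
  congr 1
  rw [Finset.mul_sum]
  refine Finset.sum_congr rfl fun u _ => ?_
  have : (∃ x, Function.extend p u z = g (D + 1) x) ↔ Function.extend p u z = g (D + 1) u := by
    refine ⟨fun ⟨x, hx⟩ => ?_, fun h => ⟨u, h⟩⟩
    rw [hx]
    congr 1
    rw [← hgp x, ← hx, extend_comp hp]
  simp only [this]
  split_ifs
  · ring
  · simp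

/-- If the final basis states are invariant under a shift, then only strings that are orthogonal to
the shift are measured: the other amplitudes cancel. -/
theorem sum_chi_eq_zero {p : Fin n → Fin w} {g : Bits n → Bits w} {s : Bits n}
    (hs : ∀ z u, Function.extend p u z = g u → Function.extend p (xorBits u s) z = g (xorBits u s))
    {z : Bits w} (hz : dot (z ∘ p) s ≠ 0) :
    (∑ u, if Function.extend p u z = g u then chi (z ∘ p) u else 0) = 0 := by
  classical
  have hinv : Function.Involutive fun u : Bits n => xorBits u s := fun u => xorBits_xorBits u s
  have h1 := hinv.bijective.sum_comp
    fun u => if Function.extend p u z = g u then chi (z ∘ p) u else 0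
  have h2 : ∀ u, (Function.extend p (xorBits u s) z = g (xorBits u s)) ↔
      Function.extend p u z = g u := fun u =>
    ⟨fun h => by simpa only [hinv u] using hs z _ h, hs z u⟩
  have h3 : chi (z ∘ p) s = -1 := by rw [chi_eq, if_neg hz]
  simp only [h2, chi_xorBits, h3, mul_neg, mul_one] at h1
  have h4 : ∀ u, (if Function.extend p u z = g u then -chi (z ∘ p) u else 0) =
      -if Function.extend p u z = g u then chi (z ∘ p) u else 0 := fun u => by
    split_ifs <;> simp
  simp only [h4, Finset.sum_neg_distrib] at h1
  exact self_eq_neg.1 h1.symm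

/-- If the final basis states are determined by the other wires, then the measured string is
uniformly random: flipping one of its bits does not change the probability. -/
theorem norm_sum_chi_update {p : Fin n → Fin w} (hp : Function.Injective p) {g : Bits n → Bits w}
    (hinj : ∀ z u u', Function.extend p u z = g u → Function.extend p u' z = g u' → u = u')
    (z : Bits w) (k : Fin n) (b : Bool) :
    ‖∑ u, if Function.extend p u (Function.update z (p k) b) = g u then
        chi (Function.update z (p k) b ∘ p) u else 0‖ =
      ‖∑ u, if Function.extend p u z = g u then chi (z ∘ p) u else 0‖ := by
  classical
  have he : ∀ u, Function.extend p u (Function.update z (p k) b) = Function.extend p u z := by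
    intro u
    funext i
    by_cases hi : ∃ k, p k = i
    · obtain ⟨k, rfl⟩ := hi
      rw [hp.extend_apply, hp.extend_apply]
    · rw [Function.extend_apply' _ _ _ hi, Function.extend_apply' _ _ _ hi,
        Function.update_of_ne fun h => hi ⟨k, h.symm⟩]
  simp only [he]
  by_cases h : ∃ u, Function.extend p u z = g u
  · obtain ⟨u, hu⟩ := h
    have h1 : ∀ y : Bits n, (∑ u, if Function.extend p u z = g u then chi y u else 0) = chi y u :=
      fun y => by
        rw [Finset.sum_eq_single u (fun u' _ hu' => if_neg fun h => hu' (hinj z u' u h hu))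
          (by simp), if_pos hu]
    rw [h1, h1, norm_chi, norm_chi]
  · have h1 : ∀ u, ¬ Function.extend p u z = g u := fun u hu => h ⟨u, hu⟩
    simp [h1]

theorem dot_update {n : ℕ} {y s : Bits n} {k : Fin n} (hk : s k = true) :
    dot (Function.update y k (!y k)) s = 0 ↔ dot y s ≠ 0 := by
  have h : dot (Function.update y k (!y k)) s = dot y s + 1 := by
    unfold dot
    rw [← Finset.add_sum_erase _ _ (Finset.mem_univ k),
      ← Finset.add_sum_erase Finset.univ (fun i => if y i && s i then (1 : ZMod 2) else 0)
        (Finset.mem_univ k),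
      Finset.sum_congr rfl (g := fun i => if y i && s i then (1 : ZMod 2) else 0) fun i hi => by
        rw [Function.update_of_ne (Finset.ne_of_mem_erase hi)],
      Function.update_self, hk]
    have h11 : (1 + 1 : ZMod 2) = 0 := by decide
    cases y k
    · simp [add_comm]
    · simp only [Bool.not_true, Bool.and_true, Bool.false_eq_true, if_false, if_true]
      linear_combination -h11
  rw [h]
  generalize dot y s = x
  revert x
  decide

/-- A uniformly random string is orthogonal to a fixed nonzero one with probability `1 / 2`. -/
theorem sum_dot_eq_half {p : Fin n → Fin w} (hp : Function.Injective p) {q : Bits w → ℝ}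
    (hq : ∀ z k b, q (Function.update z (p k) b) = q z) (hq1 : ∑ z, q z = 1) {s : Bits n}
    (hs : s ≠ fun _ => false) : (∑ z, if dot (z ∘ p) s = 0 then q z else 0) = 1 / 2 := by
  obtain ⟨k, hk⟩ : ∃ k, s k = true := by
    by_contra h
    push Not at h
    exact hs (funext fun k => by simpa using h k)
  have hinv : Function.Involutive fun z : Bits w => Function.update z (p k) (!z (p k)) := by
    intro z
    simp
  -- Flipping a bit at which `s` is one exchanges the strings that are orthogonal to `s` with the
  -- others.
  have h1 := hinv.bijective.sum_comp fun z => if dot (z ∘ p) s = 0 then q z else 0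
  have h2 : ∀ z : Bits w, Function.update z (p k) (!z (p k)) ∘ p =
      Function.update (z ∘ p) k (!(z ∘ p) k) := fun z => by
    funext i
    by_cases hi : i = k
    · subst hi; simp
    · simp [hi, hp.ne hi]
  simp only [h2, dot_update hk, hq] at h1
  have h3 : (∑ z, if dot (z ∘ p) s ≠ 0 then q z else 0) +
      (∑ z, if dot (z ∘ p) s = 0 then q z else 0) = 1 := by
    rw [← Finset.sum_add_distrib, ← hq1]
    refine Finset.sum_congr rfl fun z _ => ?_
    by_cases h : dot (z ∘ p) s = 0 <;> simp [h]
  linarith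

end simonState

/-! ### Straight-line programs over the field with two elements -/

/-- The operation `dst += a * b` on registers with values in the field with two elements. -/
structure Toffoli (V : Type) where
  dst : V
  a : V
  b : V

section programs
variable {V : Type} [DecidableEq V]

/-- The contents of the registers after the operations. -/
def runOps (L : List (Toffoli V)) (mem : V → ZMod 2) : V → ZMod 2 :=
  L.foldl (fun mem t => Function.update mem t.dst (mem t.dst + mem t.a * mem t.b)) mem

theorem runOps_append (L L' : List (Toffoli V)) (mem : V → ZMod 2) :
    runOps (L ++ L') mem = runOps L' (runOps L mem) := List.foldl_append

theorem runOps_of_ne {L : List (Toffoli V)} {r : V} (h : ∀ t ∈ L, t.dst ≠ r) :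
    ∀ mem : V → ZMod 2, runOps L mem r = mem r := by
  induction L with
  | nil => intro mem; rfl
  | cons t L ih =>
    intro mem
    exact (ih (fun t ht => h t (List.mem_cons_of_mem _ ht)) _).trans
      (Function.update_of_ne (h t List.mem_cons_self).symm _ _)

/-- If no operation reads what another one writes, then the order does not matter. -/
theorem runOps_eq_add_sum {L : List (Toffoli V)} :
    (∀ t ∈ L, ∀ t' ∈ L, t.dst ≠ t'.a ∧ t.dst ≠ t'.b) → ∀ (mem : V → ZMod 2) (r : V),
    runOps L mem r =
      mem r + (L.map fun t => if t.dst = r then mem t.a * mem t.b else 0).sum := by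
  induction L with
  | nil => intro _ mem r; simp [runOps]
  | cons t L ih =>
    intro h mem r
    have h1 := ih (fun t ht t' ht' => h t (List.mem_cons_of_mem _ ht) t'
      (List.mem_cons_of_mem _ ht')) (Function.update mem t.dst (mem t.dst + mem t.a * mem t.b)) r
    have h2 : L.map (fun t' => if t'.dst = r then
        Function.update mem t.dst (mem t.dst + mem t.a * mem t.b) t'.a *
          Function.update mem t.dst (mem t.dst + mem t.a * mem t.b) t'.b else 0) =
        L.map fun t' => if t'.dst = r then mem t'.a * mem t'.b else 0 := by
      refine List.map_congr_left fun t' ht' => ?_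
      have h3 := h t List.mem_cons_self t' (List.mem_cons_of_mem _ ht')
      rw [Function.update_of_ne h3.1.symm, Function.update_of_ne h3.2.symm]
    rw [h2] at h1
    refine h1.trans ?_
    rw [List.map_cons, List.sum_cons]
    by_cases hr : t.dst = r
    · subst hr
      rw [Function.update_self, if_pos rfl, add_assoc]
    · rw [Function.update_of_ne (Ne.symm hr), if_neg hr, zero_add]

/-- The operations `dst i += ∑ k, a i k * b i k`. -/
noncomputable def batch {ι κ : Type} [Fintype ι] [Fintype κ] (dst : ι → V) (a b : ι → κ → V) :
    List (Toffoli V) :=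
  (Finset.univ : Finset (ι × κ)).toList.map fun x => ⟨dst x.1, a x.1 x.2, b x.1 x.2⟩

theorem length_batch {ι κ : Type} [Fintype ι] [Fintype κ] (dst : ι → V) (a b : ι → κ → V) :
    (batch dst a b).length = Fintype.card ι * Fintype.card κ := by
  simp [batch]

theorem runOps_batch_of_ne {ι κ : Type} [Fintype ι] [Fintype κ] {dst : ι → V} {a b : ι → κ → V}
    {r : V} (h : ∀ i, dst i ≠ r) (mem : V → ZMod 2) : runOps (batch dst a b) mem r = mem r := by
  refine runOps_of_ne (fun t ht => ?_) mem
  obtain ⟨x, _, rfl⟩ := List.mem_map.1 ht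
  exact h x.1

theorem runOps_batch {ι κ : Type} [Fintype ι] [Fintype κ] {dst : ι → V} {a b : ι → κ → V}
    (hdst : Function.Injective dst) (h : ∀ i i' k, dst i ≠ a i' k ∧ dst i ≠ b i' k)
    (mem : V → ZMod 2) (i : ι) :
    runOps (batch dst a b) mem (dst i) = mem (dst i) + ∑ k, mem (a i k) * mem (b i k) := by
  classical
  rw [runOps_eq_add_sum]
  · unfold batch
    rw [List.map_map, Finset.sum_map_toList, Fintype.sum_prod_type]
    congr 1
    rw [Finset.sum_eq_single i]
    · simp
    · intro i' _ hi'
      simp [hdst.ne hi']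
    · simp
  · intro t ht t' ht'
    obtain ⟨x, _, rfl⟩ := List.mem_map.1 ht
    obtain ⟨x', _, rfl⟩ := List.mem_map.1 ht'
    exact h _ _ _

/-- The operations that compute the products `c j = ∏ i < j, (1 + x i)`. -/
def chain (one : V) : ∀ {k : ℕ}, (Fin k → V) → (Fin (k + 1) → V) → List (Toffoli V)
  | 0, _, c => [⟨c 0, one, one⟩]
  | k + 1, x, c => chain one (fun i => x i.castSucc) (fun i => c i.castSucc) ++
      [⟨c (Fin.last _), c (Fin.last k).castSucc, one⟩,
        ⟨c (Fin.last _), c (Fin.last k).castSucc, x (Fin.last k)⟩]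

theorem length_chain (one : V) : ∀ {k : ℕ} (x : Fin k → V) (c : Fin (k + 1) → V),
    (chain one x c).length = 1 + 2 * k
  | 0, _, _ => rfl
  | k + 1, x, c => by
    rw [chain, List.length_append, length_chain]
    simp only [List.length_cons, List.length_nil]
    omega

theorem runOps_chain_of_ne {one r : V} : ∀ {k : ℕ} {x : Fin k → V} {c : Fin (k + 1) → V},
    (∀ j, c j ≠ r) → ∀ mem : V → ZMod 2, runOps (chain one x c) mem r = mem r
  | 0, _, _, h, mem => Function.update_of_ne (h 0).symm _ _
  | k + 1, x, c, h, mem => by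
    rw [chain, runOps_append]
    refine (runOps_of_ne ?_ _).trans (runOps_chain_of_ne (fun j => h j.castSucc) mem)
    simp [h]

/-- The last two operations compute `c (k + 1) = c k + c k * x k`. -/
theorem runOps_chain {one : V} {mem : V → ZMod 2} (hone : mem one = 1) : ∀ {k : ℕ} {x : Fin k → V}
    {c : Fin (k + 1) → V}, Function.Injective c → (∀ j, c j ≠ one) → (∀ i j, c j ≠ x i) →
    (∀ j, mem (c j) = 0) → runOps (chain one x c) mem (c 0) = 1 ∧
      ∀ j : Fin k, runOps (chain one x c) mem (c j.succ) =
        runOps (chain one x c) mem (c j.castSucc) * (1 + mem (x j))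
  | 0, x, c, _, _, _, h0 => by
    refine ⟨?_, fun j => j.elim0⟩
    change Function.update mem (c 0) _ (c 0) = 1
    rw [Function.update_self, h0, hone]
    simp
  | k + 1, x, c, hc, h1, hx, h0 => by
    obtain ⟨ih0, ih⟩ := runOps_chain hone (x := fun i => x i.castSucc) (c := fun i => c i.castSucc)
      (hc.comp (Fin.castSucc_injective _)) (fun j => h1 _) (fun i j => hx _ _) fun j => h0 _
    set mem' := runOps (chain one (fun i => x i.castSucc) fun i => c i.castSucc) mem with hmem'
    have hlast : ∀ j : Fin (k + 1), c j.castSucc ≠ c (Fin.last _) :=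
      fun j h => (Fin.castSucc_lt_last j).ne (hc h)
    have hold : ∀ j : Fin (k + 1), runOps (chain one x c) mem (c j.castSucc) =
        mem' (c j.castSucc) := fun j => by
      rw [chain, runOps_append]
      exact runOps_of_ne (by simp [(hlast j).symm]) _
    have h2 : mem' one = 1 := (runOps_chain_of_ne (fun j => h1 _) mem).trans hone
    have h3 : mem' (x (Fin.last k)) = mem (x (Fin.last k)) :=
      runOps_chain_of_ne (fun j => hx _ _) mem
    have h4 : mem' (c (Fin.last _)) = 0 :=
      (runOps_chain_of_ne (fun j => hlast j) mem).trans (h0 _)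
    refine ⟨(hold 0).trans ih0, fun j => ?_⟩
    refine Fin.lastCases ?_ (fun j => ?_) j
    · rw [hold, Fin.succ_last, chain, runOps_append, ← hmem']
      simp only [runOps, List.foldl_cons, List.foldl_nil]
      change Function.update _ (c (Fin.last (k + 1))) _ (c (Fin.last (k + 1))) = _
      rw [Function.update_self, Function.update_self, Function.update_of_ne (hlast _),
        Function.update_of_ne (hx _ _).symm, h2, h3, h4]
      ring
    · rw [hold, Fin.succ_castSucc, hold]
      exact ih j

/-- The product of all `1 + α j` is one if all `α j` vanish, and zero otherwise. -/
theorem chain_last_eq {k : ℕ} : ∀ {φ : Fin (k + 1) → ZMod 2} {α : Fin k → ZMod 2}, φ 0 = 1 →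
    (∀ j, φ j.succ = φ j.castSucc * (1 + α j)) →
    (φ (Fin.last k) = 1 ∧ ∀ j, α j = 0) ∨ (φ (Fin.last k) = 0 ∧ ∃ j, α j ≠ 0) := by
  induction k with
  | zero => exact fun h _ => Or.inl ⟨h, fun j => j.elim0⟩
  | succ k ih =>
    intro φ α h0 h
    have hl := h (Fin.last k)
    rw [Fin.succ_last] at hl
    have h2 : ∀ x : ZMod 2, x = 0 ∨ x = 1 := by decide
    rcases ih (φ := fun j => φ j.castSucc) (α := fun j => α j.castSucc) h0
      (fun j => h j.castSucc) with ⟨h3, h4⟩ | ⟨h3, j, hj⟩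
    · rw [h3, one_mul] at hl
      rcases h2 (α (Fin.last k)) with h5 | h5
      · exact Or.inl ⟨by rw [hl, h5, add_zero], fun j => Fin.lastCases h5 h4 j⟩
      · refine Or.inr ⟨by rw [hl, h5]; decide, Fin.last k, by rw [h5]; decide⟩
    · rw [h3, zero_mul] at hl
      exact Or.inr ⟨hl, j.castSucc, hj⟩

/-- A bit as an element of the field with two elements. -/
def bit (b : Bool) : ZMod 2 := if b then 1 else 0

/-- The operation `dst += a * b` by six NAND gates with five auxiliary registers. -/
def Toffoli.compile {S : OracleSig} {d M : ℕ} (e : V → Fin M) (t : Fin 5 → Fin M) (op : Toffoli V) :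
    List (Step S d M) :=
  [.nand (t 0) (e op.a) (e op.b), .nand (t 1) (t 0) (t 0), .nand (t 2) (e op.dst) (t 1),
    .nand (t 3) (e op.dst) (t 2), .nand (t 4) (t 1) (t 2), .nand (e op.dst) (t 3) (t 4)]

/-- The compiled program computes the same as the program. -/
theorem acceptFrom_compile {S : OracleSig} {d M : ℕ} (O : S.Oracle) {e : V → Fin M}
    {t : Fin 5 → Fin M} (he : Function.Injective e) (ht : Function.Injective t)
    (het : ∀ v i, e v ≠ t i) (o : V) (L : List (Toffoli V)) : ∀ mem : Fin M → Bool,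
    acceptFrom (d := d) O (e o) (L.flatMap (Toffoli.compile e t)) mem =
      if runOps L (fun v => bit (mem (e v))) o = 1 then 1 else 0 := by
  induction L with
  | nil =>
    intro mem
    simp only [List.flatMap_nil, acceptFrom, runOps, List.foldl_nil, bit]
    by_cases h : mem (e o) = true <;> simp [h]
  | cons op L ih =>
    intro mem
    rw [List.flatMap_cons]
    refine (ih _).trans ?_
    have htt : ∀ i j : Fin 5, i ≠ j → t i ≠ t j := fun i j hij h => hij (ht h)
    have hte : ∀ v i, t i ≠ e v := fun v i h => het v i h.symm
    congr 2
    change runOps L _ o = runOps L _ o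
    congr 1
    funext v
    by_cases hv : v = op.dst
    · subst hv
      simp only [Function.update_self, Function.update_of_ne (het _ _),
        Function.update_of_ne (htt 3 4 (by decide)), Function.update_of_ne (htt 1 2 (by decide)),
        Function.update_of_ne (htt 1 3 (by decide)), Function.update_of_ne (htt 2 3 (by decide))]
      unfold bit
      -- `x + a * b` is the exclusive disjunction of `x` and `a && b`, which takes four NAND gates.
      cases mem (e op.dst) <;> cases mem (e op.a) <;> cases mem (e op.b) <;> decide
    · have : e v ≠ e op.dst := fun h => hv (he h)
      simp only [Function.update_of_ne this, Function.update_of_ne (het _ _),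
        Function.update_of_ne hv]

end programs

/-! ### Deciding whether the samples have a common orthogonal vector -/

/-- The registers of the scheme: the input, a zero, a one followed by zeros, the blocks of wires of
each call, and those of the elimination: for each sample the rows `row` of a matrix are multiplied
with the sample, the first row that is not orthogonal is selected as pivot, and is added to all rows
that are not orthogonal. -/
inductive Reg (n₀ d n m : ℕ) : Type
  | inp (i : Fin n₀)
  | zero
  | const (i : Fin (d + 1))
  | block (l : Fin m) (b : Fin (d + 2)) (o : Option (Fin ((d + 2) * n)))
  | row (j i : Fin n)
  | par (l : Fin m) (j : Fin n)
  | sel (l : Fin m) (j : Fin n)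
  | free (l : Fin m) (j : Fin (n + 1))
  | piv (l : Fin m) (i : Fin n)
  | nul (k : Fin (n * n + 1))
  | ans

noncomputable instance (n₀ d n m : ℕ) : DecidableEq (Reg n₀ d n m) := Classical.decEq _

section elimination
variable {n₀ d n m : ℕ}

/-- The position of a bit of a sample in a block. -/
def samplePos (d : ℕ) {n : ℕ} (i : Fin n) : Fin ((d + 2) * n) :=
  ⟨i, i.2.trans_le (Nat.le_mul_of_pos_left n (Nat.succ_pos _))⟩

/-- The register that holds a one. -/
def Reg.one : Reg n₀ d n m := .const 0

/-- The register of bit `i` of the sample `l`. -/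
def Reg.sample (l : Fin m) (i : Fin n) : Reg n₀ d n m := .block l 0 (some (samplePos d i))

/-- The elimination step for the sample `l`. -/
noncomputable def sampleOps (l : Fin m) : List (Toffoli (Reg n₀ d n m)) :=
  batch (fun j => .par l j) (fun j i => .row j i) (fun _ i => .sample l i) ++
  (chain .one (fun j => .par l j) (fun j => .free l j) ++
  (batch (fun j => .sel l j) (fun j (_ : Unit) => .free l j.castSucc) (fun j _ => .par l j) ++
  (batch (fun i => .piv l i) (fun _ j => .sel l j) (fun i j => .row j i) ++
  batch (fun x : Fin n × Fin n => .row x.1 x.2) (fun x (_ : Unit) => .par l x.1)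
    (fun x _ => .piv l x.2))))

/-- The rows span the space of the vectors that are orthogonal to the first `l` samples. -/
structure Eliminated (Y : Fin m → Fin n → ZMod 2) (l : ℕ) (mem : Reg n₀ d n m → ZMod 2) : Prop where
  one : mem .one = 1
  sample : ∀ l' i, mem (.sample l' i) = Y l' i
  fresh : ∀ l' : Fin m, l ≤ l' → (∀ j, mem (.par l' j) = 0) ∧ (∀ j, mem (.sel l' j) = 0) ∧
    (∀ j, mem (.free l' j) = 0) ∧ ∀ i, mem (.piv l' i) = 0
  nul : ∀ k, mem (.nul k) = 0
  ans : mem .ans = 0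
  span : ∀ s : Fin n → ZMod 2, (∀ l' : Fin m, (l' : ℕ) < l → ∑ i, s i * Y l' i = 0) ↔
    ∃ c : Fin n → ZMod 2, ∀ i, s i = ∑ j, c j * mem (.row j i)

/-- If a row is not orthogonal to the sample, then the first such row is the pivot, and adding it to
all such rows, including itself, makes all rows orthogonal. A combination of the old rows that is
orthogonal to the sample is the same combination of the new rows. -/
theorem Eliminated.step {Y : Fin m → Fin n → ZMod 2} {l : Fin m} {mem : Reg n₀ d n m → ZMod 2}
    (h : Eliminated Y l mem) : Eliminated Y (l + 1) (runOps (sampleOps l) mem) := by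
  obtain ⟨hpar, hsel, hfree, hpiv⟩ := h.fresh l le_rfl
  unfold sampleOps
  rw [runOps_append, runOps_append, runOps_append, runOps_append]
  -- The parities `par` tell which rows are not orthogonal to the sample.
  set m1 := runOps (batch (fun j => .par l j) (fun j i => .row j i) (fun _ i => .sample l i)) mem
    with hm1
  have e1 : ∀ r, (∀ j, .par l j ≠ r) → m1 r = mem r := fun r hr => runOps_batch_of_ne hr mem
  have a1 : ∀ j, m1 (.par l j) = ∑ i, mem (.row j i) * Y l i := by
    intro j
    rw [hm1, runOps_batch (dst := fun j => Reg.par l j) (fun _ _ h => by simpa using h)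
      (fun _ _ _ => ⟨by simp, by simp [Reg.sample]⟩), hpar, zero_add]
    simp only [h.sample]
  -- `free j` is one as long as all rows before `j` are orthogonal.
  set m2 := runOps (chain .one (fun j => .par l j) (fun j => .free l j)) m1 with hm2
  have e2 : ∀ r, (∀ j, .free l j ≠ r) → m2 r = m1 r := fun r hr => runOps_chain_of_ne hr m1
  obtain ⟨a2, b2⟩ := runOps_chain (one := Reg.one) (mem := m1) (x := fun j => .par l j)
    (c := fun j => .free l j) (by rw [e1 _ (by simp [Reg.one]), h.one])
    (fun _ _ h => by simpa using h) (by simp [Reg.one]) (by simp)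
    fun j => by rw [e1 _ (by simp), hfree]
  rw [← hm2] at a2 b2
  -- `sel` marks the first row that is not orthogonal.
  set m3 := runOps (batch (fun j => .sel l j) (fun j (_ : Unit) => .free l j.castSucc)
    (fun j _ => .par l j)) m2 with hm3
  have e3 : ∀ r, (∀ j, .sel l j ≠ r) → m3 r = m2 r := fun r hr => runOps_batch_of_ne hr m2
  have a3 : ∀ j, m3 (.sel l j) = m2 (.free l j.castSucc) * m1 (.par l j) := by
    intro j
    rw [hm3, runOps_batch (dst := fun j => Reg.sel l j) (fun _ _ h => by simpa using h)
      (fun _ _ _ => ⟨by simp, by simp⟩), e2 _ (by simp), e1 _ (by simp), hsel, zero_add,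
      Fintype.sum_unique, e2 (.par l j) (by simp)]
  -- `piv` is a copy of that row.
  set m4 := runOps (batch (fun i => .piv l i) (fun _ j => .sel l j) (fun i j => .row j i)) m3
    with hm4
  have e4 : ∀ r, (∀ j, .piv l j ≠ r) → m4 r = m3 r := fun r hr => runOps_batch_of_ne hr m3
  have a4 : ∀ i, m4 (.piv l i) = ∑ j, m3 (.sel l j) * mem (.row j i) := by
    intro i
    rw [hm4, runOps_batch (dst := fun j => Reg.piv l j) (fun _ _ h => by simpa using h)
      (fun _ _ _ => ⟨by simp, by simp⟩), e3 _ (by simp), e2 _ (by simp), e1 _ (by simp), hpiv,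
      zero_add]
    refine Finset.sum_congr rfl fun j _ => ?_
    rw [e3 (.row j i) (by simp), e2 _ (by simp), e1 _ (by simp)]
  -- The pivot is added to all rows that are not orthogonal.
  set m5 := runOps (batch (fun x : Fin n × Fin n => .row x.1 x.2) (fun x (_ : Unit) => .par l x.1)
    (fun x _ => .piv l x.2)) m4 with hm5
  have e5 : ∀ r, (∀ x : Fin n × Fin n, .row x.1 x.2 ≠ r) → m5 r = m4 r :=
    fun r hr => runOps_batch_of_ne hr m4
  have a5 : ∀ j i, m5 (.row j i) = mem (.row j i) + m1 (.par l j) * m4 (.piv l i) := by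
    intro j i
    have := runOps_batch (dst := fun x : Fin n × Fin n =>
        Reg.row (n₀ := n₀) (d := d) (m := m) x.1 x.2)
      (a := fun x (_ : Unit) => .par l x.1) (b := fun x _ => .piv l x.2)
      (fun x y h => by simpa [Prod.ext_iff] using h) (fun _ _ _ => ⟨by simp, by simp⟩) m4 (j, i)
    rw [← hm5, Fintype.sum_unique] at this
    refine this.trans ?_
    rw [e4 _ (by simp), e3 _ (by simp), e2 _ (by simp), e1 _ (by simp), e4 (.par l j) (by simp),
      e3 _ (by simp), e2 _ (by simp)]
  have hrest : ∀ r, (∀ x : Fin n × Fin n, .row x.1 x.2 ≠ r) → (∀ j, .piv l j ≠ r) →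
      (∀ j, .sel l j ≠ r) → (∀ j, .free l j ≠ r) → (∀ j, .par l j ≠ r) → m5 r = mem r :=
    fun r h5 h4 h3 h2 h1 => by rw [e5 r h5, e4 r h4, e3 r h3, e2 r h2, e1 r h1]
  -- The selected row is the first one that is not orthogonal to the sample, if there is any.
  have hτ : (∑ j, m3 (.sel l j) * m1 (.par l j) = 1) ∨ ∀ j, m1 (.par l j) = 0 := by
    rcases chain_last_eq (φ := fun j => m2 (.free l j)) a2 b2 with ⟨_, h1⟩ | ⟨h1, _⟩
    · exact Or.inr h1
    · left
      have h2 : ∀ x : ZMod 2, x * x = x ∧ -x = x := by decide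
      have h3 := Fin.sum_univ_succ fun j => m2 (.free l j)
      rw [Fin.sum_univ_castSucc, h1, a2, add_zero] at h3
      -- The sum telescopes, as `sel j = free (j + 1) - free j` over this field.
      have h4 : ∑ j, m3 (.sel l j) * m1 (.par l j) =
          ∑ j : Fin n, m2 (.free l j.succ) - ∑ j : Fin n, m2 (.free l j.castSucc) := by
        rw [← Finset.sum_sub_distrib]
        refine Finset.sum_congr rfl fun j _ => ?_
        rw [a3, mul_assoc, (h2 _).1, b2]
        ring
      rw [h4, h3, sub_add_cancel_right]
      decide
  have hP : ∑ i, m4 (.piv l i) * Y l i = ∑ j, m3 (.sel l j) * m1 (.par l j) := by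
    simp only [a4, a1, Finset.sum_mul, Finset.mul_sum]
    rw [Finset.sum_comm]
    exact Finset.sum_congr rfl fun _ _ => Finset.sum_congr rfl fun _ _ => by ring
  have horth : ∀ c : Fin n → ZMod 2, ∑ i, (∑ j, c j * mem (.row j i)) * Y l i =
      ∑ j, c j * m1 (.par l j) := by
    intro c
    simp only [a1, Finset.sum_mul, Finset.mul_sum]
    rw [Finset.sum_comm]
    exact Finset.sum_congr rfl fun _ _ => Finset.sum_congr rfl fun _ _ => by ring
  have hnew : ∀ (c : Fin n → ZMod 2) i, ∑ j, c j * m5 (.row j i) =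
      ∑ j, c j * mem (.row j i) + (∑ j, c j * m1 (.par l j)) * m4 (.piv l i) := by
    intro c i
    simp only [a5, mul_add, Finset.sum_add_distrib, Finset.sum_mul, mul_assoc]
  have h11 : (1 + 1 : ZMod 2) = 0 := by decide
  refine ⟨?_, fun l' i => ?_, fun l' hl' => ?_, fun k => ?_, ?_, fun s => ?_⟩
  · rw [hrest _ (by simp [Reg.one]) (by simp [Reg.one]) (by simp [Reg.one]) (by simp [Reg.one])
      (by simp [Reg.one]), h.one]
  · rw [hrest _ (by simp [Reg.sample]) (by simp [Reg.sample]) (by simp [Reg.sample])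
      (by simp [Reg.sample]) (by simp [Reg.sample]), h.sample]
  · obtain ⟨h1, h2, h3, h4⟩ := h.fresh l' (by omega)
    have hne : l ≠ l' := fun h => by rw [h] at hl'; omega
    refine ⟨fun j => ?_, fun j => ?_, fun j => ?_, fun j => ?_⟩
    · rw [hrest _ (by simp) (by simp) (by simp) (by simp) (by simp [hne]), h1]
    · rw [hrest _ (by simp) (by simp) (by simp [hne]) (by simp) (by simp), h2]
    · rw [hrest _ (by simp) (by simp) (by simp) (by simp [hne]) (by simp), h3]
    · rw [hrest _ (by simp) (by simp [hne]) (by simp) (by simp) (by simp), h4]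
  · rw [hrest _ (by simp) (by simp) (by simp) (by simp) (by simp), h.nul]
  · rw [hrest _ (by simp) (by simp) (by simp) (by simp) (by simp), h.ans]
  · have hsplit : (∀ l' : Fin m, (l' : ℕ) < l + 1 → ∑ i, s i * Y l' i = 0) ↔
        (∀ l' : Fin m, (l' : ℕ) < l → ∑ i, s i * Y l' i = 0) ∧ ∑ i, s i * Y l i = 0 := by
      constructor
      · exact fun h => ⟨fun l' hl' => h l' (by omega), h l (by omega)⟩
      · rintro ⟨h1, h2⟩ l' hl'
        rcases (Nat.lt_succ_iff_lt_or_eq.1 hl') with h3 | h3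
        · exact h1 l' h3
        · rwa [Fin.ext h3]
    rw [hsplit, h.span s]
    constructor
    · rintro ⟨⟨c, hc⟩, h1⟩
      refine ⟨c, fun i => ?_⟩
      simp only [hc] at h1
      rw [horth] at h1
      rw [hnew, h1, zero_mul, add_zero, hc]
    · rintro ⟨c, hc⟩
      constructor
      · refine ⟨fun k => c k + (∑ j, c j * m1 (.par l j)) * m3 (.sel l k), fun i => ?_⟩
        rw [hc, hnew, a4]
        simp only [add_mul, Finset.sum_add_distrib, Finset.mul_sum, mul_assoc]
      · simp only [hc, hnew, add_mul, Finset.sum_add_distrib]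
        rw [horth]
        simp only [mul_assoc]
        rw [← Finset.mul_sum, hP]
        rcases hτ with h1 | h1
        · rw [h1, mul_one, ← two_mul, show (2 : ZMod 2) = 0 by decide, zero_mul]
        · simp [h1]

theorem foldl_ofFn_induction {α β : Type*} {step : α → β → α} : ∀ {m : ℕ} {f : Fin m → β}
    {P : ℕ → α → Prop}, (∀ (l : Fin m) a, P l a → P (l + 1) (step a (f l))) → ∀ a, P 0 a →
    P m ((List.ofFn f).foldl step a)
  | 0, _, _, _, a, h0 => h0
  | m + 1, f, P, h, a, h0 => by
    rw [List.ofFn_succ, List.foldl_cons]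
    exact foldl_ofFn_induction (P := fun l => P (l + 1)) (fun l a ha => by
      simpa using h l.succ a (by simpa using ha)) _ (by simpa using h 0 a h0)

/-- The program that decides whether the samples have a common orthogonal vector. -/
noncomputable def decideOps (n₀ d n m : ℕ) : List (Toffoli (Reg n₀ d n m)) :=
  batch (fun j => .row j j) (fun _ (_ : Unit) => .one) (fun _ _ => .one) ++
  ((List.ofFn fun l => sampleOps l).flatten ++
  (chain .one (fun k => .row (finProdFinEquiv.symm k).1 (finProdFinEquiv.symm k).2)
    (fun k => .nul k) ++
  batch (fun _ : Unit => .ans)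
    (fun _ k => if k = true then .nul (Fin.last _) else .one) (fun _ (_ : Bool) => .one)))

/-- The program starts with the unit vectors as rows. After the elimination the rows span the common
orthogonal space, which is nonzero iff one of the entries is. -/
theorem runOps_decideOps {Y : Fin m → Fin n → ZMod 2} {mem : Reg n₀ d n m → ZMod 2}
    (hone : mem .one = 1) (hY : ∀ l i, mem (.sample l i) = Y l i)
    (hrow : ∀ j i, mem (.row j i) = 0) (hfresh : ∀ l : Fin m, (∀ j, mem (.par l j) = 0) ∧
      (∀ j, mem (.sel l j) = 0) ∧ (∀ j, mem (.free l j) = 0) ∧ ∀ i, mem (.piv l i) = 0)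
    (hnul : ∀ k, mem (.nul k) = 0) (hans : mem .ans = 0) :
    runOps (decideOps n₀ d n m) mem .ans = 1 ↔
      ∃ s : Fin n → ZMod 2, s ≠ 0 ∧ ∀ l, ∑ i, s i * Y l i = 0 := by
  unfold decideOps
  rw [runOps_append, runOps_append, runOps_append]
  set m0 := runOps (batch (fun j => .row j j) (fun _ (_ : Unit) => .one) (fun _ _ => .one)) mem
    with hm0
  have e0 : ∀ r, (∀ j, .row j j ≠ r) → m0 r = mem r := fun r hr => runOps_batch_of_ne hr mem
  have a0 : ∀ j i, m0 (.row j i) = if j = i then 1 else 0 := by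
    intro j i
    split_ifs with hji
    · subst hji
      have := runOps_batch (dst := fun j => Reg.row (n₀ := n₀) (d := d) (m := m) j j)
        (a := fun _ (_ : Unit) => .one) (b := fun _ _ => .one) (fun _ _ h => by simpa using h)
        (fun _ _ _ => ⟨by simp [Reg.one], by simp [Reg.one]⟩) mem j
      rw [← hm0, hrow, hone] at this
      simpa using this
    · rw [e0 _ (by rintro k h; simp only [Reg.row.injEq] at h; exact hji (h.1.symm.trans h.2)),
        hrow]
  have h0 : Eliminated Y 0 m0 := by
    refine ⟨?_, fun l i => ?_, fun l _ => ⟨fun j => ?_, fun j => ?_, fun j => ?_, fun j => ?_⟩,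
      fun k => ?_, ?_, fun s => ⟨fun _ => ⟨s, fun i => ?_⟩, fun _ l hl => absurd hl (by omega)⟩⟩
    · rw [e0 _ (by simp [Reg.one]), hone]
    · rw [e0 _ (by simp [Reg.sample]), hY]
    · rw [e0 _ (by simp), (hfresh l).1]
    · rw [e0 _ (by simp), (hfresh l).2.1]
    · rw [e0 _ (by simp), (hfresh l).2.2.1]
    · rw [e0 _ (by simp), (hfresh l).2.2.2]
    · rw [e0 _ (by simp), hnul]
    · rw [e0 _ (by simp), hans]
    · simp [a0]
  set m1 := runOps (List.ofFn fun l => sampleOps l).flatten m0 with hm1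
  have h1 : Eliminated Y m m1 := by
    have := foldl_ofFn_induction (f := fun l => sampleOps (n₀ := n₀) (d := d) (n := n) l)
      (step := fun mem L => runOps L mem) (P := Eliminated Y) (fun l a ha => ha.step) m0 h0
    rw [hm1]
    unfold runOps at this ⊢
    rwa [List.foldl_flatten]
  have h2 : (∃ s : Fin n → ZMod 2, s ≠ 0 ∧ ∀ l, ∑ i, s i * Y l i = 0) ↔
      ∃ j i, m1 (.row j i) ≠ 0 := by
    have h3 := fun s => h1.span s
    simp only [Fin.is_lt, true_imp_iff] at h3
    simp only [h3]
    constructor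
    · rintro ⟨s, hs, c, hc⟩
      by_contra hcon
      push Not at hcon
      exact hs (funext fun i => by simp [hc, hcon])
    · rintro ⟨j, i, hji⟩
      refine ⟨fun i => m1 (.row j i), fun h => hji (congrFun h i), fun k => if k = j then 1 else 0,
        fun i => by simp⟩
  rw [h2]
  set m2 := runOps (chain .one
    (fun k => .row (finProdFinEquiv.symm k).1 (finProdFinEquiv.symm k).2) (fun k => .nul k)) m1
    with hm2
  have e2 : ∀ r, (∀ k, .nul k ≠ r) → m2 r = m1 r := fun r hr => runOps_chain_of_ne hr m1
  obtain ⟨a2, b2⟩ := runOps_chain (one := Reg.one) (mem := m1)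
    (x := fun k => .row (finProdFinEquiv.symm k).1 (finProdFinEquiv.symm k).2)
    (c := fun k => .nul k) h1.one (fun _ _ h => by simpa using h) (by simp [Reg.one]) (by simp)
    h1.nul
  rw [← hm2] at a2 b2
  have h3 := runOps_batch (dst := fun _ : Unit => Reg.ans (n₀ := n₀) (d := d) (n := n) (m := m))
    (a := fun _ k => if k = true then .nul (Fin.last _) else .one) (b := fun _ (_ : Bool) => .one)
    (fun _ _ _ => rfl) (fun _ _ k => ⟨by split_ifs <;> simp [Reg.one], by simp [Reg.one]⟩) m2 ()
  rw [h3, Fintype.sum_bool, e2 _ (by simp), h1.ans, e2 .one (by simp [Reg.one]), h1.one]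
  simp only [if_true, Bool.false_eq_true, if_false, e2 .one (by simp [Reg.one]), h1.one, mul_one,
    zero_add]
  rcases chain_last_eq (φ := fun k => m2 (.nul k)) a2 b2 with ⟨h4, h5⟩ | ⟨h4, k, h5⟩
  · rw [h4]
    refine ⟨fun h => absurd h (by decide), ?_⟩
    rintro ⟨j, i, hji⟩
    have := h5 (finProdFinEquiv (j, i))
    simp only [Equiv.symm_apply_apply] at this
    exact absurd this hji
  · rw [h4]
    exact ⟨fun _ => ⟨_, _, h5⟩, fun _ => by decide⟩

theorem length_decideOps : (decideOps n₀ d n m).length =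
    n + (m * (n * n + (1 + 2 * n) + n + n * n + n * n) + ((1 + 2 * (n * n)) + 2)) := by
  unfold decideOps
  rw [List.length_append, List.length_append, List.length_append, length_batch, length_chain,
    length_batch, List.length_flatten, List.map_ofFn]
  have h : (List.length ∘ fun l => sampleOps (n₀ := n₀) (d := d) (n := n) (m := m) l) =
      fun _ => n * n + (1 + 2 * n) + n + n * n + n * n := by
    funext l
    simp only [Function.comp_apply, sampleOps, List.length_append, length_batch, length_chain,
      Fintype.card_fin, Fintype.card_unit, Fintype.card_prod]
    ring
  rw [h]
  simp

end elimination

/-! ### The circuit that samples orthogonal vectors -/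

/-- The wires of the circuit: the input, the one-hot encoding of an index, and `d + 2` blocks that
can each hold an answer of the oracle. -/
abbrev Wire (n₀ d n : ℕ) : Type := Fin n₀ ⊕ Fin (d + 1) ⊕ Fin (d + 2) × Option (Fin ((d + 2) * n))

/-- The numbering of the wires. -/
noncomputable def wireNo {n₀ d n : ℕ} : Wire n₀ d n ≃ Fin (Fintype.card (Wire n₀ d n)) :=
  Fintype.equivFin _

section circuit
variable {S : OracleSig} {n₀ d n m M : ℕ}

/-- The register in which call `l` keeps a wire. -/
def wireReg (l : Fin m) : Wire n₀ d n → Reg n₀ d n m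
  | .inl k => .inp k
  | .inr (.inl k) => .const k
  | .inr (.inr x) => .block l x.1 x.2

theorem wireReg_injective (l : Fin m) :
    Function.Injective (wireReg (n₀ := n₀) (d := d) (n := n) l) := by
  rintro (k | k | x) (k' | k' | x') h <;> simp only [wireReg, Reg.inp.injEq, Reg.const.injEq,
    Reg.block.injEq, reduceCtorEq, true_and] at h
  · rw [h]
  · rw [h]
  · rw [Prod.ext h.1 h.2]

/-- The index of the function that is asked for in the query layer `i`: the layers `0, …, d` compute
the functions of the shuffling one after the other, the others uncompute the intermediate values. -/
def askIndex (d i : ℕ) : Fin (d + 1) := ⟨min i (2 * d - i), by omega⟩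

/-- The wires from which a query for the function `j` is read. Only the wire `0` of the encoded
index holds a one. -/
def inWire (j : Fin (d + 1)) : Fin n₀ ⊕ Fin (d + 1) ⊕ Fin ((d + 2) * n) → Wire n₀ d n
  | .inl k => .inl k
  | .inr (.inl k) => .inr (.inl (Equiv.swap 0 j k))
  | .inr (.inr k) => .inr (.inr (j.castSucc, some k))

/-- The wires to which the answer of a query for the function `j` is added. -/
def outWire (j : Fin (d + 1)) (o : Option (Fin ((d + 2) * n))) : Wire n₀ d n :=
  .inr (.inr (j.succ, o))

theorem inWire_injective (j : Fin (d + 1)) :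
    Function.Injective (inWire (n₀ := n₀) (n := n) j) := by
  rintro (k | k | k) (k' | k' | k') h <;> simp_all [inWire]

theorem outWire_injective (j : Fin (d + 1)) :
    Function.Injective (outWire (n₀ := n₀) (n := n) j) := fun o o' h => by
  simpa [outWire] using h

theorem inWire_ne_outWire (j : Fin (d + 1)) (x : Fin n₀ ⊕ Fin (d + 1) ⊕ Fin ((d + 2) * n))
    (o : Option (Fin ((d + 2) * n))) : inWire j x ≠ outWire j o := by
  rcases x with x | x | x <;> simp [inWire, outWire, Fin.ext_iff]

/-- The wires of the samples. -/
noncomputable def sampleWire (n₀ d : ℕ) {n : ℕ} (k : Fin n) : Fin (Fintype.card (Wire n₀ d n)) :=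
  wireNo (.inr (.inr (0, some (samplePos d k))))

theorem samplePos_injective : Function.Injective (samplePos d (n := n)) := fun k k' h => by
  simpa [samplePos, Fin.ext_iff] using h

theorem sampleWire_injective : Function.Injective (sampleWire n₀ d (n := n)) := fun k k' h => by
  have h := wireNo.injective h
  simp only [Sum.inr.injEq, Prod.mk.injEq, true_and, Option.some.injEq] at h
  exact samplePos_injective h

/-- The name of a wire in binary digits, which are read from a register with a one and a register
with a zero. -/
noncomputable def wireAddr (e : Reg n₀ d n m ↪ Fin M) (r : Wire n₀ d n) : List (Fin M) :=
  (Nat.bits (wireNo r)).map fun b => if b then e .one else e .zero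

theorem readNat_bits {mem : Fin M → Bool} {r₁ r₀ : Fin M} (h1 : mem r₁ = true)
    (h0 : mem r₀ = false) (k : ℕ) :
    readNat mem ((Nat.bits k).map fun b => if b then r₁ else r₀) = k := by
  induction k using Nat.binaryRec' with
  | zero => simp [readNat]
  | bit b k hb ih =>
    rw [Nat.bits_append_bit _ _ hb]
    unfold readNat at ih ⊢
    rw [List.map_cons, List.foldr_cons, ih, Nat.bit_val]
    cases b <;> simp [h1, h0]; ring

theorem length_wireAddr_le (e : Reg n₀ d n m ↪ Fin M) (r : Wire n₀ d n) :
    (wireAddr e r).length ≤ Fintype.card (Wire n₀ d n) := by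
  unfold wireAddr
  rw [List.length_map, Nat.size_eq_bits_len, Nat.size_le]
  exact (wireNo r).2.trans Nat.lt_two_pow_self

variable (q : S.Q) (ein : S.In q ≃ Fin n₀ ⊕ Fin (d + 1) ⊕ Fin ((d + 2) * n))
  (eout : S.Out q ≃ Option (Fin ((d + 2) * n)))

/-- Simon's algorithm: between two layers of Hadamard gates on the wires of the sample, the
function is computed from block `0` into block `d + 1`. -/
noncomputable def simonCall (e : Reg n₀ d n m ↪ Fin M) (l : Fin m) : QCall S (2 * d + 1) M where
  w := Fintype.card (Wire n₀ d n)
  reg := ⟨fun r => e (wireReg l (wireNo.symm r)),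
    e.injective.comp ((wireReg_injective l).comp wireNo.symm.injective)⟩
  gates i := if i = 0 ∨ i = Fin.last _ then List.ofFn fun k : Fin n =>
      ⟨1, le_rfl, by norm_num, hadamard,
        fun _ => wireAddr e (.inr (.inr (0, some (samplePos d k))))⟩
    else []
  queries i := [⟨q, fun x => wireAddr e (inWire (askIndex d i) (ein x)),
    fun o => wireAddr e (outWire (askIndex d i) (eout o))⟩]

/-- The oracle gate of the query layer `i`. -/
noncomputable def askGate (i : ℕ) : OracleGate S (Fintype.card (Wire n₀ d n)) :=
  ⟨q, fun x => wireNo (inWire (askIndex d i) (ein x)),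
    fun o => wireNo (outWire (askIndex d i) (eout o))⟩

theorem askGate_proper (i : ℕ) : (askGate q ein eout i).Proper := by
  refine Function.Injective.sumElim
    (wireNo.injective.comp ((inWire_injective _).comp ein.injective))
    (wireNo.injective.comp ((outWire_injective _).comp eout.injective)) fun x o h => ?_
  exact inWire_ne_outWire _ _ _ (wireNo.injective h)

/-- The initial contents of the registers: the input, and a one in register `Reg.one`. -/
def baseMem (a : Bits n₀) : Reg n₀ d n m → Bool
  | .inp k => a k
  | .const k => decide (k = 0)
  | _ => false

/-- The contents of the registers after `l` calls: all registers are in their initial state, except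
for those of the blocks of these calls. -/
def Ready (e : Reg n₀ d n m ↪ Fin M) (a : Bits n₀) (l : ℕ) (mem : Fin M → Bool) : Prop :=
  ∀ r : Reg n₀ d n m, (∀ l' b o, r = .block l' b o → l ≤ l') → mem (e r) = baseMem a r

theorem filterMap_ofFn {α β : Type*} {φ : α → Option β} : ∀ {k : ℕ} {f : Fin k → α} {g : Fin k → β},
    (∀ i, φ (f i) = some (g i)) → (List.ofFn f).filterMap φ = List.ofFn g
  | 0, _, _, _ => by simp
  | k + 1, f, g, h => by
    rw [List.ofFn_succ, List.ofFn_succ, List.filterMap_cons_some (h 0),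
      filterMap_ofFn fun i => h i.succ]

section ready
variable {e : Reg n₀ d n m ↪ Fin M} {a : Bits n₀} {l : Fin m} {mem : Fin M → Bool}

theorem Ready.readNat_wireAddr {l : ℕ} (h : Ready e a l mem) (r : Wire n₀ d n) :
    readNat mem (wireAddr e r) = wireNo r :=
  readNat_bits (h _ (by simp [Reg.one])) (h _ (by simp)) _

theorem Ready.gatesAt (h : Ready e a l mem) (i : ℕ) :
    (simonCall q ein eout e l).gatesAt mem i = if i = 0 ∨ i = 2 * d + 1 then
      List.ofFn fun k => hadamardGate (sampleWire n₀ d k) else [] := by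
  unfold QCall.gatesAt simonCall
  dsimp only
  by_cases hi : i < 2 * d + 1 + 1
  · rw [dif_pos hi]
    have : ((⟨i, hi⟩ : Fin (2 * d + 1 + 1)) = 0 ∨ (⟨i, hi⟩ : Fin (2 * d + 1 + 1)) = Fin.last _) ↔
        (i = 0 ∨ i = 2 * d + 1) := by simp [Fin.ext_iff]
    simp only [this]
    split_ifs
    · refine filterMap_ofFn fun k => ?_
      unfold GateSlot.resolve
      simp only [h.readNat_wireAddr]
      rw [dif_pos fun _ => Fin.is_lt _]
      rfl
    · rfl
  · rw [dif_neg hi, if_neg (by omega)]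

theorem Ready.queriesAt (h : Ready e a l mem) {i : ℕ} (hi : i ≤ 2 * d) :
    (simonCall q ein eout e l).queriesAt mem i = [askGate q ein eout i] := by
  unfold QCall.queriesAt simonCall
  dsimp only
  rw [dif_pos (Nat.lt_succ_of_le hi), List.filterMap_cons_some, List.filterMap_nil]
  unfold OracleSlot.resolve
  simp only [h.readNat_wireAddr]
  rw [dif_pos ⟨fun _ => Fin.is_lt _, fun _ => Fin.is_lt _⟩]
  rfl

end ready

/-- The blocks that hold a value after `i` queries. -/
def filled (d i b : ℕ) : Bool :=
  decide ((b ≤ i ∧ b + i ≤ 2 * d + 1) ∨ (b = d + 1 ∧ d + 1 ≤ i))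

theorem filled_iff {d i b : ℕ} :
    filled d i b = true ↔ (b ≤ i ∧ b + i ≤ 2 * d + 1) ∨ (b = d + 1 ∧ d + 1 ≤ i) :=
  decide_eq_true_iff

/-- The contents of the wires after `i` queries, if the values `v b` belong into the blocks. -/
def wireContent (a : Bits n₀) (v : Fin (d + 2) → Big d n) (i : ℕ) : Wire n₀ d n → Bool
  | .inl k => a k
  | .inr (.inl k) => decide (k = 0)
  | .inr (.inr x) => filled d i x.1 && x.2.elim false (v x.1)

/-- The oracle computes the values `v 1, …, v (d + 1)` one from the other. -/
def Computes (O : S.Oracle) (a : Bits n₀) (v : Fin (d + 2) → Big d n) : Prop :=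
  ∀ (j : Fin (d + 1)) (o : S.Out q),
    O q (fun x => Sum.elim a (Sum.elim (fun k => decide (k = j)) (v j.castSucc)) (ein x)) o =
      (eout o).elim false (v j.succ)

/-- The query layer `i` turns the contents after `i` queries into those after `i + 1` queries: it
fills or clears one block. -/
theorem Computes.flip_askGate {O : S.Oracle} {a : Bits n₀} {v : Fin (d + 2) → Big d n}
    (h : Computes q ein eout O a v) {i : ℕ} (hi : i ≤ 2 * d) :
    (askGate q ein eout i).flip O (wireContent a v i ∘ wireNo.symm) =
      wireContent a v (i + 1) ∘ wireNo.symm := by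
  set j := askIndex d i with hj
  have hjv : (j : ℕ) = min i (2 * d - i) := rfl
  have hin : (fun x => wireContent a v i (wireNo.symm (wireNo (inWire j (ein x))))) =
      fun x => Sum.elim a (Sum.elim (fun k => decide (k = j)) (v j.castSucc)) (ein x) := by
    funext x
    rw [Equiv.symm_apply_apply]
    generalize ein x = y
    rcases y with y | y | y
    · rfl
    · simp only [inWire, wireContent, Sum.elim_inr, Sum.elim_inl]
      have : Equiv.swap 0 j y = 0 ↔ y = j := by
        rw [Equiv.swap_apply_eq_iff, Equiv.swap_apply_left]
      simp only [this]
    · simp only [inWire, wireContent, Sum.elim_inr]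
      rw [filled_iff.2 (by rw [Fin.val_castSucc]; omega), Bool.true_and]
      rfl
  have hproper := askGate_proper q ein eout i
  funext r
  obtain ⟨r, rfl⟩ := wireNo.surjective r
  by_cases hr : ∃ o, (askGate q ein eout i).outPos o = wireNo r
  · obtain ⟨(o : S.Out q), ho⟩ := hr
    rw [← ho]
    refine (hproper.out_injective.extend_apply _ _ o).trans ?_
    change xor (wireContent a v i (wireNo.symm (wireNo (outWire j (eout o)))))
      (O q (fun x => wireContent a v i (wireNo.symm (wireNo (inWire j (ein x))))) o) =
      wireContent a v (i + 1) (wireNo.symm (wireNo (outWire j (eout o))))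
    rw [hin, h, Equiv.symm_apply_apply]
    -- The block to which the answer is added is empty before or after the query, but not both.
    have h1 : filled d i j.succ = !filled d (i + 1) j.succ := by
      rw [Bool.eq_iff_iff, Bool.not_eq_true', ← Bool.not_eq_true, filled_iff, filled_iff,
        Fin.val_succ]
      omega
    simp only [outWire, wireContent, h1]
    cases filled d (i + 1) j.succ <;> simp
  · rw [OracleGate.flip_apply_of_ne _ _ _ (by simpa using hr)]
    simp only [Function.comp_apply, Equiv.symm_apply_apply]
    rcases r with r | r | ⟨b, o⟩
    · rfl
    · rfl
    · have hb : (b : ℕ) ≠ j + 1 := by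
        intro hb
        refine hr ⟨eout.symm o, ?_⟩
        simp only [askGate, outWire, Equiv.apply_symm_apply, ← hj]
        rw [show b = j.succ from Fin.ext hb]
      have h1 : filled d i b = filled d (i + 1) b := by
        rw [Bool.eq_iff_iff, filled_iff, filled_iff]
        have := b.2
        omega
      simp only [wireContent, h1]

/-- The final state of a call: after the queries, block `0` holds `x`, block `d + 1` holds the last
of the values that belong to `x`, and the blocks between are empty again. -/
theorem finalState_simonCall {O : S.Oracle} {e : Reg n₀ d n m ↪ Fin M} {a : Bits n₀} {l : Fin m}
    {mem : Fin M → Bool} (hmem : Ready e a l mem) {v : Bits n → Fin (d + 2) → Big d n}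
    (hv : ∀ x, Computes q ein eout O a (v x)) (hv0 : ∀ x, v x 0 = pad x)
    (z : Bits (Fintype.card (Wire n₀ d n))) :
    (simonCall q ein eout e l).finalState O mem z = (1 / 2) ^ n * ∑ u,
      if Function.extend (sampleWire n₀ d) u z = wireContent a (v u) (2 * d + 1) ∘ wireNo.symm
      then chi (z ∘ sampleWire n₀ d) u else 0 := by
  rw [QCall.finalState_eq]
  have hz₀ : ∀ r, mem (e (wireReg l r)) = wireContent a (fun _ => fun _ => false) 0 r := by
    rintro (k | k | ⟨b, o⟩)
    · exact hmem _ (by simp [wireReg])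
    · exact hmem _ (by simp [wireReg])
    · refine (hmem _ (by simp +contextual [wireReg])).trans ?_
      cases o <;> simp [wireReg, baseMem, wireContent]
  have hcontent : ∀ (i : ℕ) x k, filled d i 0 = true →
      wireContent a (v x) i (.inr (.inr (0, some (samplePos d k)))) = x k := by
    intro i x k hi
    simp only [wireContent, Fin.val_zero]
    rw [hi, hv0]
    simp [samplePos, pad]
  refine runLayers_hadamard (p := sampleWire n₀ d) sampleWire_injective
    (γ := fun i => askGate q ein eout i)
    (g := fun i x => wireContent a (v x) i ∘ wireNo.symm) ?_ ?_ ?_ ?_ ?_ ?_ ?_ ?_ ?_ z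
  · rw [hmem.gatesAt, if_pos (Or.inl rfl)]
  · intro i hi
    rw [hmem.gatesAt, if_neg (by omega)]
  · rw [hmem.gatesAt, if_pos (Or.inr rfl)]
  · exact fun i hi => hmem.queriesAt q ein eout hi
  · exact fun i _ => askGate_proper q ein eout i
  · intro k
    change mem (e (wireReg l (wireNo.symm (wireNo _)))) = false
    rw [Equiv.symm_apply_apply, hz₀]
    simp [wireContent]
  · intro x
    funext r
    obtain ⟨r, rfl⟩ := wireNo.surjective r
    by_cases hr : ∃ k, sampleWire n₀ d k = wireNo r
    · obtain ⟨k, hk⟩ := hr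
      rw [← hk]
      refine Eq.trans ?_ (sampleWire_injective.extend_apply _ _ _).symm
      simp only [Function.comp_apply, sampleWire, Equiv.symm_apply_apply]
      exact hcontent 0 x k (filled_iff.2 (Or.inl ⟨le_rfl, by omega⟩))
    · refine Eq.trans ?_ (Function.extend_apply' _ _ _ hr).symm
      change _ = mem (e (wireReg l (wireNo.symm (wireNo r))))
      rw [Equiv.symm_apply_apply, hz₀]
      simp only [Function.comp_apply, Equiv.symm_apply_apply]
      rcases r with r | r | ⟨b, o⟩
      · rfl
      · rfl
      · simp only [wireContent]
        by_cases hb : filled d 0 b = true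
        · have hb0 : b = 0 := by
            rw [filled_iff] at hb
            refine Fin.ext ?_
            rw [Fin.val_zero]
            omega
          subst hb0
          rw [hv0]
          rcases o with _ | o
          · rfl
          · simp only [Option.elim_some, pad]
            rw [dif_neg, Bool.and_false]
            intro ho
            exact hr ⟨⟨o, ho⟩, rfl⟩
        · rw [Bool.not_eq_true] at hb
          rw [hb, Bool.false_and, Bool.false_and]
  · exact fun i hi x => (hv x).flip_askGate q ein eout hi
  · intro x
    funext k
    simp only [Function.comp_apply, sampleWire, Equiv.symm_apply_apply]
    exact hcontent _ x k (filled_iff.2 (Or.inl ⟨by omega, by omega⟩))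

/-- The final contents of the wires depend on the point and the value of the function only. -/
theorem wireContent_last {a : Bits n₀} {v : Bits n → Fin (d + 2) → Big d n} {f : Bits n → Bits n}
    (hv0 : ∀ x, v x 0 = pad x) (hvf : ∀ x, v x (Fin.last _) = pad (f x)) {x x' : Bits n}
    (h : f x = f x') : wireContent a (v x') (2 * d + 1) ∘ wireNo.symm =
      Function.extend (sampleWire n₀ d) x' (wireContent a (v x) (2 * d + 1) ∘ wireNo.symm) := by
  funext r
  obtain ⟨r, rfl⟩ := wireNo.surjective r
  by_cases hr : ∃ k, sampleWire n₀ d k = wireNo r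
  · obtain ⟨k, hk⟩ := hr
    rw [← hk, sampleWire_injective.extend_apply]
    simp only [Function.comp_apply, sampleWire, Equiv.symm_apply_apply, wireContent, Fin.val_zero]
    rw [filled_iff.2 (Or.inl ⟨by omega, by omega⟩), hv0]
    simp [samplePos, pad]
  · rw [Function.extend_apply' _ _ _ hr]
    simp only [Function.comp_apply, Equiv.symm_apply_apply]
    rcases r with r | r | ⟨b, o⟩
    · rfl
    · rfl
    · simp only [wireContent]
      by_cases hb : filled d (2 * d + 1) b = true
      · have hb0 : b = 0 ∨ b = Fin.last _ := by
          rw [filled_iff] at hb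
          rw [Fin.ext_iff, Fin.ext_iff, Fin.val_zero, Fin.val_last]
          omega
        rcases hb0 with rfl | rfl
        · rw [hv0, hv0]
          rcases o with _ | o
          · rfl
          · simp only [Option.elim_some, pad]
            rw [dif_neg, dif_neg] <;> exact fun ho => hr ⟨⟨o, ho⟩, rfl⟩
        · rw [hvf, hvf, h]
      · rw [Bool.not_eq_true] at hb
        rw [hb, Bool.false_and, Bool.false_and]

/-- The wires that are not measured as sample determine the value of the function. -/
theorem eq_of_wireContent_eq {a : Bits n₀} {v : Bits n → Fin (d + 2) → Big d n}
    {f : Bits n → Bits n} (hvf : ∀ x, v x (Fin.last _) = pad (f x))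
    {z : Bits (Fintype.card (Wire n₀ d n))} {x x' : Bits n}
    (h : Function.extend (sampleWire n₀ d) x z = wireContent a (v x) (2 * d + 1) ∘ wireNo.symm)
    (h' : Function.extend (sampleWire n₀ d) x' z =
      wireContent a (v x') (2 * d + 1) ∘ wireNo.symm) : f x = f x' := by
  funext k
  have key : ∀ {x}, Function.extend (sampleWire n₀ d) x z =
      wireContent a (v x) (2 * d + 1) ∘ wireNo.symm →
      z (wireNo (.inr (.inr (Fin.last _, some (samplePos d k))))) = f x k := by
    intro x h
    have h1 := congrFun h (wireNo (.inr (.inr (Fin.last _, some (samplePos d k)))))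
    rw [Function.extend_apply'] at h1
    · rw [h1]
      simp only [Function.comp_apply, Equiv.symm_apply_apply, wireContent, Fin.val_last]
      rw [filled_iff.2 (Or.inr ⟨rfl, by omega⟩), hvf]
      simp [samplePos, pad]
    · rintro ⟨k', hk'⟩
      simpa [Fin.ext_iff] using wireNo.injective hk'
  rw [← key h, key h']

end circuit

/-! ### The scheme for Simon's problem -/

section scheme
variable {S : OracleSig} {n₀ d n m M : ℕ} (q : S.Q)
  (ein : S.In q ≃ Fin n₀ ⊕ Fin (d + 1) ⊕ Fin ((d + 2) * n))
  (eout : S.Out q ≃ Option (Fin ((d + 2) * n)))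

/-- The sample that call `l` has stored in its registers. -/
def sampleOf (e : Reg n₀ d n m ↪ Fin M) (mem : Fin M → Bool) (l : Fin m) : Bits n :=
  fun k => mem (e (.sample l k))

/-- The steps of the scheme that follow the call `l - 1`: the remaining calls, and the decision
whether the samples have a common orthogonal vector. -/
noncomputable def simonSteps (e : Reg n₀ d n m ↪ Fin M) (t : Fin 5 ↪ Fin M) (l : ℕ) :
    List (Step S (2 * d + 1) M) :=
  ((List.finRange m).drop l).map (fun l => .call (simonCall q ein eout e l)) ++
    (decideOps n₀ d n m).flatMap (Toffoli.compile e t)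

theorem simonSteps_eq_cons (e : Reg n₀ d n m ↪ Fin M) (t : Fin 5 ↪ Fin M) (l : Fin m) :
    simonSteps q ein eout e t l =
      .call (simonCall q ein eout e l) :: simonSteps q ein eout e t (l + 1) := by
  unfold simonSteps
  rw [List.drop_eq_getElem_cons (by simp)]
  simp

theorem simonSteps_last (e : Reg n₀ d n m ↪ Fin M) (t : Fin 5 ↪ Fin M) :
    simonSteps q ein eout e t m = (decideOps n₀ d n m).flatMap (Toffoli.compile e t) := by
  unfold simonSteps
  rw [List.drop_eq_nil_of_le (by simp)]
  simp

section next
variable {e : Reg n₀ d n m ↪ Fin M} {l : Fin m} (mem : Fin M → Bool)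
  (z : Bits (Fintype.card (Wire n₀ d n)))

/-- The contents of the registers after call `l` with outcome `z`. -/
noncomputable def nextMem (e : Reg n₀ d n m ↪ Fin M) (l : Fin m) : Fin M → Bool :=
  Function.extend (simonCall q ein eout e l).reg z mem

theorem nextMem_wireReg (r : Wire n₀ d n) :
    nextMem q ein eout mem z e l (e (wireReg l r)) = z (wireNo r) := by
  have h := (simonCall q ein eout e l).reg.injective.extend_apply z mem (wireNo r)
  have h2 : (simonCall q ein eout e l).reg (wireNo r) = e (wireReg l r) := by
    change e (wireReg l (wireNo.symm (wireNo r))) = _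
    rw [Equiv.symm_apply_apply]
  rw [h2] at h
  exact h

theorem nextMem_of_ne {r : Reg n₀ d n m} (hr : ∀ r', wireReg l r' ≠ r) :
    nextMem q ein eout mem z e l (e r) = mem (e r) :=
  Function.extend_apply' _ _ _ fun ⟨_, h⟩ => hr _ (e.injective h)

theorem sampleOf_nextMem_self :
    sampleOf e (nextMem q ein eout mem z e l) l = z ∘ sampleWire n₀ d := by
  funext k
  exact nextMem_wireReg q ein eout mem z (.inr (.inr (0, some (samplePos d k))))

theorem sampleOf_nextMem_of_ne {l' : Fin m} (h : l' ≠ l) :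
    sampleOf e (nextMem q ein eout mem z e l) l' = sampleOf e mem l' := by
  funext k
  refine nextMem_of_ne q ein eout mem z ?_
  rintro (r | r | r) <;> simp [wireReg, Reg.sample, h.symm]

end next

theorem sum_bit_mul_bit (y s : Bits n) : ∑ i, bit (s i) * bit (y i) = dot y s := by
  refine Finset.sum_congr rfl fun i _ => ?_
  unfold bit
  cases s i <;> cases y i <;> rfl

theorem exists_orthogonal_iff (y : Fin m → Bits n) :
    (∃ s : Fin n → ZMod 2, s ≠ 0 ∧ ∀ l, ∑ i, s i * bit (y l i) = 0) ↔
      ∃ s : Bits n, s ≠ (fun _ => false) ∧ ∀ l, dot (y l) s = 0 := by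
  constructor
  · rintro ⟨s, hs, h⟩
    have hb : ∀ i, bit (decide (s i = 1)) = s i := fun i => by
      generalize s i = x
      revert x
      decide
    refine ⟨fun i => decide (s i = 1), fun h0 => hs (funext fun i => ?_), fun l => ?_⟩
    · rw [← hb, congrFun h0 i]
      rfl
    · rw [← sum_bit_mul_bit]
      simp only [hb, h]
  · rintro ⟨s, hs, h⟩
    refine ⟨fun i => bit (s i), fun h0 => hs (funext fun i => ?_), fun l => ?_⟩
    · have := congrFun h0 i
      revert this
      cases s i <;> simp [bit]
    · rw [sum_bit_mul_bit, h]

section run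
variable {O : S.Oracle} {e : Reg n₀ d n m ↪ Fin M} {t : Fin 5 ↪ Fin M}
  {a : Bits n₀} {v : Bits n → Fin (d + 2) → Big d n} {f : Bits n → Bits n}

open Classical in
/-- After all calls, the scheme accepts iff the samples have a common orthogonal vector. -/
theorem acceptFrom_simonSteps_last (het : ∀ v i, e v ≠ t i) {mem : Fin M → Bool}
    (hmem : Ready e a m mem) :
    acceptFrom O (e .ans) (simonSteps q ein eout e t m) mem =
      if ∃ s : Bits n, s ≠ (fun _ => false) ∧ ∀ l, dot (sampleOf e mem l) s = 0 then 1 else 0 := by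
  have hbase : ∀ r : Reg n₀ d n m, (∀ l b o, r ≠ .block l b o) → baseMem a r = false →
      bit (mem (e r)) = 0 := fun r hr h => by
    rw [hmem r fun l b o h => absurd h (hr l b o), h]
    rfl
  rw [simonSteps_last, acceptFrom_compile O e.injective t.injective het]
  have := runOps_decideOps (mem := fun r => bit (mem (e r)))
    (Y := fun l i => bit (sampleOf e mem l i))
    (by
      have : mem (e .one) = true := hmem .one (by simp [Reg.one])
      simp [this, bit])
    (fun _ _ => rfl) (fun j i => hbase _ (by simp) rfl)
    (fun l => ⟨fun j => hbase _ (by simp) rfl, fun j => hbase _ (by simp) rfl,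
      fun j => hbase _ (by simp) rfl, fun j => hbase _ (by simp) rfl⟩)
    (fun k => hbase _ (by simp) rfl) (hbase _ (by simp) rfl)
  rw [exists_orthogonal_iff] at this
  simp only [this]

/-- A call returns the wires outside the blocks unchanged. -/
theorem Ready.next {l : Fin m} {mem : Fin M → Bool} (hmem : Ready e a l mem)
    (hv : ∀ x, Computes q ein eout O a (v x)) (hv0 : ∀ x, v x 0 = pad x)
    {z : Bits (Fintype.card (Wire n₀ d n))}
    (hz : (simonCall q ein eout e l).finalState O mem z ≠ 0) :
    Ready e a (l + 1) (nextMem q ein eout mem z e l) := by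
  rw [finalState_simonCall q ein eout hmem hv hv0] at hz
  obtain ⟨u, hu⟩ : ∃ u, Function.extend (sampleWire n₀ d) u z =
      wireContent a (v u) (2 * d + 1) ∘ wireNo.symm := by
    by_contra hcon
    push Not at hcon
    exact hz (by simp [hcon])
  have hother : ∀ r : Wire n₀ d n, (∀ x, r ≠ .inr (.inr x)) →
      z (wireNo r) = wireContent a (v u) (2 * d + 1) r := by
    intro r hr
    have h := congrFun hu (wireNo r)
    rw [Function.extend_apply' _ _ _ fun ⟨k, hk⟩ => hr _ (wireNo.injective hk).symm] at h
    simpa using h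
  intro r hr
  by_cases h : ∃ r', wireReg l r' = r
  · obtain ⟨r', rfl⟩ := h
    rw [nextMem_wireReg]
    rcases r' with k | k | x
    · exact hother _ (by simp)
    · exact hother _ (by simp)
    · have := hr l x.1 x.2 rfl
      omega
  · rw [nextMem_of_ne q ein eout mem z (by simpa using h)]
    exact hmem r fun l' b o hl => Nat.le_of_succ_le (hr l' b o hl)

/-- For a function with shift `s`, all samples are orthogonal to `s`, and the scheme always accepts.
-/
theorem acceptFrom_simonSteps_of_hasShift (het : ∀ v i, e v ≠ t i)
    (hv : ∀ x, Computes q ein eout O a (v x)) (hv0 : ∀ x, v x 0 = pad x)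
    (hvf : ∀ x, v x (Fin.last _) = pad (f x)) {s : Bits n} (hs : HasShift s f)
    (hs0 : s ≠ fun _ => false) : ∀ (k l : ℕ) (mem : Fin M → Bool), l + k = m → Ready e a l mem →
    (∀ l' : Fin m, (l' : ℕ) < l → dot (sampleOf e mem l') s = 0) →
    acceptFrom O (e .ans) (simonSteps q ein eout e t l) mem = 1
  | 0, l, mem, hl, hmem, h => by
    obtain rfl : l = m := hl
    rw [acceptFrom_simonSteps_last q ein eout het hmem, if_pos ⟨s, hs0, fun l => h l l.2⟩]
  | k + 1, l, mem, hl, hmem, h => by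
    obtain ⟨l, rfl⟩ : ∃ l' : Fin m, l = l' := ⟨⟨l, by omega⟩, rfl⟩
    rw [simonSteps_eq_cons]
    simp only [acceptFrom]
    refine Eq.trans ?_ ((simonCall q ein eout e l).sum_finalState O mem)
    refine Finset.sum_congr rfl fun (z : Bits (Fintype.card (Wire n₀ d n))) _ => ?_
    by_cases hz : (simonCall q ein eout e l).finalState O mem z = 0
    · rw [hz]
      simp
    refine (congrArg _ (acceptFrom_simonSteps_of_hasShift het hv hv0 hvf hs hs0 k (l + 1)
      (nextMem q ein eout mem z e l) (by omega) (hmem.next q ein eout hv hv0 hz)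
      fun l' hl' => ?_)).trans (mul_one _)
    by_cases hll : l' = l
    · subst hll
      rw [sampleOf_nextMem_self]
      by_contra hdot
      rw [finalState_simonCall q ein eout hmem hv hv0] at hz
      refine hz (mul_eq_zero_of_right _ (sum_chi_eq_zero (fun z u hu => ?_) hdot))
      rw [wireContent_last hv0 hvf ((hs u (xorBits u s)).2 (Or.inr rfl)), ← hu,
        extend_extend sampleWire_injective]
    · rw [sampleOf_nextMem_of_ne q ein eout mem z hll]
      exact h l' (by have : (l' : ℕ) ≠ l := fun h => hll (Fin.ext h); omega)

open Classical in
/-- For a one-to-one function the samples are uniformly random. The bound is a sum over all `s` that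
are orthogonal to the samples taken so far: each of the remaining `k` samples is orthogonal to `s`
with probability `1 / 2`. -/
theorem acceptFrom_simonSteps_le_of_injective (het : ∀ v i, e v ≠ t i)
    (hv : ∀ x, Computes q ein eout O a (v x)) (hv0 : ∀ x, v x 0 = pad x)
    (hvf : ∀ x, v x (Fin.last _) = pad (f x)) (hf : Function.Injective f) :
    ∀ (k l : ℕ) (mem : Fin M → Bool), l + k = m → Ready e a l mem →
    acceptFrom O (e .ans) (simonSteps q ein eout e t l) mem ≤
      ∑ s : Bits n, (1 / 2) ^ k * if s ≠ (fun _ => false) ∧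
        ∀ l' : Fin m, (l' : ℕ) < l → dot (sampleOf e mem l') s = 0 then 1 else 0
  | 0, l, mem, hl, hmem => by
    obtain rfl : l = m := hl
    rw [acceptFrom_simonSteps_last q ein eout het hmem]
    split_ifs with h
    · obtain ⟨s, hs⟩ := h
      refine le_trans ?_ (Finset.single_le_sum (fun s _ => ?_) (Finset.mem_univ s))
      · rw [if_pos ⟨hs.1, fun l' _ => hs.2 l'⟩]
        norm_num
      · positivity
    · exact Finset.sum_nonneg fun s _ => by positivity
  | k + 1, l, mem, hl, hmem => by
    obtain ⟨l, rfl⟩ : ∃ l' : Fin m, l = l' := ⟨⟨l, by omega⟩, rfl⟩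
    rw [simonSteps_eq_cons]
    simp only [acceptFrom]
    obtain ⟨ψ, hψ⟩ : ∃ ψ : Bits (Fintype.card (Wire n₀ d n)) → ℂ,
        (simonCall q ein eout e l).finalState O mem = ψ := ⟨_, rfl⟩
    have hψz := fun z => finalState_simonCall q ein eout hmem hv hv0 z
    rw [hψ] at hψz
    have hinv : ∀ z k b, ‖ψ (Function.update z (sampleWire n₀ d k) b)‖ ^ 2 = ‖ψ z‖ ^ 2 := by
      intro z k b
      congr 1
      rw [hψz, hψz, norm_mul, norm_mul]
      congr 1
      exact norm_sum_chi_update sampleWire_injective (fun z u u' hu hu' =>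
        hf (eq_of_wireContent_eq hvf hu hu')) z k b
    have h1 : ∑ z, ‖ψ z‖ ^ 2 = 1 := by
      rw [← hψ]
      exact (simonCall q ein eout e l).sum_finalState O mem
    rw [hψ]
    calc _ ≤ ∑ z : Bits (Fintype.card (Wire n₀ d n)), ‖ψ z‖ ^ 2 * ∑ s : Bits n, (1 / 2) ^ k *
          if (s ≠ (fun _ => false) ∧ ∀ l' : Fin m, (l' : ℕ) < l → dot (sampleOf e mem l') s = 0) ∧
            dot (z ∘ sampleWire n₀ d) s = 0 then 1 else 0 := by
          refine Finset.sum_le_sum fun (z : Bits (Fintype.card (Wire n₀ d n))) _ => ?_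
          by_cases hz : ψ z = 0
          · rw [hz]
            simp
          refine mul_le_mul_of_nonneg_left ?_ (sq_nonneg _)
          refine (acceptFrom_simonSteps_le_of_injective het hv hv0 hvf hf k (l + 1)
            (nextMem q ein eout mem z e l) (by omega)
            (hmem.next q ein eout hv hv0 (by rwa [hψ]))).trans
            (Finset.sum_le_sum fun s _ => mul_le_mul_of_nonneg_left ?_ (by positivity))
          have : (s ≠ (fun _ => false) ∧ ∀ l' : Fin m, (l' : ℕ) < l + 1 →
              dot (sampleOf e (nextMem q ein eout mem z e l) l') s = 0) →
              (s ≠ (fun _ => false) ∧ ∀ l' : Fin m, (l' : ℕ) < l →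
                dot (sampleOf e mem l') s = 0) ∧ dot (z ∘ sampleWire n₀ d) s = 0 := by
            rintro ⟨h2, h3⟩
            refine ⟨⟨h2, fun l' hl' => ?_⟩, ?_⟩
            · have h4 := h3 l' (by omega)
              rwa [sampleOf_nextMem_of_ne q ein eout mem z fun h => by rw [h] at hl'; omega] at h4
            · rw [← sampleOf_nextMem_self q ein eout mem z]
              exact h3 l (by omega)
          split_ifs <;> first | exact le_rfl | exact zero_le_one | (exfalso; tauto)
      _ = ∑ s : Bits n, (1 / 2) ^ k * ∑ z : Bits (Fintype.card (Wire n₀ d n)), ‖ψ z‖ ^ 2 *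
          if (s ≠ (fun _ => false) ∧ ∀ l' : Fin m, (l' : ℕ) < l → dot (sampleOf e mem l') s = 0) ∧
            dot (z ∘ sampleWire n₀ d) s = 0 then 1 else 0 := by
          simp only [Finset.mul_sum]
          rw [Finset.sum_comm]
          exact Finset.sum_congr rfl fun _ _ => Finset.sum_congr rfl fun _ _ => mul_left_comm _ _ _
      _ ≤ _ := by
          refine Finset.sum_le_sum fun s _ => ?_
          rw [pow_succ, mul_assoc]
          refine mul_le_mul_of_nonneg_left ?_ (by positivity)
          by_cases hs : s ≠ (fun _ => false) ∧
              ∀ l' : Fin m, (l' : ℕ) < l → dot (sampleOf e mem l') s = 0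
          · rw [if_pos hs]
            simp only [and_iff_right hs, mul_ite, mul_one, mul_zero]
            exact (sum_dot_eq_half sampleWire_injective hinv h1 hs.1).le
          · simp only [hs, false_and, if_false, mul_zero, Finset.sum_const_zero, le_refl]

end run

end scheme

/-! ### The numbering of the registers and the complete scheme -/

/-- The registers that do not hold the input, and five auxiliary registers. -/
abbrev AuxReg (d n m : ℕ) : Type :=
  Unit ⊕ Fin (d + 1) ⊕ (Fin m × Fin (d + 2) × Option (Fin ((d + 2) * n))) ⊕ (Fin n × Fin n) ⊕
    (Fin m × Fin n) ⊕ (Fin m × Fin n) ⊕ (Fin m × Fin (n + 1)) ⊕ (Fin m × Fin n) ⊕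
    Fin (n * n + 1) ⊕ Unit ⊕ Fin 5

section numbering
variable {n₀ d n m : ℕ}

/-- The registers as a sum of the input and the other registers. -/
def Reg.code : Reg n₀ d n m → Fin n₀ ⊕ AuxReg d n m
  | .inp i => .inl i
  | .zero => .inr (.inl ())
  | .const i => .inr (.inr (.inl i))
  | .block l b o => .inr (.inr (.inr (.inl (l, b, o))))
  | .row j i => .inr (.inr (.inr (.inr (.inl (j, i)))))
  | .par l j => .inr (.inr (.inr (.inr (.inr (.inl (l, j))))))
  | .sel l j => .inr (.inr (.inr (.inr (.inr (.inr (.inl (l, j)))))))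
  | .free l j => .inr (.inr (.inr (.inr (.inr (.inr (.inr (.inl (l, j))))))))
  | .piv l i => .inr (.inr (.inr (.inr (.inr (.inr (.inr (.inr (.inl (l, i)))))))))
  | .nul k => .inr (.inr (.inr (.inr (.inr (.inr (.inr (.inr (.inr (.inl k)))))))))
  | .ans => .inr (.inr (.inr (.inr (.inr (.inr (.inr (.inr (.inr (.inr (.inl ()))))))))))

/-- The auxiliary registers of the compiled operations. -/
def auxCode (i : Fin 5) : Fin n₀ ⊕ AuxReg d n m :=
  .inr (.inr (.inr (.inr (.inr (.inr (.inr (.inr (.inr (.inr (.inr i))))))))))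

theorem Reg.code_injective :
    Function.Injective (Reg.code (n₀ := n₀) (d := d) (n := n) (m := m)) := by
  let decode : Fin n₀ ⊕ AuxReg d n m → Reg n₀ d n m
    | .inl i => .inp i
    | .inr (.inl _) => .zero
    | .inr (.inr (.inl i)) => .const i
    | .inr (.inr (.inr (.inl (l, b, o)))) => .block l b o
    | .inr (.inr (.inr (.inr (.inl (j, i))))) => .row j i
    | .inr (.inr (.inr (.inr (.inr (.inl (l, j)))))) => .par l j
    | .inr (.inr (.inr (.inr (.inr (.inr (.inl (l, j))))))) => .sel l j
    | .inr (.inr (.inr (.inr (.inr (.inr (.inr (.inl (l, j)))))))) => .free l j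
    | .inr (.inr (.inr (.inr (.inr (.inr (.inr (.inr (.inl (l, i))))))))) => .piv l i
    | .inr (.inr (.inr (.inr (.inr (.inr (.inr (.inr (.inr (.inl k))))))))) => .nul k
    | .inr (.inr (.inr (.inr (.inr (.inr (.inr (.inr (.inr (.inr _))))))))) => .ans
  exact Function.LeftInverse.injective (g := decode) fun r => by cases r <;> rfl

theorem Reg.code_ne_auxCode (r : Reg n₀ d n m) (i : Fin 5) : r.code ≠ auxCode i := by
  cases r <;> simp [Reg.code, auxCode]

/-- The numbering of all registers, the input first. -/
noncomputable def regNo : Fin n₀ ⊕ AuxReg d n m ≃ Fin (n₀ + Fintype.card (AuxReg d n m)) :=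
  (Equiv.sumCongr (Equiv.refl _) (Fintype.equivFin _)).trans finSumFinEquiv

/-- The numbers of the registers. -/
noncomputable def regEmb (n₀ d n m : ℕ) :
    Reg n₀ d n m ↪ Fin (n₀ + Fintype.card (AuxReg d n m)) :=
  ⟨fun r => regNo r.code, regNo.injective.comp Reg.code_injective⟩

/-- The numbers of the auxiliary registers. -/
noncomputable def auxEmb (n₀ d n m : ℕ) : Fin 5 ↪ Fin (n₀ + Fintype.card (AuxReg d n m)) :=
  ⟨fun i => regNo (auxCode i), regNo.injective.comp fun i j h => by simpa [auxCode] using h⟩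

theorem regEmb_ne_auxEmb (r : Reg n₀ d n m) (i : Fin 5) :
    regEmb n₀ d n m r ≠ auxEmb n₀ d n m i :=
  fun h => r.code_ne_auxCode i (regNo.injective h)

theorem regEmb_inp (i : Fin n₀) : (regEmb n₀ d n m (.inp i) : ℕ) = i := rfl

end numbering

section simonScheme
variable {S : OracleSig} {n₀ d n : ℕ} (q : S.Q)
  (ein : S.In q ≃ Fin n₀ ⊕ Fin (d + 1) ⊕ Fin ((d + 2) * n))
  (eout : S.Out q ≃ Option (Fin ((d + 2) * n)))

/-- The scheme that takes `2 * n + 2` samples and accepts if these have a common orthogonal vector.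
-/
noncomputable def simonScheme : Scheme S (2 * d + 1) where
  M := n₀ + Fintype.card (AuxReg d n (2 * n + 2))
  steps := .nand (regEmb _ _ _ _ .one) (regEmb _ _ _ _ .zero) (regEmb _ _ _ _ .zero) ::
    simonSteps q ein eout (regEmb n₀ d n (2 * n + 2)) (auxEmb n₀ d n (2 * n + 2)) 0
  out := regEmb _ _ _ _ .ans

/-- The first step of the scheme writes a one into `Reg.one`; all else is as in the initial memory.
-/
theorem ready_initial {m : ℕ} (a : Bits n₀) : Ready (regEmb n₀ d n m) a 0
    (Function.update (fun r => if h : (r : ℕ) < n₀ then a ⟨r, h⟩ else false)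
      (regEmb n₀ d n m .one) true) := by
  intro r _
  have hlt : ∀ r : Reg n₀ d n m, (∀ k, r ≠ .inp k) → ¬ (regEmb n₀ d n m r : ℕ) < n₀ := by
    intro r hr h
    exact hr ⟨_, h⟩ ((regEmb n₀ d n m).injective (Fin.ext (regEmb_inp ⟨_, h⟩).symm))
  by_cases h1 : r = .one
  · subst h1
    rw [Function.update_self]
    rfl
  rw [Function.update_of_ne fun h => h1 ((regEmb n₀ d n m).injective h)]
  by_cases h2 : ∃ k, r = .inp k
  · obtain ⟨k, rfl⟩ := h2
    rw [dif_pos (by rw [regEmb_inp]; exact k.2)]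
    rfl
  · rw [dif_neg (hlt r (by simpa using h2))]
    cases r <;> simp_all [baseMem, Reg.one]

/-- For a one-to-one function, each of the at most `2 ^ n` vectors is orthogonal to all `2 * n + 2`
samples with probability `2 ^ (-(2 * n + 2))`. -/
theorem acceptProb_simonScheme {O : S.Oracle} {a : Bits n₀} {v : Bits n → Fin (d + 2) → Big d n}
    {f : Bits n → Bits n} (hv : ∀ x, Computes q ein eout O a (v x)) (hv0 : ∀ x, v x 0 = pad x)
    (hvf : ∀ x, v x (Fin.last _) = pad (f x)) :
    (IsSimon f → (simonScheme q ein eout).acceptProb O a = 1) ∧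
      (Function.Injective f → (simonScheme q ein eout).acceptProb O a ≤ 1 / 2 ^ (n + 2)) := by
  have hone : (simonScheme q ein eout).acceptProb O a =
      acceptFrom O (regEmb n₀ d n (2 * n + 2) .ans)
        (simonSteps q ein eout (regEmb n₀ d n (2 * n + 2)) (auxEmb n₀ d n (2 * n + 2)) 0)
        (Function.update (fun r => if h : (r : ℕ) < n₀ then a ⟨r, h⟩ else false)
          (regEmb n₀ d n (2 * n + 2) .one) true) := by
    unfold Scheme.acceptProb simonScheme
    simp only [acceptFrom]
    congr 2
    rw [dif_neg, Bool.and_self, Bool.not_false]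
    intro h
    have := (regEmb n₀ d n (2 * n + 2)).injective (Fin.ext (regEmb_inp ⟨_, h⟩).symm)
    simp at this
  have hready := ready_initial (d := d) (n := n) (m := 2 * n + 2) a
  rw [hone]
  constructor
  · rintro ⟨s, hs0, hs⟩
    exact acceptFrom_simonSteps_of_hasShift q ein eout regEmb_ne_auxEmb hv hv0 hvf hs hs0
      (2 * n + 2) 0 _ (by omega) hready fun l hl => absurd hl (by omega)
  · intro hf
    refine (acceptFrom_simonSteps_le_of_injective q ein eout regEmb_ne_auxEmb hv hv0 hvf hf
      (2 * n + 2) 0 _ (by omega) hready).trans ?_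
    calc _ ≤ ∑ s : Bits n, ((1 : ℝ) / 2) ^ (2 * n + 2) := by
          refine Finset.sum_le_sum fun s _ => ?_
          split_ifs
          · rw [mul_one]
          · rw [mul_zero]
            positivity
      _ = 1 / 2 ^ (n + 2) := by
          rw [Finset.sum_const, Finset.card_univ, Fintype.card_fun, Fintype.card_bool,
            Fintype.card_fin, nsmul_eq_mul, one_div_pow, show 2 * n + 2 = n + (n + 2) by ring,
            pow_add 2 n (n + 2)]
          push_cast
          field_simp

/-! ### The size of the scheme -/

/-- The number of wires of a call. -/
def wireBound (d n₀ n : ℕ) : ℕ := n₀ + (d + 1 + (d + 2) * ((d + 2) * n + 1))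

/-- A bound on the size of a call. -/
def callBound (d n₀ n : ℕ) : ℕ :=
  1 + wireBound d n₀ n + (2 * d + 2) * (n * (1 + wireBound d n₀ n)) +
    (2 * d + 1) * (1 + (n₀ + (d + 1 + (d + 2) * n)) * (wireBound d n₀ n + 1) +
      ((d + 2) * n + 1) * (wireBound d n₀ n + 1))

theorem card_wire : Fintype.card (Wire n₀ d n) = wireBound d n₀ n := by
  simp [wireBound]

theorem size_simonCall_le {m M : ℕ} (e : Reg n₀ d n m ↪ Fin M) (l : Fin m) :
    (Step.call (simonCall q ein eout e l)).size ≤ callBound d n₀ n := by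
  have haddr : ∀ r : Wire n₀ d n, (wireAddr e r).length ≤ wireBound d n₀ n := fun r =>
    (length_wireAddr_le e r).trans_eq card_wire
  have hin : Fintype.card (S.In q) = n₀ + (d + 1 + (d + 2) * n) := by
    rw [Fintype.card_congr ein]
    simp
  have hout : Fintype.card (S.Out q) = (d + 2) * n + 1 := by
    rw [Fintype.card_congr eout]
    simp
  unfold Step.size callBound
  refine Nat.add_le_add (Nat.add_le_add (Nat.add_le_add_left ?_ 1) ?_) ?_
  · exact card_wire.le
  · refine (Finset.sum_le_card_nsmul _ _ (n * (1 + wireBound d n₀ n)) fun i _ => ?_).trans_eq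
      (by rw [Finset.card_univ, Fintype.card_fin, smul_eq_mul])
    unfold simonCall
    dsimp only
    split_ifs
    · rw [List.map_ofFn]
      refine (List.sum_le_card_nsmul _ (1 + wireBound d n₀ n) fun x hx => ?_).trans_eq
        (by rw [List.length_ofFn, smul_eq_mul])
      obtain ⟨k, rfl⟩ := (List.mem_ofFn' _ _).1 hx
      simpa [GateSlot.size] using haddr _
    · simp
  · refine (Finset.sum_le_card_nsmul _ _ (1 + (n₀ + (d + 1 + (d + 2) * n)) *
      (wireBound d n₀ n + 1) + ((d + 2) * n + 1) * (wireBound d n₀ n + 1)) fun i _ => ?_).trans_eq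
      (by rw [Finset.card_univ, Fintype.card_fin, smul_eq_mul])
    simp only [simonCall, List.map_cons, List.map_nil, List.sum_cons, List.sum_nil, add_zero,
      OracleSlot.size]
    refine Nat.add_le_add (Nat.add_le_add_left ?_ 1) ?_
    · refine (Finset.sum_le_card_nsmul _ _ _
        fun x _ => Nat.add_le_add_right (haddr _) 1).trans_eq ?_
      rw [Finset.card_univ, hin, smul_eq_mul]
    · refine (Finset.sum_le_card_nsmul _ _ _
        fun x _ => Nat.add_le_add_right (haddr _) 1).trans_eq ?_
      rw [Finset.card_univ, hout, smul_eq_mul]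

theorem size_flatMap_compile {V : Type} {M k : ℕ} (e : V → Fin M) (t : Fin 5 → Fin M)
    (L : List (Toffoli V)) :
    ((L.flatMap (Toffoli.compile (S := S) (d := k) e t)).map Step.size).sum = 6 * L.length := by
  induction L with
  | nil => rfl
  | cons op L ih =>
    rw [List.flatMap_cons, List.map_append, List.sum_append, ih, List.length_cons]
    simp only [Toffoli.compile, List.map_cons, List.map_nil, List.sum_cons, List.sum_nil, Step.size]
    ring

/-- A bound on the size of the scheme. -/
def schemeBound (d n₀ n : ℕ) : ℕ :=
  n₀ + Fintype.card (AuxReg d n (2 * n + 2)) +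
    (1 + ((2 * n + 2) * callBound d n₀ n + 6 * (n + ((2 * n + 2) *
      (n * n + (1 + 2 * n) + n + n * n + n * n) + ((1 + 2 * (n * n)) + 2)))))

theorem size_simonScheme_le : (simonScheme q ein eout).size ≤ schemeBound d n₀ n := by
  unfold Scheme.size schemeBound simonScheme
  dsimp only
  refine Nat.add_le_add_left ?_ _
  rw [List.map_cons, List.sum_cons]
  refine Nat.add_le_add_left ?_ 1
  unfold simonSteps
  rw [List.map_append, List.sum_append, size_flatMap_compile, length_decideOps, List.drop_zero,
    List.map_map]
  refine Nat.add_le_add_right ?_ _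
  refine (List.sum_le_card_nsmul _ (callBound d n₀ n) fun x hx => ?_).trans_eq
    (by rw [List.length_map, List.length_finRange, smul_eq_mul])
  obtain ⟨l, _, rfl⟩ := List.mem_map.1 hx
  exact size_simonCall_le q ein eout _ l

end simonScheme

theorem PolyBounded.const (c : ℕ) : PolyBounded fun _ => c := ⟨Polynomial.C c, fun n => by simp⟩

theorem PolyBounded.id : PolyBounded fun n => n := ⟨Polynomial.X, fun n => by simp⟩

theorem PolyBounded.add {s t : ℕ → ℕ} (hs : PolyBounded s) (ht : PolyBounded t) :
    PolyBounded fun n => s n + t n := by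
  obtain ⟨p, hp⟩ := hs
  obtain ⟨p', hp'⟩ := ht
  exact ⟨p + p', fun n => by rw [Polynomial.eval_add]; exact Nat.add_le_add (hp n) (hp' n)⟩

theorem PolyBounded.mul {s t : ℕ → ℕ} (hs : PolyBounded s) (ht : PolyBounded t) :
    PolyBounded fun n => s n * t n := by
  obtain ⟨p, hp⟩ := hs
  obtain ⟨p', hp'⟩ := ht
  exact ⟨p * p', fun n => by rw [Polynomial.eval_mul]; exact Nat.mul_le_mul (hp n) (hp' n)⟩

theorem PolyBounded.mono {s t : ℕ → ℕ} (hs : PolyBounded s) (h : ∀ n, t n ≤ s n) :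
    PolyBounded t := by
  obtain ⟨p, hp⟩ := hs
  exact ⟨p, fun n => (h n).trans (hp n)⟩

theorem PolyBounded.schemeBound (d : ℕ) {n₀ : ℕ → ℕ} (h : PolyBounded n₀) :
    PolyBounded fun n => schemeBound d (n₀ n) n := by
  simp only [_root_.schemeBound, callBound, wireBound, Fintype.card_sum, Fintype.card_prod,
    Fintype.card_option, Fintype.card_fin, Fintype.card_unit]
  repeat' first
    | exact h
    | exact PolyBounded.const _
    | exact PolyBounded.id
    | apply PolyBounded.add
    | apply PolyBounded.mul

/-! ### Access to the values of a shuffling -/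

section values
variable {d n : ℕ}

/-- The values that the functions of a shuffling with prefix compositions `p` take one after the
other, if the first one is applied to `x`. -/
def pathValue (p : Fin d → Equiv.Perm (Big d n)) (f : Bits n → Bits n) (x : Bits n)
    (b : Fin (d + 2)) : Big d n :=
  if (b : ℕ) ≤ d then prefixPerm p b (pad x) else pad (f x)

theorem pathValue_zero (p : Fin d → Equiv.Perm (Big d n)) (f : Bits n → Bits n) (x : Bits n) :
    pathValue p f x 0 = pad x :=
  if_pos (Nat.zero_le d)

theorem pathValue_last (p : Fin d → Equiv.Perm (Big d n)) (f : Bits n → Bits n) (x : Bits n) :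
    pathValue p f x (Fin.last _) = pad (f x) :=
  if_neg (by rw [Fin.val_last]; omega)

/-- The functions of the shuffling take each of these values to the next one. -/
theorem shuffling_pathValue (p : Fin d → Equiv.Perm (Big d n)) (f : Bits n → Bits n) (x : Bits n)
    (j : Fin (d + 1)) : shuffling f (toShuffle p) j (pathValue p f x j.castSucc) =
      some (pathValue p f x j.succ) := by
  have h := shuffling_toShuffle (⟨fun _ => p, fun _ => f⟩ : Hidden d n Unit) () j
    (pathValue p f x j.castSucc)
  refine h.trans ?_
  unfold Hidden.answer
  have hj : ((j.castSucc : Fin (d + 2)) : ℕ) ≤ d := by rw [Fin.val_castSucc]; omega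
  unfold pathValue
  rw [if_pos hj, Fin.val_castSucc, Fin.val_succ, Equiv.symm_apply_apply]
  by_cases hjd : (j : ℕ) < d
  · rw [if_pos hjd, if_pos (Nat.succ_le_of_lt hjd)]
  · rw [if_neg hjd, firstBits_pad, if_pos rfl, if_neg (by omega)]

theorem shufflingAnswer_oneHot (f : Bits n → Bits n) (F : Shuffle d n) (j : Fin (d + 1))
    (y : Big d n) :
    shufflingAnswer f F (fun k => decide (k = j)) y = encodeAnswer (shuffling f F j y) := by
  unfold shufflingAnswer
  have h : ∃ j', ∀ i, (fun k => decide (k = j)) i = true ↔ i = j' := ⟨j, by simp⟩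
  rw [dif_pos h]
  have : h.choose = j := ((h.choose_spec j).1 (by simp)).symm
  rw [this]

/-- The oracle of the problem, for an empty input of the scheme. -/
theorem computes_sspOracle (p : Fin d → Equiv.Perm (Big d n)) (f : Bits n → Bits n) (x : Bits n) :
    Computes (S := sspSig d n) () (Equiv.emptySum (Fin 0) _).symm (Equiv.refl _)
      (sspOracle f (toShuffle p)) Fin.elim0 (pathValue p f x) := by
  intro j o
  have := shufflingAnswer_oneHot f (toShuffle p) j (pathValue p f x j.castSucc)
  rw [shuffling_pathValue] at this
  exact congrFun this o

theorem computes_familyOracle {f : ∀ n, Bits n → (Bits n → Bits n)}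
    {F : ∀ n, Bits n → Shuffle d n} {a : Bits n} {p : Fin d → Equiv.Perm (Big d n)}
    (hp : toShuffle p = F n a) (x : Bits n) :
    Computes (S := familySig d) n (Equiv.refl _) (Equiv.refl _) (familyOracle f F) a
      (pathValue p (f n a) x) := by
  intro j o
  have := shufflingAnswer_oneHot (f n a) (toShuffle p) j (pathValue p (f n a) x j.castSucc)
  rw [shuffling_pathValue, hp] at this
  exact congrFun this o

end values

/-! ### The schemes of depth `2 * d + 1` -/

/-- Simon's algorithm solves the shuffling Simon problem with circuits of depth `2 * d + 1`. -/
theorem exists_scheme_ssp (d : ℕ) : ∃ A : ∀ n, Scheme (sspSig d n) (2 * d + 1),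
    PolyBounded (fun n => (A n).size) ∧
      ∀ n, 0 < n → 1 - 1 / 2 ^ n ≤ sspSuccess (A n) ∧
        ∀ (f : Bits n → Bits n) (F : Shuffle d n),
          (IsSimon f → 1 - 1 / 2 ^ n ≤ sspAccept (A n) f F) ∧
          (Function.Injective f → sspAccept (A n) f F ≤ 1 / 2 ^ n) := by
  refine ⟨fun n => simonScheme (S := sspSig d n) (n₀ := 0) (d := d) (n := n) ()
    (Equiv.emptySum (Fin 0) _).symm (Equiv.refl _),
    (PolyBounded.schemeBound d (PolyBounded.const 0)).mono fun n => size_simonScheme_le _ _ _,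
    fun n hn => ?_⟩
  set A := simonScheme (S := sspSig d n) (n₀ := 0) (d := d) (n := n) ()
    (Equiv.emptySum (Fin 0) _).symm (Equiv.refl _) with hA
  have hpos : (0 : ℝ) ≤ 1 / 2 ^ n := by positivity
  have key : ∀ (f : Bits n → Bits n) (F : Shuffle d n),
      (IsSimon f → 1 - 1 / 2 ^ n ≤ sspAccept A f F) ∧
        (Function.Injective f → sspAccept A f F ≤ 1 / 2 ^ n) := by
    intro f F
    obtain ⟨p, rfl⟩ := (toShuffle_bijective d n).2 F
    have h := acceptProb_simonScheme _ _ _ (computes_sspOracle p f) (pathValue_zero p f)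
      (pathValue_last p f)
    refine ⟨fun hf => ?_, fun hf => (h.2 hf).trans ?_⟩
    · rw [sspAccept, h.1 hf]
      linarith
    · exact div_le_div_of_nonneg_left (by norm_num) (by positivity)
        (pow_le_pow_right₀ (by norm_num) (by omega))
  refine ⟨?_, key⟩
  classical
  unfold sspSuccess
  have h1 : 1 - 1 / 2 ^ n ≤ (Finset.univ.filter fun f : Bits n → Bits n => IsSimon f).expect
      (fun f => Finset.univ.expect fun F : Shuffle d n => sspAccept A f F) := by
    obtain ⟨f, hf⟩ := exists_hasShift (n := n) (s := fun _ => true)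
      fun h => absurd (congrFun h ⟨0, hn⟩) (by simp)
    refine Finset.le_expect ⟨f, Finset.mem_filter.2 ⟨Finset.mem_univ _, _, ?_, hf⟩⟩
      fun f hf => Finset.le_expect Finset.univ_nonempty
        fun F _ => (key f F).1 (Finset.mem_filter.1 hf).2
    exact fun h => absurd (congrFun h ⟨0, hn⟩) (by simp)
  have h2 : 1 - 1 / 2 ^ n ≤
      (Finset.univ.filter fun f : Bits n → Bits n => Function.Injective f).expect
      (fun f => Finset.univ.expect fun F : Shuffle d n => 1 - sspAccept A f F) := by
    refine Finset.le_expect ⟨id, Finset.mem_filter.2 ⟨Finset.mem_univ _, Function.injective_id⟩⟩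
      fun f hf => Finset.le_expect Finset.univ_nonempty
        fun F _ => by linarith [(key f F).2 (Finset.mem_filter.1 hf).2]
  linarith

/-- Simon's algorithm decides the language of the Simon functions of a family. -/
theorem simonLanguage_mem (d : ℕ) {f : ∀ n, Bits n → (Bits n → Bits n)}
    (hf : ∀ n a, IsSimon (f n a) ∨ Function.Injective (f n a)) (F : ∀ n, Bits n → Shuffle d n) :
    simonLanguage f ∈ BPPBQNC (familySig d) (familyOracle f F) (2 * d + 1) := by
  refine ⟨fun n => simonScheme (S := familySig d) (n₀ := n) (d := d) (n := n) n
    (Equiv.refl _) (Equiv.refl _),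
    (PolyBounded.schemeBound d PolyBounded.id).mono fun n => size_simonScheme_le _ _ _,
    fun n _ a => ?_⟩
  obtain ⟨p, hp⟩ := (toShuffle_bijective d n).2 (F n a)
  have h := acceptProb_simonScheme _ _ _ (computes_familyOracle (f := f) hp)
    (pathValue_zero p (f n a)) (pathValue_last p (f n a))
  refine ⟨fun ha => ?_, fun ha => (h.2 ((hf n a).resolve_left ha)).trans ?_⟩
  · rw [h.1 ha]
    norm_num
  · have : (2 : ℝ) ^ 2 ≤ 2 ^ (n + 2) := pow_le_pow_right₀ (by norm_num) (by omega)
    exact (div_le_div_of_nonneg_left (by norm_num) (by norm_num) this).trans (by norm_num)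

theorem mainTheorem1 (d : ℕ) :
    -- some `(2d+1)`-CQ scheme solves the `d`-shuffling Simon problem with high probability
    (∃ A : ∀ n, Scheme (sspSig d n) (2 * d + 1), PolyBounded (fun n => (A n).size) ∧
      ∀ n, 0 < n → 1 - 1 / 2 ^ n ≤ sspSuccess (A n) ∧
        ∀ (f : Bits n → Bits n) (F : Shuffle d n),
          (IsSimon f → 1 - 1 / 2 ^ n ≤ sspAccept (A n) f F) ∧
          (Function.Injective f → sspAccept (A n) f F ≤ 1 / 2 ^ n)) ∧
    -- no `d`-CQ scheme solves it noticeably better than guessing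
    (∀ A : ∀ n, Scheme (sspSig d n) d, PolyBounded (fun n => (A n).size) →
      ∀ ε : ℝ, 0 < ε → ∀ᶠ n in Filter.atTop, sspSuccess (A n) ≤ 1 / 2 + ε) ∧
    -- the classes are different relative to an oracle that consists of shuffling oracles
    (∃ (f : ∀ n, Bits n → (Bits n → Bits n)) (F : ∀ n, Bits n → Shuffle d n),
      (∀ n a, IsSimon (f n a) ∨ Function.Injective (f n a)) ∧
      simonLanguage f ∈ BPPBQNC (familySig d) (familyOracle f F) (2 * d + 1) ∧
      simonLanguage f ∉ BPPBQNC (familySig d) (familyOracle f F) d ∧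
      BPPBQNC (familySig d) (familyOracle f F) d ≠
        BPPBQNC (familySig d) (familyOracle f F) (2 * d + 1)) := by
  obtain ⟨f, F, hf, hnot⟩ := exists_family_defeating d
  have hmem := simonLanguage_mem d hf F
  exact ⟨exists_scheme_ssp d, fun A hA ε hε => eventually_sspSuccess_le A hA hε,
    f, F, hf, hmem, hnot, fun h => hnot (h ▸ hmem)⟩
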